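/- All rings are commutative with $1$ and of characteristic $0$. For a ring $A$ with a ring automorphism $\sigma$ (a difference ring $(A,\sigma)$; a difference field if $A$ is a field), let $A^*$ be the group of units and $\mathrm{const}(A,\sigma)=\{c\in A\mid\sigma(c)=c\}$. For a subgroup $G\le A^*$ the nonzero semi-constants over $G$ are the nonzero $c\in A$ with $\sigma(c)=u\,c$ for some $u\in G$. **Towers.** An $R\Pi\Sigma$-extension $(E,\sigma)$ of a difference field $(F,\sigma)$ is a tower $E=F\langle t_1\rangle\cdots\langle t_e\rangle$ with $\sigma$ extended to $E$ such that for each $i$, with $A=F\langle t_1\rangle\cdots\langle t_{i-1}\rangle$, one of the following holds and $\mathrm{const}(A\langle t_i\rangle,\sigma)=\mathrm{const}(A,\sigma)$: ($R$) $A\langle t_i\rangle=A[t_i]$ is the free $A$-module with basis $1,t_i,\dots,t_i^{\lambda-1}$, where $t_i^\lambda=1$, $\lambda>1$, and $\sigma(t_i)=\alpha t_i$ with $\alpha\in A^*$; ($\Pi$) $A\langle t_i\rangle=A[t_i,t_i^{-1}]$ is a ring of Laurent polynomials and $\sigma(t_i)=\alpha t_i$ with $\alpha\in A^*$; ($\Sigma$)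 $A\langle t_i\rangle=A[t_i]$ is a polynomial ring and $\sigma(t_i)-t_i\in A$. The product group $(F^*)^E_F$ is the set of all $h\,t_1^{m_1}\cdots t_e^{m_e}$ with $h\in F^*$ and $m_i\in\mathbb Z$, where $m_i=0$ if $t_i$ is of type $\Sigma$. The extension is simple if $\sigma(t_i)/t_i\in(F^*)^E_F$ for all $t_i$ of type $R$ or $\Pi$. **Problems.** *Problem O in a group $G$*: given $a\in G$, find its order (put $0$ if the order is infinite). *Problem PMT in $(A,\sigma)$ for $G\le A^*$*: given $n$ and $f\in G^n$, find a $\mathbb Z$-basis of $\{m\in\mathbb Z^n\mid \sigma(g)=f_1^{m_1}\cdots f_n^{m_n}\,g\text{ for some }g\in A\setminus\{0\}\}$. *Problem PFLDE in $(A,\sigma)$ for $G\le A^*$*: given $n$, $u\in G$ and $f\in A^n$, find a $K$-basis of $\{(c_1,\dots,c_n,g)\in K^n\times A\mid\sigma(g)-u\,g=c_1f_1+\dots+c_nf_n\}$, where $K=\mathrm{const}(A,\sigma)$. The last two problems are posed only if the nonzero semi-constants over $G$ form a subgroup of $A^*$; their solvability includes this. A problem is solvable if an algorithm solves it on all admissible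 inputs. A difference field $(F,\sigma)$ is computable if its elements are coded so that equality is decidable and the field operations and $\sigma$ are computable; elements of an $R\Pi\Sigma$-extension $E$ are then given as sums of terms $c\,t_1^{m_1}\cdots t_e^{m_e}$ with $c\in F$ (with $m_i\ge0$ if $t_i$ is of type $\Sigma$). $(F,\sigma)$ is strong constant-stable if $\mathrm{const}(F,\sigma^k)=\mathrm{const}(F,\sigma)$ for all $k>0$ and every root of unity in $F$ is a constant. **Theorem.** Let $(F,\sigma)$ be a computable difference field such that Problem O is solvable in $\mathrm{const}(F,\sigma)^*$, and let $(E,\sigma)$ be a simple $R\Pi\Sigma$-extension of $(F,\sigma)$. 1. If every root of unity in $F$ is a constant, then Problem O is solvable in $(F^*)^E_F$. If $(F,\sigma)$ is strong constant-stable, then: 2. Problem PMT is solvable in $(E,\sigma)$ for $(F^*)^E_F$ if it is solvable in $(F,\sigma)$ for $F^*$. 3. Problem PFLDE is solvable in $(E,\sigma)$ for $(F^*)^E_F$ if Problem PMT is solvable in $(F,\sigma)$ for $F^*$ and Problem PFLDE is solvable in $(F,\sigma^k)$ for $F^*$ for all $k>0$. -/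

import Mathlib

namespace DifferenceRing

section Basic

variable {A : Type*} [CommRing A]

/-- The ring of constants of the difference ring `(A, σ)`. -/
def constants (σ : A ≃+* A) : Subring A where
  carrier := {c | σ c = c}
  mul_mem' := by
    intro a b ha hb
    simp only [Set.mem_ofPred_eq] at *
    rw [map_mul, ha, hb]
  one_mem' := map_one σ
  add_mem' := by
    intro a b ha hb
    simp only [Set.mem_ofPred_eq] at *
    rw [map_add, ha, hb]
  zero_mem' := map_zero σ
  neg_mem' := by
    intro a ha
    simp only [Set.mem_ofPred_eq] at *
    rw [map_neg, ha]

/-- The group of those units of `A` that are constants of `(A, σ)`. If the constants form a field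
`K`, this is `K \ {0}`. -/
def constantUnits (σ : A ≃+* A) : Subgroup Aˣ where
  carrier := {u | σ (u : A) = u}
  mul_mem' := by
    intro a b ha hb
    simp only [Set.mem_ofPred_eq, Units.val_mul] at *
    rw [map_mul, ha, hb]
  one_mem' := by simp
  inv_mem' := by
    intro a ha
    have h : Units.map (σ : A →* A) a = a := Units.ext ha
    have h2 : Units.map (σ : A →* A) a⁻¹ = a⁻¹ := by rw [map_inv, h]
    exact congrArg Units.val h2

/-- Every root of unity of `A` is a constant. -/
def RootsOfUnityConstant (σ : A ≃+* A) : Prop :=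
  ∀ z : A, (∃ n : ℕ, 0 < n ∧ z ^ n = 1) → z ∈ constants σ

/-- `(A, σ)` is strong constant-stable: for all `k > 0` the constants of `(A, σ ^ k)` are those of
`(A, σ)`, and every root of unity of `A` is a constant. -/
def StrongConstantStable (σ : A ≃+* A) : Prop :=
  (∀ k : ℕ, 0 < k → constants (σ ^ k) = constants σ) ∧ RootsOfUnityConstant σ

/-- The set of semi-constants of `(A, σ)` over the group `G` of units. -/
def semiconstants (σ : A ≃+* A) (G : Subgroup Aˣ) : Set A :=
  {c | ∃ u ∈ G, σ c = u * c}

/-- The nonzero semi-constants over `G` form a subgroup of the group of units of `A`. -/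
def SemiconstantsFormGroup (σ : A ≃+* A) (G : Subgroup Aˣ) : Prop :=
  ∃ H : Subgroup Aˣ, semiconstants σ G \ {0} = (fun u : Aˣ => (u : A)) '' (H : Set Aˣ)

/-- The set `M(f, A)` of all integer vectors `m` such that `σ g = f₁ ^ m₁ ⋯ fₙ ^ mₙ * g` for some
nonzero `g` in `A`. -/
def multRelations (σ : A ≃+* A) {n : ℕ} (f : Fin n → Aˣ) : Set (Fin n → ℤ) :=
  {m | ∃ g : A, g ≠ 0 ∧ σ g = ((∏ i, f i ^ m i : Aˣ) : A) * g}

/-- The set `V(u, f, (A, σ))` of all `(c₁, …, cₙ, g)` with constants `cᵢ` and `g` in `A` such that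
`σ g - u * g = c₁ * f₁ + ⋯ + cₙ * fₙ`. -/
def pldeSolutions (σ : A ≃+* A) {n : ℕ} (u : A) (f : Fin n → A) : Set ((Fin n → A) × A) :=
  {v | (∀ i, v.1 i ∈ constants σ) ∧ σ v.2 - u * v.2 = ∑ i, v.1 i * f i}

/-- `b` is an `R`-basis of the subset `S` of the `R`-module `M`. -/
def IsBasisOf (R : Type*) {M : Type*} [Ring R] [AddCommGroup M] [Module R M] {d : ℕ}
    (b : Fin d → M) (S : Set M) : Prop :=
  LinearIndependent R b ∧ (Submodule.span R (Set.range b) : Set M) = S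

/-!
Algorithmic problems. The elements of `A` are handled through names: `ν c` is the element with
name `c`, and an element may have several names. "Solvable" means that some partial recursive
function, started on names of an admissible input, halts with (names of) a correct output.
-/

variable {C : Type*} [Primcodable C]

/-- Problem O is solvable in `G`: the order of an element of `G` (`0` if it is infinite) can be
computed. -/
def ProblemOSolvable (ν : C → A) (G : Subgroup Aˣ) : Prop :=
  ∃ alg : C →. ℕ, Partrec alg ∧
    ∀ (c : C) (a : Aˣ), a ∈ G → ν c = a → orderOf a ∈ alg c

/-- Problem PMT is solvable in `(A, σ)` for `G`: the problem is well-posed, and from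
`f₁, …, fₙ ∈ G` (where `n` is part of the input) a `ℤ`-basis of `M(f, A)` can be computed. -/
def PMTSolvable (ν : C → A) (σ : A ≃+* A) (G : Subgroup Aˣ) : Prop :=
  SemiconstantsFormGroup σ G ∧
  ∃ alg : List C →. List (List ℤ), Partrec alg ∧
    ∀ (fs : List C) (n : ℕ) (f : Fin n → Aˣ), (∀ i, f i ∈ G) →
      fs.map ν = List.ofFn (fun i => (f i : A)) →
      ∃ out ∈ alg fs, ∃ (d : ℕ) (b : Fin d → Fin n → ℤ),
        IsBasisOf ℤ b (multRelations σ f) ∧ out = List.ofFn (fun k => List.ofFn (b k))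

/-- Problem PFLDE is solvable in `(A, σ)` for `G`: the problem is well-posed, and from `u ∈ G` and
`f₁, …, fₙ ∈ A` (where `n` is part of the input) a basis of `V(u, f, (A, σ))` over the constants
of `(A, σ)` can be computed. -/
def PFLDESolvable (ν : C → A) (σ : A ≃+* A) (G : Subgroup Aˣ) : Prop :=
  SemiconstantsFormGroup σ G ∧
  ∃ alg : C × List C →. List (List C × C), Partrec alg ∧
    ∀ (cu : C) (u : Aˣ) (fs : List C) (n : ℕ) (f : Fin n → A), u ∈ G → ν cu = u →
      fs.map ν = List.ofFn f →
      ∃ out ∈ alg (cu, fs), ∃ (d : ℕ) (b : Fin d → (Fin n → A) × A),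
        IsBasisOf (constants σ) b (pldeSolutions σ (u : A) f) ∧
        out.map (fun p => (p.1.map ν, ν p.2)) = List.ofFn (fun k => (List.ofFn (b k).1, (b k).2))

end Basic

/-- `(F, σ)` is a computable difference field. The elements of `F` are identified with their codes
by the instance `Primcodable F`, so that zero recognition and equality are decidable. -/
structure IsComputableDifferenceField {F : Type*} [Field F] [Primcodable F] (σ : F ≃+* F) :
    Prop where
  add : Computable₂ (fun a b : F => a + b)
  neg : Computable (fun a : F => -a)
  mul : Computable₂ (fun a b : F => a * b)
  inv : Computable (fun a : F => a⁻¹)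
  map : Computable (fun a : F => σ a)

/-- A generator of a tower, with its intended type: a root of unity monomial `x` of order `n`,
a `Π`-monomial `t`, or a `Σ`-monomial `s`. -/
inductive Generator (E : Type*) [CommRing E] where
  | root (n : ℕ) (x : Eˣ) : Generator E
  | pi (t : Eˣ) : Generator E
  | sigma (s : E) : Generator E

namespace Generator

variable {E : Type*} [CommRing E]

/-- The elements that a generator adjoins. -/
def adjoined : Generator E → Set E
  | root _ x => {(x : E)}
  | pi t => {(t : E), ((t⁻¹ : Eˣ) : E)}
  | sigma s => {s}

/-- The factor with which a generator enters the product group; it is trivial for a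
`Σ`-monomial. -/
def unitPart : Generator E → Eˣ
  | root _ x => x
  | pi t => t
  | sigma _ => 1

/-- Powers of a generator. Only non-negative exponents are meant for a `Σ`-monomial. -/
def pow : Generator E → ℤ → E
  | root _ x, m => ((x ^ m : Eˣ) : E)
  | pi t, m => ((t ^ m : Eˣ) : E)
  | sigma s, m => s ^ m.toNat

variable {F : Type*} [Field F] [Algebra F E]

/-- The generator is algebraic of order `n`, resp. a Laurent polynomial variable, resp. a
polynomial variable over the subring `A`, and `σ` acts on it as it has to. -/
def IsUnimonomialOver (σ : E ≃+* E) (A : Subalgebra F E) : Generator E → Prop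
  | root n x => 1 < n ∧ x ^ n = 1 ∧ LinearIndependent A (fun k : Fin n => (x : E) ^ (k : ℕ)) ∧
      ∃ α : Aˣ, σ (x : E) = ((α : A) : E) * x
  | pi t => Transcendental A (t : E) ∧ ∃ α : Aˣ, σ (t : E) = ((α : A) : E) * t
  | sigma s => Transcendental A s ∧ σ s - s ∈ A

/-- The quotient `σ t / t` lies in `H` unless the generator `t` is a `Σ`-monomial. -/
def QuotientIn (σ : E ≃+* E) (H : Subgroup Eˣ) : Generator E → Prop
  | root _ x => ∃ u ∈ H, σ (x : E) = (u : E) * x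
  | pi t => ∃ u ∈ H, σ (t : E) = (u : E) * t
  | sigma _ => True

end Generator

section Tower

variable {F : Type*} [Field F] {E : Type*} [CommRing E] [Algebra F E] {e : ℕ}

/-- The subring `F⟨t₁⟩⋯⟨tᵢ⟩` of `E`. -/
def stage (F : Type*) [Field F] {E : Type*} [CommRing E] [Algebra F E] {e : ℕ}
    (t : Fin e → Generator E) (i : ℕ) : Subalgebra F E :=
  Algebra.adjoin F {a | ∃ j : Fin e, (j : ℕ) < i ∧ a ∈ (t j).adjoined}

/-- `(E, σ')` is the `RΠΣ`-extension `F⟨t₁⟩⋯⟨tₑ⟩` of the difference field `(F, σ)`: a tower in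
which each generator is unimonomial or algebraic over the previous stage and adds no constant. -/
structure IsRPiSigmaExtension (σ : F ≃+* F) (σ' : E ≃+* E) (t : Fin e → Generator E) : Prop where
  injective : Function.Injective (algebraMap F E)
  extends_map : ∀ a : F, σ' (algebraMap F E a) = algebraMap F E (σ a)
  generated : stage F t e = ⊤
  unimonomial : ∀ i : Fin e, (t i).IsUnimonomialOver σ' (stage F t i)
  constants_eq : ∀ i : Fin e, ∀ c ∈ stage F t (i + 1), c ∈ constants σ' → c ∈ stage F t i

/-- The product group over `G`: all `h * t₁ ^ m₁ * ⋯ * tₑ ^ mₑ` with `h ∈ G` and integers `mᵢ`,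
where the `Σ`-monomials are left out. -/
def productGroup (G : Subgroup Fˣ) (t : Fin e → Generator E) : Subgroup Eˣ where
  carrier := {a | ∃ h ∈ G, ∃ m : Fin e → ℤ,
    a = Units.map (algebraMap F E : F →* E) h * ∏ i, (t i).unitPart ^ m i}
  mul_mem' := by
    rintro a b ⟨h, hh, m, rfl⟩ ⟨h', hh', m', rfl⟩
    refine ⟨h * h', G.mul_mem hh hh', m + m', ?_⟩
    simp only [map_mul, Pi.add_apply, zpow_add, Finset.prod_mul_distrib]
    exact mul_mul_mul_comm _ _ _ _
  one_mem' := ⟨1, G.one_mem, 0, by simp⟩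
  inv_mem' := by
    rintro a ⟨h, hh, m, rfl⟩
    refine ⟨h⁻¹, G.inv_mem hh, -m, ?_⟩
    simp only [map_inv, Pi.neg_apply, zpow_neg, Finset.prod_inv_distrib, mul_inv]

/-- The `RΠΣ`-extension is `G`-simple. -/
def IsSimpleOver (G : Subgroup Fˣ) (σ' : E ≃+* E) (t : Fin e → Generator E) : Prop :=
  ∀ i : Fin e, (t i).QuotientIn σ' (productGroup G t)

/-- Names for the elements of `E`: finite lists of terms, each a coefficient in `F` with an
exponent vector. -/
abbrev Name (F : Type*) (e : ℕ) : Type _ := List (F × (Fin e → ℤ))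

/-- The element of `E` with a given name, the sum of the terms `c * t₁ ^ m₁ * ⋯ * tₑ ^ mₑ`. -/
def value (t : Fin e → Generator E) (l : Name F e) : E :=
  (l.map (fun p => algebraMap F E p.1 * ∏ i, (t i).pow (p.2 i))).sum

end Tower

end DifferenceRing

/-! Algorithms are obtained by search. A problem counts as solved once there is an enumerable
relation between inputs and outputs that offers some output on every admissible input and only
correct ones there (`Solves`); unbounded search then yields a partial recursive function
(`Solves.exists_partrec`). It therefore suffices to reduce each problem to steps whose results carry
a certificate that can be checked.

Structure of `E`. The monomials in the generators form an `F`-basis (`IsRPiSigmaExtension.basis`),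
and any single generator can play the role of the last variable. An element of finite order in the
product group contains no Π-monomial, so `σ'` preserves the subring `R` generated by all root of
unity monomials together, wherever they stand in the tower. The product of the averages of their
powers is an idempotent `ε` with `R * ε = F * ε`. Since roots of unity in `F` are constants, `ε` has
a finite period `P`, and its conjugates are orthogonal with sum `1` (`exists_isRootIdempotent`). So
`R` is a product of `P` copies of `F` permuted cyclically by `σ'`, and an equation `σ' g = u * g +
r` in `R` is an equation for one component over `(F, σ ^ P)`.

Semi-constants. By induction along the chain that starts with `R` and adds the other generators in
order, every nonzero semi-constant over the product group is a unit of `R` times a product of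
Π-monomials (`isSemimonomial_of_map_eq`). In a Π-step all but one coefficient vanish, because two of
them would give homogeneous solutions that differ by a constant factor; in a Σ-step a positive
degree would produce a new constant. Hence the nonzero semi-constants form a group.

Order. A term `h * t ^ a` has finite order exactly when its Π-exponents vanish and `h` has finite
order; such an `h` is a constant, and the given algorithm applies to it.

Multiplicative relations. Dividing by Π-monomials leaves a quotient `σ' ρ / ρ` with `ρ` in `R`.
Strong constant-stability turns this into the solvability of `σ c = h * b * c` in `F`, where `b` is
a constant whose `P`-th power is a prescribed root of unity (`exists_root_iff`). With discrete
logarithms to a fixed root of unity, all conditions become multiplicative relations in `F` together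
with linear equations between exponents (`exists_linear_criterion`), and the answer is a projection
of a lattice.

Linear difference equations. Right hand sides carry tags from an arbitrary vector space, so that the
constants `cᵢ` are remembered by the same combination of the tags. In `R` the problem is PFLDE for
`σ ^ P`. For a further generator the exponents of a solution are bounded
(`coeff_eq_zero_of_homogeneous`, `coeff_eq_zero_of_shift`, `coeff_eq_zero_of_sigma`), where the
Π-case needs one homogeneous solution, supplied by PMT. The coefficients are then eliminated one
after the other by the solver for the ring below (`solves_elimination`), and the residual is forced
to vanish by linear algebra over the constants (`nullSolvable_self`). -/

namespace DifferenceRing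

set_option linter.unusedSectionVars false

/-! ### Enumerable predicates and unbounded search -/

section Enumerability

variable {α β γ : Type*} [Primcodable α] [Primcodable β] [Primcodable γ]

/-- A predicate is enumerable if it is the projection of a computable one. -/
def Enumerable (p : α → Prop) : Prop :=
  ∃ f : α × ℕ → Bool, Computable f ∧ ∀ a, p a ↔ ∃ n, f (a, n) = true

theorem Enumerable.of_iff {p q : α → Prop} (hp : Enumerable p) (h : ∀ a, q a ↔ p a) :
    Enumerable q := by
  obtain ⟨f, hf, hfp⟩ := hp
  exact ⟨f, hf, fun a => (h a).trans (hfp a)⟩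

theorem Enumerable.comp {p : β → Prop} (hp : Enumerable p) {g : α → β} (hg : Computable g) :
    Enumerable fun a => p (g a) := by
  obtain ⟨f, hf, hfp⟩ := hp
  exact ⟨fun x => f (g x.1, x.2),
    hf.comp ((hg.comp Computable.fst).pair Computable.snd), fun a => hfp _⟩

theorem Enumerable.of_bool {f : α → Bool} (hf : Computable f) : Enumerable fun a => f a = true :=
  ⟨fun x => f x.1, hf.comp Computable.fst, fun a => by simp⟩

theorem Enumerable.and {p q : α → Prop} (hp : Enumerable p) (hq : Enumerable q) :
    Enumerable fun a => p a ∧ q a := by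
  obtain ⟨f, hf, hfp⟩ := hp
  obtain ⟨g, hg, hgq⟩ := hq
  refine ⟨fun x => f (x.1, x.2.unpair.1) && g (x.1, x.2.unpair.2), ?_, fun a => ?_⟩
  · have h1 : Computable fun x : α × ℕ => x.2.unpair := Computable.unpair.comp Computable.snd
    exact Primrec.and.to_comp.comp
      (hf.comp (Computable.fst.pair (Computable.fst.comp h1)))
      (hg.comp (Computable.fst.pair (Computable.snd.comp h1)))
  · simp only [hfp, hgq]
    constructor
    · rintro ⟨⟨m, hm⟩, n, hn⟩
      exact ⟨Nat.pair m n, by simp [hm, hn]⟩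
    · rintro ⟨n, hn⟩
      rw [Bool.and_eq_true] at hn
      exact ⟨⟨_, hn.1⟩, _, hn.2⟩

theorem Enumerable.or {p q : α → Prop} (hp : Enumerable p) (hq : Enumerable q) :
    Enumerable fun a => p a ∨ q a := by
  obtain ⟨f, hf, hfp⟩ := hp
  obtain ⟨g, hg, hgq⟩ := hq
  refine ⟨fun x => f x || g x, Primrec.or.to_comp.comp hf hg, fun a => ?_⟩
  simp only [hfp, hgq, ← exists_or]
  simp

/-- A witness and the stage that confirms it are packed into one natural number. A number that
decodes to no witness counts as a failed stage. -/
theorem Enumerable.exists {p : α → β → Prop} (hp : Enumerable fun x : α × β => p x.1 x.2) :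
    Enumerable fun a => ∃ b, p a b := by
  obtain ⟨f, hf, hfp⟩ := hp
  refine ⟨fun x => Option.casesOn (Encodable.decode (α := β) x.2.unpair.1) false
    fun b => f ((x.1, b), x.2.unpair.2), ?_, fun a => ?_⟩
  · have h1 : Computable fun x : α × ℕ => x.2.unpair := Computable.unpair.comp Computable.snd
    refine Computable.option_casesOn (Computable.decode.comp (Computable.fst.comp h1))
      (Computable.const false) ?_
    exact hf.comp (((Computable.fst.comp Computable.fst).pair Computable.snd).pair
      (Computable.snd.comp (h1.comp Computable.fst)))
  · constructor
    · rintro ⟨b, hb⟩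
      obtain ⟨n, hn⟩ := (hfp (a, b)).1 hb
      exact ⟨Nat.pair (Encodable.encode b) n, by simpa using hn⟩
    · rintro ⟨n, hn⟩
      rcases h : Encodable.decode (α := β) n.unpair.1 with _ | b
      · simp [h] at hn
      · exact ⟨b, (hfp (a, b)).2 ⟨n.unpair.2, by simpa [h] using hn⟩⟩

theorem computable_decide_eq [DecidableEq β] {f g : α → β} (hf : Computable f)
    (hg : Computable g) : Computable fun a => decide (f a = g a) :=
  (Primrec.eq (α := β)).decide.to_comp.comp hf hg

theorem Enumerable.eq {f g : α → β} (hf : Computable f) (hg : Computable g) :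
    Enumerable fun a => f a = g a := by
  classical
  exact (Enumerable.of_bool (computable_decide_eq hf hg)).of_iff fun a => by simp

theorem Enumerable.ne {f g : α → β} (hf : Computable f) (hg : Computable g) :
    Enumerable fun a => f a ≠ g a := by
  classical
  exact (Enumerable.of_bool (Primrec.not.to_comp.comp (computable_decide_eq hf hg))).of_iff
    fun a => by simp

theorem Enumerable.const (P : Prop) : Enumerable fun _ : α => P := by
  by_cases h : P
  · exact ⟨fun _ => true, Computable.const _, fun a => by simp [h]⟩
  · exact ⟨fun _ => false, Computable.const _, fun a => by simp [h]⟩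

theorem computable_ball_lt {g : α × ℕ → Bool} (hg : Computable g) :
    Computable fun x : α × ℕ => decide (∀ i < x.2, g (x.1, i) = true) := by
  refine (Computable.nat_rec (σ := Bool) (f := fun x : α × ℕ => x.2) (g := fun _ => true)
    (h := fun x p => p.2 && g (x.1, p.1)) Computable.snd (Computable.const _) ?_).of_eq fun x => ?_
  · exact Primrec.and.to_comp.comp (Computable.snd.comp Computable.snd)
      (hg.comp ((Computable.fst.comp Computable.fst).pair (Computable.fst.comp Computable.snd)))
  · obtain ⟨a, n⟩ := x
    induction n with
    | zero => simp
    | succ n ih =>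
      rw [Bool.eq_iff_iff] at ih ⊢
      simp only [decide_eq_true_eq] at ih ⊢
      rw [Bool.and_eq_true, ih]
      simp only [Nat.lt_succ_iff_lt_or_eq]
      constructor
      · rintro ⟨h1, h2⟩ i (h | rfl)
        exacts [h1 i h, h2]
      · exact fun h => ⟨fun i hi => h i (Or.inl hi), h n (Or.inr rfl)⟩

/-- Each index below the bound has its own confirming stage. These finitely many stages form one
list, so the bounded quantifier costs a single existential over lists followed by a computable
check. -/
theorem Enumerable.ball_lt {p : α → ℕ → Prop} (hp : Enumerable fun x : α × ℕ => p x.1 x.2)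
    {k : α → ℕ} (hk : Computable k) : Enumerable fun a => ∀ i < k a, p a i := by
  obtain ⟨f, hf, hfp⟩ := hp
  have key : Enumerable fun x : α × List ℕ =>
      decide (∀ i < k x.1, f ((x.1, i), (x.2[i]?).getD 0) = true) = true := by
    apply Enumerable.of_bool
    have h := computable_ball_lt (α := α × List ℕ)
      (g := fun y => f ((y.1.1, y.2), (y.1.2[y.2]?).getD 0)) (by
        refine hf.comp (Computable.pair ((Computable.fst.comp Computable.fst).pair Computable.snd) ?_)
        exact Computable.option_getD (Computable.list_getElem?.comp
          (Computable.snd.comp Computable.fst) Computable.snd) (Computable.const 0))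
    exact h.comp (Computable.id.pair (hk.comp Computable.fst))
  refine (key.exists (p := fun a l => decide (∀ i < k a, f ((a, i), (l[i]?).getD 0) = true) = true)
    ).of_iff fun a => ?_
  simp only [decide_eq_true_eq]
  constructor
  · intro h
    have h' : ∀ i, ∃ n, i < k a → f ((a, i), n) = true := by
      intro i
      by_cases hi : i < k a
      · obtain ⟨n, hn⟩ := (hfp (a, i)).1 (h i hi)
        exact ⟨n, fun _ => hn⟩
      · exact ⟨0, fun h => absurd h hi⟩
    choose w hw using h'
    refine ⟨(List.range (k a)).map w, fun i hi => ?_⟩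
    simp [List.getElem?_range hi, hw i hi]
  · rintro ⟨l, hl⟩ i hi
    exact (hfp (a, i)).2 ⟨_, hl i hi⟩

theorem Enumerable.ball_mem {p : α → β → Prop} (hp : Enumerable fun x : α × β => p x.1 x.2)
    {l : α → List β} (hl : Computable l) : Enumerable fun a => ∀ b ∈ l a, p a b := by
  have h1 : Enumerable fun x : α × ℕ => ∃ b, (l x.1)[x.2]? = some b ∧ p x.1 b := by
    refine Enumerable.exists (p := fun (x : α × ℕ) b => (l x.1)[x.2]? = some b ∧ p x.1 b) ?_
    refine Enumerable.and (Enumerable.eq ?_ (Computable.option_some.comp Computable.snd)) ?_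
    · exact Computable.list_getElem?.comp
        (hl.comp (Computable.fst.comp Computable.fst)) (Computable.snd.comp Computable.fst)
    · exact hp.comp ((Computable.fst.comp Computable.fst).pair Computable.snd)
  refine (h1.ball_lt (p := fun a i => ∃ b, (l a)[i]? = some b ∧ p a b)
    (Computable.list_length.comp hl)).of_iff fun a => ?_
  constructor
  · intro h i hi
    exact ⟨_, List.getElem?_eq_getElem hi, h _ (List.getElem_mem hi)⟩
  · intro h b hb
    obtain ⟨i, hi, rfl⟩ := List.getElem_of_mem hb
    obtain ⟨b, hb, hpb⟩ := h i hi
    rw [List.getElem?_eq_getElem hi] at hb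
    cases hb
    exact hpb

theorem Enumerable.forall₂ {R : α → β → γ → Prop}
    (hR : Enumerable fun x : α × β × γ => R x.1 x.2.1 x.2.2)
    {l : α → List β} {l' : α → List γ} (hl : Computable l) (hl' : Computable l') :
    Enumerable fun a => List.Forall₂ (R a) (l a) (l' a) := by
  have h1 : Enumerable fun x : α × ℕ =>
      ∃ bc : β × γ, ((l x.1)[x.2]? = some bc.1 ∧ (l' x.1)[x.2]? = some bc.2) ∧
        R x.1 bc.1 bc.2 := by
    refine Enumerable.exists (p := fun (x : α × ℕ) (bc : β × γ) =>
      ((l x.1)[x.2]? = some bc.1 ∧ (l' x.1)[x.2]? = some bc.2) ∧ R x.1 bc.1 bc.2) ?_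
    refine Enumerable.and (Enumerable.and (Enumerable.eq ?_ ?_) (Enumerable.eq ?_ ?_)) ?_
    · exact Computable.list_getElem?.comp
        (hl.comp (Computable.fst.comp Computable.fst)) (Computable.snd.comp Computable.fst)
    · exact Computable.option_some.comp (Computable.fst.comp Computable.snd)
    · exact Computable.list_getElem?.comp
        (hl'.comp (Computable.fst.comp Computable.fst)) (Computable.snd.comp Computable.fst)
    · exact Computable.option_some.comp (Computable.snd.comp Computable.snd)
    · exact hR.comp ((Computable.fst.comp Computable.fst).pair Computable.snd)
  have h2 : Enumerable fun a => (l a).length = (l' a).length :=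
    Enumerable.eq (Computable.list_length.comp hl) (Computable.list_length.comp hl')
  refine (h2.and (h1.ball_lt (p := fun a i => ∃ bc : β × γ,
    ((l a)[i]? = some bc.1 ∧ (l' a)[i]? = some bc.2) ∧ R a bc.1 bc.2)
    (Computable.list_length.comp hl))).of_iff fun a => ?_
  rw [List.forall₂_iff_get]
  refine and_congr_right fun hlen => ?_
  constructor
  · intro h i hi
    exact ⟨((l a)[i], (l' a)[i]'(hlen ▸ hi)), ⟨List.getElem?_eq_getElem hi,
      List.getElem?_eq_getElem _⟩, h i hi (hlen ▸ hi)⟩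
  · intro h i hi hi'
    obtain ⟨bc, ⟨h1, h2⟩, h3⟩ := h i hi
    rw [List.getElem?_eq_getElem hi] at h1
    rw [List.getElem?_eq_getElem hi'] at h2
    simp only [Option.some.injEq] at h1 h2
    simpa only [List.get_eq_getElem, h1, h2] using h3

/-- A path is a finite list with related neighbours, so reachability is an existential over lists.
-/
theorem Enumerable.reflTransGen {R : α → β → β → Prop}
    (hR : Enumerable fun x : α × β × β => R x.1 x.2.1 x.2.2) :
    Enumerable fun x : α × β × β => Relation.ReflTransGen (R x.1) x.2.1 x.2.2 := by
  have h1 : Enumerable fun y : ((α × β × β) × List β) × ℕ =>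
      ∃ bc : β × β, (y.1.2[y.2]? = some bc.1 ∧ y.1.2[y.2 + 1]? = some bc.2) ∧
        R y.1.1.1 bc.1 bc.2 := by
    refine Enumerable.exists (p := fun (y : ((α × β × β) × List β) × ℕ) (bc : β × β) =>
      (y.1.2[y.2]? = some bc.1 ∧ y.1.2[y.2 + 1]? = some bc.2) ∧ R y.1.1.1 bc.1 bc.2) ?_
    have hl : Computable fun y : (((α × β × β) × List β) × ℕ) × (β × β) => y.1.1.2 :=
      Computable.snd.comp (Computable.fst.comp Computable.fst)
    have hn : Computable fun y : (((α × β × β) × List β) × ℕ) × (β × β) => y.1.2 :=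
      Computable.snd.comp Computable.fst
    refine Enumerable.and (Enumerable.and (Enumerable.eq ?_ ?_) (Enumerable.eq ?_ ?_)) ?_
    · exact Computable.list_getElem?.comp hl hn
    · exact Computable.option_some.comp (Computable.fst.comp Computable.snd)
    · exact Computable.list_getElem?.comp hl (Computable.succ.comp hn)
    · exact Computable.option_some.comp (Computable.snd.comp Computable.snd)
    · exact hR.comp ((Computable.fst.comp (Computable.fst.comp
        (Computable.fst.comp Computable.fst))).pair Computable.snd)
  have h2 := h1.ball_lt (p := fun (z : (α × β × β) × List β) i =>
    ∃ bc : β × β, (z.2[i]? = some bc.1 ∧ z.2[i + 1]? = some bc.2) ∧ R z.1.1 bc.1 bc.2)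
    (k := fun z => z.2.length - 1)
    (Computable.pred.comp (Computable.list_length.comp Computable.snd))
  have h3 : Enumerable fun z : (α × β × β) × List β => z.2[0]? = some z.1.2.1 :=
    Enumerable.eq (Computable.list_getElem?.comp Computable.snd (Computable.const 0))
      (Computable.option_some.comp (Computable.fst.comp (Computable.snd.comp Computable.fst)))
  have h4 : Enumerable fun z : (α × β × β) × List β => z.2[z.2.length - 1]? = some z.1.2.2 :=
    Enumerable.eq (Computable.list_getElem?.comp Computable.snd
      (Computable.pred.comp (Computable.list_length.comp Computable.snd)))
      (Computable.option_some.comp (Computable.snd.comp (Computable.snd.comp Computable.fst)))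
  refine (((h3.and h4).and h2).exists (p := fun (x : α × β × β) (l : List β) =>
    (l[0]? = some x.2.1 ∧ l[l.length - 1]? = some x.2.2) ∧ ∀ i < l.length - 1,
      ∃ bc : β × β, (l[i]? = some bc.1 ∧ l[i + 1]? = some bc.2) ∧ R x.1 bc.1 bc.2)).of_iff ?_
  rintro ⟨a, b, c⟩
  simp only
  constructor
  · intro h
    induction h using Relation.ReflTransGen.head_induction_on with
    | refl => exact ⟨[c], by simp⟩
    | @head b b' hbb' _ ih =>
      obtain ⟨l, ⟨h0, hlast⟩, hl⟩ := ih
      cases l with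
      | nil => simp at h0
      | cons d l =>
        simp only [List.getElem?_cons_zero, Option.some.injEq] at h0
        subst h0
        refine ⟨b :: d :: l, ⟨by simp, by simpa using hlast⟩, fun i hi => ?_⟩
        cases i with
        | zero => exact ⟨(b, d), by simpa using hbb'⟩
        | succ i => simpa using hl i (by simpa using hi)
  · rintro ⟨l, ⟨h0, hlast⟩, hl⟩
    have key : ∀ i < l.length, ∀ d, l[i]? = some d → Relation.ReflTransGen (R a) b d := by
      intro i
      induction i with
      | zero =>
        intro _ d hd
        rw [h0] at hd
        cases hd
        exact .refl
      | succ i ih =>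
        intro hi d hd
        obtain ⟨⟨d1, d2⟩, ⟨h1, h2⟩, h3⟩ := hl i (by omega)
        simp only at h1 h2
        rw [hd] at h2
        cases h2
        exact (ih (by omega) d1 h1).tail h3
    have hpos : 0 < l.length := by
      by_contra h
      have : l = [] := List.eq_nil_of_length_eq_zero (by omega)
      simp [this] at h0
    exact key (l.length - 1) (by omega) c hlast

/-- The bounded evaluator `evaln` is computable and finds every value of the function once its bound
is large enough. -/
theorem Enumerable.of_partrec {f : α →. β} (hf : Partrec f) :
    Enumerable fun x : α × β => x.2 ∈ f x.1 := by
  obtain ⟨c, hc⟩ := Nat.Partrec.Code.exists_code.1 hf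
  classical
  refine ⟨fun y => decide (Nat.Partrec.Code.evaln y.2 c (Encodable.encode y.1.1) =
    some (Encodable.encode y.1.2)), ?_, ?_⟩
  · apply computable_decide_eq
    · exact Nat.Partrec.Code.primrec_evaln.to_comp.comp ((Computable.snd.pair (Computable.const c)).pair
        (Computable.encode.comp (Computable.fst.comp Computable.fst)))
    · exact Computable.option_some.comp (Computable.encode.comp
        (Computable.snd.comp Computable.fst))
  · rintro ⟨a, b⟩
    have h1 : b ∈ f a ↔ Encodable.encode b ∈ Nat.Partrec.Code.eval c (Encodable.encode a) := by
      rw [hc]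
      simp
    simp only [h1, Nat.Partrec.Code.evaln_complete, decide_eq_true_eq, Option.mem_def]

/-- Search through all pairs of a candidate and a stage. Which candidate is found depends on the
order of the search, so the value is only known to be related to the input. -/
theorem Enumerable.exists_partrec {R : α → β → Prop} (hR : Enumerable fun x : α × β => R x.1 x.2) :
    ∃ f : α →. β, Partrec f ∧ (∀ a, (∃ b, R a b) → ∃ b, b ∈ f a) ∧ ∀ a, ∀ b ∈ f a, R a b := by
  obtain ⟨g, hg, hgR⟩ := hR
  let h : α → ℕ → Option β := fun a n =>
    Option.casesOn (Encodable.decode (α := β) n.unpair.1) none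
      fun b => bif g ((a, b), n.unpair.2) then some b else none
  have hh : Computable₂ h := by
    have h1 : Computable fun x : α × ℕ => x.2.unpair := Computable.unpair.comp Computable.snd
    refine Computable.option_casesOn (Computable.decode.comp (Computable.fst.comp h1))
      (Computable.const none) ?_
    refine Computable.cond (hg.comp ?_) (Computable.option_some.comp Computable.snd)
      (Computable.const none)
    exact ((Computable.fst.comp Computable.fst).pair Computable.snd).pair
      (Computable.snd.comp (h1.comp Computable.fst))
  have hspec : ∀ a n b, h a n = some b → R a b := by
    intro a n b hb
    rcases hd : Encodable.decode (α := β) n.unpair.1 with _ | b'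
    · simp [h, hd] at hb
    · simp only [h, hd] at hb
      rcases hgb : g ((a, b'), n.unpair.2) with _ | _
      · simp [hgb] at hb
      · simp only [hgb, cond_true, Option.some.injEq] at hb
        subst hb
        exact (hgR (a, b')).2 ⟨_, hgb⟩
  refine ⟨fun a => Nat.rfindOpt (h a), Partrec.rfindOpt hh, ?_, ?_⟩
  · rintro a ⟨b, hb⟩
    obtain ⟨n, hn⟩ := (hgR (a, b)).1 hb
    have hdom : (Nat.rfindOpt (h a)).Dom := by
      rw [Nat.rfindOpt_dom]
      exact ⟨Nat.pair (Encodable.encode b) n, b, by simp [h, hn]⟩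
    exact ⟨_, Part.get_mem hdom⟩
  · intro a b hb
    obtain ⟨n, hn⟩ := Nat.rfindOpt_spec hb
    exact hspec a n b hn

/-- A total function is computed by searching for its value. This replaces explicit recursion
schemes below: it is enough to describe the graph. -/
theorem computable_of_graph {f : α → β} (hf : Enumerable fun x : α × β => x.2 = f x.1) :
    Computable f := by
  obtain ⟨g, hg, hg1, hg2⟩ := hf.exists_partrec (R := fun a b => b = f a)
  refine Partrec.of_eq_tot hg fun a => ?_
  obtain ⟨b, hb⟩ := hg1 a ⟨_, rfl⟩
  rwa [hg2 a b hb] at hb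

theorem computable_decide {p : α → Prop} [DecidablePred p] (hp : Enumerable p)
    (hn : Enumerable fun a => ¬ p a) : Computable fun a => decide (p a) := by
  refine computable_of_graph (((hp.comp Computable.fst).and
    (Enumerable.eq Computable.snd (Computable.const true))).or
    ((hn.comp Computable.fst).and (Enumerable.eq Computable.snd (Computable.const false)))
    |>.of_iff ?_)
  rintro ⟨a, b⟩
  by_cases h : p a <;> simp [h]

theorem Computable.list_map {f : α → List β} {g : α → β → γ} (hf : Computable f)
    (hg : Computable₂ g) : Computable fun a => (f a).map (g a) := by
  refine computable_of_graph ((Enumerable.forall₂ (α := α × List γ) (β := β) (γ := γ)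
    (R := fun x b c => c = g x.1 b) (l := fun x => f x.1) (l' := fun x => x.2)
    (Enumerable.eq (Computable.snd.comp Computable.snd) (hg.comp
      (Computable.fst.comp Computable.fst) (Computable.fst.comp Computable.snd)))
    (hf.comp Computable.fst) Computable.snd).of_iff ?_)
  rintro ⟨a, l⟩
  simp only
  generalize f a = m
  induction m generalizing l with
  | nil => simp [List.forall₂_nil_left_iff]
  | cons b m ih =>
    cases l with
    | nil => simp
    | cons c l => simp [ih]

theorem Computable.list_foldl {f : α → List β} {g : α → γ} {h : α → γ × β → γ}
    (hf : Computable f) (hg : Computable g) (hh : Computable₂ h) :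
    Computable fun a => (f a).foldl (fun s b => h a (s, b)) (g a) := by
  have key : Computable fun a => (Nat.rec (g a) (fun n s =>
      Option.casesOn ((f a)[n]?) s fun b => h a (s, b)) (f a).length : γ) := by
    refine Computable.nat_rec (h := fun a p => Option.casesOn ((f a)[p.1]?) p.2
      fun b => h a (p.2, b)) (Computable.list_length.comp hf) hg ?_
    refine Computable.option_casesOn (Computable.list_getElem?.comp (hf.comp Computable.fst)
      (Computable.fst.comp Computable.snd)) (Computable.snd.comp Computable.snd) ?_
    exact hh.comp (Computable.fst.comp Computable.fst)
      ((Computable.snd.comp (Computable.snd.comp Computable.fst)).pair Computable.snd)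
  refine key.of_eq fun a => ?_
  have h2 : ∀ n, (Nat.rec (g a) (fun n s => Option.casesOn ((f a)[n]?) s fun b => h a (s, b)) n : γ)
      = ((f a).take n).foldl (fun s b => h a (s, b)) (g a) := by
    intro n
    induction n with
    | zero => simp
    | succ n ih =>
      simp only [ih]
      rw [List.take_add_one, List.foldl_append]
      rcases (f a)[n]? with _ | b <;> simp
  rw [h2, List.take_length]

theorem Computable.list_sum {f : α → List β} [AddCommMonoid β] (hadd : Computable₂ fun a b : β => a + b)
    (hf : Computable f) : Computable fun a => (f a).sum := by
  refine (Computable.list_foldl (h := fun _ p => p.1 + p.2) hf (Computable.const (0 : β))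
    (hadd.comp (Computable.fst.comp Computable.snd)
    (Computable.snd.comp Computable.snd))).of_eq fun a => ?_
  rw [List.sum_eq_foldl]

theorem Computable.list_flatMap {f : α → List β} {g : α → β → List γ} (hf : Computable f)
    (hg : Computable₂ g) : Computable fun a => (f a).flatMap (g a) := by
  refine (Computable.list_foldl (h := fun a q => q.1 ++ g a q.2)
    hf (Computable.const []) ?_).of_eq fun a => ?_
  · exact Computable.list_append.comp (Computable.fst.comp Computable.snd)
      (hg.comp Computable.fst (Computable.snd.comp Computable.snd))
  · have : ∀ (l : List β) m, l.foldl (fun s b => s ++ g a b) m = m ++ l.flatMap (g a) := by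
      intro l
      induction l with
      | nil => simp
      | cons b l ih => intro m; simp [ih]
    simp [this]

end Enumerability

/-! ### Problems as enumerable relations between inputs and outputs -/

section Solvability

variable {α β γ δ : Type*} [Primcodable α] [Primcodable β] [Primcodable γ] [Primcodable δ]

/-- From every input in `D` an output that is correct according to `P` can be computed. -/
def Solves (D : α → Prop) (P : α → β → Prop) : Prop :=
  ∃ R : α → β → Prop, Enumerable (fun x : α × β => R x.1 x.2) ∧ (∀ a, D a → ∃ b, R a b) ∧
    ∀ a, D a → ∀ b, R a b → P a b

theorem Solves.mono {D D' : α → Prop} {P P' : α → β → Prop} (h : Solves D P)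
    (hD : ∀ a, D' a → D a) (hP : ∀ a b, D' a → P a b → P' a b) : Solves D' P' := by
  obtain ⟨R, h1, h2, h3⟩ := h
  exact ⟨R, h1, fun a ha => h2 a (hD a ha), fun a ha b hb => hP a b ha (h3 a (hD a ha) b hb)⟩

theorem Solves.of_enumerable {D : α → Prop} {P : α → β → Prop}
    (hP : Enumerable fun x : α × β => P x.1 x.2) (h : ∀ a, D a → ∃ b, P a b) : Solves D P :=
  ⟨P, hP, h, fun _ _ _ hb => hb⟩

theorem Solves.of_computable {D : α → Prop} {P : α → β → Prop} {f : α → β} (hf : Computable f)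
    (h : ∀ a, D a → P a (f a)) : Solves D P :=
  ⟨fun a b => b = f a, Enumerable.eq Computable.snd (hf.comp Computable.fst),
    fun a _ => ⟨f a, rfl⟩, by rintro a ha b rfl; exact h a ha⟩

theorem Solves.comp {D : β → Prop} {P : β → γ → Prop} (h : Solves D P) {g : α → β}
    (hg : Computable g) : Solves (fun a => D (g a)) fun a => P (g a) := by
  obtain ⟨R, h1, h2, h3⟩ := h
  exact ⟨fun a => R (g a), h1.comp ((hg.comp Computable.fst).pair Computable.snd),
    fun a => h2 (g a), fun a => h3 (g a)⟩

/-- Sequential composition. The intermediate output survives in the conclusion as an existential, so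
that facts about it stay available. -/
theorem Solves.bind {D : α → Prop} {P : α → β → Prop} {D' : α × β → Prop} {Q : α × β → γ → Prop}
    (h : Solves D P) (h' : Solves D' Q) (hD : ∀ a b, D a → P a b → D' (a, b)) :
    Solves D fun a c => ∃ b, P a b ∧ Q (a, b) c := by
  obtain ⟨R, h1, h2, h3⟩ := h
  obtain ⟨S, k1, k2, k3⟩ := h'
  refine ⟨fun a c => ∃ b, R a b ∧ S (a, b) c, ?_, ?_, ?_⟩
  · refine Enumerable.exists (p := fun (x : α × γ) b => R x.1 b ∧ S (x.1, b) x.2) ?_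
    exact (h1.comp ((Computable.fst.comp Computable.fst).pair Computable.snd)).and
      (k1.comp (((Computable.fst.comp Computable.fst).pair Computable.snd).pair
        (Computable.snd.comp Computable.fst)))
  · intro a ha
    obtain ⟨b, hb⟩ := h2 a ha
    obtain ⟨c, hc⟩ := k2 (a, b) (hD a b ha (h3 a ha b hb))
    exact ⟨c, b, hb, hc⟩
  · rintro a ha c ⟨b, hb, hc⟩
    have := h3 a ha b hb
    exact ⟨b, this, k3 (a, b) (hD a b ha this) c hc⟩

theorem Solves.cases {D c : α → Prop} {P : α → β → Prop} (hc : Enumerable c)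
    (hn : Enumerable fun a => ¬ c a) (h1 : Solves (fun a => D a ∧ c a) P)
    (h2 : Solves (fun a => D a ∧ ¬ c a) P) : Solves D P := by
  obtain ⟨R, a1, a2, a3⟩ := h1
  obtain ⟨S, b1, b2, b3⟩ := h2
  refine ⟨fun a b => c a ∧ R a b ∨ ¬ c a ∧ S a b,
    ((hc.comp Computable.fst).and a1).or ((hn.comp Computable.fst).and b1), ?_, ?_⟩
  · intro a ha
    by_cases h : c a
    · obtain ⟨b, hb⟩ := a2 a ⟨ha, h⟩
      exact ⟨b, Or.inl ⟨h, hb⟩⟩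
    · obtain ⟨b, hb⟩ := b2 a ⟨ha, h⟩
      exact ⟨b, Or.inr ⟨h, hb⟩⟩
  · rintro a ha b (⟨h, hb⟩ | ⟨h, hb⟩)
    · exact a3 a ⟨ha, h⟩ b hb
    · exact b3 a ⟨ha, h⟩ b hb

/-- A while loop as reachability under the step relation. The measure `μ` only proves termination
and need not be computable; the preorder `Rel` transports what a run preserves. -/
theorem Solves.iterate {Inv done : α → Prop} {Rel : α → α → Prop} (μ : α → ℕ)
    (hdone : Enumerable done) (hnot : Enumerable fun a => ¬ done a)
    (hstep : Solves (fun s => Inv s ∧ ¬ done s) fun s s' => Inv s' ∧ μ s' < μ s ∧ Rel s s')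
    (hrefl : ∀ s, Rel s s) (htrans : ∀ a b c, Rel a b → Rel b c → Rel a c) :
    Solves Inv fun s s' => Inv s' ∧ done s' ∧ Rel s s' := by
  obtain ⟨R, h1, h2, h3⟩ := hstep
  have hR : Enumerable fun x : Unit × α × α => ¬ done x.2.1 ∧ R x.2.1 x.2.2 :=
    (hnot.comp (Computable.fst.comp Computable.snd)).and (h1.comp Computable.snd)
  refine ⟨fun s s' => Relation.ReflTransGen (fun s s' => ¬ done s ∧ R s s') s s' ∧ done s',
    ((Enumerable.reflTransGen (R := fun _ s s' => ¬ done s ∧ R s s') hR).comp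
      ((Computable.const ()).pair Computable.id)).and (hdone.comp Computable.snd), ?_, ?_⟩
  · have : ∀ n, ∀ s, μ s ≤ n → Inv s → ∃ s',
        Relation.ReflTransGen (fun s s' => ¬ done s ∧ R s s') s s' ∧ done s' := by
      intro n
      induction n with
      | zero =>
        intro s hs hi
        by_cases hd : done s
        · exact ⟨s, .refl, hd⟩
        · obtain ⟨b, hb⟩ := h2 s ⟨hi, hd⟩
          have := h3 s ⟨hi, hd⟩ b hb
          omega
      | succ n ih =>
        intro s hs hi
        by_cases hd : done s
        · exact ⟨s, .refl, hd⟩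
        · obtain ⟨b, hb⟩ := h2 s ⟨hi, hd⟩
          obtain ⟨hb1, hb2, -⟩ := h3 s ⟨hi, hd⟩ b hb
          obtain ⟨s', h4, h5⟩ := ih b (by omega) hb1
          exact ⟨s', .head ⟨hd, hb⟩ h4, h5⟩
    exact fun s => this _ s le_rfl
  · rintro s hs s' ⟨hss', hd⟩
    have : Inv s' ∧ Rel s s' := by
      clear hd
      induction hss' with
      | refl => exact ⟨hs, hrefl s⟩
      | tail _ hbc ih =>
        obtain ⟨hc1, -, hc2⟩ := h3 _ ⟨ih.1, hbc.1⟩ _ hbc.2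
        exact ⟨hc1, htrans _ _ _ ih.2 hc2⟩
    exact ⟨this.1, hd, this.2⟩

theorem Solves.of_partrec {D : α → Prop} {P : α → β → Prop} {f : α →. β} (hf : Partrec f)
    (h : ∀ a, D a → ∃ b ∈ f a, P a b) : Solves D P := by
  refine ⟨fun a b => b ∈ f a, Enumerable.of_partrec hf, fun a ha => ?_, fun a ha b hb => ?_⟩
  · obtain ⟨b, hb, -⟩ := h a ha
    exact ⟨b, hb⟩
  · obtain ⟨b', hb', hP⟩ := h a ha
    rwa [Part.mem_unique hb hb']

theorem Solves.exists_partrec {D : α → Prop} {P : α → β → Prop} (h : Solves D P) :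
    ∃ f : α →. β, Partrec f ∧ ∀ a, D a → ∃ b ∈ f a, P a b := by
  obtain ⟨R, h1, h2, h3⟩ := h
  obtain ⟨f, hf, hf1, hf2⟩ := h1.exists_partrec
  refine ⟨f, hf, fun a ha => ?_⟩
  obtain ⟨b, hb⟩ := hf1 a (h2 a ha)
  exact ⟨b, hb, h3 a ha b (hf2 a b hb)⟩

end Solvability

/-! ### Codings of sets whose elements have names -/

section Codings

/-- Keep for each element of `A` only its least code. By decidable equality of names these codes
form a decidable set, which is infinite because `A` is, and counting through it gives a bijection
with `ℕ` that is computable in both directions. -/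
theorem exists_primcodable_of_surjective {C A : Type*} [Primcodable C] [Infinite A] {ν : C → A}
    (hν : Function.Surjective ν) [DecidableEq A]
    (heq : Computable fun x : C × C => decide (ν x.1 = ν x.2)) :
    ∃ _ : Primcodable A, Computable ν ∧ ∃ s : A → C, Computable s ∧ ∀ a, ν (s a) = a := by
  classical
  -- `isNew (n, m)` tests that the number `n` does not name the same element as `m`. A number `m`
  -- that is not a code is never an obstacle.
  obtain ⟨isNew, hisNew, hnone, hsome⟩ : ∃ isNew : ℕ × ℕ → Bool, Computable isNew ∧
      (∀ n m, Encodable.decode (α := C) m = none → (Encodable.decode (α := C) n).isSome →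
        isNew (n, m) = true) ∧
      ∀ n m c c', Encodable.decode (α := C) n = some c → Encodable.decode (α := C) m = some c' →
        (isNew (n, m) = true ↔ ν c ≠ ν c') := by
    refine ⟨fun x => Option.casesOn (Encodable.decode (α := C) x.1) false fun c =>
      Option.casesOn (Encodable.decode (α := C) x.2) true fun c' => !decide (ν c = ν c'), ?_, ?_, ?_⟩
    · refine Computable.option_casesOn (o := fun x : ℕ × ℕ => Encodable.decode (α := C) x.1)
        (f := fun _ => false) (g := fun x c => Option.casesOn (Encodable.decode (α := C) x.2) true
          fun c' => !decide (ν c = ν c')) (Computable.decode.comp Computable.fst)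
        (Computable.const false) ?_
      refine Computable.option_casesOn (o := fun y : (ℕ × ℕ) × C => Encodable.decode (α := C) y.1.2)
        (f := fun _ => true) (g := fun y c' => !decide (ν y.2 = ν c')) (Computable.decode.comp
        (Computable.snd.comp Computable.fst)) (Computable.const true) ?_
      have h1 : Computable fun z : ((ℕ × ℕ) × C) × C => (z.1.2, z.2) :=
        (Computable.snd.comp Computable.fst).pair Computable.snd
      have h2 : Computable fun z : ((ℕ × ℕ) × C) × C => decide (ν z.1.2 = ν z.2) :=
        (heq.comp h1).of_eq fun _ => rfl
      have h3 : Computable fun z : ((ℕ × ℕ) × C) × C => !decide (ν z.1.2 = ν z.2) :=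
        Computable.comp Primrec.not.to_comp h2
      exact h3
    · intro n m hm hn
      obtain ⟨c, hc⟩ := Option.isSome_iff_exists.1 hn
      simp [hm, hc]
    · intro n m c c' hc hc'
      simp [hc, hc']
  -- The kept codes: those whose element is not named by a smaller code.
  obtain ⟨p, hpdef⟩ : ∃ p : ℕ → Prop, ∀ n, p n ↔ (Encodable.decode (α := C) n).isSome ∧
    ∀ m < n, isNew (n, m) = true := ⟨_, fun _ => Iff.rfl⟩
  have : DecidablePred p := Classical.decPred p
  have hp : Computable fun n : ℕ => decide (p n) := by
    have h1 : Computable fun n : ℕ => decide (∀ m < n, isNew (n, m) = true) :=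
      (computable_ball_lt hisNew).comp (Computable.id.pair Computable.id)
    have h2 : Computable fun n : ℕ => (Encodable.decode (α := C) n).isSome :=
      Primrec.option_isSome.to_comp.comp Computable.decode
    refine (Primrec.and.to_comp.comp h2 h1).of_eq fun n => ?_
    simp [hpdef]
  have hcount : Computable (Nat.count p) := by
    refine (Computable.nat_rec (f := fun n : ℕ => n) (g := fun _ => 0)
      (h := fun _ q => q.2 + bif decide (p q.1) then 1 else 0) Computable.id
      (Computable.const 0) ?_).of_eq fun n => ?_
    · exact Primrec.nat_add.to_comp.comp (Computable.snd.comp Computable.snd)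
        (Computable.cond (hp.comp (Computable.fst.comp Computable.snd)) (Computable.const 1)
          (Computable.const 0))
    · induction n with
      | zero => simp
      | succ n ih => rw [Nat.count_succ, ← ih]; by_cases h : p n <;> simp [h]
  have hex : ∀ a : A, ∃ n c, p n ∧ Encodable.decode (α := C) n = some c ∧ ν c = a := by
    intro a
    have hne : ∃ n, ∃ c, Encodable.decode (α := C) n = some c ∧ ν c = a := by
      obtain ⟨c, hc⟩ := hν a
      exact ⟨Encodable.encode c, c, Encodable.encodek c, hc⟩
    obtain ⟨c, hc, hca⟩ := Nat.find_spec hne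
    refine ⟨Nat.find hne, c, (hpdef _).2 ⟨by simp [hc], fun m hm => ?_⟩, hc, hca⟩
    have hm' := Nat.find_min hne hm
    rcases hd : Encodable.decode (α := C) m with _ | c'
    · exact hnone _ _ hd (by simp [hc])
    · refine (hsome _ _ c c' hc hd).2 fun h => ?_
      exact hm' ⟨c', hd, h ▸ hca⟩
  have hinj : ∀ n m c c', p n → p m → Encodable.decode (α := C) n = some c →
      Encodable.decode (α := C) m = some c' → ν c = ν c' → n = m := by
    have key : ∀ n m c c', p n → Encodable.decode (α := C) n = some c →
      Encodable.decode (α := C) m = some c' → ν c = ν c' → ¬ m < n := by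
      intro n m c c' hn hc hc' h hlt
      exact (hsome _ _ c c' hc hc').1 (((hpdef _).1 hn).2 m hlt) h
    intro n m c c' hn hm hc hc' h
    exact le_antisymm (not_lt.1 (key n m c c' hn hc hc' h)) (not_lt.1 (key m n c' c hm hc' hc h.symm))
  have hinf : (Set.ofPred p).Infinite := by
    intro hfin
    refine not_finite_iff_infinite.2 ‹Infinite A› ?_
    refine Set.finite_univ_iff.1 ((hfin.image fun n => if h : (Encodable.decode (α := C) n).isSome
      then ν (Option.get _ h) else Classical.arbitrary A).subset fun a _ => ?_)
    obtain ⟨n, c, hn, hc, hca⟩ := hex a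
    exact ⟨n, hn, by simp [hc, hca]⟩
  -- The graph of the enumeration is decidable, since `y` is its `n`-th value exactly when `p y`
  -- holds and `n` kept codes precede `y`.
  have hnth : Computable (Nat.nth p) := by
    refine computable_of_graph (((Enumerable.of_bool hp).comp Computable.snd).and
      (Enumerable.eq (hcount.comp Computable.snd) Computable.fst) |>.of_iff ?_)
    rintro ⟨n, y⟩
    simp only [decide_eq_true_eq]
    constructor
    · rintro rfl
      exact ⟨Nat.nth_mem_of_infinite hinf n, Nat.count_nth_of_infinite hinf n⟩
    · rintro ⟨h1, rfl⟩
      exact (Nat.nth_count h1).symm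
  have hget : ∀ n, ∃ c, Encodable.decode (α := C) (Nat.nth p n) = some c := fun n =>
    Option.isSome_iff_exists.1 ((hpdef _).1 (Nat.nth_mem_of_infinite hinf n)).1
  choose g hg using hget
  have hbij : Function.Bijective fun n => ν (g n) := by
    constructor
    · intro m n h
      exact Nat.nth_injective hinf (hinj _ _ _ _ (Nat.nth_mem_of_infinite hinf m)
        (Nat.nth_mem_of_infinite hinf n) (hg m) (hg n) h)
    · intro a
      obtain ⟨n, c, hn, hc, hca⟩ := hex a
      refine ⟨Nat.count p n, ?_⟩
      have := hg (Nat.count p n)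
      rw [Nat.nth_count hn, hc] at this
      simp only [Option.some.injEq] at this
      simp only [← this, hca]
  let e : ℕ ≃ A := Equiv.ofBijective _ hbij
  let inst : Denumerable A := Denumerable.mk' e.symm
  have henc : ∀ a, ν (g (Encodable.encode a)) = a := fun a => e.apply_symm_apply a
  refine ⟨Primcodable.ofDenumerable A, ?_, fun a => g (Encodable.encode a), ?_, henc⟩
  · refine Computable.encode_iff.1 (computable_of_graph ?_)
    have h1 : Enumerable fun x : C × ℕ => ∃ c', Encodable.decode (α := C) (Nat.nth p x.2) = some c' ∧
        decide (ν c' = ν x.1) = true := by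
      refine Enumerable.exists (p := fun (x : C × ℕ) c' =>
        Encodable.decode (α := C) (Nat.nth p x.2) = some c' ∧ decide (ν c' = ν x.1) = true) ?_
      refine Enumerable.and (Enumerable.eq (Computable.decode.comp (hnth.comp
        (Computable.snd.comp Computable.fst))) (Computable.option_some.comp Computable.snd)) ?_
      exact Enumerable.of_bool (heq.comp (Computable.snd.pair
        (Computable.fst.comp Computable.fst)))
    refine h1.of_iff ?_
    rintro ⟨c, m⟩
    simp only [decide_eq_true_eq, hg, Option.some.injEq, exists_eq_left']
    constructor
    · rintro rfl
      exact henc _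
    · intro h
      have : e m = ν c := h
      exact (Equiv.symm_apply_eq e).2 this.symm |>.symm
  · refine computable_of_graph ((Enumerable.eq (Computable.decode.comp (hnth.comp
      (Computable.encode.comp Computable.fst))) (Computable.option_some.comp Computable.snd)).of_iff ?_)
    rintro ⟨a, c⟩
    simp only [hg, Option.some.injEq]
    exact eq_comm

/-! ### Computability of integer arithmetic -/

theorem computable_natCast_int : Computable fun n : ℕ => (n : ℤ) := by
  -- The integers are coded with non-negative numbers at even and negative ones at odd positions.
  refine Computable.encode_iff.1 ((Primrec.nat_mul.to_comp.comp (Computable.const 2)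
    Computable.id).of_eq fun n => ?_)
  rfl

theorem computable_negSucc : Computable fun n : ℕ => Int.negSucc n := by
  refine Computable.encode_iff.1 ((Primrec.nat_add.to_comp.comp (Primrec.nat_mul.to_comp.comp
    (Computable.const 2) Computable.id) (Computable.const 1)).of_eq fun n => ?_)
  rfl

theorem computable_toNat : Computable Int.toNat := by
  refine computable_of_graph ((Enumerable.or (Enumerable.eq (computable_natCast_int.comp
    Computable.snd) Computable.fst) (Enumerable.and (Enumerable.eq Computable.snd
    (Computable.const 0)) (Enumerable.exists (p := fun (x : ℤ × ℕ) (n : ℕ) =>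
      x.1 = Int.negSucc n) (Enumerable.eq (Computable.fst.comp Computable.fst)
      (computable_negSucc.comp Computable.snd))))).of_iff ?_)
  rintro ⟨z, n⟩
  cases z with
  | ofNat m => simp [eq_comm]
  | negSucc m => simp

theorem computable_natCast_sub : Computable fun x : ℕ × ℕ => (x.1 : ℤ) - x.2 := by
  refine computable_of_graph ((Enumerable.or (Enumerable.exists (p := fun (x : (ℕ × ℕ) × ℤ) (n : ℕ)
    => x.1.1 = x.1.2 + n ∧ x.2 = (n : ℤ)) (Enumerable.and (Enumerable.eq ?_ ?_) (Enumerable.eq ?_ ?_)))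
    (Enumerable.exists (p := fun (x : (ℕ × ℕ) × ℤ) (n : ℕ)
    => x.1.2 = x.1.1 + (n + 1) ∧ x.2 = Int.negSucc n)
    (Enumerable.and (Enumerable.eq ?_ ?_) (Enumerable.eq ?_ ?_)))).of_iff ?_)
  · exact Computable.fst.comp (Computable.fst.comp Computable.fst)
  · exact Primrec.nat_add.to_comp.comp (Computable.snd.comp (Computable.fst.comp Computable.fst))
      Computable.snd
  · exact Computable.snd.comp Computable.fst
  · exact computable_natCast_int.comp Computable.snd
  · exact Computable.snd.comp (Computable.fst.comp Computable.fst)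
  · exact Primrec.nat_add.to_comp.comp (Computable.fst.comp (Computable.fst.comp Computable.fst))
      (Computable.succ.comp Computable.snd)
  · exact Computable.snd.comp Computable.fst
  · exact computable_negSucc.comp Computable.snd
  · rintro ⟨⟨a, b⟩, z⟩
    simp only
    constructor
    · rintro rfl
      rcases le_or_gt b a with h | h
      · exact Or.inl ⟨a - b, by omega, by omega⟩
      · exact Or.inr ⟨b - a - 1, by omega, by omega⟩
    · rintro (⟨n, h1, h2⟩ | ⟨n, h1, h2⟩) <;> omega

theorem computable_int_neg : Computable fun z : ℤ => -z := by
  have h1 : Computable fun w : (ℤ × ℤ) × (ℕ × ℕ) => (w.2.2, w.2.1) :=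
    (Computable.snd.comp Computable.snd).pair (Computable.fst.comp Computable.snd)
  have h2 : Computable fun w : (ℤ × ℤ) × (ℕ × ℕ) => (w.2.2 : ℤ) - w.2.1 :=
    (computable_natCast_sub.comp h1).of_eq fun _ => rfl
  have h3 : Computable fun w : (ℤ × ℤ) × (ℕ × ℕ) => (w.2.1 : ℤ) - w.2.2 :=
    Computable.comp computable_natCast_sub Computable.snd
  have h4 : Enumerable fun w : (ℤ × ℤ) × (ℕ × ℕ) =>
      w.1.1 = (w.2.1 : ℤ) - w.2.2 ∧ w.1.2 = (w.2.2 : ℤ) - w.2.1 :=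
    Enumerable.and (Enumerable.eq (Computable.fst.comp Computable.fst) h3)
      (Enumerable.eq (Computable.snd.comp Computable.fst) h2)
  refine computable_of_graph ((Enumerable.exists (p := fun (x : ℤ × ℤ) (y : ℕ × ℕ) =>
    x.1 = (y.1 : ℤ) - y.2 ∧ x.2 = (y.2 : ℤ) - y.1) h4).of_iff ?_)
  rintro ⟨a, b⟩
  simp only
  constructor
  · rintro rfl
    exact ⟨(a.toNat, (-a).toNat), by dsimp only; omega, by dsimp only; omega⟩
  · rintro ⟨y, h1, h2⟩
    omega

theorem computable_int_add : Computable₂ fun a b : ℤ => a + b := by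
  have hn : Computable fun a : ℤ => (-a).toNat := computable_toNat.comp computable_int_neg
  have ha := Primrec.nat_add.to_comp
  have h1 : Computable fun x : ℤ × ℤ => x.1.toNat + x.2.toNat :=
    ha.comp (computable_toNat.comp Computable.fst) (computable_toNat.comp Computable.snd)
  have h2 : Computable fun x : ℤ × ℤ => (-x.1).toNat + (-x.2).toNat :=
    ha.comp (hn.comp Computable.fst) (hn.comp Computable.snd)
  refine (computable_natCast_sub.comp (h1.pair h2)).of_eq ?_
  rintro ⟨a, b⟩
  simp only
  omega

theorem computable_int_mul : Computable₂ fun a b : ℤ => a * b := by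
  have hn : Computable fun a : ℤ => (-a).toNat := computable_toNat.comp computable_int_neg
  have hp := computable_toNat
  have ha := Primrec.nat_add.to_comp
  have hm := Primrec.nat_mul.to_comp
  have h3 : Computable fun x : ℤ × ℤ => x.1.toNat * x.2.toNat + (-x.1).toNat * (-x.2).toNat :=
    ha.comp (hm.comp (hp.comp Computable.fst) (hp.comp Computable.snd))
      (hm.comp (hn.comp Computable.fst) (hn.comp Computable.snd))
  have h4 : Computable fun x : ℤ × ℤ => x.1.toNat * (-x.2).toNat + (-x.1).toNat * x.2.toNat :=
    ha.comp (hm.comp (hp.comp Computable.fst) (hn.comp Computable.snd))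
      (hm.comp (hn.comp Computable.fst) (hp.comp Computable.snd))
  refine (computable_natCast_sub.comp (h3.pair h4)).of_eq ?_
  rintro ⟨a, b⟩
  have h1 : ((a.toNat : ℤ) - (-a).toNat) = a := by omega
  have h2 : ((b.toNat : ℤ) - (-b).toNat) = b := by omega
  simp only
  conv_rhs => rw [← h1, ← h2]
  push_cast
  ring

end Codings

/-! ### Powers of a single generator over a subring -/

namespace Generator

variable {E : Type*} [CommRing E]

/-- The exponents with which a generator occurs in the monomial basis. -/
def IsExponent : Generator E → ℤ → Prop
  | root n _, k => 0 ≤ k ∧ k < n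
  | pi _, _ => True
  | sigma _, k => 0 ≤ k

/-- The exponent in the monomial basis that gives the same power. -/
def reduce : Generator E → ℤ → ℤ
  | root n _, k => k % n
  | pi _, k => k
  | sigma _, k => max k 0

def IsRoot : Generator E → Prop
  | root _ _ => True
  | _ => False

def IsPi : Generator E → Prop
  | pi _ => True
  | _ => False

def IsSigma : Generator E → Prop
  | sigma _ => True
  | _ => False

theorem pow_zero_eq (g : Generator E) : g.pow 0 = 1 := by
  cases g <;> simp [pow]

theorem reduce_zero (g : Generator E) : g.reduce 0 = 0 := by
  cases g <;> simp [reduce]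

variable {F : Type*} [Field F] [Algebra F E] {σ : E ≃+* E} {A : Subalgebra F E} {g : Generator E}

theorem IsUnimonomialOver.isExponent_reduce (h : g.IsUnimonomialOver σ A) (k : ℤ) :
    g.IsExponent (g.reduce k) := by
  cases g with
  | root n x =>
    have : 0 < n := lt_trans Nat.zero_lt_one h.1
    exact ⟨Int.emod_nonneg _ (by omega), Int.emod_lt_of_pos _ (by omega)⟩
  | pi x => trivial
  | sigma s => exact le_max_right _ _

theorem IsUnimonomialOver.isExponent_zero (h : g.IsUnimonomialOver σ A) : g.IsExponent 0 := by
  simpa [reduce_zero] using h.isExponent_reduce 0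

theorem IsUnimonomialOver.pow_reduce (h : g.IsUnimonomialOver σ A) (k : ℤ) :
    g.pow (g.reduce k) = g.pow k := by
  cases g with
  | root n x =>
    have hn : x ^ (n : ℤ) = 1 := by simpa using h.2.1
    simp only [pow, reduce]
    congr 1
    conv_rhs => rw [← Int.emod_add_mul_ediv k n, zpow_add, zpow_mul, hn, one_zpow, mul_one]
  | pi x => rfl
  | sigma s =>
    simp only [pow, reduce]
    congr 1
    omega

theorem IsUnimonomialOver.pow_mul_pow (h : g.IsUnimonomialOver σ A) {k l : ℤ}
    (hk : g.IsExponent k) (hl : g.IsExponent l) :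
    g.pow k * g.pow l = g.pow (g.reduce (k + l)) := by
  rw [h.pow_reduce]
  cases g with
  | root n x => simp [pow, zpow_add]
  | pi x => simp [pow, zpow_add]
  | sigma s =>
    simp only [IsExponent] at hk hl
    simp only [pow, Int.toNat_add hk hl, pow_add]

theorem eq_zero_of_sum_pow_eq_zero {x : E} (hx : Transcendental A x) (n : ℕ) (b : ℕ → E)
    (hb : ∀ k, b k ∈ A) (h : ∑ k ∈ Finset.range n, b k * x ^ k = 0) : ∀ k < n, b k = 0 := by
  intro k hk
  rw [transcendental_iff] at hx
  have := hx (∑ k ∈ Finset.range n, Polynomial.monomial k ⟨b k, hb k⟩) (by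
    simp only [map_sum, Polynomial.aeval_monomial]
    exact h)
  have h2 := congrArg (fun p => Polynomial.coeff p k) this
  simp only [Polynomial.finsetSum_coeff, Polynomial.coeff_monomial, Polynomial.coeff_zero,
    Finset.sum_ite_eq', Finset.mem_range, hk, if_true] at h2
  simpa using congrArg Subtype.val h2

/-- Everything is brought to natural exponents. For a root of unity monomial the claim is then the
assumed linear independence, for a Σ-monomial it is transcendence, and for a Π-monomial negative
exponents are cleared first. -/
theorem IsUnimonomialOver.eq_zero_of_sum (h : g.IsUnimonomialOver σ A) (s : Finset ℤ) (b : ℤ → E)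
    (hs : ∀ k ∈ s, g.IsExponent k) (hb : ∀ k, b k ∈ A) (h0 : ∑ k ∈ s, b k * g.pow k = 0) :
    ∀ k ∈ s, b k = 0 := by
  classical
  have nat_case : ∀ (s : Finset ℤ) (n : ℕ), (∀ k ∈ s, 0 ≤ k ∧ k < n) → ∀ (b : ℤ → E) (x : E),
      ∑ k ∈ s, b k * x ^ k.toNat =
        ∑ k ∈ Finset.range n, (if (k : ℤ) ∈ s then b k else 0) * x ^ k := by
    intro s n hs b x
    simp only [ite_mul, zero_mul]
    rw [← Finset.sum_filter]
    refine Finset.sum_nbij' Int.toNat (fun k => (k : ℤ)) ?_ ?_ ?_ ?_ ?_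
    · intro k hk
      have := hs k hk
      simp only [Finset.mem_filter, Finset.mem_range]
      exact ⟨by omega, by rwa [Int.toNat_of_nonneg this.1]⟩
    · intro k hk
      exact (Finset.mem_filter.1 hk).2
    · intro k hk
      exact Int.toNat_of_nonneg (hs k hk).1
    · intro k hk
      simp
    · intro k hk
      simp [Int.toNat_of_nonneg (hs k hk).1]
  have bound : ∀ s : Finset ℤ, ∃ n : ℕ, ∀ k ∈ s, -(n : ℤ) ≤ k ∧ k < n := by
    intro s
    refine ⟨s.sup Int.natAbs + 1, fun k hk => ?_⟩
    have : k.natAbs ≤ s.sup Int.natAbs := Finset.le_sup (f := Int.natAbs) hk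
    omega
  have trans_case : ∀ x : E, Transcendental A x → ∀ (s : Finset ℤ) (b : ℤ → E), (∀ k ∈ s, 0 ≤ k) →
      (∀ k, b k ∈ A) → ∑ k ∈ s, b k * x ^ k.toNat = 0 → ∀ k ∈ s, b k = 0 := by
    intro x hx s b hs hb h0 k hk
    obtain ⟨n, hn⟩ := bound s
    rw [nat_case s n fun k hk => ⟨hs k hk, (hn k hk).2⟩] at h0
    have := eq_zero_of_sum_pow_eq_zero hx n (fun k => if (k : ℤ) ∈ s then b k else 0)
      (fun k => by split_ifs; exacts [hb _, A.zero_mem]) h0 k.toNat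
      (by have := hs k hk; have := hn k hk; omega)
    simpa [Int.toNat_of_nonneg (hs k hk), hk] using this
  cases g with
  | root n x =>
    intro k hk
    have hk' := hs k hk
    have h1 : ∑ k ∈ s, b k * (x : E) ^ k.toNat = 0 := by
      rw [← h0]
      refine Finset.sum_congr rfl fun k hk => ?_
      have : k = (k.toNat : ℤ) := (Int.toNat_of_nonneg (hs k hk).1).symm
      have h2 : x ^ k = x ^ k.toNat := by rw [← zpow_natCast, ← this]
      simp only [pow, h2, Units.val_pow_eq_pow_val]
    rw [nat_case s n hs, ← Fin.sum_univ_eq_sum_range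
      (fun k => (if (k : ℤ) ∈ s then b k else 0) * (x : E) ^ k)] at h1
    have h2 := Fintype.linearIndependent_iff.1 h.2.2.1
      (fun k => if (k : ℤ) ∈ s then ⟨b k, hb k⟩ else 0) (by
        rw [← h1]
        refine Finset.sum_congr rfl fun k _ => ?_
        split_ifs <;> simp [Algebra.smul_def]) ⟨k.toNat, by
          have := hk'.1; have := hk'.2; omega⟩
    simp only [Int.toNat_of_nonneg hk'.1, hk, if_true] at h2
    exact congrArg Subtype.val h2
  | pi x =>
    intro k hk
    obtain ⟨n, hn⟩ := bound s
    -- Multiplication by `x ^ n`, with `-n` below all exponents, makes the relation polynomial.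
    have h1 : ∑ k ∈ s.map (addRightEmbedding (n : ℤ)), b (k - n) * (x : E) ^ k.toNat = 0 := by
      rw [Finset.sum_map]
      have : ((x ^ (n : ℤ) : Eˣ) : E) * ∑ k ∈ s, b k * (pi x).pow k = 0 := by rw [h0, mul_zero]
      rw [← this, Finset.mul_sum]
      refine Finset.sum_congr rfl fun k hk => ?_
      have h2 : k + n = ((k + n).toNat : ℤ) := (Int.toNat_of_nonneg (by have := hn k hk; omega)).symm
      simp only [addRightEmbedding_apply, add_sub_cancel_right, pow]
      rw [mul_left_comm, ← Units.val_mul, ← zpow_add, add_comm (n : ℤ), h2, zpow_natCast,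
        Int.toNat_natCast, Units.val_pow_eq_pow_val]
    have := trans_case x h.1 _ (fun k => b (k - n)) ?_ (fun k => hb _) h1 (k + n) (by simpa using hk)
    · simpa using this
    · intro k hk
      simp only [Finset.mem_map, addRightEmbedding_apply] at hk
      obtain ⟨l, hl, rfl⟩ := hk
      have := hn l hl
      omega
  | sigma x => exact trans_case x h.1 s b hs hb h0

end Generator

/-! ### The monomial basis of the tower -/

section Monomials

variable {F : Type*} [Field F] {E : Type*} [CommRing E] [Algebra F E] {e : ℕ}

/-- The monomial with the given exponent vector. -/
def monomial (t : Fin e → Generator E) (a : Fin e → ℤ) : E := ∏ i, (t i).pow (a i)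

/-- The exponent vectors of the monomial basis. -/
def IsExponentVector (t : Fin e → Generator E) (a : Fin e → ℤ) : Prop :=
  ∀ i, (t i).IsExponent (a i)

/-- The subalgebra generated by the generators with index in `S`. -/
def adjoinOver (F : Type*) [Field F] {E : Type*} [CommRing E] [Algebra F E] {e : ℕ}
    (t : Fin e → Generator E) (S : Set (Fin e)) : Subalgebra F E :=
  Algebra.adjoin F {a | ∃ j ∈ S, a ∈ (t j).adjoined}

theorem stage_eq_adjoinOver (t : Fin e → Generator E) (i : ℕ) :
    stage F t i = adjoinOver F t {j | (j : ℕ) < i} := rfl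

theorem adjoinOver_mono (t : Fin e → Generator E) {S T : Set (Fin e)} (h : S ⊆ T) :
    adjoinOver F t S ≤ adjoinOver F t T :=
  Algebra.adjoin_mono fun _ ⟨j, hj, ha⟩ => ⟨j, h hj, ha⟩

theorem pow_mem_adjoinOver (t : Fin e → Generator E) {S : Set (Fin e)} {i : Fin e} (hi : i ∈ S)
    {k : ℤ} (hk : (t i).IsExponent k ∨ 0 ≤ k) : (t i).pow k ∈ adjoinOver F t S := by
  have key : ∀ a ∈ (t i).adjoined, a ∈ adjoinOver F t S := fun a ha =>
    Algebra.subset_adjoin ⟨i, hi, ha⟩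
  cases h : t i with
  | root n x =>
    rw [h] at hk key
    have : 0 ≤ k := hk.elim (fun h => h.1) id
    obtain ⟨k, rfl⟩ := Int.eq_ofNat_of_zero_le this
    simp only [Generator.pow, zpow_natCast, Units.val_pow_eq_pow_val]
    exact pow_mem (key _ rfl) _
  | pi x =>
    rw [h] at key
    obtain ⟨k, rfl | rfl⟩ := k.eq_nat_or_neg
    · simp only [Generator.pow, zpow_natCast, Units.val_pow_eq_pow_val]
      exact pow_mem (key _ (Or.inl rfl)) _
    · simp only [Generator.pow, zpow_neg, zpow_natCast, ← inv_pow, Units.val_pow_eq_pow_val]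
      exact pow_mem (key _ (Or.inr rfl)) _
  | sigma x =>
    rw [h] at key
    exact pow_mem (key _ rfl) _

theorem monomial_mem_adjoinOver (t : Fin e → Generator E) {S : Set (Fin e)} {a : Fin e → ℤ}
    (ha : IsExponentVector t a) (h : ∀ j ∉ S, a j = 0) : monomial t a ∈ adjoinOver F t S := by
  refine prod_mem fun i _ => ?_
  by_cases hi : i ∈ S
  · exact pow_mem_adjoinOver t hi (Or.inl (ha i))
  · rw [h i hi, Generator.pow_zero_eq]
    exact one_mem _

theorem monomial_update (t : Fin e → Generator E) (a : Fin e → ℤ) (i : Fin e) :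
    monomial t (Function.update a i 0) * (t i).pow (a i) = monomial t a := by
  rw [monomial, monomial, ← Finset.mul_prod_erase _ _ (Finset.mem_univ i),
    ← Finset.mul_prod_erase _ (fun j => (t j).pow (a j)) (Finset.mem_univ i)]
  simp only [Function.update_self, Generator.pow_zero_eq, one_mul]
  rw [mul_comm]
  congr 1
  refine Finset.prod_congr rfl fun j hj => ?_
  rw [Function.update_of_ne (Finset.ne_of_mem_erase hj)]

theorem IsExponentVector.update {t : Fin e → Generator E} {a : Fin e → ℤ} (ha : IsExponentVector t a)
    (i : Fin e) {k : ℤ}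
    (hk : (t i).IsExponent k) : IsExponentVector t (Function.update a i k) := by
  intro j
  by_cases h : j = i
  · subst h
    simpa using hk
  · simpa [h] using ha j

variable {σ : F ≃+* F} {σ' : E ≃+* E} {t : Fin e → Generator E}

theorem monomial_zero (t : Fin e → Generator E) : monomial t 0 = 1 := by
  simp [monomial, Generator.pow_zero_eq]

namespace IsRPiSigmaExtension

variable (hE : IsRPiSigmaExtension σ σ' t)

include hE

theorem nontrivial : Nontrivial E := hE.injective.nontrivial

theorem isExponentVector_reduce (a : Fin e → ℤ) :
    IsExponentVector t fun i => (t i).reduce (a i) :=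
  fun i => (hE.unimonomial i).isExponent_reduce (a i)

theorem isExponentVector_zero : IsExponentVector t 0 :=
  fun i => (hE.unimonomial i).isExponent_zero

theorem monomial_reduce (a : Fin e → ℤ) : monomial t (fun i => (t i).reduce (a i)) = monomial t a :=
  Finset.prod_congr rfl fun i _ => (hE.unimonomial i).pow_reduce (a i)

theorem monomial_mul_monomial {a b : Fin e → ℤ} (ha : IsExponentVector t a)
    (hb : IsExponentVector t b) :
    monomial t a * monomial t b = monomial t fun i => (t i).reduce (a i + b i) := by
  rw [monomial, monomial, ← Finset.prod_mul_distrib]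
  exact Finset.prod_congr rfl fun i _ => (hE.unimonomial i).pow_mul_pow (ha i) (hb i)

theorem isExponentVector_update_zero {a : Fin e → ℤ} (ha : IsExponentVector t a) (i : Fin e) :
    IsExponentVector t (Function.update a i 0) :=
  ha.update i (hE.unimonomial i).isExponent_zero

/-- The span on the right is already a ring, because a product of two monomials is again a monomial
after reducing exponents. The set `S` is arbitrary and need not be an initial segment of the tower.
-/
theorem toSubmodule_adjoinOver (S : Set (Fin e)) :
    Subalgebra.toSubmodule (adjoinOver F t S) =
      Submodule.span F (monomial t '' {a | IsExponentVector t a ∧ ∀ j ∉ S, a j = 0}) := by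
  apply le_antisymm
  · intro x hx
    rw [Subalgebra.mem_toSubmodule, adjoinOver] at hx
    have h1 : (1 : E) ∈ Submodule.span F
        (monomial t '' {a | IsExponentVector t a ∧ ∀ j ∉ S, a j = 0}) :=
      Submodule.subset_span ⟨0, ⟨hE.isExponentVector_zero, fun _ _ => rfl⟩, monomial_zero t⟩
    induction hx using Algebra.adjoin_induction with
    | mem x hx =>
      obtain ⟨j, hj, hx⟩ := hx
      have : ∃ k, x = (t j).pow k := by
        cases h : t j with
        | root n y => rw [h] at hx; exact ⟨1, by simpa [Generator.pow, Generator.adjoined] using hx⟩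
        | pi y =>
          rw [h] at hx
          rcases hx with rfl | rfl
          · exact ⟨1, by simp [Generator.pow]⟩
          · exact ⟨-1, by simp [Generator.pow]⟩
        | sigma y => rw [h] at hx; exact ⟨1, by simpa [Generator.pow, Generator.adjoined] using hx⟩
      obtain ⟨k, rfl⟩ := this
      rw [← (hE.unimonomial j).pow_reduce]
      refine Submodule.subset_span ⟨Function.update 0 j ((t j).reduce k),
        ⟨hE.isExponentVector_zero.update j
          ((hE.unimonomial j).isExponent_reduce k), fun i hi => ?_⟩, ?_⟩
      · rw [Function.update_of_ne (fun h => hi (by rwa [h]))]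
        rfl
      · rw [← monomial_update t _ j]
        simp [monomial_zero]
    | algebraMap r =>
      rw [Algebra.algebraMap_eq_smul_one]
      exact Submodule.smul_mem _ _ h1
    | add x y _ _ hx hy => exact Submodule.add_mem _ hx hy
    | mul x y hx' hy' hx hy =>
      clear hx' hy'
      induction hx using Submodule.span_induction with
      | zero => simp
      | add x x' _ _ hx hx' => rw [add_mul]; exact Submodule.add_mem _ hx hx'
      | smul c x _ hx => rw [smul_mul_assoc]; exact Submodule.smul_mem _ _ hx
      | mem x hx =>
        induction hy using Submodule.span_induction with
        | zero => simp
        | add x x' _ _ hx hx' => rw [mul_add]; exact Submodule.add_mem _ hx hx'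
        | smul c x _ hx => rw [mul_smul_comm]; exact Submodule.smul_mem _ _ hx
        | mem y hy =>
          obtain ⟨a, ⟨ha, ha'⟩, rfl⟩ := hx
          obtain ⟨b, ⟨hb, hb'⟩, rfl⟩ := hy
          rw [hE.monomial_mul_monomial ha hb]
          refine Submodule.subset_span ⟨_, ⟨hE.isExponentVector_reduce (a + b), fun j hj => ?_⟩, rfl⟩
          simp only [Pi.add_apply, ha' j hj, hb' j hj]
          simp [Generator.reduce_zero]
  · rw [Submodule.span_le]
    rintro _ ⟨a, ⟨ha, ha'⟩, rfl⟩
    exact monomial_mem_adjoinOver t ha ha'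

/-- Induction on the number of generators involved: sort the sum by the exponent of the last one.
Each bracket lies in the stage below and vanishes by `IsUnimonomialOver.eq_zero_of_sum`. -/
theorem eq_zero_of_sum_monomial (i : ℕ) (hi : i ≤ e) (s : Finset (Fin e → ℤ)) (c : (Fin e → ℤ) → F)
    (hs : ∀ a ∈ s, IsExponentVector t a ∧ ∀ j : Fin e, i ≤ j → a j = 0)
    (h : ∑ a ∈ s, c a • monomial t a = 0) : ∀ a ∈ s, c a = 0 := by
  classical
  induction i generalizing s c with
  | zero =>
    intro a ha
    have h0 : ∀ b ∈ s, b = 0 := fun b hb => funext fun j => (hs b hb).2 j (Nat.zero_le _)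
    have : s = {0} := Finset.eq_singleton_iff_unique_mem.2 ⟨h0 a ha ▸ ha, h0⟩
    rw [this, Finset.sum_singleton, monomial_zero, ← Algebra.algebraMap_eq_smul_one,
      map_eq_zero_iff _ hE.injective] at h
    rw [h0 a ha, h]
  | succ i ih =>
    let ι : Fin e := ⟨i, hi⟩
    intro a ha
    -- The coefficient of the `k`-th power of the last generator; clearing the exponent at `ι` puts
    -- it in the stage below.
    let b : ℤ → E := fun k => ∑ a ∈ s with a ι = k, c a • monomial t (Function.update a ι 0)
    have hb : ∀ k, b k ∈ stage F t i := by
      intro k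
      refine sum_mem fun a ha => Subalgebra.smul_mem _ (monomial_mem_adjoinOver t
        (hE.isExponentVector_update_zero (hs a (Finset.mem_filter.1 ha).1).1 ι) fun j hj => ?_) _
      by_cases h : j = ι
      · rw [h, Function.update_self]
      · rw [Function.update_of_ne h]
        refine (hs a (Finset.mem_filter.1 ha).1).2 j ?_
        have h1 : ¬ (j : ℕ) < i := hj
        have h2 : (j : ℕ) ≠ i := fun h' => h (Fin.ext h')
        omega
    have hsum : ∑ k ∈ s.image (fun a => a ι), b k * (t ι).pow k = 0 := by
      rw [← h, ← Finset.sum_fiberwise_of_maps_to (g := fun a : Fin e → ℤ => a ι)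
        (t := s.image fun a => a ι) fun a ha => Finset.mem_image_of_mem _ ha]
      refine Finset.sum_congr rfl fun k _ => ?_
      simp only [b]
      rw [Finset.sum_mul]
      refine Finset.sum_congr rfl fun a ha => ?_
      rw [smul_mul_assoc, ← (Finset.mem_filter.1 ha).2, monomial_update]
    have h0 := (hE.unimonomial ι).eq_zero_of_sum _ b (fun k hk => by
      obtain ⟨a, ha, rfl⟩ := Finset.mem_image.1 hk
      exact (hs a ha).1 ι) hb hsum (a ι) (Finset.mem_image_of_mem _ ha)
    have hinj : Set.InjOn (fun b : Fin e → ℤ => Function.update b ι 0)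
        ({b ∈ s | b ι = a ι} : Finset (Fin e → ℤ)) := by
      intro x hx y hy hxy
      have hx := (Finset.mem_filter.1 hx).2
      have hy := (Finset.mem_filter.1 hy).2
      funext j
      by_cases hj : j = ι
      · rw [hj, hx, hy]
      · simpa [hj] using congrFun hxy j
    have hback : ∀ b ∈ ({b ∈ s | b ι = a ι} : Finset (Fin e → ℤ)),
        Function.update (Function.update b ι 0) ι (a ι) = b := by
      intro b hb
      rw [Function.update_idem, ← (Finset.mem_filter.1 hb).2, Function.update_eq_self]
    have := ih (by omega) (({b ∈ s | b ι = a ι} : Finset (Fin e → ℤ)).image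
      fun b => Function.update b ι 0) (fun b => c (Function.update b ι (a ι))) ?_ ?_
      (Function.update a ι 0) (Finset.mem_image_of_mem _ (Finset.mem_filter.2 ⟨ha, rfl⟩))
    · simpa using this
    · intro b' hb'
      obtain ⟨b, hb, rfl⟩ := Finset.mem_image.1 hb'
      have hb' := hs b (Finset.mem_filter.1 hb).1
      refine ⟨hE.isExponentVector_update_zero hb'.1 ι, fun j hj => ?_⟩
      by_cases h : j = ι
      · rw [h, Function.update_self]
      · rw [Function.update_of_ne h]
        have h2 : (j : ℕ) ≠ i := fun h' => h (Fin.ext h')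
        exact hb'.2 j (by omega)
    · rw [Finset.sum_image hinj, ← h0]
      refine Finset.sum_congr rfl fun b hb => ?_
      simp only [hback b hb]

/-- The basis of monomials. -/
noncomputable def basis : Module.Basis {a : Fin e → ℤ // IsExponentVector t a} F E :=
  Module.Basis.mk (v := fun a => monomial t a.1) (by
    classical
    rw [linearIndependent_iff']
    intro s c hc a ha
    have := hE.eq_zero_of_sum_monomial e le_rfl (s.map (Function.Embedding.subtype _))
      (fun a => if h : IsExponentVector t a then c ⟨a, h⟩ else 0) ?_ ?_ a.1 (by simpa using ⟨a.2, ha⟩)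
    · simpa [a.2] using this
    · intro a ha
      simp only [Finset.mem_map, Function.Embedding.subtype_apply] at ha
      obtain ⟨b, -, rfl⟩ := ha
      exact ⟨b.2, fun j hj => absurd j.2 (not_lt.2 hj)⟩
    · rw [Finset.sum_map, ← hc]
      refine Finset.sum_congr rfl fun b _ => ?_
      simp [b.2]) (by
    have h1 : adjoinOver F t Set.univ = ⊤ := by
      rw [← hE.generated, stage_eq_adjoinOver]
      congr
      ext j
      simp
    have h2 := hE.toSubmodule_adjoinOver Set.univ
    rw [h1, Algebra.top_toSubmodule] at h2
    rw [h2]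
    refine Submodule.span_mono ?_
    rintro _ ⟨a, ha, rfl⟩
    exact ⟨⟨a, ha.1⟩, rfl⟩)

theorem basis_apply (a : {a : Fin e → ℤ // IsExponentVector t a}) :
    hE.basis a = monomial t a.1 := by simp [basis]

theorem mem_adjoinOver_iff {S : Set (Fin e)} {x : E} :
    x ∈ adjoinOver F t S ↔ ∀ a, hE.basis.repr x a ≠ 0 → ∀ j ∉ S, a.1 j = 0 := by
  rw [← Subalgebra.mem_toSubmodule, hE.toSubmodule_adjoinOver]
  have : monomial t '' {a | IsExponentVector t a ∧ ∀ j ∉ S, a j = 0} =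
      hE.basis '' {a | ∀ j ∉ S, a.1 j = 0} := by
    ext x
    constructor
    · rintro ⟨a, ⟨ha, ha'⟩, rfl⟩
      exact ⟨⟨a, ha⟩, ha', hE.basis_apply _⟩
    · rintro ⟨a, ha, rfl⟩
      exact ⟨a.1, ⟨a.2, ha⟩, (hE.basis_apply _).symm⟩
  rw [this, Module.Basis.mem_span_image]
  constructor
  · intro h a ha
    exact h (Finsupp.mem_support_iff.2 ha)
  · intro h a ha
    exact h a (Finsupp.mem_support_iff.1 ha)

theorem repr_monomial {a : Fin e → ℤ} (ha : IsExponentVector t a) :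
    hE.basis.repr (monomial t a) = Finsupp.single ⟨a, ha⟩ 1 := by
  rw [← hE.basis_apply ⟨a, ha⟩, Module.Basis.repr_self]

/-- The coefficient of the `k`-th power of the generator `t i`. -/
noncomputable def coeff (i : Fin e) (k : ℤ) : E →ₗ[F] E := by
  classical
  exact hE.basis.constr F fun a => if a.1 i = k then monomial t (Function.update a.1 i 0) else 0

open Classical in
theorem coeff_monomial (i : Fin e) (k : ℤ) {a : Fin e → ℤ} (ha : IsExponentVector t a) :
    hE.coeff i k (monomial t a) = if a i = k then monomial t (Function.update a i 0) else 0 := by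
  rw [← hE.basis_apply ⟨a, ha⟩, coeff, Module.Basis.constr_basis]

theorem adjoinOver_induction {S : Set (Fin e)} {p : E → Prop} (h0 : p 0)
    (hadd : ∀ x y, p x → p y → p (x + y)) (hsmul : ∀ (c : F) x, p x → p (c • x))
    (hmon : ∀ a, IsExponentVector t a → (∀ j ∉ S, a j = 0) → p (monomial t a)) {x : E}
    (hx : x ∈ adjoinOver F t S) : p x := by
  rw [← Subalgebra.mem_toSubmodule, hE.toSubmodule_adjoinOver] at hx
  induction hx using Submodule.span_induction with
  | zero => exact h0
  | add x y _ _ hx hy => exact hadd x y hx hy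
  | smul c x _ hx => exact hsmul c x hx
  | mem x hx => obtain ⟨a, ⟨ha, ha'⟩, rfl⟩ := hx; exact hmon a ha ha'

theorem adjoinOver_univ : adjoinOver F t Set.univ = ⊤ := by
  rw [← hE.generated, stage_eq_adjoinOver]
  congr
  ext j
  simp

/-- On basis monomials this is immediate, and it holds for every `i` outside `S`. So the ring over
`insert i S` may be treated as an extension by `t i` of the ring over `S`, whatever the position of
`t i` in the tower. -/
theorem coeff_mul_pow {S : Set (Fin e)} {i : Fin e} (hi : i ∉ S) {x : E}
    (hx : x ∈ adjoinOver F t S) (k : ℤ) {l : ℤ} (hl : (t i).IsExponent l) :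
    hE.coeff i k (x * (t i).pow l) = if k = l then x else 0 := by
  refine hE.adjoinOver_induction (p := fun x => hE.coeff i k (x * (t i).pow l) = if k = l then x else 0)
    ?_ ?_ ?_ ?_ hx
  · simp
  · intro x y hx hy
    simp only [add_mul, map_add, hx, hy]
    split_ifs <;> simp
  · intro c x hx
    simp only [smul_mul_assoc, map_smul, hx]
    split_ifs <;> simp
  · intro a ha ha'
    have h1 : Function.update (Function.update a i l) i 0 = a := by
      rw [Function.update_idem, ← ha' i hi, Function.update_eq_self]
    have h2 : monomial t a * (t i).pow l = monomial t (Function.update a i l) := by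
      rw [← monomial_update t (Function.update a i l) i, h1, Function.update_self]
    rw [h2, hE.coeff_monomial i k (ha.update i hl), h1, Function.update_self]
    simp only [eq_comm]

theorem coeff_of_mem {S : Set (Fin e)} {i : Fin e} (hi : i ∉ S) {x : E}
    (hx : x ∈ adjoinOver F t S) (k : ℤ) : hE.coeff i k x = if k = 0 then x else 0 := by
  have := hE.coeff_mul_pow hi hx k (hE.unimonomial i).isExponent_zero
  rwa [Generator.pow_zero_eq, mul_one] at this

theorem coeff_mem {S : Set (Fin e)} {i : Fin e} {x : E}
    (hx : x ∈ adjoinOver F t S) (k : ℤ) : hE.coeff i k x ∈ adjoinOver F t (S \ {i}) := by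
  refine hE.adjoinOver_induction (p := fun x => hE.coeff i k x ∈ adjoinOver F t (S \ {i}))
    ?_ ?_ ?_ ?_ hx
  · simp
  · intro x y hx hy
    rw [map_add]
    exact add_mem hx hy
  · intro c x hx
    rw [map_smul]
    exact Subalgebra.smul_mem _ hx c
  · intro a ha ha'
    rw [hE.coeff_monomial i k ha]
    split_ifs
    · refine monomial_mem_adjoinOver t (hE.isExponentVector_update_zero ha i) fun j hj => ?_
      by_cases h : j = i
      · rw [h, Function.update_self]
      · rw [Function.update_of_ne h]
        exact ha' j fun h' => hj ⟨h', h⟩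
    · exact zero_mem _

theorem coeff_eq_zero {i : Fin e} {k : ℤ} (hk : ¬ (t i).IsExponent k) (x : E) :
    hE.coeff i k x = 0 := by
  refine hE.adjoinOver_induction (p := fun x => hE.coeff i k x = 0) (S := Set.univ)
    (map_zero _) ?_ ?_ ?_ (x := x) (by rw [hE.adjoinOver_univ]; trivial)
  · intro x y hx hy
    rw [map_add, hx, hy, add_zero]
  · intro c x hx
    rw [map_smul, hx, smul_zero]
  · intro a ha _
    rw [hE.coeff_monomial i k ha, if_neg]
    rintro rfl
    exact hk (ha i)

theorem exists_sum_coeff (i : Fin e) (x : E) : ∃ s : Finset ℤ, (∀ k ∉ s, hE.coeff i k x = 0) ∧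
    x = ∑ k ∈ s, hE.coeff i k x * (t i).pow k := by
  classical
  have mono : ∀ (x : E) (s s' : Finset ℤ), s ⊆ s' → (∀ k ∉ s, hE.coeff i k x = 0) →
      x = ∑ k ∈ s, hE.coeff i k x * (t i).pow k →
      x = ∑ k ∈ s', hE.coeff i k x * (t i).pow k := by
    intro x s s' hss hs hx
    rw [← Finset.sum_subset hss, ← hx]
    intro k _ hk
    rw [hs k hk, zero_mul]
  refine hE.adjoinOver_induction (p := fun x => ∃ s : Finset ℤ, (∀ k ∉ s, hE.coeff i k x = 0) ∧
    x = ∑ k ∈ s, hE.coeff i k x * (t i).pow k) (S := Set.univ)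
    ⟨∅, by simp⟩ ?_ ?_ ?_ (x := x) (by rw [hE.adjoinOver_univ]; trivial)
  · rintro x y ⟨s, hs, hx⟩ ⟨s', hs', hy⟩
    refine ⟨s ∪ s', fun k hk => ?_, ?_⟩
    · rw [Finset.mem_union, not_or] at hk
      rw [map_add, hs k hk.1, hs' k hk.2, add_zero]
    · simp only [map_add, add_mul, Finset.sum_add_distrib]
      rw [← mono x s _ Finset.subset_union_left hs hx, ← mono y s' _ Finset.subset_union_right hs' hy]
  · rintro c x ⟨s, hs, hx⟩
    refine ⟨s, fun k hk => by rw [map_smul, hs k hk, smul_zero], ?_⟩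
    simp only [map_smul, smul_mul_assoc, ← Finset.smul_sum]
    rw [← hx]
  · intro a ha _
    refine ⟨{a i}, fun k hk => ?_, ?_⟩
    · rw [hE.coeff_monomial i k ha, if_neg]
      rintro rfl
      simp at hk
    · rw [Finset.sum_singleton, hE.coeff_monomial i _ ha, if_pos rfl, monomial_update]

theorem ext_coeff (i : Fin e) {x y : E} (h : ∀ k, hE.coeff i k x = hE.coeff i k y) : x = y := by
  rw [← sub_eq_zero]
  obtain ⟨s, -, hx⟩ := hE.exists_sum_coeff i (x - y)
  rw [hx]
  refine Finset.sum_eq_zero fun k _ => ?_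
  rw [map_sub, h k, sub_self, zero_mul]

/-- No generator adds a constant, so a constant descends from the top through all stages to stage
`0`, which is the image of `F`. -/
theorem exists_of_mem_constants {c : E} (hc : c ∈ constants σ') :
    ∃ k ∈ constants σ, algebraMap F E k = c := by
  have h : ∀ i ≤ e, c ∈ stage F t (e - i) := by
    intro i
    induction i with
    | zero => intro _; rw [Nat.sub_zero, hE.generated]; trivial
    | succ i ih =>
      intro hi
      refine hE.constants_eq ⟨e - (i + 1), by omega⟩ c ?_ hc
      have : e - (i + 1) + 1 = e - i := by omega
      simp only [this]
      exact ih (by omega)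
  have h0 := h e le_rfl
  rw [Nat.sub_self, stage] at h0
  simp only [Nat.not_lt_zero, false_and, exists_false, Set.ofPred_false, Algebra.adjoin_empty] at h0
  obtain ⟨k, rfl⟩ := Algebra.mem_bot.1 h0
  refine ⟨k, hE.injective ?_, rfl⟩
  rw [← hE.extends_map]
  exact hc

theorem algebraMap_mem_constants {k : F} (hk : k ∈ constants σ) :
    algebraMap F E k ∈ constants σ' := by
  change σ' _ = _
  rw [hE.extends_map]
  exact congrArg _ hk

end IsRPiSigmaExtension

end Monomials

/-! ### The subring of the root of unity monomials and its idempotent -/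

section RootPart

variable {F : Type*} [Field F] {E : Type*} [CommRing E] [Algebra F E] {e : ℕ}
  {σ : F ≃+* F} {σ' : E ≃+* E} {t : Fin e → Generator E}

/-- The indices of the root of unity monomials. -/
def roots (t : Fin e → Generator E) : Set (Fin e) := {j | (t j).IsRoot}

theorem Generator.unitPart_pow_eq {g : Generator E} (hg : ¬ g.IsSigma) (k : ℤ) :
    ((g.unitPart ^ k : Eˣ) : E) = g.pow k := by
  cases g with
  | root n x => rfl
  | pi x => rfl
  | sigma s => exact absurd trivial hg

theorem Generator.unitPart_sigma {g : Generator E} (hg : g.IsSigma) : g.unitPart = 1 := by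
  cases g with
  | root n x => exact hg.elim
  | pi x => exact hg.elim
  | sigma s => rfl

/-- The order of a root of unity monomial; it is `1` for the other generators. -/
def Generator.order : Generator E → ℕ
  | root n _ => n
  | _ => 1

theorem Generator.IsUnimonomialOver.order_pos {A : Subalgebra F E} {g : Generator E}
    (h : g.IsUnimonomialOver σ' A) : 0 < g.order := by
  cases g with
  | root n x => exact lt_trans Nat.zero_lt_one h.1
  | pi x => exact Nat.one_pos
  | sigma s => exact Nat.one_pos

theorem Generator.IsUnimonomialOver.pow_order {A : Subalgebra F E} {g : Generator E}
    (h : g.IsUnimonomialOver σ' A) (hg : g.IsRoot) (k : ℤ) : g.pow k ^ g.order = 1 := by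
  cases g with
  | root n x =>
    have : x ^ n = 1 := h.2.1
    simp only [pow, order, ← Units.val_pow_eq_pow_val, ← zpow_natCast, ← zpow_mul]
    rw [mul_comm, zpow_mul, zpow_natCast, this, one_zpow, Units.val_one]
  | pi x => exact hg.elim
  | sigma s => exact hg.elim

/-- The unit with the given exponents, where the `Σ`-monomials are left out. -/
def unitMonomial (t : Fin e → Generator E) (m : Fin e → ℤ) : Eˣ := ∏ i, (t i).unitPart ^ m i

theorem coe_unitMonomial {t : Fin e → Generator E} {a : Fin e → ℤ} (ha : ∀ j, (t j).IsSigma → a j = 0) :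
    (unitMonomial t a : E) = monomial t a := by
  rw [unitMonomial, monomial, Units.coe_prod]
  refine Finset.prod_congr rfl fun j _ => ?_
  by_cases hj : (t j).IsSigma
  · simp [ha j hj, Generator.pow_zero_eq]
  · rw [Generator.unitPart_pow_eq hj]

theorem pow_mem_constants_apply {σ : F ≃+* F} {k : F} (hk : k ∈ constants σ) (n : ℕ) :
    (σ ^ n) k = k := by
  induction n with
  | zero => rfl
  | succ n ih => rw [pow_succ, RingAut.mul_apply, show σ k = k from hk, ih]

namespace IsRPiSigmaExtension

variable (hE : IsRPiSigmaExtension σ σ' t)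

include hE

theorem map_smul' (c : F) (x : E) : σ' (c • x) = σ c • σ' x := by
  rw [Algebra.smul_def, map_mul, hE.extends_map, ← Algebra.smul_def]

theorem pow_map_smul (n : ℕ) (c : F) (x : E) : (σ' ^ n) (c • x) = (σ ^ n) c • (σ' ^ n) x := by
  induction n with
  | zero => rfl
  | succ n ih => simp only [pow_succ', RingAut.mul_apply, ih, hE.map_smul']

/-- Passage from arbitrary exponents to exponents of the basis. Only root exponents are really
reduced: Π-exponents are kept, and Σ-exponents are set to zero because they do not contribute. -/
theorem exists_unitMonomial_eq (m : Fin e → ℤ) : ∃ a : Fin e → ℤ, IsExponentVector t a ∧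
    (∀ j, (t j).IsSigma → a j = 0) ∧ (∀ j, (t j).IsPi → a j = m j) ∧ (∀ j, m j = 0 → a j = 0) ∧
    (unitMonomial t m : E) = monomial t a := by
  classical
  refine ⟨fun j => (t j).reduce (if (t j).IsSigma then 0 else m j),
    hE.isExponentVector_reduce fun j => if (t j).IsSigma then 0 else m j, ?_, ?_, ?_, ?_⟩
  · intro j hj
    simp [hj, Generator.reduce_zero]
  · intro j hj
    cases h : t j with
    | root n x => rw [h] at hj; exact hj.elim
    | pi x => simp [h, Generator.IsSigma, Generator.reduce]
    | sigma s => rw [h] at hj; exact hj.elim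
  · intro j hj
    simp [hj, Generator.reduce_zero]
  · rw [hE.monomial_reduce, unitMonomial, monomial, Units.coe_prod]
    refine Finset.prod_congr rfl fun j _ => ?_
    by_cases hj : (t j).IsSigma
    · simp [hj, Generator.unitPart_sigma hj, Generator.pow_zero_eq]
    · rw [if_neg hj, Generator.unitPart_pow_eq hj]

theorem exists_of_mem_productGroup {u : Eˣ} (hu : u ∈ productGroup (⊤ : Subgroup Fˣ) t) :
    ∃ h : F, h ≠ 0 ∧ ∃ a, IsExponentVector t a ∧ (∀ j, (t j).IsSigma → a j = 0) ∧
      (u : E) = h • monomial t a := by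
  obtain ⟨h, -, m, rfl⟩ := hu
  obtain ⟨a, ha, ha', -, -, hm⟩ := hE.exists_unitMonomial_eq m
  exact ⟨h, h.ne_zero, a, ha, ha', by
    rw [Units.val_mul, ← unitMonomial, hm, Algebra.smul_def]; rfl⟩

theorem smul_monomial_inj {h h' : F} (hh : h ≠ 0) {a b : Fin e → ℤ} (ha : IsExponentVector t a)
    (hb : IsExponentVector t b) (heq : h • monomial t a = h' • monomial t b) : a = b ∧ h = h' := by
  have h1 := congrArg hE.basis.repr heq
  rw [map_smul, map_smul, hE.repr_monomial ha, hE.repr_monomial hb, Finsupp.smul_single,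
    Finsupp.smul_single, Finsupp.single_eq_single_iff] at h1
  rcases h1 with ⟨h1, h2⟩ | ⟨h1, -⟩
  · exact ⟨congrArg Subtype.val h1, by simpa using h2⟩
  · simp [hh] at h1

theorem order_pos : 0 < ∏ j, (t j).order :=
  Finset.prod_pos fun j _ => (hE.unimonomial j).order_pos

theorem monomial_pow_order {a : Fin e → ℤ} (ha : ∀ j ∉ roots t, a j = 0) :
    monomial t a ^ ∏ j, (t j).order = 1 := by
  rw [monomial, ← Finset.prod_pow]
  refine Finset.prod_eq_one fun j _ => ?_
  by_cases hj : j ∈ roots t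
  · rw [← Finset.mul_prod_erase _ _ (Finset.mem_univ j), pow_mul,
      (hE.unimonomial j).pow_order hj, one_pow]
  · rw [ha j hj, Generator.pow_zero_eq, one_pow]

/-- The `n`-th power is a scalar times a basis monomial whose exponent at a Π-monomial is `n * m j`;
comparison with the monomial `1` forces it to vanish. -/
theorem eq_zero_of_pow_eq_one {u : Eˣ} {h : Fˣ} {m : Fin e → ℤ} {n : ℕ} (hn : 0 < n)
    (hu : u = Units.map (algebraMap F E : F →* E) h * unitMonomial t m) (hun : u ^ n = 1) {j : Fin e}
    (hj : (t j).IsPi) : m j = 0 := by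
  obtain ⟨a, ha, -, ha', -, hm⟩ := hE.exists_unitMonomial_eq ((n : ℤ) • m)
  have h1 : (h ^ n : F) • monomial t a = (1 : F) • monomial t 0 := by
    rw [← hm, Algebra.smul_def, monomial_zero, one_smul, ← Units.val_one, ← hun, hu, mul_pow,
      ← map_pow]
    simp only [unitMonomial, Units.val_mul, Pi.smul_apply, smul_eq_mul, mul_comm (n : ℤ), zpow_mul,
      zpow_natCast, Finset.prod_pow]
    rfl
  have h2 := congrFun (hE.smul_monomial_inj (pow_ne_zero n h.ne_zero) ha
    hE.isExponentVector_zero h1).1 j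
  rw [ha' j hj] at h2
  simp only [Pi.smul_apply, smul_eq_mul, Pi.zero_apply, mul_eq_zero] at h2
  exact h2.resolve_left (by omega)

/-- An element of the product group of finite order is a root of unity times a product of
root of unity monomials. -/
theorem exists_of_pow_eq_one {u : Eˣ} (hu : u ∈ productGroup (⊤ : Subgroup Fˣ) t) {n : ℕ}
    (hn : 0 < n) (hun : u ^ n = 1) : ∃ h : F, (∃ N, 0 < N ∧ h ^ N = 1) ∧ ∃ a, IsExponentVector t a ∧
      (∀ j ∉ roots t, a j = 0) ∧ (u : E) = h • monomial t a := by
  obtain ⟨h, -, m, hm⟩ := hu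
  obtain ⟨a, ha, hs, hp, -, hm'⟩ := hE.exists_unitMonomial_eq m
  have ha' : ∀ j ∉ roots t, a j = 0 := by
    intro j hj
    cases h : t j with
    | root n x => exact absurd (by simp only [roots, Set.mem_ofPred_eq, h]; trivial) hj
    | pi x =>
      have hpi : (t j).IsPi := by rw [h]; trivial
      rw [hp j hpi, hE.eq_zero_of_pow_eq_one hn hm hun hpi]
    | sigma s => exact hs j (by rw [h]; trivial)
  have hu' : (u : E) = (h : F) • monomial t a := by
    rw [hm, Units.val_mul, ← unitMonomial, hm', Algebra.smul_def]; rfl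
  refine ⟨h, ⟨n * ∏ j, (t j).order, mul_pos hn hE.order_pos, hE.injective ?_⟩, a, ha, ha', hu'⟩
  have h1 : (u : E) ^ (n * ∏ j, (t j).order) = 1 := by
    rw [pow_mul, ← Units.val_pow_eq_pow_val, hun, Units.val_one, one_pow]
  rw [hu', smul_pow, mul_comm n, pow_mul (monomial t a), hE.monomial_pow_order ha', one_pow,
    ← Algebra.algebraMap_eq_smul_one] at h1
  rw [mul_comm, h1, map_one]

/-- From `x ^ n = 1` the quotient of `σ' x` by `x` is also an `n`-th root of unity. Being of finite
order in the product group, it contains no Π-monomial. It may contain root of unity monomials that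
come later in the tower, which is why these are all treated together. -/
theorem map_root (hsimple : IsSimpleOver (⊤ : Subgroup Fˣ) σ' t) {j : Fin e} {n : ℕ} {x : Eˣ}
    (hj : t j = .root n x) : ∃ h : F, (∃ N, 0 < N ∧ h ^ N = 1) ∧ ∃ a, IsExponentVector t a ∧
      (∀ j ∉ roots t, a j = 0) ∧ σ' (x : E) = h • monomial t a * x := by
  have h1 := hE.unimonomial j
  have h2 := hsimple j
  rw [hj] at h1 h2
  obtain ⟨u, hu, hux⟩ := h2
  have hun : u ^ n = 1 := by
    have h3 : (x : E) ^ n = 1 := by rw [← Units.val_pow_eq_pow_val, h1.2.1, Units.val_one]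
    have h4 := congrArg σ' h3
    rw [map_pow, hux, mul_pow, h3, mul_one, map_one] at h4
    exact Units.ext (by rw [Units.val_pow_eq_pow_val, h4, Units.val_one])
  obtain ⟨h, hN, a, ha, ha', hu'⟩ :=
    hE.exists_of_pow_eq_one hu (lt_trans Nat.zero_lt_one h1.1) hun
  exact ⟨h, hN, a, ha, ha', by rw [← hu', hux]⟩

/-- Root of unity monomials stay in the root part by `map_root`; the image of any other generator in
`S` involves only itself and its predecessors, which by `hS'` belong to `S`. -/
theorem map_mem_adjoinOver (hsimple : IsSimpleOver (⊤ : Subgroup Fˣ) σ' t) {S : Set (Fin e)}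
    (hS : roots t ⊆ S) (hS' : ∀ i ∈ S, i ∈ roots t ∨ ∀ j < i, j ∈ S) {x : E}
    (hx : x ∈ adjoinOver F t S) : σ' x ∈ adjoinOver F t S := by
  rw [adjoinOver] at hx
  induction hx using Algebra.adjoin_induction with
  | algebraMap r => rw [hE.extends_map]; exact Subalgebra.algebraMap_mem _ _
  | add x y _ _ hx hy => rw [map_add]; exact add_mem hx hy
  | mul x y _ _ hx hy => rw [map_mul]; exact mul_mem hx hy
  | mem x hx =>
    obtain ⟨j, hj, hx⟩ := hx
    have hmem : x ∈ adjoinOver F t S := Algebra.subset_adjoin ⟨j, hj, hx⟩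
    have hstage : j ∉ roots t → ∀ y ∈ stage F t j, y ∈ adjoinOver F t S := by
      intro h y hy
      rw [stage_eq_adjoinOver] at hy
      exact adjoinOver_mono t (fun i hi => ((hS' j hj).resolve_left h) i hi) hy
    have h1 := hE.unimonomial j
    cases h : t j with
    | root n y =>
      obtain ⟨c, -, a, ha, ha', hy⟩ := hE.map_root hsimple h
      rw [h] at hx
      obtain rfl : x = y := hx
      rw [hy]
      refine mul_mem (Subalgebra.smul_mem _ (monomial_mem_adjoinOver t ha fun i hi => ?_) _) hmem
      exact ha' i fun h' => hi (hS h')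
    | pi y =>
      have hj' : j ∉ roots t := by simp only [roots, Set.mem_ofPred_eq, h]; exact id
      rw [h] at hx h1
      obtain ⟨-, α, hα⟩ := h1
      rcases hx with rfl | rfl
      · rw [hα]
        exact mul_mem (hstage hj' _ (α : stage F t j).2) hmem
      -- The inverse of a Π-monomial is one of the adjoined elements, so its image is needed as
      -- well; the unit `α` is inverted inside the stage below.
      · have : σ' ((y⁻¹ : Eˣ) : E) = ((α⁻¹ : (stage F t j)ˣ) : stage F t j) * ((y⁻¹ : Eˣ) : E) := by
          have h3 : σ' ((y⁻¹ : Eˣ) : E) * σ' (y : E) = 1 := by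
            rw [← map_mul, Units.inv_mul, map_one]
          have h4 : (((α⁻¹ : (stage F t j)ˣ) : stage F t j) : E) * ((α : stage F t j) : E) = 1 := by
            rw [← Subalgebra.coe_mul, Units.inv_mul, Subalgebra.coe_one]
          have h5 : ((y⁻¹ : Eˣ) : E) * (y : E) = 1 := Units.inv_mul y
          rw [hα] at h3
          linear_combination (((α⁻¹ : (stage F t j)ˣ) : stage F t j) : E) * ((y⁻¹ : Eˣ) : E) * h3
            - σ' ((y⁻¹ : Eˣ) : E) * h4 * ((y⁻¹ : Eˣ) : E) * y - σ' ((y⁻¹ : Eˣ) : E) * h5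
        rw [this]
        exact mul_mem (hstage hj' _ (α⁻¹ : (stage F t j)ˣ).1.2) hmem
    | sigma s =>
      have hj' : j ∉ roots t := by simp only [roots, Set.mem_ofPred_eq, h]; exact id
      rw [h] at hx h1
      obtain rfl : x = s := hx
      rw [← sub_add_cancel (σ' x) x]
      exact add_mem (hstage hj' _ h1.2) hmem

theorem map_mem_adjoinOver_roots (hsimple : IsSimpleOver (⊤ : Subgroup Fˣ) σ' t) {x : E}
    (hx : x ∈ adjoinOver F t (roots t)) : σ' x ∈ adjoinOver F t (roots t) :=
  hE.map_mem_adjoinOver hsimple subset_rfl (fun _ h => Or.inl h) hx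

end IsRPiSigmaExtension

/-- A primitive idempotent of the subring generated by the root of unity monomials, with its
period under `σ'`. -/
structure IsRootIdempotent (F : Type*) [Field F] {E : Type*} [CommRing E] [Algebra F E] {e : ℕ}
    (σ' : E ≃+* E) (t : Fin e → Generator E) (P : ℕ) (ε : E) : Prop where
  pos : 0 < P
  ne_zero : ε ≠ 0
  mem : ε ∈ adjoinOver F t (roots t)
  mul_self : ε * ε = ε
  exists_smul : ∀ a ∈ adjoinOver F t (roots t), ∃ c : F, a * ε = c • ε
  period : (σ' ^ P) ε = ε
  orthogonal : ∀ k, 0 < k → k < P → ε * (σ' ^ k) ε = 0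
  sum_eq_one : ∑ k ∈ Finset.range P, (σ' ^ k) ε = 1

/-- The average of the powers of a root of unity monomial. -/
noncomputable def Generator.average (F : Type*) [Field F] {E : Type*} [CommRing E] [Algebra F E] :
    Generator E → E
  | root n x => (n : F)⁻¹ • ∑ k ∈ Finset.range n, (x : E) ^ k
  | _ => 1

theorem average_mem {t : Fin e → Generator E} (j : Fin e) : (t j).average F ∈ adjoinOver F t (roots t) := by
  cases hj : t j with
  | pi x => exact one_mem _
  | sigma s => exact one_mem _
  | root n x =>
    refine Subalgebra.smul_mem _ (sum_mem fun k _ => pow_mem ?_ _) _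
    exact Algebra.subset_adjoin ⟨j, by simp only [roots, Set.mem_ofPred_eq, hj]; trivial,
      by rw [hj]; rfl⟩

namespace IsRPiSigmaExtension

variable (hE : IsRPiSigmaExtension σ σ' t)

include hE

/-- Multiplication by `x` permutes `1, x, …, x ^ (n - 1)` cyclically. -/
theorem root_mul_average [CharZero F] {j : Fin e} {n : ℕ} {x : Eˣ} (hj : t j = .root n x) :
    (x : E) * (t j).average F = (t j).average F := by
  have h1 := hE.unimonomial j
  rw [hj] at h1 ⊢
  have hxn : (x : E) ^ n = 1 := by rw [← Units.val_pow_eq_pow_val, h1.2.1, Units.val_one]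
  simp only [Generator.average, mul_smul_comm]
  congr 1
  have := Finset.sum_range_succ' (fun k => (x : E) ^ k) n
  rw [Finset.sum_range_succ, hxn, pow_zero] at this
  conv_rhs => rw [add_right_cancel this]
  rw [Finset.mul_sum]
  exact Finset.sum_congr rfl fun k _ => (pow_succ' _ _).symm

theorem average_mul_average [CharZero F] (j : Fin e) :
    (t j).average F * (t j).average F = (t j).average F := by
  cases hj : t j with
  | pi x => simp [Generator.average]
  | sigma s => simp [Generator.average]
  | root n x =>
    have h1 := hE.unimonomial j
    have h2 := hE.root_mul_average hj
    rw [hj] at h1 h2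
    have h3 : ∀ k, (x : E) ^ k * (Generator.root n x).average F = (Generator.root n x).average F := by
      intro k
      induction k with
      | zero => rw [pow_zero, one_mul]
      | succ k ih => rw [pow_succ, mul_assoc, h2, ih]
    have hn : (n : F) ≠ 0 := Nat.cast_ne_zero.2 (by have := h1.1; omega)
    conv_lhs => enter [1]; rw [Generator.average]
    rw [smul_mul_assoc, Finset.sum_mul, Finset.sum_congr rfl fun k _ => h3 k, Finset.sum_const,
      Finset.card_range, ← Nat.cast_smul_eq_nsmul F, smul_smul, inv_mul_cancel₀ hn, one_smul]

/-- Expanded, the product is a nonzero scalar times the sum of all basis monomials in the roots,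
each with coefficient `1`. Characteristic `0` makes the scalar exist. -/
theorem prod_average_ne_zero [CharZero F] : ∏ j, (t j).average F ≠ 0 := by
  classical
  let Q : Fin e → Finset ℤ := fun j => if (t j).IsRoot then Finset.Ico 0 ((t j).order : ℤ) else {0}
  have hQ : ∀ j, (t j).average F = ((t j).order : F)⁻¹ • ∑ k ∈ Q j, (t j).pow k := by
    intro j
    cases hj : t j with
    | pi x => simp [Generator.average, Q, hj, Generator.IsRoot, Generator.order, Generator.pow]
    | sigma s => simp [Generator.average, Q, hj, Generator.IsRoot, Generator.order, Generator.pow]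
    | root n x =>
      simp only [Generator.average, Q, hj, Generator.IsRoot, Generator.order, if_true]
      congr 1
      refine Finset.sum_nbij' (fun k => (k : ℤ)) Int.toNat ?_ ?_ ?_ ?_ ?_
      · intro k hk
        simpa using hk
      · intro k hk
        simp only [Finset.mem_Ico] at hk
        simp only [Finset.mem_range]
        omega
      · intro k _
        simp
      · intro k hk
        exact Int.toNat_of_nonneg (Finset.mem_Ico.1 hk).1
      · intro k _
        simp [Generator.pow]
  have h0 : ∀ j, 0 ∈ Q j := by
    intro j
    have := (hE.unimonomial j).order_pos
    simp only [Q]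
    split_ifs
    · simpa using this
    · simp
  simp only [hQ]
  rw [Finset.prod_smul, Finset.prod_univ_sum]
  refine smul_ne_zero (Finset.prod_ne_zero_iff.2 fun j _ => inv_ne_zero
    (Nat.cast_ne_zero.2 (hE.unimonomial j).order_pos.ne')) fun h => ?_
  have := hE.eq_zero_of_sum_monomial e le_rfl (Fintype.piFinset Q) (fun _ => 1)
    (fun a ha => ⟨fun j => ?_, fun j hj => absurd j.2 (not_lt.2 hj)⟩) (by simpa [monomial] using h)
    0 (by simpa using h0)
  · exact one_ne_zero this
  · have h1 := Fintype.mem_piFinset.1 ha j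
    simp only [Q] at h1
    cases hj : t j with
    | pi x => trivial
    | sigma s =>
      simp only [hj, Generator.IsRoot, if_false, Finset.mem_singleton] at h1
      simp [h1, Generator.IsExponent]
    | root n x =>
      simp only [hj, Generator.IsRoot, if_true, Finset.mem_Ico] at h1
      exact h1

theorem pow_map_mem_roots (hsimple : IsSimpleOver (⊤ : Subgroup Fˣ) σ' t) {x : E}
    (hx : x ∈ adjoinOver F t (roots t)) (n : ℕ) : (σ' ^ n) x ∈ adjoinOver F t (roots t) := by
  induction n with
  | zero => exact hx
  | succ n ih => rw [pow_succ', RingAut.mul_apply]; exact hE.map_mem_adjoinOver_roots hsimple ih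

/-- The terms `c • monomial t a` with `c` in a finite group of roots of unity and `a` supported on
the roots form a finite monoid. It is stable under `σ'` because the coefficients `c` are constants,
so the injective map `σ'` acts on it with finite orbits; the product of the periods of the
generators serves all of them. -/
theorem exists_period [CharZero F] (hsimple : IsSimpleOver (⊤ : Subgroup Fˣ) σ' t)
    (hroot : RootsOfUnityConstant σ) :
    ∃ w, 0 < w ∧ ∀ j n x, t j = .root n x → (σ' ^ w) (x : E) = x := by
  classical
  have h1 : ∀ j, ∃ N, 0 < N ∧ ∀ n x, t j = .root n x → ∃ h : F, h ^ N = 1 ∧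
      ∃ a, IsExponentVector t a ∧ (∀ j ∉ roots t, a j = 0) ∧ σ' (x : E) = h • monomial t a * x := by
    intro j
    by_cases hj : ∃ n x, t j = .root n x
    · obtain ⟨n, x, hj⟩ := hj
      obtain ⟨h, ⟨N, hN, hN'⟩, a, ha⟩ := hE.map_root hsimple hj
      refine ⟨N, hN, fun n' x' hj' => ?_⟩
      rw [hj] at hj'
      cases hj'
      exact ⟨h, hN', a, ha⟩
    · exact ⟨1, Nat.one_pos, fun n x h => absurd ⟨n, x, h⟩ hj⟩
  choose N hN hroots using h1
  -- A common exponent for the scalars that occur in the images of the root of unity monomials.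
  let M := ∏ j, N j
  have hM : 0 < M := Finset.prod_pos fun j _ => hN j
  let W : Submonoid E :=
    { carrier := {y | ∃ c : F, c ^ M = 1 ∧ ∃ a, IsExponentVector t a ∧ (∀ j ∉ roots t, a j = 0) ∧
        y = c • monomial t a}
      one_mem' := ⟨1, one_pow _, 0, hE.isExponentVector_zero, fun _ _ => rfl, by
        rw [monomial_zero, one_smul]⟩
      mul_mem' := by
        rintro _ _ ⟨c, hc, a, ha, ha', rfl⟩ ⟨d, hd, b, hb, hb', rfl⟩
        refine ⟨c * d, by rw [mul_pow, hc, hd, mul_one], _, hE.isExponentVector_reduce (a + b),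
          fun j hj => ?_, ?_⟩
        · simp [ha' j hj, hb' j hj, Generator.reduce_zero]
        · rw [smul_mul_smul_comm, hE.monomial_mul_monomial ha hb]
          rfl }
  have hx : ∀ j n x, t j = .root n x → (x : E) ∈ W := by
    intro j n x hj
    have h1 := hE.unimonomial j
    refine ⟨1, one_pow _, Function.update 0 j 1, hE.isExponentVector_zero.update j ?_, ?_, ?_⟩
    · rw [hj] at h1 ⊢
      exact ⟨zero_le_one, by exact_mod_cast h1.1⟩
    · intro i hi
      rw [Function.update_of_ne]
      · rfl
      · rintro rfl
        exact hi (by simp only [roots, Set.mem_ofPred_eq, hj]; trivial)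
    · rw [← monomial_update t _ j, Function.update_idem, Function.update_self, hj]
      simp [Function.update_eq_self_iff.2, monomial_zero, Generator.pow]
  have hσx : ∀ j n x, t j = .root n x → σ' (x : E) ∈ W := by
    intro j n x hj
    obtain ⟨h, hh, a, ha, ha', hx'⟩ := hroots j n x hj
    rw [hx']
    refine W.mul_mem ⟨h, ?_, a, ha, ha', rfl⟩ (hx j n x hj)
    rw [show M = N j * _ from (Finset.mul_prod_erase _ _ (Finset.mem_univ j)).symm, pow_mul, hh,
      one_pow]
  have hσ : ∀ y ∈ W, σ' y ∈ W := by
    rintro _ ⟨c, hc, a, ha, ha', rfl⟩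
    rw [hE.map_smul', show σ c = c from hroot c ⟨M, hM, hc⟩, ← smul_one_mul c, monomial, map_prod]
    refine W.mul_mem ⟨c, hc, 0, hE.isExponentVector_zero, fun _ _ => rfl, by rw [monomial_zero]⟩
      (W.prod_mem fun j _ => ?_)
    by_cases hj : j ∈ roots t
    · have h2 := ha j
      cases h : t j with
      | root n x =>
        rw [h] at h2
        obtain ⟨k, hk⟩ := Int.eq_ofNat_of_zero_le h2.1
        rw [hk]
        simp only [Generator.pow, zpow_natCast, Units.val_pow_eq_pow_val, map_pow]
        exact W.pow_mem (hσx j n x h) k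
      | pi x => simp only [roots, Set.mem_ofPred_eq, h] at hj; exact hj.elim
      | sigma s => simp only [roots, Set.mem_ofPred_eq, h] at hj; exact hj.elim
    · rw [ha' j hj, Generator.pow_zero_eq, map_one]
      exact W.one_mem
  have hσn : ∀ (n : ℕ), ∀ y ∈ W, (σ' ^ n) y ∈ W := by
    intro n y hy
    induction n with
    | zero => exact hy
    | succ n ih => rw [pow_succ', RingAut.mul_apply]; exact hσ _ ih
  have hfin : (W : Set E).Finite := by
    have h1 : {c : F | c ^ M = 1}.Finite := by
      refine (Polynomial.nthRoots M (1 : F)).toFinset.finite_toSet.subset fun c hc => ?_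
      simpa [Polynomial.mem_nthRoots hM] using hc
    have h2 : {a : Fin e → ℤ | ∀ j, a j ∈ Set.Icc 0 ((t j).order : ℤ)}.Finite := by
      have := Set.Finite.pi' (t := fun j => Set.Icc 0 ((t j).order : ℤ))
        (fun j => Set.finite_Icc _ _)
      exact this
    refine ((h1.prod h2).image fun p => p.1 • monomial t p.2).subset ?_
    rintro _ ⟨c, hc, a, ha, ha', rfl⟩
    refine ⟨(c, a), ⟨hc, fun j => ?_⟩, rfl⟩
    by_cases hj : j ∈ roots t
    · have := ha j
      cases h : t j with
      | root n x =>
        rw [h] at this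
        exact ⟨this.1, this.2.le⟩
      | pi x => simp only [roots, Set.mem_ofPred_eq, h] at hj; exact hj.elim
      | sigma s => simp only [roots, Set.mem_ofPred_eq, h] at hj; exact hj.elim
    · simp [ha' j hj]
  have hper : ∀ y ∈ W, ∃ w, 0 < w ∧ (σ' ^ w) y = y := by
    intro y hy
    have : Finite W := hfin
    obtain ⟨m, n, hmn, h⟩ := Finite.exists_ne_map_eq_of_infinite
      (fun n : ℕ => (⟨(σ' ^ n) y, hσn n y hy⟩ : W))
    have h' : (σ' ^ m) y = (σ' ^ n) y := congrArg Subtype.val h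
    have key : ∀ m n : ℕ, m < n → (σ' ^ m) y = (σ' ^ n) y → ∃ w, 0 < w ∧ (σ' ^ w) y = y := by
      intro m n hmn h
      refine ⟨n - m, by omega, (σ' ^ m).injective ?_⟩
      rw [← RingAut.mul_apply, ← pow_add, Nat.add_sub_cancel' hmn.le, h]
    rcases lt_or_gt_of_ne hmn with hlt | hlt
    exacts [key m n hlt h', key n m hlt h'.symm]
  have h2 : ∀ j, ∃ w, 0 < w ∧ ∀ n x, t j = .root n x → (σ' ^ w) (x : E) = x := by
    intro j
    by_cases hj : ∃ n x, t j = .root n x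
    · obtain ⟨n, x, hj⟩ := hj
      obtain ⟨w, hw, hw'⟩ := hper _ (hx j n x hj)
      refine ⟨w, hw, fun n' x' hj' => ?_⟩
      rw [hj] at hj'
      cases hj'
      exact hw'
    · exact ⟨1, Nat.one_pos, fun n x h => absurd ⟨n, x, h⟩ hj⟩
  choose w hw hw' using h2
  refine ⟨∏ j, w j, Finset.prod_pos fun j _ => hw j, fun j n x hj => ?_⟩
  rw [← Finset.mul_prod_erase _ _ (Finset.mem_univ j), pow_mul]
  generalize (∏ i ∈ Finset.univ.erase j, w i) = k
  induction k with
  | zero => rfl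
  | succ k ih => rw [pow_succ, RingAut.mul_apply, hw' j n x hj, ih]

/-- Each root of unity monomial `x` satisfies `x * ε = ε`, so the root part acts on `ε` through
scalars. Consequently `ε` is primitive, two conjugates of it are equal or orthogonal, and the sum
over its orbit is a constant, which multiplication by `ε` identifies as `1`. -/
theorem exists_isRootIdempotent [CharZero F] (hsimple : IsSimpleOver (⊤ : Subgroup Fˣ) σ' t)
    (hroot : RootsOfUnityConstant σ) : ∃ P ε, IsRootIdempotent F σ' t P ε := by
  classical
  let ε := ∏ j, (t j).average F
  have hne : ε ≠ 0 := hE.prod_average_ne_zero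
  have hmem : ε ∈ adjoinOver F t (roots t) := prod_mem fun j _ => average_mem j
  have hself : ε * ε = ε := by
    rw [← Finset.prod_mul_distrib]
    exact Finset.prod_congr rfl fun j _ => hE.average_mul_average j
  have hx : ∀ j n x, t j = .root n x → (x : E) * ε = ε := by
    intro j n x hj
    simp only [ε]
    rw [← Finset.mul_prod_erase _ _ (Finset.mem_univ j), ← mul_assoc, hE.root_mul_average hj]
  have hsmul : ∀ a ∈ adjoinOver F t (roots t), ∃ c : F, a * ε = c • ε := by
    intro a ha
    rw [adjoinOver] at ha
    induction ha using Algebra.adjoin_induction with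
    | mem x hx' =>
      obtain ⟨j, hj, hx'⟩ := hx'
      refine ⟨1, ?_⟩
      cases h : t j with
      | root n y =>
        rw [h] at hx'
        obtain rfl : x = y := hx'
        rw [hx j n y h, one_smul]
      | pi x => simp only [roots, Set.mem_ofPred_eq, h] at hj; exact hj.elim
      | sigma s => simp only [roots, Set.mem_ofPred_eq, h] at hj; exact hj.elim
    | algebraMap r => exact ⟨r, (Algebra.smul_def _ _).symm⟩
    | add x y _ _ hx hy =>
      obtain ⟨c, hc⟩ := hx
      obtain ⟨d, hd⟩ := hy
      exact ⟨c + d, by rw [add_mul, hc, hd, add_smul]⟩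
    | mul x y _ _ hx hy =>
      obtain ⟨c, hc⟩ := hx
      obtain ⟨d, hd⟩ := hy
      exact ⟨d * c, by rw [mul_assoc, hd, mul_smul_comm, hc, smul_smul]⟩
  have hper : ∃ w, 0 < w ∧ (σ' ^ w) ε = ε := by
    obtain ⟨w, hw, hw'⟩ := hE.exists_period hsimple hroot
    refine ⟨w, hw, ?_⟩
    simp only [ε, map_prod]
    refine Finset.prod_congr rfl fun j _ => ?_
    cases h : t j with
    | pi x => exact map_one _
    | sigma s => exact map_one _
    | root n x =>
      simp only [Generator.average]
      rw [hE.pow_map_smul, map_inv₀, map_natCast, map_sum]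
      simp only [map_pow, hw' j n x h]
  -- The least period, so that the conjugates with index below `P` differ from `ε`.
  let P := Nat.find hper
  obtain ⟨hP, hP'⟩ : 0 < P ∧ (σ' ^ P) ε = ε := Nat.find_spec hper
  have hmin : ∀ k, 0 < k → k < P → (σ' ^ k) ε ≠ ε := fun k h0 hk h =>
    Nat.find_min hper hk ⟨h0, h⟩
  have hidem : ∀ (c : F) (y : E), y * y = y → y ≠ 0 → c • y * c • y = c • y → c = 0 ∨ c = 1 := by
    intro c y hy hy0 h
    rw [smul_mul_smul_comm, hy] at h
    have := smul_left_injective F hy0 h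
    by_cases hc : c = 0
    · exact Or.inl hc
    · exact Or.inr (mul_left_cancel₀ hc (by rw [this, mul_one]))
  -- The product of the two idempotents is a multiple `c` of the first and a multiple of the second.
  -- Both factors are `0` or `1`; if neither is `0`, the idempotents coincide, against minimality of
  -- `P`.
  have horth : ∀ k, 0 < k → k < P → ε * (σ' ^ k) ε = 0 := by
    intro k h0 hk
    have hk1 : ((σ' ^ k) ε) * (σ' ^ k) ε = (σ' ^ k) ε := by rw [← map_mul, hself]
    have hk0 : (σ' ^ k) ε ≠ 0 := fun h => hne ((map_eq_zero_iff _ (σ' ^ k).injective).1 h)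
    have hprod : (ε * (σ' ^ k) ε) * (ε * (σ' ^ k) ε) = ε * (σ' ^ k) ε := by
      linear_combination ((σ' ^ k) ε * (σ' ^ k) ε) * hself + ε * hk1
    obtain ⟨c, hc⟩ := hsmul _ (hE.pow_map_mem_roots hsimple hmem k)
    obtain ⟨d, hd⟩ := hsmul _ (hE.pow_map_mem_roots hsimple hmem (P - k))
    have hd' : ε * (σ' ^ k) ε = (σ ^ k) d • (σ' ^ k) ε := by
      rw [← hE.pow_map_smul, ← hd, map_mul, ← RingAut.mul_apply, ← pow_add,
        Nat.add_sub_cancel' hk.le, hP']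
    have hc' : ε * (σ' ^ k) ε = c • ε := by rw [mul_comm, hc]
    rcases hidem c ε hself hne (by rw [← hc', hprod]) with h | h
    · rw [hc', h, zero_smul]
    · rcases hidem _ _ hk1 hk0 (by rw [← hd', hprod]) with h' | h'
      · rw [hd', h', zero_smul]
      · refine absurd ?_ (hmin k h0 hk)
        rw [h, one_smul] at hc'
        rw [h', one_smul] at hd'
        rw [← hd', hc']
  refine ⟨P, ε, hP, hne, hmem, hself, hsmul, hP', horth, ?_⟩
  obtain ⟨P', hP''⟩ : ∃ P', P = P' + 1 := ⟨P - 1, by omega⟩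
  -- `σ'` permutes the orbit, so the sum is a constant and therefore lies in `F`.
  have hconst : ∑ k ∈ Finset.range P, (σ' ^ k) ε ∈ constants σ' := by
    change σ' _ = _
    rw [map_sum]
    have h1 := Finset.sum_range_succ (fun k => (σ' ^ k) ε) P
    rw [Finset.sum_range_succ', hP'] at h1
    simpa only [pow_succ', RingAut.mul_apply] using add_right_cancel h1
  obtain ⟨c, -, hc⟩ := hE.exists_of_mem_constants hconst
  have h2 : ε * ∑ k ∈ Finset.range P, (σ' ^ k) ε = ε := by
    rw [hP'', Finset.sum_range_succ', mul_add, Finset.mul_sum, Finset.sum_eq_zero, zero_add]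
    · exact hself
    · intro k hk
      exact horth _ (Nat.succ_pos k) (by have := Finset.mem_range.1 hk; omega)
  rw [← hc, mul_comm, ← Algebra.smul_def] at h2
  have h3 : c = 1 := smul_left_injective F hne (by simpa using h2)
  rw [← hc, h3, map_one]

end IsRPiSigmaExtension

namespace IsRootIdempotent

variable {P : ℕ} {ε : E} (hε : IsRootIdempotent F σ' t P ε)

include hε

theorem smul_injective {c d : F} (h : c • ε = d • ε) : c = d :=
  smul_left_injective F hε.ne_zero h

/-- Write `1` as the sum of the conjugates of `ε`. The part of `x` at the `j`-th conjugate is moved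
to `ε` by applying `σ' ^ (P - j)`. -/
theorem eq_zero_of_mul_eq_zero {x : E} (h : ∀ j < P, ε * (σ' ^ j) x = 0) : x = 0 := by
  rw [← one_mul x, ← hε.sum_eq_one, Finset.sum_mul]
  refine Finset.sum_eq_zero fun j hj => ?_
  have hj := Finset.mem_range.1 hj
  rcases Nat.eq_zero_or_pos j with rfl | h0
  · exact h 0 hε.pos
  · refine (map_eq_zero_iff _ (σ' ^ (P - j)).injective).1 ?_
    rw [map_mul, ← RingAut.mul_apply, ← pow_add, Nat.sub_add_cancel hj.le, hε.period]
    exact h _ (by omega)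

/-- An element of the root part is reconstructed from its components. -/
theorem exists_of_components (hE : IsRPiSigmaExtension σ σ' t)
    (hsimple : IsSimpleOver (⊤ : Subgroup Fˣ) σ' t) (c : ℕ → F) :
    ∃ g ∈ adjoinOver F t (roots t), ∀ j < P, ε * (σ' ^ j) g = c j • ε := by
  -- The `i`-th summand is built so that `σ' ^ i` turns it into `c i • (σ' ^ P) ε`, which is `c i •
  -- ε`; all other powers below `P` move it to a conjugate orthogonal to `ε`.
  refine ⟨∑ i ∈ Finset.range P, (σ ^ i).symm (c i) • (σ' ^ (P - i)) ε, sum_mem fun i _ =>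
    Subalgebra.smul_mem _ (hE.pow_map_mem_roots hsimple hε.mem _) _, fun j hj => ?_⟩
  rw [map_sum, Finset.mul_sum, Finset.sum_eq_single j]
  · rw [hE.pow_map_smul, ← RingAut.mul_apply (σ' ^ j), ← pow_add, Nat.add_sub_cancel' hj.le,
      hε.period, mul_smul_comm, hε.mul_self, RingEquiv.apply_symm_apply]
  · intro i hi hij
    have hi := Finset.mem_range.1 hi
    rw [hE.pow_map_smul, mul_smul_comm, ← RingAut.mul_apply (σ' ^ j), ← pow_add]
    rcases lt_or_gt_of_ne hij with h | h
    · rw [show j + (P - i) = (j - i) + P by omega, pow_add, RingAut.mul_apply, hε.period,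
        hε.orthogonal _ (by omega) (by omega), smul_zero]
    · rw [hε.orthogonal _ (by omega) (by omega), smul_zero]
  · intro h
    exact absurd (Finset.mem_range.2 hj) h

end IsRootIdempotent

end RootPart

/-! ### Splitting off one generator above the root part -/

section Semiconstants

variable {F : Type*} [Field F] {E : Type*} [CommRing E] [Algebra F E] {e : ℕ}
  {σ : F ≃+* F} {σ' : E ≃+* E} {t : Fin e → Generator E}

/-- The indices of the root of unity monomials and of the first `i` generators. -/
def chain (t : Fin e → Generator E) (i : ℕ) : Set (Fin e) := roots t ∪ {j | (j : ℕ) < i}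

theorem chain_zero (t : Fin e → Generator E) : chain t 0 = roots t := by
  simp [chain]

theorem chain_top (t : Fin e → Generator E) : chain t e = Set.univ := by
  simp [chain]

theorem roots_subset_chain (t : Fin e → Generator E) (i : ℕ) : roots t ⊆ chain t i :=
  Set.subset_union_left

theorem chain_succ (t : Fin e → Generator E) (i : Fin e) :
    chain t (i + 1) = insert i (chain t i) := by
  ext j
  simp only [chain, Set.mem_union, Set.mem_insert_iff, Set.mem_ofPred_eq, Fin.ext_iff,
    Nat.lt_succ_iff_lt_or_eq]
  tauto

theorem notMem_chain {i : Fin e} (hi : i ∉ roots t) : i ∉ chain t i := by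
  simp [chain, hi]

theorem unitMonomial_neg (t : Fin e → Generator E) (b : Fin e → ℤ) :
    unitMonomial t (-b) = (unitMonomial t b)⁻¹ := by
  simp [unitMonomial, Finset.prod_inv_distrib]

/-- A unit of the root part times a product of `Π`-monomials with indices in `S`. -/
def IsSemimonomial (F : Type*) [Field F] {E : Type*} [CommRing E] [Algebra F E] {e : ℕ}
    (t : Fin e → Generator E) (S : Set (Fin e)) (g : E) : Prop :=
  ∃ ρ ∈ adjoinOver F t (roots t), ∃ ρ' ∈ adjoinOver F t (roots t), ρ * ρ' = 1 ∧
    ∃ b : Fin e → ℤ, (∀ j, ¬ (t j).IsPi → b j = 0) ∧ (∀ j ∉ S, b j = 0) ∧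
      g = ρ * (unitMonomial t b : Eˣ)

namespace IsRPiSigmaExtension

theorem stage_le_chain (t : Fin e → Generator E) (i : ℕ) :
    stage F t i ≤ adjoinOver F t (chain t i) := by
  rw [stage_eq_adjoinOver]
  exact adjoinOver_mono t Set.subset_union_right

variable (hE : IsRPiSigmaExtension σ σ' t)

include hE

theorem map_mem_chain (hsimple : IsSimpleOver (⊤ : Subgroup Fˣ) σ' t) {i : ℕ} {x : E}
    (hx : x ∈ adjoinOver F t (chain t i)) : σ' x ∈ adjoinOver F t (chain t i) := by
  refine hE.map_mem_adjoinOver hsimple (roots_subset_chain t i) (fun j hj => ?_) hx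
  rcases hj with hj | hj
  · exact Or.inl hj
  · exact Or.inr fun k hk => Or.inr (lt_trans (show (k : ℕ) < j from hk) hj)

theorem unitMonomial_mem {S : Set (Fin e)} {b : Fin e → ℤ} (hb : ∀ j ∉ S, b j = 0) :
    (unitMonomial t b : E) ∈ adjoinOver F t S := by
  obtain ⟨a, ha, -, -, ha', h⟩ := hE.exists_unitMonomial_eq b
  rw [h]
  exact monomial_mem_adjoinOver t ha fun j hj => ha' j (hb j hj)

theorem exists_of_mem_productGroup_of_mem {S : Set (Fin e)} {u : Eˣ}
    (hu : u ∈ productGroup (⊤ : Subgroup Fˣ) t) (huS : (u : E) ∈ adjoinOver F t S) :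
    ∃ h : Fˣ, ∃ a, IsExponentVector t a ∧ (∀ j, (t j).IsSigma → a j = 0) ∧ (∀ j ∉ S, a j = 0) ∧
      u = Units.map (algebraMap F E : F →* E) h * unitMonomial t a := by
  obtain ⟨h, hh, a, ha, ha', hu'⟩ := hE.exists_of_mem_productGroup hu
  refine ⟨Units.mk0 h hh, a, ha, ha', ?_, Units.ext ?_⟩
  · have := hE.mem_adjoinOver_iff.1 huS ⟨a, ha⟩
    rw [hu', map_smul, hE.repr_monomial ha] at this
    exact this (by simpa using hh)
  · rw [hu', Units.val_mul, coe_unitMonomial ha', Algebra.smul_def]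
    rfl

theorem inv_mem_of_mem_productGroup {S : Set (Fin e)} {u : Eˣ}
    (hu : u ∈ productGroup (⊤ : Subgroup Fˣ) t) (huS : (u : E) ∈ adjoinOver F t S) :
    ((u⁻¹ : Eˣ) : E) ∈ adjoinOver F t S := by
  obtain ⟨h, a, -, -, ha, rfl⟩ := hE.exists_of_mem_productGroup_of_mem hu huS
  rw [mul_inv, ← map_inv, ← unitMonomial_neg, Units.val_mul]
  exact mul_mem (Subalgebra.algebraMap_mem _ _) (hE.unitMonomial_mem fun j hj => by simp [ha j hj])

theorem zpow_mem_of_mem_productGroup {S : Set (Fin e)} {u : Eˣ}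
    (hu : u ∈ productGroup (⊤ : Subgroup Fˣ) t) (huS : (u : E) ∈ adjoinOver F t S) (k : ℤ) :
    ((u ^ k : Eˣ) : E) ∈ adjoinOver F t S := by
  obtain ⟨k, rfl | rfl⟩ := k.eq_nat_or_neg
  · rw [zpow_natCast, Units.val_pow_eq_pow_val]
    exact pow_mem huS _
  · rw [zpow_neg, zpow_natCast, ← inv_pow, Units.val_pow_eq_pow_val]
    exact pow_mem (hE.inv_mem_of_mem_productGroup hu huS) _

/-- Splitting off the power of a generator from an element of the product group. -/
theorem exists_mul_pow_of_mem_productGroup {S : Set (Fin e)} {i : Fin e} {u : Eˣ}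
    (hu : u ∈ productGroup (⊤ : Subgroup Fˣ) t) (huS : (u : E) ∈ adjoinOver F t (insert i S)) :
    ∃ v ∈ productGroup (⊤ : Subgroup Fˣ) t, (v : E) ∈ adjoinOver F t S ∧ ∃ m : ℤ,
      u = v * (t i).unitPart ^ m := by
  obtain ⟨h, a, -, ha1, ha2, rfl⟩ := hE.exists_of_mem_productGroup_of_mem hu huS
  have hfac : unitMonomial t a = unitMonomial t (Function.update a i 0) * (t i).unitPart ^ a i := by
    rw [unitMonomial, unitMonomial, ← Finset.mul_prod_erase _ _ (Finset.mem_univ i),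
      ← Finset.mul_prod_erase _ (fun j => (t j).unitPart ^ Function.update a i 0 j)
      (Finset.mem_univ i), Function.update_self, zpow_zero, one_mul, mul_comm]
    congr 1
    refine Finset.prod_congr rfl fun j hj => ?_
    rw [Function.update_of_ne (Finset.ne_of_mem_erase hj)]
  refine ⟨Units.map (algebraMap F E : F →* E) h * unitMonomial t (Function.update a i 0),
    ⟨h, Subgroup.mem_top _, _, rfl⟩, ?_, a i, ?_⟩
  · rw [Units.val_mul]
    refine mul_mem (Subalgebra.algebraMap_mem _ _) (hE.unitMonomial_mem fun j hj => ?_)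
    by_cases h : j = i
    · rw [h, Function.update_self]
    · rw [Function.update_of_ne h]
      exact ha2 j fun h' => h'.elim h hj
  · rw [hfac, mul_assoc]

/-- The quotient of the two solutions is a constant. Only `y` has to be invertible. -/
theorem eq_smul_of_map_eq {u x y y' : E} (hu : IsUnit u) (hx : σ' x = u * x) (hy : σ' y = u * y)
    (hyy : y * y' = 1) : ∃ κ ∈ constants σ, x = κ • y := by
  obtain ⟨w, rfl⟩ := hu
  have h1 : σ' y * σ' y' = 1 := by rw [← map_mul, hyy, map_one]
  rw [hy] at h1
  have h2 : x * y' ∈ constants σ' := by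
    change σ' (x * y') = x * y'
    rw [map_mul, hx]
    linear_combination x * y' * h1 - w * x * σ' y' * hyy
  obtain ⟨κ, hκ, hκ'⟩ := hE.exists_of_mem_constants h2
  exact ⟨κ, hκ, by rw [Algebra.smul_def, hκ']; linear_combination -x * hyy⟩

theorem coeff_sum {S : Set (Fin e)} {i : Fin e} (hi : i ∉ S) (s : Finset ℤ) (b : ℤ → E)
    (hb : ∀ k ∈ s, b k ∈ adjoinOver F t S) (hs : ∀ k ∈ s, (t i).IsExponent k) (k : ℤ) :
    hE.coeff i k (∑ l ∈ s, b l * (t i).pow l) = if k ∈ s then b k else 0 := by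
  rw [map_sum, Finset.sum_congr rfl fun l hl => hE.coeff_mul_pow hi (hb l hl) k (hs l hl),
    Finset.sum_ite_eq]

theorem coeff_mul_left {S : Set (Fin e)} {i : Fin e} (hi : i ∉ S) {v x : E}
    (hv : v ∈ adjoinOver F t S) (hx : x ∈ adjoinOver F t (insert i S)) (k : ℤ) :
    hE.coeff i k (v * x) = v * hE.coeff i k x := by
  obtain ⟨s, hs, h⟩ := hE.exists_sum_coeff i x
  have hmem : ∀ k, hE.coeff i k x ∈ adjoinOver F t S := fun k => by
    have := hE.coeff_mem hx (i := i) k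
    rwa [Set.insert_sdiff_self_of_notMem hi] at this
  classical
  have h' : x = ∑ k ∈ s with (t i).IsExponent k, hE.coeff i k x * (t i).pow k := by
    rw [Finset.sum_filter]
    conv_lhs => rw [h]
    refine Finset.sum_congr rfl fun k _ => ?_
    split_ifs with h1
    · rfl
    · rw [hE.coeff_eq_zero h1, zero_mul]
  have h2 : v * x = ∑ k ∈ s with (t i).IsExponent k, (v * hE.coeff i k x) * (t i).pow k := by
    conv_lhs => rw [h', Finset.mul_sum]
    simp only [mul_assoc]
  rw [h2, hE.coeff_sum hi _ (fun k => v * hE.coeff i k x) (fun k _ => mul_mem hv (hmem k)) (by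
    intro k hk; exact (Finset.mem_filter.1 hk).2)]
  split_ifs with h1
  · rfl
  · rw [Finset.mem_filter, not_and_or] at h1
    rcases h1 with h1 | h1
    · rw [hs k h1, mul_zero]
    · rw [hE.coeff_eq_zero h1, mul_zero]

theorem coeff_mem_of_insert {S : Set (Fin e)} {i : Fin e} (hi : i ∉ S) {x : E}
    (hx : x ∈ adjoinOver F t (insert i S)) (k : ℤ) : hE.coeff i k x ∈ adjoinOver F t S := by
  have := hE.coeff_mem hx (i := i) k
  rwa [Set.insert_sdiff_self_of_notMem hi] at this

end IsRPiSigmaExtension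

/-! ### Coefficients with respect to a Π-monomial -/

section Pi

variable (hE : IsRPiSigmaExtension σ σ' t) {i : Fin e} {τ : Eˣ} {α : Eˣ} {S : Set (Fin e)}

include hE

theorem IsRPiSigmaExtension.exists_quotient_of_pi (hsimple : IsSimpleOver (⊤ : Subgroup Fˣ) σ' t)
    (hi : t i = .pi τ) : ∃ α ∈ productGroup (⊤ : Subgroup Fˣ) t,
      (α : E) ∈ adjoinOver F t (chain t i) ∧ σ' (τ : E) = α * τ := by
  have h1 := hE.unimonomial i
  have h2 := hsimple i
  rw [hi] at h1 h2
  obtain ⟨u, hu, hu'⟩ := h2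
  obtain ⟨-, β, hβ⟩ := h1
  refine ⟨u, hu, ?_, hu'⟩
  have : (u : E) = ((β : stage F t i) : E) := τ.mul_left_inj.1 (by rw [← hu', hβ])
  rw [this]
  exact IsRPiSigmaExtension.stage_le_chain t i (β : stage F t i).2

omit hE [Algebra F E] [Field F] in
theorem map_zpow_of_map_eq (hα : σ' (τ : E) = α * τ) (k : ℤ) :
    σ' ((τ ^ k : Eˣ) : E) = ((α ^ k : Eˣ) : E) * ((τ ^ k : Eˣ) : E) := by
  have h : Units.map (σ' : E →* E) τ = α * τ := Units.ext hα
  have h2 := congrArg Units.val (map_zpow (Units.map (σ' : E →* E)) τ k)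
  rw [h, mul_zpow] at h2
  exact h2

theorem IsRPiSigmaExtension.coeff_map_of_pi (hi : t i = .pi τ) (hiS : i ∉ S)
    (hσ : ∀ x ∈ adjoinOver F t S, σ' x ∈ adjoinOver F t S)
    (hα : σ' (τ : E) = α * τ) (hαG : α ∈ productGroup (⊤ : Subgroup Fˣ) t)
    (hαS : (α : E) ∈ adjoinOver F t S) {x : E} (hx : x ∈ adjoinOver F t (insert i S)) (k : ℤ) :
    hE.coeff i k (σ' x) = σ' (hE.coeff i k x) * ((α ^ k : Eˣ) : E) := by
  obtain ⟨s, hs, h⟩ := hE.exists_sum_coeff i x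
  have h2 : σ' x = ∑ k ∈ s, (σ' (hE.coeff i k x) * ((α ^ k : Eˣ) : E)) * (t i).pow k := by
    conv_lhs => rw [h, map_sum]
    refine Finset.sum_congr rfl fun k _ => ?_
    rw [map_mul, hi, Generator.pow, map_zpow_of_map_eq hα, mul_assoc]
  rw [h2, hE.coeff_sum hiS _ (fun k => σ' (hE.coeff i k x) * ((α ^ k : Eˣ) : E)) (fun k _ =>
    mul_mem (hσ _ (hE.coeff_mem_of_insert hiS hx k)) (hE.zpow_mem_of_mem_productGroup hαG hαS k))
    (fun k _ => by rw [hi]; trivial)]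
  split_ifs with h1
  · rfl
  · rw [hs k h1, map_zero, zero_mul]

theorem IsRPiSigmaExtension.coeff_mul_zpow (hi : t i = .pi τ) (hiS : i ∉ S) {v x : E}
    (hv : v ∈ adjoinOver F t S) (hx : x ∈ adjoinOver F t (insert i S)) (m k : ℤ) :
    hE.coeff i k (v * ((τ ^ m : Eˣ) : E) * x) = v * hE.coeff i (k - m) x := by
  obtain ⟨s, hs, h⟩ := hE.exists_sum_coeff i x
  have h2 : v * ((τ ^ m : Eˣ) : E) * x =
      ∑ k ∈ s.map (addRightEmbedding m), (v * hE.coeff i (k - m) x) * (t i).pow k := by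
    rw [Finset.sum_map]
    conv_lhs => rw [h, Finset.mul_sum]
    refine Finset.sum_congr rfl fun k _ => ?_
    simp only [addRightEmbedding_apply, add_sub_cancel_right, hi, Generator.pow, zpow_add,
      Units.val_mul]
    ring
  rw [h2, hE.coeff_sum hiS _ (fun k => v * hE.coeff i (k - m) x) (fun k _ =>
    mul_mem hv (hE.coeff_mem_of_insert hiS hx _)) (fun k _ => by rw [hi]; trivial)]
  split_ifs with h1
  · rfl
  · rw [hs (k - m), mul_zero]
    intro h'
    exact h1 (by simpa [addRightEmbedding] using ⟨k - m, h', by ring⟩)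

end Pi

/-! ### Coefficients with respect to a Σ-monomial -/

section Sigma

variable (hE : IsRPiSigmaExtension σ σ' t) {i : Fin e} {s : E} {S : Set (Fin e)}

include hE

theorem IsRPiSigmaExtension.exists_sum_of_sigma (hi : t i = .sigma s) (x : E) :
    ∃ N : ℕ, (∀ k : ℤ, N < k → hE.coeff i k x = 0) ∧
      ∀ M, N ≤ M → x = ∑ k ∈ Finset.range (M + 1), hE.coeff i k x * s ^ k := by
  obtain ⟨r, hr, h⟩ := hE.exists_sum_coeff i x
  have hbound : ∀ k ∈ r, k ≤ (r.sup Int.toNat : ℕ) := fun k hk => by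
    have : k.toNat ≤ r.sup Int.toNat := Finset.le_sup (f := Int.toNat) hk
    omega
  refine ⟨r.sup Int.toNat, fun k hk => hr k fun hk' => ?_, fun M hM => ?_⟩
  · have := hbound k hk'
    omega
  · conv_lhs => rw [h]
    symm
    have h0 : ∀ k ∈ r, ¬ (0 ≤ k) → hE.coeff i k x * (t i).pow k = 0 := by
      intro k _ hk
      rw [hE.coeff_eq_zero (by rw [hi]; exact hk), zero_mul]
    rw [← Finset.sum_filter_of_ne (p := fun k => 0 ≤ k) fun k hk hne =>
      not_not.1 fun h' => hne (h0 k hk h')]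
    have hinj : Function.Injective (fun k : ℕ => (k : ℤ)) := Nat.cast_injective
    rw [Finset.sum_subset (s₂ := (Finset.range (M + 1)).map ⟨_, hinj⟩), Finset.sum_map]
    · refine Finset.sum_congr rfl fun k _ => ?_
      simp [hi, Generator.pow]
    · intro k hk
      obtain ⟨h1, h2⟩ := Finset.mem_filter.1 hk
      simp only [Finset.mem_map, Finset.mem_range, Function.Embedding.coeFn_mk]
      exact ⟨k.toNat, by have := hbound k h1; omega, by omega⟩
    · intro k hk hk'
      obtain ⟨l, -, rfl⟩ := Finset.mem_map.1 hk
      rw [hr, zero_mul]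
      intro h'
      exact hk' (Finset.mem_filter.2 ⟨h', Int.natCast_nonneg l⟩)

/-- Binomial expansion of `(s + (σ' s - s)) ^ k`, where the second summand lies in the ring of
coefficients. -/
theorem IsRPiSigmaExtension.coeff_map_of_sigma (hi : t i = .sigma s) (hiS : i ∉ S)
    (hσ : ∀ x ∈ adjoinOver F t S, σ' x ∈ adjoinOver F t S) (hs : σ' s - s ∈ adjoinOver F t S)
    {x : E} (hx : x ∈ adjoinOver F t (insert i S)) (N : ℕ)
    (hN : ∀ k : ℤ, N < k → hE.coeff i k x = 0) (l : ℕ) :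
    hE.coeff i l (σ' x) = ∑ k ∈ Finset.range (N + 1),
      σ' (hE.coeff i k x) * ((σ' s - s) ^ (k - l) * (k.choose l : ℕ)) := by
  obtain ⟨M, hM, h⟩ := hE.exists_sum_of_sigma hi x
  have hx' : x = ∑ k ∈ Finset.range (N + 1), hE.coeff i k x * s ^ k := by
    conv_lhs => rw [h (max M N) (le_max_left _ _)]
    symm
    refine Finset.sum_subset (Finset.range_subset_range.2 (by omega)) fun k _ hk => ?_
    rw [hN k (by have := Finset.mem_range.not.1 hk; omega), zero_mul]
  conv_lhs => rw [hx', map_sum, map_sum]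
  refine Finset.sum_congr rfl fun k _ => ?_
  have hsub : σ' s = s + (σ' s - s) := by ring
  rw [map_mul, map_pow, hsub, add_pow, add_sub_cancel_left, Finset.mul_sum, map_sum,
    Finset.sum_congr rfl (g := fun j : ℕ => if (l : ℤ) = (j : ℤ) then
      σ' (hE.coeff i k x) * ((σ' s - s) ^ (k - j) * (k.choose j : ℕ)) else 0)]
  · simp only [Nat.cast_inj, Finset.sum_ite_eq, Finset.mem_range]
    split_ifs with h1
    · rfl
    · rw [Nat.choose_eq_zero_of_lt (by omega), Nat.cast_zero, mul_zero, mul_zero]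
  · intro j _
    have h1 : σ' (hE.coeff i k x) * (s ^ j * (σ' s - s) ^ (k - j) * (k.choose j : ℕ)) =
        σ' (hE.coeff i k x) * ((σ' s - s) ^ (k - j) * (k.choose j : ℕ)) * (t i).pow (j : ℤ) := by
      simp only [hi, Generator.pow, Int.toNat_natCast]
      ring
    rw [h1, hE.coeff_mul_pow hiS]
    · exact mul_mem (hσ _ (hE.coeff_mem_of_insert hiS hx k)) (mul_mem (pow_mem hs _)
        (natCast_mem _ _))
    · rw [hi]
      exact Int.natCast_nonneg j

end Sigma

end Semiconstants

/-! ### Nonzero semi-constants are units of a special form -/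

section Semiconstants

variable {F : Type*} [Field F] {E : Type*} [CommRing E] [Algebra F E] {e : ℕ}
  {σ : F ≃+* F} {σ' : E ≃+* E} {t : Fin e → Generator E}

theorem IsSemimonomial.exists_inv {S : Set (Fin e)} {g : E} (hg : IsSemimonomial F t S g)
    (hE : IsRPiSigmaExtension σ σ' t) (hS : roots t ⊆ S) :
    ∃ g' ∈ adjoinOver F t S, g * g' = 1 := by
  obtain ⟨ρ, -, ρ', hρ', h1, b, -, hb, rfl⟩ := hg
  refine ⟨ρ' * (unitMonomial t (-b) : Eˣ), mul_mem (adjoinOver_mono t hS hρ')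
    (hE.unitMonomial_mem fun j hj => by simp [hb j hj]), ?_⟩
  have h2 : ((unitMonomial t b : Eˣ) : E) * (unitMonomial t (-b) : Eˣ) = 1 := by
    rw [unitMonomial_neg, Units.mul_inv]
  linear_combination ((unitMonomial t b : Eˣ) : E) * (unitMonomial t (-b) : Eˣ) * h1 + h2

namespace IsRPiSigmaExtension

variable (hE : IsRPiSigmaExtension σ σ' t)

include hE

/-- Leading coefficients of solutions in a `Σ`-extension that cannot occur. -/
theorem false_of_sigma_leading [CharZero F] {i : Fin e} {s : E} {S : Set (Fin e)}
    (hi : t i = .sigma s) (hiS : i ∉ S)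
    (hσ : ∀ x ∈ adjoinOver F t S, σ' x ∈ adjoinOver F t S) (hs : σ' s - s ∈ adjoinOver F t S)
    {g : E} (hg : g ∈ adjoinOver F t (insert i S)) (D : ℕ)
    (hD : ∀ k : ℤ, (D + 1 : ℕ) < k → hE.coeff i k g = 0) {w : E} (hw : w ∈ adjoinOver F t S)
    (hgw : hE.coeff i (D + 1 : ℕ) g * w = 1) {u : E} (hu : IsUnit u) (huS : u ∈ adjoinOver F t S)
    (h1 : hE.coeff i (D + 1 : ℕ) (σ' g - u * g) = 0) (h2 : hE.coeff i (D : ℕ) (σ' g - u * g) = 0) :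
    False := by
  rw [map_sub, hE.coeff_mul_left hiS huS hg, hE.coeff_map_of_sigma hi hiS hσ hs hg (D + 1) hD,
    Finset.sum_range_succ, Finset.sum_eq_zero, zero_add, sub_eq_zero] at h1
  swap
  · intro k hk
    rw [Nat.choose_eq_zero_of_lt (by have := Finset.mem_range.1 hk; omega), Nat.cast_zero, mul_zero,
      mul_zero]
  rw [map_sub, hE.coeff_mul_left hiS huS hg, hE.coeff_map_of_sigma hi hiS hσ hs hg (D + 1) hD,
    Finset.sum_range_succ, Finset.sum_range_succ, Finset.sum_eq_zero, zero_add, sub_eq_zero] at h2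
  swap
  · intro k hk
    rw [Nat.choose_eq_zero_of_lt (by have := Finset.mem_range.1 hk; omega), Nat.cast_zero, mul_zero,
      mul_zero]
  simp only [Nat.sub_self, pow_zero, Nat.choose_self, Nat.cast_one, mul_one,
    Nat.add_sub_cancel_left, pow_one, Nat.choose_succ_self_right] at h1 h2
  set c := hE.coeff i (D + 1 : ℕ) g
  set d := hE.coeff i (D : ℕ) g
  have hd : d ∈ adjoinOver F t S := hE.coeff_mem_of_insert hiS hg _
  obtain ⟨u', rfl⟩ := hu
  have h3 : σ' c * σ' w = 1 := by rw [← map_mul, hgw, map_one]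
  -- With `c` and `d` the two highest coefficients, the hypotheses say `σ' c = u * c` and `σ' d + (D
  -- + 1) * (σ' s - s) * σ' c = u * d`. Dividing the second by the first yields a constant of degree
  -- one in `s`.
  have hconst : ((D + 1 : ℕ) : E) * s + d * w ∈ constants σ' := by
    change σ' _ = _
    rw [map_add, map_mul, map_mul, map_natCast]
    have h4 : (u' : E) * c * σ' w = 1 := by rw [← h1, h3]
    have h5 : (u' : E) * σ' w = w := by linear_combination w * h4 - u' * σ' w * hgw
    rw [h1] at h2
    linear_combination σ' w * h2 + d * h5 - ((D + 1 : ℕ) : E) * (σ' s - s) * h4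
  obtain ⟨q, -, hq⟩ := hE.exists_of_mem_constants hconst
  -- Constants lie in `F` and have no linear coefficient, while here it is `D + 1`, which is nonzero
  -- in characteristic `0`.
  have h6 := congrArg (hE.coeff i 1) hq
  have hs1 : s = (t i).pow 1 := by rw [hi]; simp [Generator.pow]
  have he1 : (t i).IsExponent 1 := by rw [hi]; exact zero_le_one
  rw [map_add, hE.coeff_of_mem hiS (Subalgebra.algebraMap_mem _ _),
    hE.coeff_of_mem hiS (mul_mem hd hw), hs1, hE.coeff_mul_pow hiS (natCast_mem _ _) _ he1] at h6
  simp only [one_ne_zero, if_false, if_true, add_zero] at h6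
  have h7 : algebraMap F E ((D + 1 : ℕ) : F) = algebraMap F E 0 := by
    rw [map_natCast, map_zero, ← h6]
  exact (Nat.cast_ne_zero (R := F)).2 (Nat.succ_ne_zero D) (hE.injective h7)

/-- The components of `g` satisfy `c (j + 1) = d j * c j`, and the cycle closes with `c P = (σ ^ P)
(c 0)`. Hence one vanishing component makes all vanish; if `g` is not zero, its inverse is formed
component by component in the field `F`. -/
theorem isSemimonomial_root_part {P : ℕ} {ε : E} (hε : IsRootIdempotent F σ' t P ε)
    (hsimple : IsSimpleOver (⊤ : Subgroup Fˣ) σ' t) {g : E}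
    (hg : g ∈ adjoinOver F t (roots t)) (hg0 : g ≠ 0) {u : E}
    (huR : u ∈ adjoinOver F t (roots t)) (h : σ' g = u * g) :
    IsSemimonomial F t (roots t) g := by
  have hcomp : ∀ x ∈ adjoinOver F t (roots t), ∀ j : ℕ, ∃ c : F, ε * (σ' ^ j) x = c • ε := by
    intro x hx j
    obtain ⟨c, hc⟩ := hε.exists_smul _ (hE.pow_map_mem_roots hsimple hx j)
    exact ⟨c, by rw [mul_comm, hc]⟩
  choose c hc using hcomp g hg
  choose d hd using hcomp u huR
  have hstep : ∀ j, c (j + 1) = d j * c j := by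
    intro j
    apply hε.smul_injective
    rw [← hc, pow_succ, RingAut.mul_apply, h, map_mul, ← smul_smul, ← hc]
    have := hd j
    calc ε * ((σ' ^ j) u * (σ' ^ j) g) = (ε * (σ' ^ j) u) * (σ' ^ j) g := by ring
      _ = _ := by rw [hd j, smul_mul_assoc]
  have hP : c P = (σ ^ P) (c 0) := by
    apply hε.smul_injective
    rw [← hc, ← hε.period, ← hE.pow_map_smul, ← map_mul, ← hc 0, pow_zero]
    rfl
  have hpropagate : ∀ j k, c j = 0 → c (j + k) = 0 := by
    intro j k hj
    induction k with
    | zero => exact hj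
    | succ k ih => rw [← add_assoc, hstep, ih, mul_zero]
  have hne : ∀ j ≤ P, c j ≠ 0 := by
    intro j hj h0
    have h1 : c P = 0 := by
      rw [← Nat.add_sub_cancel' hj]
      exact hpropagate _ _ h0
    rw [hP, map_eq_zero_iff _ (σ ^ P).injective] at h1
    refine hg0 (hε.eq_zero_of_mul_eq_zero fun k _ => ?_)
    rw [hc, ← zero_add k, hpropagate 0 k h1, zero_smul]
  obtain ⟨g', hg', hg''⟩ := hε.exists_of_components hE hsimple fun j => (c j)⁻¹
  refine ⟨g, hg, g', hg', ?_, 0, fun _ _ => rfl, fun _ _ => rfl, by simp [unitMonomial]⟩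
  rw [← sub_eq_zero]
  refine hε.eq_zero_of_mul_eq_zero fun j hj => ?_
  rw [map_sub, map_mul, map_one, mul_sub, mul_one]
  have h1 : ε * ((σ' ^ j) g * (σ' ^ j) g') = (ε * (σ' ^ j) g) * (ε * (σ' ^ j) g') := by
    linear_combination -(σ' ^ j) g * (σ' ^ j) g' * hε.mul_self
  rw [h1, hc, hg'' j hj, smul_mul_smul_comm, hε.mul_self, mul_inv_cancel₀ (hne j hj.le), one_smul,
    sub_self]

/-- Nonzero semi-constants over the product group are products of units. -/
theorem isSemimonomial_of_map_eq [CharZero F] (hsimple : IsSimpleOver (⊤ : Subgroup Fˣ) σ' t)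
    (hroot : RootsOfUnityConstant σ) (i : ℕ) (hie : i ≤ e) {g : E}
    (hg : g ∈ adjoinOver F t (chain t i)) (hg0 : g ≠ 0) {u : Eˣ}
    (hu : u ∈ productGroup (⊤ : Subgroup Fˣ) t) (huS : (u : E) ∈ adjoinOver F t (chain t i))
    (h : σ' g = u * g) : IsSemimonomial F t (chain t i) g := by
  classical
  induction i generalizing g u with
  | zero =>
    obtain ⟨P, ε, hε⟩ := hE.exists_isRootIdempotent hsimple hroot
    rw [chain_zero] at hg huS ⊢
    exact hE.isSemimonomial_root_part hε hsimple hg hg0 huS h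
  | succ i ih =>
    let ι : Fin e := ⟨i, hie⟩
    have hchain : chain t (i + 1) = insert ι (chain t i) := chain_succ t ι
    by_cases hιr : ι ∈ roots t
    · rw [Set.insert_eq_of_mem (roots_subset_chain t i hιr)] at hchain
      rw [hchain] at hg huS ⊢
      exact ih (by omega) hg hg0 hu huS h
    · have hιS : ι ∉ chain t i := notMem_chain (i := ι) hιr
      rw [hchain] at hg huS
      have hσ : ∀ x ∈ adjoinOver F t (chain t i), σ' x ∈ adjoinOver F t (chain t i) :=
        fun x hx => hE.map_mem_chain hsimple hx
      cases hι : t ι with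
      | root n x => exact absurd (by simp only [roots, Set.mem_ofPred_eq, hι]; trivial) hιr
      | pi τ =>
        obtain ⟨α, hαG, hαS, hα⟩ := hE.exists_quotient_of_pi hsimple hι
        obtain ⟨v, hv, hvS, m, hm⟩ := hE.exists_mul_pow_of_mem_productGroup hu huS
        rw [hι] at hm
        have hm' : (u : E) = v * ((τ ^ m : Eˣ) : E) := by rw [hm, Units.val_mul]; rfl
        have key : ∀ k, σ' (hE.coeff ι k g) * ((α ^ k : Eˣ) : E) = v * hE.coeff ι (k - m) g := by
          intro k
          rw [← hE.coeff_map_of_pi hι hιS hσ hα hαG hαS hg, h, hm',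
            hE.coeff_mul_zpow hι hιS hvS hg]
        obtain ⟨s, hs, hsum⟩ := hE.exists_sum_coeff ι g
        obtain ⟨k₀, hk₀⟩ : ∃ k, hE.coeff ι k g ≠ 0 := by
          by_contra! hall
          exact hg0 (hE.ext_coeff ι fun k => by rw [hall k, map_zero])
        have hiff : ∀ k, hE.coeff ι k g ≠ 0 ↔ hE.coeff ι (k - m) g ≠ 0 := by
          intro k
          rw [not_iff_not, ← Units.mul_right_eq_zero v (a := hE.coeff ι (k - m) g), ← key k]
          constructor
          · intro h
            rw [h, map_zero, zero_mul]
          · intro h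
            exact (map_eq_zero_iff _ σ'.injective).1 ((Units.mul_left_eq_zero _).1 h)
        -- Otherwise the finite set of exponents occurring in `g` would be stable under the shift by
        -- `m`.
        have hm0 : m = 0 := by
          by_contra hne
          have hall : ∀ n : ℕ, hE.coeff ι (k₀ - n * m) g ≠ 0 := by
            intro n
            induction n with
            | zero => simpa using hk₀
            | succ n ih =>
              have := (hiff _).1 ih
              rwa [show k₀ - n * m - m = k₀ - (n + 1 : ℕ) * m by push_cast; ring] at this
          have hmaps : Set.MapsTo (fun n : ℕ => k₀ - n * m) Set.univ (s : Set ℤ) := fun n _ =>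
            not_not.1 fun h' => hall n (hs _ h')
          have hinj : Set.InjOn (fun n : ℕ => k₀ - n * m) Set.univ := by
            intro a _ b _ hab
            simpa [hne] using hab
          exact Set.infinite_univ (Set.Finite.of_injOn hmaps hinj s.finite_toSet)
        subst hm0
        have key' : ∀ k, σ' (hE.coeff ι k g) = ((v * α ^ (-k) : Eˣ) : E) * hE.coeff ι k g := by
          intro k
          have h1 := key k
          rw [sub_zero] at h1
          have h2 : ((α ^ k : Eˣ) : E) * ((α ^ (-k) : Eˣ) : E) = 1 := by
            rw [← Units.val_mul, ← zpow_add, add_neg_cancel, zpow_zero, Units.val_one]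
          rw [Units.val_mul]
          linear_combination ((α ^ (-k) : Eˣ) : E) * h1 - σ' (hE.coeff ι k g) * h2
        have hsemi : ∀ k, hE.coeff ι k g ≠ 0 → IsSemimonomial F t (chain t i) (hE.coeff ι k g) := by
          intro k hk
          refine ih (by omega) (hE.coeff_mem_of_insert hιS hg k) hk
            (mul_mem hv (zpow_mem hαG (-k))) ?_ (key' k)
          rw [Units.val_mul]
          exact mul_mem hvS (hE.zpow_mem_of_mem_productGroup hαG hαS _)
        -- Two nonzero coefficients give two solutions, of exponents `k` and `k₀`, of the same
        -- homogeneous equation. One of them is invertible by induction, so they differ by a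
        -- constant factor, which is impossible for different exponents.
        have huniq : ∀ k, k ≠ k₀ → hE.coeff ι k g = 0 := by
          intro k hk
          by_contra hne
          obtain ⟨y', hy', hyy⟩ := (hsemi k₀ hk₀).exists_inv hE (roots_subset_chain t i)
          have hmap : ∀ k, σ' (hE.coeff ι k g * ((τ ^ k : Eˣ) : E)) =
              v * (hE.coeff ι k g * ((τ ^ k : Eˣ) : E)) := by
            intro k
            have h1 := key k
            rw [sub_zero] at h1
            rw [map_mul, map_zpow_of_map_eq hα]
            linear_combination ((τ ^ k : Eˣ) : E) * h1
          have hτ : ((τ ^ k₀ : Eˣ) : E) * ((τ ^ (-k₀) : Eˣ) : E) = 1 := by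
            rw [← Units.val_mul, ← zpow_add, add_neg_cancel, zpow_zero, Units.val_one]
          obtain ⟨κ, -, hκ⟩ := hE.eq_smul_of_map_eq v.isUnit (hmap k) (hmap k₀)
            (y' := y' * ((τ ^ (-k₀) : Eˣ) : E))
            (by linear_combination ((τ ^ k₀ : Eˣ) : E) * ((τ ^ (-k₀) : Eˣ) : E) * hyy + hτ)
          have hpow : ∀ k, ((τ ^ k : Eˣ) : E) = (t ι).pow k := fun k => by rw [hι]; rfl
          have := congrArg (hE.coeff ι k) hκ
          rw [map_smul, hpow, hpow, hE.coeff_mul_pow hιS (hE.coeff_mem_of_insert hιS hg k) _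
            (by rw [hι]; trivial), hE.coeff_mul_pow hιS (hE.coeff_mem_of_insert hιS hg k₀) _
            (by rw [hι]; trivial), if_pos rfl, if_neg hk, smul_zero] at this
          exact hne this
        have hg1 : g = hE.coeff ι k₀ g * ((τ ^ k₀ : Eˣ) : E) := by
          conv_lhs => rw [hsum]
          rw [Finset.sum_eq_single k₀]
          · rw [hι]
            rfl
          · intro k _ hk
            rw [huniq k hk, zero_mul]
          · intro hk
            rw [hs k₀ hk, zero_mul]
        obtain ⟨ρ, hρ, ρ', hρ', hρρ, b, hb, hbS, hgb⟩ := hsemi k₀ hk₀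
        refine ⟨ρ, hρ, ρ', hρ', hρρ, Function.update b ι k₀, fun j hj => ?_, fun j hj => ?_, ?_⟩
        · rw [Function.update_of_ne, hb j hj]
          rintro rfl
          rw [hι] at hj
          exact hj trivial
        · rw [hchain] at hj
          rw [Function.update_of_ne, hbS j fun h' => hj (Or.inr h')]
          rintro rfl
          exact hj (Or.inl rfl)
        · have hbι : b ι = 0 := hbS ι hιS
          have hfac : unitMonomial t (Function.update b ι k₀) = unitMonomial t b * τ ^ k₀ := by
            rw [unitMonomial, unitMonomial, ← Finset.mul_prod_erase _ _ (Finset.mem_univ ι),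
              ← Finset.mul_prod_erase _ (fun j => (t j).unitPart ^ b j) (Finset.mem_univ ι),
              Function.update_self, hbι, zpow_zero, one_mul, mul_comm, hι]
            congr 1
            refine Finset.prod_congr rfl fun j hj => ?_
            rw [Function.update_of_ne (Finset.ne_of_mem_erase hj)]
          rw [hfac, Units.val_mul, ← mul_assoc, ← hgb, ← hg1]
      | sigma s =>
        have hs : σ' s - s ∈ adjoinOver F t (chain t i) := by
          have h1 := hE.unimonomial ι
          rw [hι] at h1
          exact stage_le_chain t i h1.2
        -- Elements of the product group do not contain Σ-monomials.
        have huA : (u : E) ∈ adjoinOver F t (chain t i) := by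
          obtain ⟨v, hv, hvS, m, hm⟩ := hE.exists_mul_pow_of_mem_productGroup hu huS
          rw [hι] at hm
          simpa [hm, Generator.unitPart] using hvS
        obtain ⟨N, hN, hsum⟩ := hE.exists_sum_of_sigma hι g
        -- Descent on the degree: a nonzero leading coefficient of positive degree is a
        -- semi-constant of the ring below, hence invertible by induction, and
        -- `false_of_sigma_leading` applies.
        have hdeg : ∀ N : ℕ, (∀ k : ℤ, N < k → hE.coeff ι k g = 0) →
            ∀ k : ℤ, 0 < k → hE.coeff ι k g = 0 := by
          intro N
          induction N with
          | zero => exact fun h => h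
          | succ D ihD =>
            intro hD
            by_cases htop : hE.coeff ι (D + 1 : ℕ) g = 0
            · refine ihD fun k hk => ?_
              rcases lt_or_eq_of_le (show ((D + 1 : ℕ) : ℤ) ≤ k by push_cast; omega) with hlt | heq
              · exact hD k hlt
              · rw [← heq, htop]
            · have htopeq : σ' (hE.coeff ι (D + 1 : ℕ) g) = u * hE.coeff ι (D + 1 : ℕ) g := by
                have h1 := hE.coeff_map_of_sigma hι hιS hσ hs hg (D + 1) hD (D + 1)
                rw [h, hE.coeff_mul_left hιS huA hg, Finset.sum_range_succ, Finset.sum_eq_zero,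
                  zero_add] at h1
                · simpa using h1.symm
                · intro k hk
                  rw [Nat.choose_eq_zero_of_lt (by have := Finset.mem_range.1 hk; omega),
                    Nat.cast_zero, mul_zero, mul_zero]
              obtain ⟨w, hw, hgw⟩ := (ih (by omega) (hE.coeff_mem_of_insert hιS hg _) htop hu huA
                htopeq).exists_inv hE (roots_subset_chain t i)
              exact (hE.false_of_sigma_leading hι hιS hσ hs hg D hD hw hgw u.isUnit huA
                (by rw [h, sub_self, map_zero]) (by rw [h, sub_self, map_zero])).elim
        have hgA : g ∈ adjoinOver F t (chain t i) := by
          rw [hsum N le_rfl]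
          refine sum_mem fun k _ => ?_
          rcases Nat.eq_zero_or_pos k with rfl | hk
          · rw [pow_zero, mul_one]
            exact hE.coeff_mem_of_insert hιS hg _
          · rw [hdeg N hN k (by omega), zero_mul]
            exact zero_mem _
        obtain ⟨ρ, hρ, ρ', hρ', hρρ, b, hb, hbS, hgb⟩ := ih (by omega) hgA hg0 hu huA h
        refine ⟨ρ, hρ, ρ', hρ', hρρ, b, hb, fun j hj => hbS j fun h' => hj ?_, hgb⟩
        rw [hchain]
        exact Or.inr h'

theorem isSemimonomial_univ [CharZero F] (hsimple : IsSimpleOver (⊤ : Subgroup Fˣ) σ' t)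
    (hroot : RootsOfUnityConstant σ) {g : E} (hg0 : g ≠ 0) {u : Eˣ}
    (hu : u ∈ productGroup (⊤ : Subgroup Fˣ) t) (h : σ' g = u * g) :
    IsSemimonomial F t Set.univ g := by
  have htop : ∀ x : E, x ∈ adjoinOver F t (chain t e) := fun x => by
    rw [chain_top, hE.adjoinOver_univ]
    trivial
  rw [← chain_top t]
  exact hE.isSemimonomial_of_map_eq hsimple hroot e le_rfl (htop g) hg0 hu (htop _) h

/-- Every nonzero semi-constant is a unit by `isSemimonomial_univ`, so the semi-constants are
exactly the units `w` whose quotient of `σ' w` by `w` lies in the product group. -/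
theorem semiconstantsFormGroup [CharZero F] (hsimple : IsSimpleOver (⊤ : Subgroup Fˣ) σ' t)
    (hroot : RootsOfUnityConstant σ) :
    SemiconstantsFormGroup σ' (productGroup (⊤ : Subgroup Fˣ) t) := by
  have := hE.nontrivial
  refine ⟨{ carrier := {w | ∃ u ∈ productGroup (⊤ : Subgroup Fˣ) t,
              Units.map (σ' : E →* E) w = u * w}
            one_mem' := ⟨1, one_mem _, by simp⟩
            mul_mem' := ?_
            inv_mem' := ?_ }, ?_⟩
  · rintro a b ⟨u, hu, hua⟩ ⟨v, hv, hvb⟩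
    exact ⟨u * v, mul_mem hu hv, by rw [map_mul, hua, hvb, mul_mul_mul_comm]⟩
  · rintro a ⟨u, hu, hua⟩
    exact ⟨u⁻¹, inv_mem hu, by rw [map_inv, hua, mul_inv]⟩
  · ext g
    constructor
    · rintro ⟨⟨u, hu, hug⟩, hg0⟩
      obtain ⟨g', -, hg'⟩ := (hE.isSemimonomial_univ hsimple hroot hg0 hu hug).exists_inv hE
        (Set.subset_univ _)
      exact ⟨Units.mkOfMulEqOne _ _ hg', ⟨u, hu, Units.ext hug⟩, rfl⟩
    · rintro ⟨w, ⟨u, hu, huw⟩, rfl⟩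
      exact ⟨⟨u, hu, congrArg Units.val huw⟩, w.ne_zero⟩

end IsRPiSigmaExtension

end Semiconstants

-- Closure rules for computable functions

attribute [fun_prop] Computable

section FunProp

variable {α β γ δ : Type*} [Primcodable α] [Primcodable β] [Primcodable γ] [Primcodable δ]

@[fun_prop]
theorem computable_id : Computable fun a : α => a := Computable.id

@[fun_prop]
theorem computable_const (b : β) : Computable fun _ : α => b := Computable.const b

@[fun_prop]
theorem computable_comp {f : β → γ} {g : α → β} (hf : Computable f) (hg : Computable g) :
    Computable fun a => f (g a) := hf.comp hg

@[fun_prop]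
theorem computable_prodMk {f : α → β} {g : α → γ} (hf : Computable f) (hg : Computable g) :
    Computable fun a => (f a, g a) := hf.pair hg

@[fun_prop]
theorem computable_fst {f : α → β × γ} (hf : Computable f) : Computable fun a => (f a).1 :=
  Computable.fst.comp hf

@[fun_prop]
theorem computable_snd {f : α → β × γ} (hf : Computable f) : Computable fun a => (f a).2 :=
  Computable.snd.comp hf

@[fun_prop]
theorem computable_list_map {l : α → List β} {g : α → β → γ} (hl : Computable l)
    (hg : Computable fun x : α × β => g x.1 x.2) : Computable fun a => (l a).map (g a) :=
  Computable.list_map hl hg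

@[fun_prop]
theorem computable_list_flatMap {l : α → List β} {g : α → β → List γ} (hl : Computable l)
    (hg : Computable fun x : α × β => g x.1 x.2) : Computable fun a => (l a).flatMap (g a) :=
  Computable.list_flatMap hl hg

@[fun_prop]
theorem computable_list_append {l m : α → List β} (hl : Computable l) (hm : Computable m) :
    Computable fun a => l a ++ m a := Computable.list_append.comp hl hm

@[fun_prop]
theorem computable_list_cons {b : α → β} {l : α → List β} (hb : Computable b) (hl : Computable l) :
    Computable fun a => b a :: l a := Computable.list_cons.comp hb hl

@[fun_prop]
theorem computable_list_length {l : α → List β} (hl : Computable l) :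
    Computable fun a => (l a).length := Computable.list_length.comp hl

@[fun_prop]
theorem computable_list_tail {l : α → List β} (hl : Computable l) :
    Computable fun a => (l a).tail := Primrec.list_tail.to_comp.comp hl

@[fun_prop]
theorem computable_list_range {n : α → ℕ} (hn : Computable n) :
    Computable fun a => List.range (n a) := Primrec.list_range.to_comp.comp hn

@[fun_prop]
theorem computable_list_getD {l : α → List β} {n : α → ℕ} {b : α → β} (hl : Computable l)
    (hn : Computable n) (hb : Computable b) : Computable fun a => (l a).getD (n a) (b a) :=
  (Computable.option_getD (Computable.list_getElem?.comp hl hn) hb).of_eq fun _ => by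
    rw [List.getD_eq_getElem?_getD]

@[fun_prop]
theorem computable_list_headD {l : α → List β} {b : α → β} (hl : Computable l)
    (hb : Computable b) : Computable fun a => (l a).headD (b a) :=
  (computable_list_getD hl (computable_const 0) hb).of_eq fun a => by cases l a <;> rfl

@[fun_prop]
theorem computable_natCast {n : α → ℕ} (hn : Computable n) : Computable fun a => (n a : ℤ) :=
  computable_natCast_int.comp hn

@[fun_prop]
theorem computable_int_toNat {n : α → ℤ} (hn : Computable n) : Computable fun a => (n a).toNat :=
  computable_toNat.comp hn

theorem computable_ite {p : α → Prop} [DecidablePred p] {f g : α → β}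
    (hp : Computable fun a => decide (p a)) (hf : Computable f) (hg : Computable g) :
    Computable fun a => if p a then f a else g a :=
  (Computable.cond hp hf hg).of_eq fun a => by by_cases h : p a <;> simp [h]

@[fun_prop]
theorem computable_ite_eq {u v : α → γ} [∀ a, Decidable (u a = v a)] {f g : α → β}
    (hu : Computable u) (hv : Computable v) (hf : Computable f) (hg : Computable g) :
    Computable fun a => if u a = v a then f a else g a :=
  computable_ite (by classical exact (computable_decide_eq hu hv).of_eq fun a => by congr) hf hg

@[fun_prop]
theorem computable_decide_eq' [DecidableEq γ] {u v : α → γ}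
    (hu : Computable u) (hv : Computable v) : Computable fun a => decide (u a = v a) :=
  computable_decide_eq hu hv

@[fun_prop]
theorem computable_fin_app {n : ℕ} (i : Fin n) : Computable fun f : Fin n → β => f i :=
  (Primrec.fin_app.to_comp.comp Computable.id (Computable.const i)).of_eq fun _ => rfl

theorem Enumerable.forall_fin {n : ℕ} {p : Fin n → α → Prop} (h : ∀ i, Enumerable (p i)) :
    Enumerable fun a => ∀ i, p i a := by
  induction n with
  | zero => exact (Enumerable.const True).of_iff fun a => by simp
  | succ n ih =>
    exact ((h 0).and (ih fun i => h i.succ)).of_iff fun a => Fin.forall_fin_succ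

@[fun_prop]
theorem computable_fin_lam {n : ℕ} {f : α → Fin n → β} (h : ∀ i, Computable fun a => f a i) :
    Computable fun a i => f a i := by
  refine computable_of_graph ((Enumerable.forall_fin (p := fun i (x : α × (Fin n → β)) =>
    x.2 i = f x.1 i) fun i => Enumerable.eq (by fun_prop) ((h i).comp Computable.fst)).of_iff ?_)
  rintro ⟨a, g⟩
  exact funext_iff

end FunProp

/-! ### Computable algebraic operations -/

section Classes

/-- Addition is computable. -/
class ComputableAdd (A : Type*) [Primcodable A] [Add A] : Prop where
  add : Computable fun x : A × A => x.1 + x.2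

/-- Negation is computable. -/
class ComputableNeg (A : Type*) [Primcodable A] [Neg A] : Prop where
  neg : Computable fun x : A => -x

/-- Multiplication is computable. -/
class ComputableMul (A : Type*) [Primcodable A] [Mul A] : Prop where
  mul : Computable fun x : A × A => x.1 * x.2

/-- Inversion is computable. -/
class ComputableInv (A : Type*) [Primcodable A] [Inv A] : Prop where
  inv : Computable fun x : A => x⁻¹

/-- Scalar multiplication is computable. -/
class ComputableSMul (R A : Type*) [Primcodable R] [Primcodable A] [SMul R A] : Prop where
  smul : Computable fun x : R × A => x.1 • x.2

variable {α β γ : Type*} [Primcodable α] [Primcodable β] [Primcodable γ]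

@[fun_prop]
theorem computable_add [Add β] [ComputableAdd β] {f g : α → β} (hf : Computable f)
    (hg : Computable g) : Computable fun a => f a + g a := ComputableAdd.add.comp (hf.pair hg)

@[fun_prop]
theorem computable_neg [Neg β] [ComputableNeg β] {f : α → β} (hf : Computable f) :
    Computable fun a => -f a := ComputableNeg.neg.comp hf

@[fun_prop]
theorem computable_sub [AddGroup β] [ComputableAdd β] [ComputableNeg β] {f g : α → β}
    (hf : Computable f) (hg : Computable g) : Computable fun a => f a - g a := by
  simp only [sub_eq_add_neg]
  fun_prop

@[fun_prop]
theorem computable_mul [Mul β] [ComputableMul β] {f g : α → β} (hf : Computable f)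
    (hg : Computable g) : Computable fun a => f a * g a := ComputableMul.mul.comp (hf.pair hg)

@[fun_prop]
theorem computable_inv [Inv β] [ComputableInv β] {f : α → β} (hf : Computable f) :
    Computable fun a => (f a)⁻¹ := ComputableInv.inv.comp hf

@[fun_prop]
theorem computable_div [DivisionRing β] [ComputableMul β] [ComputableInv β] {f g : α → β}
    (hf : Computable f) (hg : Computable g) : Computable fun a => f a / g a := by
  simp only [div_eq_mul_inv]
  fun_prop

@[fun_prop]
theorem computable_smul [SMul γ β] [ComputableSMul γ β] {f : α → γ} {g : α → β}
    (hf : Computable f) (hg : Computable g) : Computable fun a => f a • g a :=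
  ComputableSMul.smul.comp (hf.pair hg)

@[fun_prop]
theorem computable_list_sum [AddCommMonoid β] [ComputableAdd β] {l : α → List β}
    (hl : Computable l) : Computable fun a => (l a).sum :=
  Computable.list_sum (ComputableAdd.add (A := β)) hl

theorem computable_fin_prod {ι : Type*} [CommMonoid β] [ComputableMul β] (s : Finset ι)
    {f : α → ι → β} (hf : ∀ i, Computable fun a => f a i) : Computable fun a => ∏ i ∈ s, f a i := by
  classical
  induction s using Finset.induction_on with
  | empty => simpa using Computable.const 1
  | insert i s hi ih =>
    simp only [Finset.prod_insert hi]
    have := hf i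
    fun_prop

theorem computable_fin_sum {ι : Type*} [AddCommMonoid β] [ComputableAdd β] (s : Finset ι)
    {f : α → ι → β} (hf : ∀ i, Computable fun a => f a i) : Computable fun a => ∑ i ∈ s, f a i := by
  classical
  induction s using Finset.induction_on with
  | empty => simpa using Computable.const 0
  | insert i s hi ih =>
    simp only [Finset.sum_insert hi]
    have := hf i
    fun_prop

theorem computable_pow [Monoid β] [ComputableMul β] {f : α → β} {n : α → ℕ} (hf : Computable f)
    (hn : Computable n) : Computable fun a => f a ^ n a := by
  refine (Computable.nat_rec (h := fun a p => p.2 * f a) hn (Computable.const 1) ?_).of_eq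
    fun a => ?_
  · show Computable fun x : α × ℕ × β => x.2.2 * f x.1
    fun_prop
  · induction n a with
    | zero => simp
    | succ k ih => simp only [pow_succ, ← ih]

attribute [fun_prop] computable_pow

instance [Add β] [Add γ] [ComputableAdd β] [ComputableAdd γ] : ComputableAdd (β × γ) :=
  ⟨by change Computable fun x : (β × γ) × (β × γ) => (x.1.1 + x.2.1, x.1.2 + x.2.2); fun_prop⟩

instance [Neg β] [Neg γ] [ComputableNeg β] [ComputableNeg γ] : ComputableNeg (β × γ) :=
  ⟨by change Computable fun x : β × γ => (-x.1, -x.2); fun_prop⟩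

instance [SMul α β] [SMul α γ] [ComputableSMul α β] [ComputableSMul α γ] :
    ComputableSMul α (β × γ) :=
  ⟨by change Computable fun x : α × β × γ => (x.1 • x.2.1, x.1 • x.2.2); fun_prop⟩

instance [Mul α] [ComputableMul α] : ComputableSMul α α := ⟨ComputableMul.mul⟩

instance : ComputableAdd ℤ := ⟨computable_int_add⟩
instance : ComputableNeg ℤ := ⟨computable_int_neg⟩
instance : ComputableMul ℤ := ⟨computable_int_mul⟩
instance : ComputableAdd ℕ := ⟨Primrec.nat_add.to_comp⟩

end Classes

/-! ### Coding finitely supported sequences by lists -/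

section Finsupp

variable {A : Type*} [Zero A]

/-- The finitely supported sequence with the given initial entries. -/
noncomputable def ofList (l : List A) : ℕ →₀ A :=
  Finsupp.onFinset (Finset.range l.length) (fun i => l.getD i 0) fun i hi => by
    by_contra h
    exact hi (List.getD_eq_default _ _ (by simpa using h))

@[simp]
theorem ofList_apply (l : List A) (i : ℕ) : ofList l i = l.getD i 0 := rfl

theorem ofList_surjective : Function.Surjective (ofList (A := A)) := by
  intro z
  refine ⟨(List.range (z.support.sup id + 1)).map z, Finsupp.ext fun i => ?_⟩
  rw [ofList_apply]
  by_cases h : i < z.support.sup id + 1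
  · rw [List.getD_eq_getElem _ _ (by simpa using h)]
    simp
  · rw [List.getD_eq_default _ _ (by simpa using h)]
    by_contra h'
    have := Finset.le_sup (f := id) (Finsupp.mem_support_iff.2 (Ne.symm h'))
    simp only [id] at this
    omega

theorem ofList_eq_iff {l m : List A} :
    ofList l = ofList m ↔ ∀ i < l.length + m.length, l.getD i 0 = m.getD i 0 := by
  constructor
  · intro h i _
    rw [← ofList_apply, ← ofList_apply, h]
  · intro h
    ext i
    rw [ofList_apply, ofList_apply]
    by_cases hi : i < l.length + m.length
    · exact h i hi
    · rw [List.getD_eq_default _ _ (by omega), List.getD_eq_default _ _ (by omega)]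

/-- Lists name sequences up to trailing zeros, and equality of names is decided on finitely many
entries. These sequences serve as a vector space for tags when the number of unknowns is part of the
input. -/
theorem exists_primcodable_finsupp [Nontrivial A] [Primcodable A] :
    ∃ _ : Primcodable (ℕ →₀ A), Computable (ofList (A := A)) ∧
      ∃ s : (ℕ →₀ A) → List A, Computable s ∧ ∀ z, ofList (s z) = z := by
  classical
  have : Infinite (ℕ →₀ A) := by
    obtain ⟨a, ha⟩ := exists_ne (0 : A)
    exact Infinite.of_injective (fun i : ℕ => Finsupp.single i a) fun i j h =>
      (Finsupp.single_left_inj ha).1 h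
  refine exists_primcodable_of_surjective ofList_surjective ?_
  simp only [ofList_eq_iff]
  refine ((computable_ball_lt (α := List A × List A)
    (g := fun x => decide (x.1.1.getD x.2 0 = x.1.2.getD x.2 0)) (by fun_prop)).comp
    (Computable.pair Computable.id
      (show Computable fun x : List A × List A => x.1.length + x.2.length by fun_prop))).of_eq ?_
  intro x
  simp

variable [Nontrivial A] [Primcodable A]

noncomputable instance : Primcodable (ℕ →₀ A) := exists_primcodable_finsupp.choose

/-- A list of the entries of a finitely supported sequence, up to trailing zeros. -/
noncomputable def toList : (ℕ →₀ A) → List A :=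
  (exists_primcodable_finsupp (A := A)).choose_spec.2.choose

@[simp]
theorem ofList_toList (z : ℕ →₀ A) : ofList (toList z) = z :=
  (exists_primcodable_finsupp (A := A)).choose_spec.2.choose_spec.2 z

theorem computable_ofList : Computable (ofList (A := A)) :=
  (exists_primcodable_finsupp (A := A)).choose_spec.1

theorem computable_toList : Computable (toList (A := A)) :=
  (exists_primcodable_finsupp (A := A)).choose_spec.2.choose_spec.1

variable {α : Type*} [Primcodable α]

attribute [fun_prop] computable_ofList computable_toList

theorem toList_getD (z : ℕ →₀ A) (i : ℕ) : (toList z).getD i 0 = z i := by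
  rw [← ofList_apply, ofList_toList]

@[fun_prop]
theorem computable_finsupp_apply {z : α → ℕ →₀ A} {i : α → ℕ} (hz : Computable z)
    (hi : Computable i) : Computable fun a => z a (i a) := by
  simp only [← toList_getD]
  fun_prop

omit [Nontrivial A] [Primcodable A] in
theorem ofList_range {n : ℕ} {f : ℕ → A} {z : ℕ →₀ A} (h : ∀ i < n, f i = z i)
    (h' : ∀ i, n ≤ i → z i = 0) : ofList ((List.range n).map f) = z := by
  ext i
  rw [ofList_apply]
  by_cases hi : i < n
  · rw [List.getD_eq_getElem _ _ (by simpa using hi)]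
    simp [h i hi]
  · rw [List.getD_eq_default _ _ (by simpa using hi), h' i (by omega)]

theorem apply_eq_zero_of_length_le {z : ℕ →₀ A} {i : ℕ} (h : (toList z).length ≤ i) : z i = 0 := by
  rw [← toList_getD, List.getD_eq_default _ _ h]

@[fun_prop]
theorem computable_finsupp_single {i : α → ℕ} {b : α → A} (hi : Computable i)
    (hb : Computable b) : Computable fun a => Finsupp.single (i a) (b a) := by
  have h : Computable fun a => ofList ((List.range (i a + 1)).map
      fun j => if j = i a then b a else 0) := by fun_prop
  refine h.of_eq fun a => ofList_range (fun j _ => ?_) fun j hj => ?_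
  · simp only [Finsupp.single_apply, eq_comm]
  · rw [Finsupp.single_apply, if_neg (by omega)]

end Finsupp

/-! ### Computable operations on finitely supported sequences -/

section Finsupp

variable {A : Type*} [Nontrivial A] [Primcodable A]

instance [AddZeroClass A] [ComputableAdd A] : ComputableAdd (ℕ →₀ A) := ⟨by
  have h : Computable fun x : (ℕ →₀ A) × (ℕ →₀ A) => ofList ((List.range
    ((toList x.1).length + (toList x.2).length)).map fun i => x.1 i + x.2 i) := by fun_prop
  refine h.of_eq fun x => ofList_range (fun i _ => rfl) fun i hi => ?_
  rw [Finsupp.add_apply, apply_eq_zero_of_length_le (by omega),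
    apply_eq_zero_of_length_le (by omega), add_zero]⟩

instance [AddCommGroup A] [ComputableNeg A] : ComputableNeg (ℕ →₀ A) := ⟨by
  have h : Computable fun x : ℕ →₀ A => ofList ((List.range
    (toList x).length).map fun i => -x i) := by fun_prop
  refine h.of_eq fun x => ofList_range (fun i _ => rfl) fun i hi => ?_
  rw [Finsupp.neg_apply, apply_eq_zero_of_length_le hi, neg_zero]⟩

instance {R : Type*} [Primcodable R] [Zero A] [SMulZeroClass R A] [ComputableSMul R A] :
    ComputableSMul R (ℕ →₀ A) := ⟨by
  have h : Computable fun x : R × (ℕ →₀ A) => ofList ((List.range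
    (toList x.2).length).map fun i => x.1 • x.2 i) := by fun_prop
  refine h.of_eq fun x => ofList_range (fun i _ => rfl) fun i hi => ?_
  rw [Finsupp.smul_apply, apply_eq_zero_of_length_le hi, smul_zero]⟩

end Finsupp

section Solvability

variable {α β γ : Type*} [Primcodable α] [Primcodable β] [Primcodable γ]

theorem Solves.map {D : α → Prop} {P : α → β → Prop} (h : Solves D P) {f : α → β → γ}
    (hf : Computable fun x : α × β => f x.1 x.2) :
    Solves D fun a c => ∃ b, P a b ∧ c = f a b := by
  have h2 : Solves (fun _ : α × β => True) fun x c => c = f x.1 x.2 :=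
    Solves.of_computable (f := fun x : α × β => f x.1 x.2) hf fun _ _ => rfl
  exact (h.bind h2 fun _ _ _ _ => trivial)

end Solvability

/-! ### Spans over the field of constants -/

section Span

variable {F : Type*} [Field F] (σ : F ≃+* F)

/-- The span of the entries of a list over the field of constants. -/
def listSpan {Z : Type*} [AddCommGroup Z] [Module F Z] (L : List Z) : Submodule (constants σ) Z :=
  Submodule.span (constants σ) {z | z ∈ L}

variable {Z Y : Type*} [AddCommGroup Z] [Module F Z] [AddCommGroup Y] [Module F Y]

@[simp]
theorem listSpan_nil : listSpan σ ([] : List Z) = ⊥ := by simp [listSpan]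

variable {σ}

theorem mem_listSpan_of_mem {L : List Z} {z : Z} (h : z ∈ L) : z ∈ listSpan σ L :=
  Submodule.subset_span h

theorem listSpan_map (f : Z →ₗ[constants σ] Y) (L : List Z) :
    listSpan σ (L.map f) = (listSpan σ L).map f := by
  rw [listSpan, listSpan, Submodule.map_span]
  congr 1
  ext y
  simp

variable (σ) in
/-- `f` is linear over the field of constants. -/
structure IsConstLinear (f : Z → Y) : Prop where
  add : ∀ x y, f (x + y) = f x + f y
  smul : ∀ c : F, σ c = c → ∀ x, f (c • x) = c • f x

/-- A map that is linear over the constants as a linear map. -/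
def IsConstLinear.toLinearMap {f : Z → Y} (hf : IsConstLinear σ f) : Z →ₗ[constants σ] Y where
  toFun := f
  map_add' := hf.add
  map_smul' c := hf.smul c c.2

theorem _root_.LinearMap.isConstLinear (f : Z →ₗ[F] Y) : IsConstLinear σ f :=
  ⟨map_add f, fun c _ => map_smul f c⟩

theorem mem_listSpan_map {f : Z → Y} (hf : IsConstLinear σ f) {L : List Z}
    {y : Y} : y ∈ listSpan σ (L.map f) ↔ ∃ z ∈ listSpan σ L, f z = y := by
  rw [show f = hf.toLinearMap from rfl, listSpan_map, Submodule.mem_map]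

/-- The graph of a linear map over a list. -/
theorem mem_listSpan_graph {f : Z → Y} (hf : IsConstLinear σ f) {L : List Z} {z : Z} {y : Y} :
    (z, y) ∈ listSpan σ (L.map fun z => (z, f z)) ↔ z ∈ listSpan σ L ∧ f z = y := by
  rw [mem_listSpan_map (f := fun z => (z, f z)) ⟨fun x y => by simp [hf.add],
    fun c hc x => by simp [hf.smul c hc]⟩]
  constructor
  · rintro ⟨w, hw, h⟩
    rw [Prod.mk.injEq] at h
    obtain ⟨rfl, rfl⟩ := h
    exact ⟨hw, rfl⟩
  · rintro ⟨h1, h2⟩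
    exact ⟨z, h1, by rw [h2]⟩

theorem mem_listSpan_cons {L : List Z} {x z : Z} :
    x ∈ listSpan σ (z :: L) ↔ ∃ c ∈ constants σ, ∃ y ∈ listSpan σ L, x = c • z + y := by
  have : {y | y ∈ z :: L} = insert z {y | y ∈ L} := by
    ext
    simp
  rw [listSpan, this, Submodule.mem_span_insert]
  constructor
  · rintro ⟨c, y, hy, rfl⟩
    exact ⟨c.1, c.2, y, hy, rfl⟩
  · rintro ⟨c, hc, y, hy, rfl⟩
    exact ⟨⟨c, hc⟩, y, hy, rfl⟩

theorem listSpan_le {L : List Z} {p : Submodule (constants σ) Z} :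
    listSpan σ L ≤ p ↔ ∀ z ∈ L, z ∈ p := Submodule.span_le

theorem mem_listSpan_iff {L : List Z} {z : Z} : z ∈ listSpan σ L ↔
    ∃ cs : List F, List.Forall₂ (fun c _ => σ c = c) cs L ∧
      z = (List.zipWith (fun c y => c • y) cs L).sum := by
  induction L generalizing z with
  | nil => simp
  | cons y L ih =>
    rw [mem_listSpan_cons]
    constructor
    · rintro ⟨c, hc, x, hx, rfl⟩
      obtain ⟨cs, h1, rfl⟩ := ih.1 hx
      exact ⟨c :: cs, .cons hc h1, by simp⟩
    · rintro ⟨cs, h1, rfl⟩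
      cases h1 with
      | @cons c _ cs _ h h1 => exact ⟨c, h, _, ih.2 ⟨cs, h1, rfl⟩, by simp⟩

theorem isField_constants : IsField (constants σ) where
  exists_pair_ne := ⟨0, 1, fun h => zero_ne_one (congrArg Subtype.val h : (0 : F) = 1)⟩
  mul_comm := mul_comm
  mul_inv_cancel := by
    rintro ⟨a, ha⟩ h
    have ha0 : a ≠ 0 := fun h' => h (Subtype.ext h')
    exact ⟨⟨a⁻¹, by rw [constants] at ha ⊢; exact (map_inv₀ σ a).trans (congrArg _ ha)⟩,
      Subtype.ext (mul_inv_cancel₀ ha0)⟩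

theorem exists_sublist_linearIndependent (L : List Z) : ∃ B : List Z, listSpan σ B = listSpan σ L ∧
    LinearIndependent (constants σ) fun i : Fin B.length => B.get i := by
  let _ : Field (constants σ) := isField_constants.toField
  obtain ⟨b, hb, hspan, hind⟩ := exists_linearIndependent (constants σ) {z | z ∈ L}
  have hfin : b.Finite := (List.finite_toSet L).subset hb
  have hset : {z | z ∈ hfin.toFinset.toList} = b := by
    ext z
    simp
  refine ⟨hfin.toFinset.toList, ?_, ?_⟩
  · rw [listSpan, hset, hspan]
    rfl
  · let f : Fin hfin.toFinset.toList.length → b := fun i =>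
      ⟨hfin.toFinset.toList.get i, (Set.ext_iff.1 hset _).1 (List.get_mem _ _)⟩
    have hf : Function.Injective f := fun i j h =>
      (List.nodup_iff_injective_get.1 (Finset.nodup_toList _)) (congrArg Subtype.val h)
    exact hind.comp f hf

end Span

/-! ### Computability of pairing two lists -/

section Zip

variable {α β γ δ : Type*} [Primcodable α] [Primcodable β] [Primcodable γ] [Primcodable δ]

@[fun_prop]
theorem computable_zipWith {l : α → List β} {m : α → List γ} {g : α → β → γ → δ}
    (hl : Computable l) (hm : Computable m) (hg : Computable fun x : α × β × γ => g x.1 x.2.1 x.2.2) :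
    Computable fun a => List.zipWith (g a) (l a) (m a) := by
  have h : Computable fun a => (List.range (l a).length).flatMap fun i =>
      Option.casesOn (motive := fun _ => List δ) ((l a)[i]?) [] fun b =>
        Option.casesOn (motive := fun _ => List δ) ((m a)[i]?) [] fun c => [g a b c] := by
    refine Computable.list_flatMap (by fun_prop) ?_
    refine Computable.option_casesOn (o := fun x : α × ℕ => (l x.1)[x.2]?)
      (g := fun x b => Option.casesOn (motive := fun _ => List δ) ((m x.1)[x.2]?) [] fun c => [g x.1 b c])
      (Computable.list_getElem?.comp (by fun_prop) (by fun_prop)) (Computable.const []) ?_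
    refine Computable.option_casesOn (o := fun x : (α × ℕ) × β => (m x.1.1)[x.1.2]?)
      (g := fun x c => [g x.1.1 x.2 c])
      (Computable.list_getElem?.comp (by fun_prop) (by fun_prop)) (Computable.const []) ?_
    have : Computable fun x : ((α × ℕ) × β) × γ => [g x.1.1.1 x.1.2 x.2] :=
      computable_list_cons (hg.comp (f := fun x : α × β × γ => g x.1 x.2.1 x.2.2)
        (g := fun x : ((α × ℕ) × β) × γ => (x.1.1.1, x.1.2, x.2)) (by fun_prop))
        (Computable.const [])
    exact this
  refine h.of_eq fun a => ?_
  generalize l a = l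
  generalize m a = m
  induction l generalizing m with
  | nil => simp
  | cons b l ih =>
    cases m with
    | nil =>
      simp only [List.zipWith_nil_right, List.flatMap_eq_nil_iff]
      intro i _
      cases (b :: l)[i]? <;> rfl
    | cons c m =>
      rw [List.zipWith_cons_cons, ← ih, List.length_cons, List.range_succ_eq_map,
        List.flatMap_cons, List.flatMap_map]
      simp

end Zip

/-! ### Linear algebra over the constants -/

section Null

variable {F : Type*} [Field F] [Primcodable F] {σ : F ≃+* F}

theorem enumerable_mem_listSpan [ComputableAdd F] (hσ : Computable σ) {α Z : Type*} [Primcodable α]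
    [AddCommGroup Z] [Module F Z] [Primcodable Z] [ComputableAdd Z] [ComputableSMul F Z]
    {z : α → Z} {L : α → List Z} (hz : Computable z) (hL : Computable L) :
    Enumerable fun a => z a ∈ listSpan σ (L a) := by
  simp only [mem_listSpan_iff]
  refine Enumerable.exists (p := fun a (cs : List F) =>
    List.Forall₂ (fun c _ => σ c = c) cs (L a) ∧
      z a = (List.zipWith (fun c y => c • y) cs (L a)).sum) ?_
  refine Enumerable.and ?_ (Enumerable.eq (by fun_prop) (by fun_prop))
  exact Enumerable.forall₂ (R := fun _ c _ => σ c = c) (Enumerable.eq (by fun_prop) (by fun_prop))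
    (by fun_prop) (by fun_prop)

universe v w

/-- Generators of the space of all `z` with `(z, 0)` in the span of a given list can be
computed. -/
def NullSolvable (σ : F ≃+* F) (Y : Type w) [AddCommGroup Y] [Module F Y] [Primcodable Y] : Prop :=
  ∀ (Z : Type v) [AddCommGroup Z] [Module F Z] [Primcodable Z] [ComputableAdd Z] [ComputableNeg Z]
    [ComputableSMul F Z], Solves (fun _ : List (Z × Y) => True)
      fun L N => ∀ z, z ∈ listSpan σ N ↔ (z, (0 : Y)) ∈ listSpan σ L

/-- Elimination over the constants for vectors with entries in the larger field `F`. Given a pivot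
`(z₀, a)` with `a ≠ 0`, a combination `q` of the other entries can be completed to one with value
`0` exactly when `q.2 / a` is a constant, that is, when `σ (q.2 / a) - q.2 / a` vanishes. This is a
problem of the same kind for a list that is shorter by one. -/
theorem nullSolvable_self [ComputableAdd F] [ComputableNeg F] [ComputableMul F] [ComputableInv F]
    (hσ : Computable σ) : NullSolvable.{v} σ F := by
  intro Z _ _ _ _ _ _
  classical
  -- One step on a pair of finished tags and remaining entries. An entry of value `0` is finished at
  -- once; otherwise it is the pivot and is subtracted from the tags of the others.
  have hf : Computable fun s : List Z × List (Z × F) => if (s.2.headD 0).2 = 0 then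
    ((s.2.headD 0).1 :: s.1, s.2.tail) else
    (s.1, s.2.tail.map fun q => (q.1 - (q.2 / (s.2.headD 0).2) • (s.2.headD 0).1,
      σ (q.2 / (s.2.headD 0).2) - q.2 / (s.2.headD 0).2)) := by fun_prop
  -- Preserved in every step: the space of all `z` that split into a combination of finished tags
  -- and a tag reachable with value `0` from the remaining list.
  let Rel : List Z × List (Z × F) → List Z × List (Z × F) → Prop := fun s s' =>
    ∀ z, (∃ d ∈ listSpan σ s'.1, (z - d, (0 : F)) ∈ listSpan σ s'.2) ↔
      ∃ d ∈ listSpan σ s.1, (z - d, (0 : F)) ∈ listSpan σ s.2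
  have hstep : Solves (fun s : List Z × List (Z × F) => True ∧ ¬ s.2 = []) fun s s' => True ∧
      s'.2.length < s.2.length ∧ Rel s s' := by
    refine Solves.of_computable hf ?_
    rintro ⟨done, L⟩ ⟨-, hL⟩
    obtain ⟨⟨z₀, a⟩, L, rfl⟩ := List.exists_cons_of_ne_nil hL
    simp only [List.headD_cons, List.tail_cons, List.length_cons, true_and, Rel]
    by_cases ha : a = 0
    · subst ha
      simp only [↓reduceIte]
      refine ⟨by simp, fun z => ⟨?_, ?_⟩⟩
      · rintro ⟨d, hd, h⟩
        obtain ⟨c, hc, d', hd', rfl⟩ := mem_listSpan_cons.1 hd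
        have h3 : (z - d', (0 : F)) = c • (z₀, (0 : F)) + (z - (c • z₀ + d'), (0 : F)) := by
          ext
          · simp only [Prod.fst_add, Prod.smul_fst]
            abel
          · simp
        refine ⟨d', hd', ?_⟩
        rw [mem_listSpan_cons]
        exact ⟨c, hc, _, h, h3⟩
      · rintro ⟨d, hd, h⟩
        obtain ⟨c, hc, y, hy, h⟩ := mem_listSpan_cons.1 h
        refine ⟨c • z₀ + d, mem_listSpan_cons.2 ⟨c, hc, d, hd, rfl⟩, ?_⟩
        convert hy using 1
        obtain ⟨y1, y2⟩ := y
        simp only [Prod.smul_mk, smul_zero, Prod.mk_add_mk, zero_add, Prod.mk.injEq] at h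
        rw [Prod.mk.injEq]
        exact ⟨by rw [sub_add_eq_sub_sub_swap, h.1]; simp, h.2⟩
    · simp only [ha, ↓reduceIte]
      refine ⟨by simp, fun z => exists_congr fun d => and_congr_right fun _ => ?_⟩
      generalize z - d = z
      have hψ : IsConstLinear σ fun q : Z × F => (q.1 - (q.2 / a) • z₀, σ (q.2 / a) - q.2 / a) := by
        refine ⟨fun q r => ?_, fun c hc q => ?_⟩
        · ext
          · simp only [Prod.fst_add, Prod.snd_add, add_div, add_smul]
            abel
          · simp only [Prod.snd_add, add_div, map_add]
            abel
        · ext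
          · simp only [Prod.smul_fst, Prod.smul_snd, smul_sub, smul_smul, smul_eq_mul, mul_div_assoc]
          · simp only [Prod.smul_snd, smul_eq_mul, mul_div_assoc, map_mul, hc, mul_sub]
      rw [mem_listSpan_map hψ, mem_listSpan_cons]
      constructor
      · rintro ⟨q, hq, h⟩
        obtain ⟨h1, h2⟩ := Prod.mk.inj h
        refine ⟨-(q.2 / a), neg_mem (sub_eq_zero.1 h2), q, hq, ?_⟩
        ext
        · simp only [Prod.fst_add, neg_smul, Prod.fst_neg, Prod.smul_fst, ← h1]
          abel
        · simp [ha]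
      · rintro ⟨c, hc, q, hq, h⟩
        refine ⟨q, hq, ?_⟩
        have h1 := congrArg Prod.fst h
        have h2 := congrArg Prod.snd h
        simp only [Prod.fst_add, Prod.smul_fst, Prod.snd_add, Prod.smul_snd, smul_eq_mul] at h1 h2
        have h3 : q.2 / a = -c := by
          field_simp
          linear_combination -h2
        have hc' : σ c = c := hc
        ext
        · simp only [h3, h1, neg_smul]
          abel
        · simp only [h3, map_neg, hc']
          ring
  have hloop := Solves.iterate (Inv := fun _ : List Z × List (Z × F) => True)
    (done := fun s => s.2 = []) (Rel := Rel) (fun s => s.2.length)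
    (Enumerable.eq (by fun_prop) (by fun_prop)) (Enumerable.ne (by fun_prop) (by fun_prop)) hstep
    (fun s z => Iff.rfl) (fun a b c h1 h2 z => (h2 z).trans (h1 z))
  refine ((hloop.comp (g := fun L : List (Z × F) => (([] : List Z), L)) (by fun_prop)).map
    (f := fun _ s => s.1) (by fun_prop)).mono (fun _ _ => trivial) ?_
  rintro L _ - ⟨s, ⟨-, hs, hrel⟩, rfl⟩ z
  have := hrel z
  simp only [hs, listSpan_nil, Submodule.mem_bot, exists_eq_left, sub_zero, Prod.mk_eq_zero, and_true,
    sub_eq_zero, exists_eq_right'] at this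
  exact this

/-- The coordinates are forced to vanish one after the other, with the pair of tag and vector as the
new tag. Only coordinates in the supports of the given vectors matter. -/
theorem NullSolvable.of_coordinates {Y : Type v} {Y' : Type w} {ι : Type*} [AddCommGroup Y]
    [Module F Y] [Primcodable Y] [ComputableAdd Y] [ComputableNeg Y] [ComputableSMul F Y]
    [AddCommGroup Y'] [Module F Y'] [Primcodable Y'] [Primcodable ι] [Inhabited ι]
    (h : NullSolvable.{v} σ Y') (c : ι → Y →ₗ[F] Y') (hc : Computable fun x : ι × Y => c x.1 x.2)
    (supp : Y → List ι) (hsupp : Computable supp) (hmem : ∀ y, ∀ i ∉ supp y, c i y = 0)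
    (hsep : ∀ y, (∀ i, c i y = 0) → y = 0) : NullSolvable.{v} σ Y := by
  intro Z _ _ _ _ _ _
  let Inv : List ι × List (Z × Y) → Prop := fun s => ∀ p ∈ listSpan σ s.2, ∀ i ∉ s.1, c i p.2 = 0
  let Rel : List ι × List (Z × Y) → List ι × List (Z × Y) → Prop := fun s s' =>
    ∀ z, (z, (0 : Y)) ∈ listSpan σ s'.2 ↔ (z, (0 : Y)) ∈ listSpan σ s.2
  have hg : Computable fun s : List ι × List (Z × Y) =>
      s.2.map fun p => (p, c (s.1.headD default) p.2) := by
    refine computable_list_map (by fun_prop) ?_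
    refine Computable.pair (by fun_prop) ?_
    exact Computable.comp hc (show Computable fun x : (List ι × List (Z × Y)) × (Z × Y) =>
      (x.1.1.headD default, x.2.2) by fun_prop)
  have hstep : Solves (fun s => Inv s ∧ ¬ s.1 = []) fun s s' => Inv s' ∧
      s'.1.length < s.1.length ∧ Rel s s' := by
    refine (((h (Z × Y)).comp hg).map (f := fun s N => (s.1.tail, N)) (by fun_prop)).mono
      (fun _ _ => trivial) ?_
    rintro ⟨is, L⟩ _ ⟨hinv, his⟩ ⟨N, hN, rfl⟩
    obtain ⟨i, is, rfl⟩ := List.exists_cons_of_ne_nil his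
    simp only [List.headD_cons, List.tail_cons, List.length_cons] at hN ⊢
    have hN' : ∀ p, p ∈ listSpan σ N ↔ p ∈ listSpan σ L ∧ c i p.2 = 0 := fun p => by
      rw [hN, mem_listSpan_graph (f := fun p : Z × Y => c i p.2)
        ((c i).comp (LinearMap.snd F Z Y)).isConstLinear]
    refine ⟨fun p hp j hj => ?_, by simp, fun z => ?_⟩
    · obtain ⟨h1, h2⟩ := (hN' p).1 hp
      by_cases hij : j = i
      · rw [hij, h2]
      · exact hinv p h1 j (by simpa [hij] using hj)
    · rw [hN' (z, 0)]
      simp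
  have hloop := Solves.iterate (Inv := Inv)
    (done := fun s => s.1 = []) (Rel := Rel) (fun s => s.1.length)
    (Enumerable.eq (by fun_prop) (by fun_prop)) (Enumerable.ne (by fun_prop) (by fun_prop)) hstep
    (fun s z => Iff.rfl) (fun a b c h1 h2 z => (h2 z).trans (h1 z))
  refine ((hloop.comp (g := fun L : List (Z × Y) => (L.flatMap fun p => supp p.2, L))
    (by fun_prop)).map (f := fun _ s => s.2.map Prod.fst) (by fun_prop)).mono (fun L _ => ?_) ?_
  -- A coordinate outside all supports vanishes on the generators and hence on their span.
  · intro p hp i hi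
    have hle : listSpan σ L ≤ LinearMap.ker
        (((c i).restrictScalars (constants σ)).comp (LinearMap.snd (constants σ) Z Y)) :=
      listSpan_le.2 fun q hq => hmem _ _ fun h' => hi (List.mem_flatMap.2 ⟨q, hq, h'⟩)
    exact hle hp
  · rintro L _ - ⟨s, ⟨hinv, hs, hrel⟩, rfl⟩ z
    rw [← hrel z, mem_listSpan_map (f := Prod.fst) (LinearMap.fst F Z Y).isConstLinear]
    constructor
    · rintro ⟨p, hp, rfl⟩
      have : p.2 = 0 := hsep _ fun i => hinv p hp i (by rw [hs]; exact List.not_mem_nil)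
      rwa [← this]
    · exact fun h => ⟨_, h, rfl⟩

theorem NullSolvable.prod {Y Y' : Type v} [AddCommGroup Y] [Module F Y] [Primcodable Y]
    [AddCommGroup Y'] [Module F Y'] [Primcodable Y'] [ComputableAdd Y'] [ComputableNeg Y']
    [ComputableSMul F Y'] (h : NullSolvable.{v} σ Y) (h' : NullSolvable.{v} σ Y') :
    NullSolvable.{v} σ (Y × Y') := by
  intro Z _ _ _ _ _ _
  refine (((h (Z × Y')).comp (g := fun L : List (Z × Y × Y') => L.map fun p =>
    ((p.1, p.2.2), p.2.1)) (by fun_prop)).bind (Solves.comp (h' Z)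
    (g := fun x : List (Z × Y × Y') × List (Z × Y') => x.2) (by fun_prop))
      fun _ _ _ _ => trivial).mono (fun _ _ => trivial) ?_
  rintro L N - ⟨M, h1, h2⟩ z
  rw [h2, h1, mem_listSpan_map (f := fun p : Z × Y × Y' => ((p.1, p.2.2), p.2.1))
    ⟨fun _ _ => rfl, fun _ _ _ => rfl⟩]
  constructor
  · rintro ⟨⟨z', y, y'⟩, hp, h⟩
    simp only [Prod.mk.injEq] at h
    obtain ⟨⟨rfl, rfl⟩, rfl⟩ := h
    exact hp
  · exact fun h => ⟨_, h, rfl⟩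

/-- A basis of the span of a given list can be computed. -/
theorem NullSolvable.solves_basis [ComputableAdd F] (hσ : Computable σ) {Y : Type v}
    [AddCommGroup Y] [Module F Y] [Primcodable Y] [ComputableAdd Y] [ComputableSMul F Y] [ComputableNeg Y] [Nontrivial Y]
    (h : NullSolvable.{v} σ Y) {Z : Type v} [AddCommGroup Z] [Module F Z] [Nontrivial Z] [Primcodable Z]
    [ComputableAdd Z] [ComputableNeg Z] [ComputableSMul F Z] : Solves (fun _ : List Y => True)
      fun L B => listSpan σ B = listSpan σ L ∧
        LinearIndependent (constants σ) fun i : Fin B.length => B.get i := by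
  obtain ⟨y₀, hy₀⟩ := exists_ne (0 : Z)
  obtain ⟨R, hR, hR1, hR2⟩ := h (ℕ →₀ Z)
  -- Tagging the `i`-th vector with the sequence supported at `i` makes the null space the space of
  -- linear relations. Independence is thereby certified by an output of the null solver that
  -- consists of zeros.
  have hlin : ∀ (B : List Y) (N : List (ℕ →₀ Z)), R ((List.range B.length).map fun i =>
      (Finsupp.single i y₀, B.getD i 0)) N →
      ((∀ z ∈ N, z = 0) ↔ LinearIndependent (constants σ) fun i : Fin B.length => B.get i) := by
    intro B N hN
    have hN := hR2 _ trivial _ hN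
    let φ : (Fin B.length → constants σ) →ₗ[constants σ] (ℕ →₀ Z) × Y :=
      Fintype.linearCombination (constants σ) fun i =>
        (Finsupp.single (i : ℕ) y₀, B.get i)
    have hφ : ∀ a : Fin B.length → constants σ, φ a =
        (∑ i : Fin B.length, Finsupp.single (i : ℕ) ((a i : F) • y₀), ∑ i, a i • B.get i) := by
      intro a
      simp only [φ, Fintype.linearCombination_apply, Prod.smul_mk, Finsupp.smul_single]
      rw [Prod.ext_iff, Prod.fst_sum, Prod.snd_sum]
      exact ⟨rfl, rfl⟩
    have hspan : listSpan σ ((List.range B.length).map fun i =>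
        (Finsupp.single i y₀, B.getD i 0)) = LinearMap.range φ := by
      rw [Fintype.range_linearCombination, listSpan]
      congr 1
      ext p
      simp only [List.mem_map, List.mem_range, Set.mem_ofPred_eq, Set.mem_range]
      constructor
      · rintro ⟨i, hi, rfl⟩
        exact ⟨⟨i, hi⟩, by simp [hi]⟩
      · rintro ⟨i, rfl⟩
        exact ⟨i, i.2, by simp⟩
    have hcoord : ∀ (a : Fin B.length → constants σ) (j : Fin B.length),
        (∑ i : Fin B.length, Finsupp.single (i : ℕ) ((a i : F) • y₀)) (j : ℕ) = (a j : F) • y₀ := by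
      intro a j
      rw [Finsupp.finsetSum_apply, Finset.sum_eq_single j]
      · simp
      · intro i _ hij
        rw [Finsupp.single_apply, if_neg fun h => hij (Fin.ext h)]
      · simp
    rw [Fintype.linearIndependent_iff]
    have hker : (∀ z ∈ N, z = 0) ↔ ∀ z, (z, (0 : Y)) ∈ LinearMap.range φ → z = 0 := by
      constructor
      · intro h0 z hz
        have hle : listSpan σ N ≤ ⊥ := listSpan_le.2 fun z hz => by simp [h0 z hz]
        exact (Submodule.mem_bot _).1 (hle ((hN z).2 (by rw [hspan]; exact hz)))
      · intro h0 z hz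
        exact h0 z (by rw [← hspan]; exact (hN z).1 (mem_listSpan_of_mem hz))
    rw [hker]
    constructor
    · intro h0 a ha j
      have := h0 _ ⟨a, (hφ a).trans (by rw [ha])⟩
      have h1 := hcoord a j
      rw [this, Finsupp.zero_apply, eq_comm, smul_eq_zero] at h1
      exact Subtype.ext (h1.resolve_right hy₀)
    · rintro h0 z ⟨a, ha⟩
      rw [hφ, Prod.mk.injEq] at ha
      have ha0 := h0 a ha.2
      rw [← ha.1]
      simp [ha0]
  -- A basis is found by search: equality of spans is enumerable through the coefficients, and
  -- independence through the null solver.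
  refine (Solves.of_enumerable (D := fun _ => True) (P := fun (L B : List Y) =>
    ((∀ b ∈ B, b ∈ listSpan σ L) ∧ ∀ b ∈ L, b ∈ listSpan σ B) ∧ ∃ N : List (ℕ →₀ Z),
      R ((List.range B.length).map fun i => (Finsupp.single i y₀, B.getD i 0)) N ∧
        ∀ z ∈ N, z = 0) ?_ ?_).mono (fun _ _ => trivial) ?_
  · refine ((Enumerable.ball_mem (p := fun (x : List Y × List Y) b => b ∈ listSpan σ x.1)
      (enumerable_mem_listSpan hσ (by fun_prop) (by fun_prop)) (by fun_prop)).and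
      (Enumerable.ball_mem (p := fun (x : List Y × List Y) b => b ∈ listSpan σ x.2)
      (enumerable_mem_listSpan hσ (by fun_prop) (by fun_prop)) (by fun_prop))).and ?_
    refine Enumerable.exists (p := fun (x : List Y × List Y) N =>
      R ((List.range x.2.length).map fun i => (Finsupp.single i y₀, x.2.getD i 0)) N ∧
        ∀ z ∈ N, z = 0) (Enumerable.and ?_ ?_)
    · exact hR.comp (g := fun x : (List Y × List Y) × List (ℕ →₀ Z) =>
        ((List.range x.1.2.length).map fun i => (Finsupp.single i y₀, x.1.2.getD i 0), x.2))
        (by fun_prop)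
    · exact Enumerable.ball_mem (p := fun (x : (List Y × List Y) × List (ℕ →₀ Z)) z => z = 0)
        (Enumerable.eq (by fun_prop) (by fun_prop)) (by fun_prop)
  · intro L _
    obtain ⟨B, hB, hind⟩ := exists_sublist_linearIndependent (σ := σ) L
    obtain ⟨N, hN⟩ := hR1 ((List.range B.length).map fun i =>
      (Finsupp.single i y₀, B.getD i 0)) trivial
    exact ⟨B, ⟨fun b hb => hB ▸ mem_listSpan_of_mem hb, fun b hb => hB ▸ mem_listSpan_of_mem hb⟩,
      N, hN, (hlin B N hN).2 hind⟩
  · rintro L B - ⟨⟨h1, h2⟩, N, hN, h0⟩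
    exact ⟨le_antisymm (listSpan_le.2 h1) (listSpan_le.2 h2), (hlin B N hN).1 h0⟩

end Null

/-! ### Computability of exponent reduction and of powers of units -/

section Arithmetic

theorem computable_comp₂ {α β γ δ : Type*} [Primcodable α] [Primcodable β] [Primcodable γ]
    [Primcodable δ] {f : β → γ → δ} {g : α → β} {h : α → γ}
    (hf : Computable fun x : β × γ => f x.1 x.2) (hg : Computable g) (hh : Computable h) :
    Computable fun a => f (g a) (h a) := hf.comp (hg.pair hh)

variable {α : Type*} [Primcodable α]

theorem computable_int_emod (n : ℕ) : Computable fun k : ℤ => k % (n : ℤ) := by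
  rcases Nat.eq_zero_or_pos n with rfl | hn
  · exact Computable.id.of_eq fun k => by simp
  refine computable_of_graph ((Enumerable.exists (p := fun (x : ℤ × ℤ) (y : ℤ × ℕ) =>
    (x.1 = n * y.1 + y.2 ∧ x.2 = y.2) ∧ decide (y.2 < n) = true) (Enumerable.and (Enumerable.and
    (Enumerable.eq (by fun_prop) (by fun_prop)) (Enumerable.eq (by fun_prop) (by fun_prop)))
    (Enumerable.of_bool ?_))).of_iff ?_)
  · exact (Primrec.nat_lt.decide.to_comp).comp (show Computable fun x : (ℤ × ℤ) × (ℤ × ℕ) => x.2.2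
      by fun_prop) (Computable.const n)
  · rintro ⟨a, b⟩
    simp only [decide_eq_true_eq]
    have h0 : (n : ℤ) ≠ 0 := by omega
    constructor
    · rintro rfl
      have h1 := Int.emod_nonneg a h0
      have h2 := Int.emod_lt_of_pos a (show (0 : ℤ) < n by omega)
      have h3 := Int.mul_ediv_add_emod a n
      refine ⟨(a / n, (a % n).toNat), ⟨?_, ?_⟩, ?_⟩ <;> simp only <;> omega
    · rintro ⟨⟨q, r⟩, ⟨h1, h2⟩, h3⟩
      simp only at h1 h2 h3
      rw [h1, h2, Int.mul_add_emod_self_left, Int.emod_eq_of_lt (by omega) (by omega)]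

theorem Generator.computable_reduce {E : Type*} [CommRing E] (g : Generator E) :
    Computable g.reduce := by
  cases g with
  | root n _ => exact computable_int_emod n
  | pi _ => exact Computable.id
  | sigma _ =>
    have h : Computable fun k : ℤ => (k.toNat : ℤ) := by fun_prop
    exact h.of_eq fun k => by
      change (k.toNat : ℤ) = max k 0
      omega

theorem Units.val_zpow_eq {M : Type*} [CommRing M] (u : Mˣ) (k : ℤ) :
    ((u ^ k : Mˣ) : M) = (u : M) ^ k.toNat * ((u⁻¹ : Mˣ) : M) ^ (-k).toNat := by
  rcases Int.le_total 0 k with h | h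
  · lift k to ℕ using h
    simp
  · obtain ⟨n, rfl⟩ : ∃ n : ℕ, k = -n := ⟨(-k).toNat, by omega⟩
    simp

theorem computable_units_zpow {M : Type*} [CommRing M] [Primcodable M] [ComputableMul M] (u : Mˣ)
    {k : α → ℤ} (hk : Computable k) : Computable fun a => ((u ^ k a : Mˣ) : M) := by
  simp only [Units.val_zpow_eq]
  fun_prop

end Arithmetic

/-! ### Computing in the tower by names -/

section Names

variable {F : Type*} [Field F] {E : Type*} [CommRing E] [Algebra F E] {e : ℕ}
  {σ : F ≃+* F} {σ' : E ≃+* E} {t : Fin e → Generator E}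

theorem value_eq (l : Name F e) : value t l = (l.map fun p => p.1 • monomial t p.2).sum := by
  simp only [value, monomial, Algebra.smul_def]

/-- The normalized exponent vector that gives the same monomial. -/
def reduceExponents (t : Fin e → Generator E) (a : Fin e → ℤ) : Fin e → ℤ :=
  fun i => (t i).reduce (a i)

@[fun_prop]
theorem computable_reduceExponents (t : Fin e → Generator E) :
    Computable (reduceExponents t) := by
  refine computable_fin_lam fun i => ?_
  exact (t i).computable_reduce.comp (computable_fin_app i)

theorem value_append (l m : Name F e) : value t (l ++ m) = value t l + value t m := by
  simp [value]

namespace IsRPiSigmaExtension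

variable (hE : IsRPiSigmaExtension σ σ' t)

/-- The coordinate of a basis monomial. -/
noncomputable def coord (a : Fin e → ℤ) : E →ₗ[F] F := by
  classical
  exact hE.basis.constr F fun b => if b.1 = a then 1 else 0

include hE

open Classical in
theorem coord_monomial {a : Fin e → ℤ} (ha : IsExponentVector t a) (b : Fin e → ℤ) :
    hE.coord b (monomial t a) = if a = b then 1 else 0 := by
  rw [← hE.basis_apply ⟨a, ha⟩, coord, Module.Basis.constr_basis]

open Classical in
theorem coord_monomial' (a b : Fin e → ℤ) :
    hE.coord b (monomial t a) = if reduceExponents t a = b then 1 else 0 := by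
  rw [← hE.monomial_reduce, hE.coord_monomial (hE.isExponentVector_reduce a)]
  rfl

theorem coord_eq_repr (a : {a : Fin e → ℤ // IsExponentVector t a}) (x : E) :
    hE.coord a.1 x = hE.basis.repr x a := by
  have h : hE.coord a.1 = (Finsupp.lapply a).comp (hE.basis.repr : E →ₗ[F] _) := by
    refine hE.basis.ext fun b => ?_
    rw [LinearMap.comp_apply, hE.basis_apply, hE.coord_monomial b.2]
    rw [LinearEquiv.coe_coe, hE.repr_monomial b.2, Finsupp.lapply_apply, Finsupp.single_apply]
    simp only [Subtype.ext_iff]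
  rw [h]
  rfl

theorem eq_zero_of_coord {x : E} (h : ∀ a, hE.coord a x = 0) : x = 0 := by
  apply hE.basis.repr.injective
  ext a
  rw [← hE.coord_eq_repr, h]
  simp

open Classical in
theorem coord_value (l : Name F e) (a : Fin e → ℤ) : hE.coord a (value t l) =
    (l.map fun p => if reduceExponents t p.2 = a then p.1 else 0).sum := by
  rw [value_eq, map_list_sum, List.map_map]
  congr 2
  funext p
  simp only [Function.comp, map_smul, hE.coord_monomial', smul_eq_mul, mul_ite, mul_one, mul_zero]

theorem coord_value_eq_zero {l : Name F e} {a : Fin e → ℤ}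
    (h : ∀ p ∈ l, reduceExponents t p.2 ≠ a) : hE.coord a (value t l) = 0 := by
  classical
  rw [hE.coord_value]
  refine List.sum_eq_zero fun x hx => ?_
  obtain ⟨p, hp, rfl⟩ := List.mem_map.1 hx
  rw [if_neg (h p hp)]

theorem value_surjective : Function.Surjective (value (F := F) t) := by
  intro x
  have hx : x ∈ adjoinOver F t Set.univ := by
    rw [hE.adjoinOver_univ]
    trivial
  refine hE.adjoinOver_induction (p := fun x => ∃ l, value (F := F) t l = x) ⟨[], rfl⟩ ?_ ?_ ?_ hx
  · rintro _ _ ⟨l, rfl⟩ ⟨m, rfl⟩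
    exact ⟨l ++ m, value_append l m⟩
  · rintro c _ ⟨l, rfl⟩
    refine ⟨l.map fun p => (c * p.1, p.2), ?_⟩
    rw [value_eq, value_eq, List.smul_sum, List.map_map, List.map_map]
    simp [Function.comp_def, mul_smul]
  · intro a _ _
    exact ⟨[(1, a)], by simp [value_eq]⟩

open Classical in
theorem coeff_monomial' (i : Fin e) (k : ℤ) (a : Fin e → ℤ) : hE.coeff i k (monomial t a) =
    if (t i).reduce (a i) = k then monomial t (Function.update a i 0) else 0 := by
  rw [← hE.monomial_reduce a, hE.coeff_monomial i k (hE.isExponentVector_reduce a),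
    ← hE.monomial_reduce (Function.update a i 0)]
  congr 2
  funext j
  by_cases hj : j = i
  · subst hj
    simp [Generator.reduce_zero]
  · simp [Function.update_of_ne hj]

end IsRPiSigmaExtension

variable (F t) in
/-- The codes of the elements of `E` can be translated into names and back. -/
structure IsComputableTower [Primcodable F] [Primcodable E] : Prop where
  value : Computable (value (F := F) t)
  exists_name : ∃ nm : E → Name F e, Computable nm ∧ ∀ x, DifferenceRing.value t (nm x) = x

variable [Primcodable F] [ComputableAdd F] [ComputableNeg F] [ComputableMul F]

theorem IsRPiSigmaExtension.computable_coord_value (hE : IsRPiSigmaExtension σ σ' t) :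
    Computable fun x : (Fin e → ℤ) × Name F e => hE.coord x.1 (value t x.2) := by
  classical
  simp only [hE.coord_value]
  fun_prop

/-- Two names have the same value exactly when all coordinates in the monomial basis agree, and only
the reduced exponents that occur in the names have to be compared. So equality is decidable, and
`exists_primcodable_of_surjective` applies. -/
theorem IsRPiSigmaExtension.exists_isComputableTower [CharZero F]
    (hE : IsRPiSigmaExtension σ σ' t) :
    ∃ _ : Primcodable E, IsComputableTower F t := by
  classical
  have : Infinite E := Infinite.of_injective _ hE.injective
  have hc := hE.computable_coord_value
  have hiff : ∀ l m : Name F e, value t l = value t m ↔ ∀ p ∈ l ++ m,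
      hE.coord (reduceExponents t p.2) (value t l) =
        hE.coord (reduceExponents t p.2) (value t m) := by
    intro l m
    refine ⟨fun h _ _ => by rw [h], fun h => ?_⟩
    rw [← sub_eq_zero]
    refine hE.eq_zero_of_coord fun a => ?_
    by_cases ha : ∃ p ∈ l ++ m, reduceExponents t p.2 = a
    · obtain ⟨p, hp, rfl⟩ := ha
      rw [map_sub, h p hp, sub_self]
    · push Not at ha
      rw [map_sub, hE.coord_value_eq_zero fun p hp => ha p (List.mem_append_left _ hp),
        hE.coord_value_eq_zero fun p hp => ha p (List.mem_append_right _ hp), sub_zero]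
  have h1 : Computable fun x : (Name F e × Name F e) × (Fin e → ℤ) =>
      hE.coord x.2 (value t x.1.1) :=
    computable_comp₂ (f := fun a l => hE.coord a (value t l)) hc (by fun_prop) (by fun_prop)
  have h2 : Computable fun x : (Name F e × Name F e) × (Fin e → ℤ) =>
      hE.coord x.2 (value t x.1.2) :=
    computable_comp₂ (f := fun a l => hE.coord a (value t l)) hc (by fun_prop) (by fun_prop)
  have h3 : Computable fun x : (Name F e × Name F e) × (F × (Fin e → ℤ)) =>
      hE.coord (reduceExponents t x.2.2) (value t x.1.1) :=
    computable_comp₂ (f := fun a l => hE.coord a (value t l)) hc (by fun_prop) (by fun_prop)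
  have h3' : Computable fun x : (Name F e × Name F e) × (F × (Fin e → ℤ)) =>
      hE.coord (reduceExponents t x.2.2) (value t x.1.2) :=
    computable_comp₂ (f := fun a l => hE.coord a (value t l)) hc (by fun_prop) (by fun_prop)
  have h4 : Enumerable fun x : Name F e × Name F e => value (F := F) t x.1 = value t x.2 :=
    (Enumerable.ball_mem (p := fun (x : Name F e × Name F e) (p : F × (Fin e → ℤ)) =>
      hE.coord (reduceExponents t p.2) (value t x.1) =
        hE.coord (reduceExponents t p.2) (value t x.2))
      (Enumerable.eq h3 h3') (l := fun x => x.1 ++ x.2) (by fun_prop)).of_iff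
      fun x => hiff x.1 x.2
  -- Distinct values are separated by a coordinate, which makes the complement enumerable too.
  have h5 : Enumerable fun x : Name F e × Name F e => ¬ value (F := F) t x.1 = value t x.2 := by
    refine (Enumerable.exists (p := fun (x : Name F e × Name F e) a =>
      hE.coord a (value t x.1) ≠ hE.coord a (value t x.2)) (Enumerable.ne h1 h2)).of_iff fun x => ?_
    constructor
    · intro h
      rw [hiff] at h
      push Not at h
      obtain ⟨p, -, hp⟩ := h
      exact ⟨_, hp⟩
    · rintro ⟨a, ha⟩ h
      exact ha (by rw [h])
  have h6 : Computable fun x : Name F e × Name F e =>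
      decide (value (F := F) t x.1 = value (F := F) t x.2) := computable_decide h4 h5
  have h7 := exists_primcodable_of_surjective hE.value_surjective h6
  exact h7.elim fun i hi => ⟨i, @IsComputableTower.mk _ _ _ _ _ _ t _ i hi.1 hi.2⟩

namespace IsComputableTower

variable [Primcodable E] (hC : IsComputableTower F t)

include hC

omit [ComputableAdd F] [ComputableNeg F] [ComputableMul F] in
theorem computable {α β : Type*} [Primcodable α] [Primcodable β] {f : β × E → α}
    (h : Computable fun x : β × Name F e => f (x.1, DifferenceRing.value t x.2)) : Computable f := by
  obtain ⟨nm, hnm, hv⟩ := hC.exists_name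
  refine (h.comp (show Computable fun x : β × E => (x.1, nm x.2) by fun_prop)).of_eq fun x => ?_
  rw [hv]

omit [ComputableAdd F] [ComputableNeg F] [ComputableMul F] in
theorem computable' {α : Type*} [Primcodable α] {f : E → α}
    (h : Computable fun x => f (DifferenceRing.value (F := F) t x)) : Computable f := by
  obtain ⟨nm, hnm, hv⟩ := hC.exists_name
  refine (h.comp hnm).of_eq fun x => ?_
  rw [hv]

omit [ComputableAdd F] [ComputableNeg F] [ComputableMul F] in
theorem add : ComputableAdd E := by
  obtain ⟨nm, hnm, hv⟩ := hC.exists_name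
  have h1 := hC.value
  have : Computable fun x : E × E => DifferenceRing.value (F := F) t (nm x.1 ++ nm x.2) := by
    fun_prop
  exact ⟨this.of_eq fun x => by rw [value_append, hv, hv]⟩

theorem smul : ComputableSMul F E := by
  obtain ⟨nm, hnm, hv⟩ := hC.exists_name
  have h1 := hC.value
  have : Computable fun x : F × E =>
      DifferenceRing.value (F := F) t ((nm x.2).map fun p => (x.1 * p.1, p.2)) := by fun_prop
  exact ⟨this.of_eq fun x => by
    conv_rhs => rw [← hv x.2]
    rw [value_eq, value_eq, List.smul_sum, List.map_map, List.map_map]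
    simp [Function.comp_def, mul_smul]⟩

theorem neg : ComputableNeg E := by
  have := hC.smul
  have h : Computable fun x : E => (-1 : F) • x := by fun_prop
  exact ⟨h.of_eq fun x => by simp⟩

theorem computable_monomial : Computable (monomial t) := by
  have h1 := hC.value
  have : Computable fun a : Fin e → ℤ => DifferenceRing.value (F := F) t [(1, a)] := by fun_prop
  exact this.of_eq fun a => by simp [value_eq]

theorem mul (hE : IsRPiSigmaExtension σ σ' t) : ComputableMul E := by
  obtain ⟨nm, hnm, hv⟩ := hC.exists_name
  have h1 := hC.value
  let add : (Fin e → ℤ) → (Fin e → ℤ) → Fin e → ℤ := fun a b =>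
    reduceExponents t fun i => reduceExponents t a i + reduceExponents t b i
  have h2 : Computable fun x : (Fin e → ℤ) × (Fin e → ℤ) => add x.1 x.2 := by
    refine (computable_reduceExponents t).comp (computable_fin_lam fun i => ?_)
    have := (computable_fin_app i).comp (computable_reduceExponents t)
    exact computable_add (this.comp Computable.fst) (this.comp Computable.snd)
  have h3 : Computable fun x : (E × E) × (F × (Fin e → ℤ)) =>
      (nm x.1.2).map fun q => (x.2.1 * q.1, add x.2.2 q.2) := by fun_prop
  have h4 : Computable fun x : E × E => DifferenceRing.value (F := F) t ((nm x.1).flatMap fun p =>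
      (nm x.2).map fun q => (p.1 * q.1, add p.2 q.2)) :=
    h1.comp (computable_list_flatMap (by fun_prop) h3)
  refine ⟨h4.of_eq fun x => ?_⟩
  conv_rhs => rw [← hv x.1, ← hv x.2]
  have hmul : ∀ a b : Fin e → ℤ, monomial t (add a b) = monomial t a * monomial t b :=
      fun a b => by
    rw [← hE.monomial_reduce a, ← hE.monomial_reduce b]
    exact (hE.monomial_mul_monomial (hE.isExponentVector_reduce a)
      (hE.isExponentVector_reduce b)).symm
  generalize nm x.1 = l
  generalize nm x.2 = m
  induction l with
  | nil => simp [DifferenceRing.value]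
  | cons p l ih =>
    rw [List.flatMap_cons, value_append, ih, show p :: l = [p] ++ l from rfl, value_append, add_mul]
    congr 1
    rw [value_eq, value_eq, value_eq, List.map_map, List.map_singleton, List.sum_singleton,
      ← List.sum_map_mul_left]
    simp [Function.comp_def, hmul, mul_smul, smul_comm p.1]

/-- The map `σ'` is determined by `σ` and the images of the finitely many generators and their
inverses, which are fixed data of the algorithm. -/
theorem computable_map (hE : IsRPiSigmaExtension σ σ' t) (hσ : Computable σ) : Computable σ' := by
  have := hC.add
  have := hC.smul
  have := hC.mul hE
  have hpow : ∀ i, Computable fun a : Fin e → ℤ => σ' ((t i).pow (a i)) := by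
    intro i
    cases h : t i with
    | root n u => exact (computable_units_zpow (Units.map (σ' : E →* E) u)
        (computable_fin_app i)).of_eq fun a => by rw [← map_zpow]; rfl
    | pi u => exact (computable_units_zpow (Units.map (σ' : E →* E) u)
        (computable_fin_app i)).of_eq fun a => by rw [← map_zpow]; rfl
    | sigma s =>
      have : Computable fun a : Fin e → ℤ => σ' s ^ (a i).toNat := by fun_prop
      exact this.of_eq fun a => by rw [← map_pow]; rfl
  have hmon : Computable fun a : Fin e → ℤ => ∏ i, σ' ((t i).pow (a i)) :=
    computable_fin_prod _ hpow
  refine hC.computable' ?_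
  have h : Computable fun l : Name F e => (l.map fun p => σ p.1 • ∏ i, σ' ((t i).pow (p.2 i))).sum := by
    refine computable_list_sum (computable_list_map (by fun_prop) (computable_smul (by fun_prop) ?_))
    exact hmon.comp (show Computable fun x : Name F e × (F × (Fin e → ℤ)) => x.2.2 by fun_prop)
  refine h.of_eq fun l => ?_
  rw [value_eq, map_list_sum, List.map_map]
  simp only [Function.comp_def, hE.map_smul', monomial, map_prod]

theorem computable_pow (i : Fin e) : Computable fun k : ℤ => (t i).pow k := by
  classical
  have h : Computable fun k : ℤ => monomial t fun j => if j = i then k else 0 := by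
    refine hC.computable_monomial.comp (computable_fin_lam fun j => ?_)
    by_cases hj : j = i <;> simp only [hj, ↓reduceIte] <;> fun_prop
  refine h.of_eq fun k => ?_
  rw [monomial, Finset.prod_eq_single i]
  · simp
  · intro j _ hj
    rw [if_neg hj, Generator.pow_zero_eq]
  · simp

theorem computable_coeff (hE : IsRPiSigmaExtension σ σ' t) (i : Fin e) :
    Computable fun x : ℤ × E => hE.coeff i x.1 x.2 := by
  classical
  have := hC.add
  have := hC.smul
  have hm := hC.computable_monomial
  have hr := (t i).computable_reduce
  have hu : Computable fun a : Fin e → ℤ => monomial t (Function.update a i 0) := by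
    refine hC.computable_monomial.comp (computable_fin_lam fun j => ?_)
    by_cases hj : j = i
    · subst hj
      simp only [Function.update_self]
      fun_prop
    · simp only [Function.update_of_ne hj]
      fun_prop
  refine hC.computable ?_
  have h : Computable fun x : ℤ × Name F e => (x.2.map fun p =>
      if (t i).reduce (p.2 i) = x.1 then p.1 • monomial t (Function.update p.2 i 0) else 0).sum := by
    refine computable_list_sum (computable_list_map (by fun_prop) (computable_ite_eq (by fun_prop)
      (by fun_prop) (computable_smul (by fun_prop) ?_) (by fun_prop)))
    exact hu.comp (show Computable fun x : (ℤ × Name F e) × (F × (Fin e → ℤ)) => x.2.2 by fun_prop)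
  refine h.of_eq fun x => ?_
  rw [value_eq, map_list_sum, List.map_map]
  simp only [Function.comp_def, map_smul, hE.coeff_monomial', smul_ite, smul_zero]

theorem computable_coord (hE : IsRPiSigmaExtension σ σ' t) :
    Computable fun x : (Fin e → ℤ) × E => hE.coord x.1 x.2 :=
  hC.computable hE.computable_coord_value

/-- An element belongs to the subring exactly when some name of it uses only exponents supported in
`S`. Semi-decidability is enough for the searches below. -/
theorem enumerable_mem_adjoinOver (hE : IsRPiSigmaExtension σ σ' t) (S : Set (Fin e)) :
    Enumerable fun x => x ∈ adjoinOver F t S := by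
  have hv := hC.value
  have h : Enumerable fun x : (E × Name F e) × (F × (Fin e → ℤ)) => ∀ j, j ∉ S → x.2.2 j = 0 := by
    refine Enumerable.forall_fin fun j => ?_
    by_cases hj : j ∈ S
    · exact (Enumerable.const True).of_iff fun _ => by simp [hj]
    · simp only [hj, not_false_eq_true, true_imp_iff]
      exact Enumerable.eq (by fun_prop) (by fun_prop)
  refine (Enumerable.exists (p := fun x (l : Name F e) => DifferenceRing.value t l = x ∧
    ∀ p ∈ l, ∀ j, j ∉ S → p.2 j = 0) (Enumerable.and (Enumerable.eq (by fun_prop) (by fun_prop))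
      (Enumerable.ball_mem (p := fun (_ : E × Name F e) (p : F × (Fin e → ℤ)) =>
        ∀ j, j ∉ S → p.2 j = 0) h (by fun_prop)))).of_iff fun x => ?_
  constructor
  · intro hx
    refine hE.adjoinOver_induction (p := fun x => ∃ l : Name F e, DifferenceRing.value t l = x ∧
      ∀ p ∈ l, ∀ j, j ∉ S → p.2 j = 0) ⟨[], rfl, by simp⟩ ?_ ?_ ?_ hx
    · rintro _ _ ⟨l, rfl, hl⟩ ⟨m, rfl, hm⟩
      refine ⟨l ++ m, value_append l m, fun p hp => ?_⟩
      exact (List.mem_append.1 hp).elim (hl p) (hm p)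
    · rintro c _ ⟨l, rfl, hl⟩
      refine ⟨l.map fun p => (c * p.1, p.2), ?_, ?_⟩
      · rw [value_eq, value_eq, List.smul_sum, List.map_map, List.map_map]
        simp [Function.comp_def, mul_smul]
      · intro p hp
        obtain ⟨q, hq, rfl⟩ := List.mem_map.1 hp
        exact hl q hq
    · intro a _ ha
      exact ⟨[(1, a)], by simp [value_eq], by simpa using ha⟩
  · rintro ⟨l, rfl, hl⟩
    rw [value_eq]
    refine list_sum_mem fun x hx => ?_
    obtain ⟨p, hp, rfl⟩ := List.mem_map.1 hx
    rw [← hE.monomial_reduce]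
    refine Subalgebra.smul_mem _ (monomial_mem_adjoinOver t (hE.isExponentVector_reduce _)
      fun j hj => ?_) _
    rw [hl p hp j hj, Generator.reduce_zero]

end IsComputableTower

end Names

/-! ### Linear algebra over the constants with entries in the tower -/

section Null

universe v

theorem IsComputableTower.nullSolvable {F : Type*} [Field F] [Primcodable F] [ComputableAdd F]
    [ComputableNeg F] [ComputableMul F] [ComputableInv F] {σ : F ≃+* F} {E : Type v} [CommRing E]
    [Algebra F E] [Primcodable E] {σ' : E ≃+* E} {e : ℕ} {t : Fin e → Generator E}
    (hC : IsComputableTower F t) (hE : IsRPiSigmaExtension σ σ' t) (hσ : Computable σ) : NullSolvable.{v} σ E := by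
  have := hC.add
  have := hC.smul
  have := hC.neg
  obtain ⟨nm, hnm, hv⟩ := hC.exists_name
  refine NullSolvable.of_coordinates (nullSolvable_self hσ) hE.coord (hC.computable_coord hE)
    (fun x => (nm x).map fun p => reduceExponents t p.2) (by fun_prop) ?_
    fun x => hE.eq_zero_of_coord
  intro x a ha
  rw [← hv x]
  exact hE.coord_value_eq_zero fun p hp h => ha (List.mem_map.2 ⟨p, hp, h⟩)

end Null

/-! ### Transport of spans along linear relations -/

section Span

variable {F : Type*} [Field F] {σ : F ≃+* F}
variable {Z Y : Type*} [AddCommGroup Z] [Module F Z] [AddCommGroup Y] [Module F Y]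

/-- A relation that is a subspace over the field of constants. -/
structure IsConstRel (σ : F ≃+* F) (Q : Z → Y → Prop) : Prop where
  zero : Q 0 0
  add : ∀ x y x' y', Q x y → Q x' y' → Q (x + x') (y + y')
  smul : ∀ c : F, σ c = c → ∀ x y, Q x y → Q (c • x) (c • y)

/-- Solutions of a reduced problem are lifted by search and not by a linear map. A linear relation
between the generators still extends to the spans, in both directions. -/
theorem exists_of_forall₂ {Q : Z → Y → Prop} (hQ : IsConstRel σ Q) {L : List Z} {M : List Y}
    (h : List.Forall₂ Q L M) : (∀ x ∈ listSpan σ L, ∃ y ∈ listSpan σ M, Q x y) ∧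
      ∀ y ∈ listSpan σ M, ∃ x ∈ listSpan σ L, Q x y := by
  induction h with
  | nil =>
    simp only [listSpan_nil, Submodule.mem_bot, forall_eq, exists_eq_left]
    exact ⟨hQ.zero, hQ.zero⟩
  | cons h1 _ ih =>
    constructor
    · intro x hx
      obtain ⟨c, hc, x', hx', rfl⟩ := mem_listSpan_cons.1 hx
      obtain ⟨y', hy', h2⟩ := ih.1 x' hx'
      exact ⟨_, mem_listSpan_cons.2 ⟨c, hc, y', hy', rfl⟩, hQ.add _ _ _ _ (hQ.smul c hc _ _ h1) h2⟩
    · intro y hy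
      obtain ⟨c, hc, y', hy', rfl⟩ := mem_listSpan_cons.1 hy
      obtain ⟨x', hx', h2⟩ := ih.2 y' hy'
      exact ⟨_, mem_listSpan_cons.2 ⟨c, hc, x', hx', rfl⟩, hQ.add _ _ _ _ (hQ.smul c hc _ _ h1) h2⟩

theorem mem_listSpan_iff_fin {L : List Z} {z : Z} : z ∈ listSpan σ L ↔
    ∃ c : Fin L.length → F, (∀ i, σ (c i) = c i) ∧ z = ∑ i, c i • L.get i := by
  induction L generalizing z with
  | nil => simp
  | cons y L ih =>
    rw [mem_listSpan_cons]
    constructor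
    · rintro ⟨a, ha, x, hx, rfl⟩
      obtain ⟨c, hc, rfl⟩ := ih.1 hx
      refine ⟨Fin.cons a c, fun i => ?_, ?_⟩
      · refine Fin.cases ?_ (fun j => ?_) i
        · exact ha
        · exact hc j
      · exact (Fin.sum_univ_succ (n := L.length) fun i =>
          (Fin.cons a c : Fin (L.length + 1) → F) i • (y :: L).get i).symm
    · rintro ⟨c, hc, rfl⟩
      refine ⟨c 0, hc 0, _, ih.2 ⟨fun i => c i.succ, fun i => hc _, rfl⟩, ?_⟩
      exact Fin.sum_univ_succ (n := L.length) fun i => c i • (y :: L).get i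

/-- Allows one to pass between the powers of `σ` when these have the same constants. -/
theorem listSpan_congr {τ : F ≃+* F} (h : constants τ = constants σ) {L : List Z} {z : Z} :
    z ∈ listSpan τ L ↔ z ∈ listSpan σ L := by
  rw [mem_listSpan_iff_fin, mem_listSpan_iff_fin]
  refine exists_congr fun c => and_congr_left fun _ => forall_congr' fun i => ?_
  exact SetLike.ext_iff.1 h (c i)

end Span

/-! ### Problem PFLDE in the ground field with tags -/

section Oracle

universe v

variable {F : Type*} [Field F] [Primcodable F] [ComputableAdd F] [ComputableMul F]

/-- Problem PFLDE in a field for right hand sides with tags. -/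
theorem PFLDESolvable.solves {τ : F ≃+* F} (h : PFLDESolvable (id : F → F) τ (⊤ : Subgroup Fˣ))
    (Z : Type v) [AddCommGroup Z] [Module F Z] [Primcodable Z] [ComputableAdd Z]
    [ComputableSMul F Z] : Solves (fun x : F × List (Z × F) => x.1 ≠ 0)
      fun x N => ∀ p : Z × F, p ∈ listSpan τ N ↔
        (p.1, τ p.2 - x.1 * p.2) ∈ listSpan τ x.2 := by
  obtain ⟨-, alg, halg, hspec⟩ := h
  let P : F × List F → List (List F × F) → Prop := fun x out =>
    ∃ (d : ℕ) (b : Fin d → (Fin x.2.length → F) × F),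
      IsBasisOf (constants τ) b (pldeSolutions τ x.1 x.2.get) ∧
      out = List.ofFn fun k => (List.ofFn (b k).1, (b k).2)
  have h1 : Solves (fun x : F × List F => x.1 ≠ 0) P := by
    refine Solves.of_partrec halg fun x hx => ?_
    obtain ⟨out, hout, d, b, hb, ho⟩ := hspec x.1 (Units.mk0 x.1 hx) x.2 x.2.length x.2.get
      (Subgroup.mem_top _) rfl (by rw [List.map_id]; exact (List.ofFn_get x.2).symm)
    refine ⟨out, hout, d, b, hb, ?_⟩
    rw [← ho]
    simp
  -- The vector of constants in a basis element is replaced by the same combination of the tags.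
  -- With unit vectors as tags nothing is lost, and later reductions are free to choose other tags.
  refine ((h1.comp (g := fun x : F × List (Z × F) => (x.1, x.2.map Prod.snd)) (by fun_prop)).map
    (f := fun x out => out.map fun q => ((List.zipWith (fun c z => c • z) q.1
      (x.2.map Prod.fst)).sum, q.2)) (by fun_prop)).mono (fun _ hx => hx) ?_
  rintro ⟨u, L⟩ _ hu ⟨out, ⟨d, b, hb, rfl⟩, rfl⟩ p
  simp only at b hb ⊢
  have hlen : (L.map Prod.snd).length = L.length := List.length_map _
  let z : Fin (L.map Prod.snd).length → Z := fun i => (L.get (i.cast hlen)).1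
  have hz : ∀ c : Fin (L.map Prod.snd).length → F,
      (List.zipWith (fun c z => c • z) (List.ofFn c) (L.map Prod.fst)).sum = ∑ i, c i • z i := by
    intro c
    have : L.map Prod.fst = List.ofFn z := by
      refine List.ext_get (by simp) fun n h1 h2 => ?_
      simp [z]
    rw [this, ← List.sum_ofFn]
    congr 1
    refine List.ext_get (by simp) fun n h1 h2 => ?_
    simp
  have hf : IsConstLinear τ fun q : (Fin (L.map Prod.snd).length → F) × F =>
      ((∑ i, q.1 i • z i, q.2) : Z × F) := by
    refine ⟨fun x y => ?_, fun c _ x => ?_⟩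
    · simp [add_smul, Finset.sum_add_distrib]
    · simp [mul_smul, Finset.smul_sum]
  have hN : (List.ofFn fun k => (List.ofFn (b k).1, (b k).2)).map (fun q : List F × F =>
      ((List.zipWith (fun c z => c • z) q.1 (L.map Prod.fst)).sum, q.2)) =
      (List.ofFn b).map fun q => ((∑ i, q.1 i • z i, q.2) : Z × F) := by
    rw [List.map_ofFn, List.map_ofFn]
    congr 1
    funext k
    simp only [Function.comp, hz]
  rw [hN, mem_listSpan_map hf]
  have hspan : ∀ q, q ∈ listSpan τ (List.ofFn b) ↔ q ∈ pldeSolutions τ u (L.map Prod.snd).get := by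
    intro q
    rw [← hb.2, SetLike.mem_coe, listSpan]
    have : {z | z ∈ List.ofFn b} = Set.range b := by
      ext
      simp [List.mem_ofFn]
    rw [this]
  rw [mem_listSpan_iff_fin]
  constructor
  · rintro ⟨q, hq, rfl⟩
    obtain ⟨h1, h2⟩ := (hspan q).1 hq
    refine ⟨fun i => q.1 (i.cast hlen.symm), fun i => h1 _, ?_⟩
    have h3 := fun f : Fin (L.map Prod.snd).length → Z =>
      (Equiv.sum_comp (finCongr hlen.symm) f).symm
    have h4 := fun f : Fin (L.map Prod.snd).length → F =>
      (Equiv.sum_comp (finCongr hlen.symm) f).symm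
    simp only at h2 ⊢
    rw [h2, h3, h4]
    ext
    · simp [Prod.fst_sum, z]
    · simp [Prod.snd_sum]
  · rintro ⟨c, hc, hp⟩
    refine ⟨(fun i => c (i.cast hlen), p.2), (hspan _).2 ⟨fun i => hc _, ?_⟩, ?_⟩
    · have := congrArg Prod.snd hp
      simp only [Prod.snd_sum, Prod.smul_snd, smul_eq_mul] at this
      simp only
      rw [this, ← Equiv.sum_comp (finCongr hlen)]
      simp
    · have := congrArg Prod.fst hp
      simp only [Prod.fst_sum, Prod.smul_fst] at this
      ext
      · rw [this, ← Equiv.sum_comp (finCongr hlen)]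
        rfl
      · rfl

end Oracle

/-! ### Equations in the root part and their components -/

section Root

variable {F : Type*} [Field F] {E : Type*} [CommRing E] [Algebra F E] {e : ℕ}
  {σ : F ≃+* F} {σ' : E ≃+* E} {t : Fin e → Generator E}

/-- The product of the first `n` iterates of `u`. -/
def iterateProd (σ' : E ≃+* E) (u : E) : ℕ → E
  | 0 => 1
  | n + 1 => (σ' ^ n) u * iterateProd σ' u n

/-- The inhomogeneous part of the `n`-th iterate of `g` if `σ g = u * g + r`. -/
def iterateSum (σ' : E ≃+* E) (u r : E) : ℕ → E
  | 0 => 0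
  | n + 1 => (σ' ^ n) u * iterateSum σ' u r n + (σ' ^ n) r

theorem pow_map_eq {g u r : E} (h : σ' g = u * g + r) (n : ℕ) :
    (σ' ^ n) g = iterateProd σ' u n * g + iterateSum σ' u r n := by
  induction n with
  | zero => simp [iterateProd, iterateSum]
  | succ n ih =>
    rw [pow_succ, RingAut.mul_apply, h, map_add, map_mul, ih, iterateProd, iterateSum]
    ring

theorem iterateProd_mul (u v : E) (n : ℕ) :
    iterateProd σ' (u * v) n = iterateProd σ' u n * iterateProd σ' v n := by
  induction n with
  | zero => simp [iterateProd]
  | succ n ih =>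
    rw [iterateProd, iterateProd, iterateProd, ih, map_mul]
    ring

theorem iterateProd_one (n : ℕ) : iterateProd σ' 1 n = 1 := by
  induction n with
  | zero => rfl
  | succ n ih => rw [iterateProd, ih, map_one, mul_one]

theorem iterateSum_add (u r s : E) (n : ℕ) :
    iterateSum σ' u (r + s) n = iterateSum σ' u r n + iterateSum σ' u s n := by
  induction n with
  | zero => simp [iterateSum]
  | succ n ih =>
    rw [iterateSum, iterateSum, iterateSum, ih, map_add]
    ring

theorem iterateSum_smul (hE : IsRPiSigmaExtension σ σ' t) (u r : E) {c : F} (hc : σ c = c) (n : ℕ) :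
    iterateSum σ' u (c • r) n = c • iterateSum σ' u r n := by
  induction n with
  | zero => simp [iterateSum]
  | succ n ih =>
    rw [iterateSum, iterateSum, ih, hE.pow_map_smul, pow_mem_constants_apply hc, smul_add,
      mul_smul_comm]

theorem iterateProd_mem (hE : IsRPiSigmaExtension σ σ' t)
    (hsimple : IsSimpleOver (⊤ : Subgroup Fˣ) σ' t) {u : E} (hu : u ∈ adjoinOver F t (roots t))
    (n : ℕ) : iterateProd σ' u n ∈ adjoinOver F t (roots t) := by
  induction n with
  | zero => exact one_mem _
  | succ n ih => exact mul_mem (hE.pow_map_mem_roots hsimple hu n) ih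

theorem iterateSum_mem (hE : IsRPiSigmaExtension σ σ' t)
    (hsimple : IsSimpleOver (⊤ : Subgroup Fˣ) σ' t) {u r : E} (hu : u ∈ adjoinOver F t (roots t))
    (hr : r ∈ adjoinOver F t (roots t)) (n : ℕ) :
    iterateSum σ' u r n ∈ adjoinOver F t (roots t) := by
  induction n with
  | zero => exact zero_mem _
  | succ n ih =>
    exact add_mem (mul_mem (hE.pow_map_mem_roots hsimple hu n) ih)
      (hE.pow_map_mem_roots hsimple hr n)

section Computable

variable {α : Type*} [Primcodable α] [Primcodable E] [ComputableMul E]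

theorem computable_pow_map (hσ' : Computable σ') (n : ℕ) : Computable (σ' ^ n) := by
  induction n with
  | zero => exact Computable.id.of_eq fun _ => rfl
  | succ n ih => exact (ih.comp hσ').of_eq fun x => by rw [pow_succ, RingAut.mul_apply]

theorem computable_iterateProd (hσ' : Computable σ') (n : ℕ) :
    Computable fun u => iterateProd σ' u n := by
  induction n with
  | zero => exact Computable.const 1
  | succ n ih =>
    have := computable_pow_map hσ' n
    simp only [iterateProd]
    fun_prop

theorem computable_iterateSum [ComputableAdd E] (hσ' : Computable σ') (n : ℕ) :
    Computable fun x : E × E => iterateSum σ' x.1 x.2 n := by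
  induction n with
  | zero => exact Computable.const 0
  | succ n ih =>
    have := computable_pow_map hσ' n
    simp only [iterateSum]
    fun_prop

end Computable

namespace IsRootIdempotent

variable {P : ℕ} {ε : E} (hε : IsRootIdempotent F σ' t P ε)

include hε

/-- Choose a basis monomial that occurs in `ε`. Since `ε * x` is a multiple of `ε`, the factor is
the quotient of the two coordinates there, which is a computable linear functional of `x`. -/
theorem exists_component [Primcodable F] [ComputableMul F] [ComputableInv F]
    [Primcodable E] [ComputableMul E] (hE : IsRPiSigmaExtension σ σ' t)
    (hcoord : Computable fun x : (Fin e → ℤ) × E => hE.coord x.1 x.2) :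
    ∃ φ : E →ₗ[F] F, Computable φ ∧ ∀ x ∈ adjoinOver F t (roots t), ε * x = φ x • ε := by
  obtain ⟨a, ha⟩ : ∃ a, hE.coord a ε ≠ 0 := by
    by_contra! h
    exact hε.ne_zero (hE.eq_zero_of_coord h)
  refine ⟨(hE.coord a ε)⁻¹ • (hE.coord a).comp (LinearMap.mulLeft F ε), ?_, fun x hx => ?_⟩
  · have h1 : Computable fun x : E => hE.coord a (ε * x) :=
      computable_comp₂ (f := fun a x => hE.coord a x) hcoord (by fun_prop) (by fun_prop)
    have h2 : Computable fun x : E => (hE.coord a ε)⁻¹ * hE.coord a (ε * x) := by fun_prop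
    exact h2.of_eq fun _ => rfl
  · obtain ⟨c, hc⟩ := hε.exists_smul x hx
    rw [mul_comm, hc]
    congr 1
    simp only [LinearMap.smul_apply, LinearMap.comp_apply, LinearMap.mulLeft_apply, mul_comm ε, hc,
      map_smul, smul_eq_mul]
    field_simp

variable (hE : IsRPiSigmaExtension σ σ' t) (hsimple : IsSimpleOver (⊤ : Subgroup Fˣ) σ' t)
  {φ : E →ₗ[F] F} (hφ : ∀ x ∈ adjoinOver F t (roots t), ε * x = φ x • ε)

include hφ

theorem component_mul {x y : E} (hx : x ∈ adjoinOver F t (roots t))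
    (hy : y ∈ adjoinOver F t (roots t)) : φ (x * y) = φ x * φ y := by
  apply hε.smul_injective
  rw [← hφ _ (mul_mem hx hy), ← mul_assoc, hφ x hx, smul_mul_assoc, hφ y hy, smul_smul]

theorem component_one : φ 1 = 1 := by
  apply hε.smul_injective
  rw [← hφ _ (one_mem _), mul_one, one_smul]

include hE hsimple

/-- The `P`-th iterate of the equation returns to the component at `ε`, which gives a first order
equation over `(F, σ ^ P)`. -/
theorem component_pow_map {g u r : E} (hg : g ∈ adjoinOver F t (roots t))
    (hu : u ∈ adjoinOver F t (roots t)) (h : σ' g = u * g + r) : (σ ^ P) (φ g) =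
      φ (iterateProd σ' u P) * φ g + φ (iterateSum σ' u r P) := by
  apply hε.smul_injective
  rw [← hε.component_mul hφ (iterateProd_mem hE hsimple hu P) hg, ← map_add, ← pow_map_eq h,
    ← hφ _ (hE.pow_map_mem_roots hsimple hg P), ← hε.period, ← hE.pow_map_smul, ← hφ g hg, map_mul]

/-- The other components are dictated by the recursion `b`, and `hc` says precisely that the
recursion closes up after `P` steps. -/
theorem exists_of_component {u r : E} (hu : u ∈ adjoinOver F t (roots t))
    (hr : r ∈ adjoinOver F t (roots t)) {c : F}
    (hc : (σ ^ P) c = φ (iterateProd σ' u P) * c + φ (iterateSum σ' u r P)) :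
    ∃ g ∈ adjoinOver F t (roots t), σ' g = u * g + r ∧ ε * g = c • ε := by
  let b : ℕ → F := fun j => φ (iterateProd σ' u j) * c + φ (iterateSum σ' u r j)
  have hb0 : b 0 = c := by
    simp only [b, iterateProd, iterateSum, hε.component_one hφ, map_zero, one_mul, add_zero]
  have hb : ∀ j, b (j + 1) = φ ((σ' ^ j) u) * b j + φ ((σ' ^ j) r) := by
    intro j
    simp only [b, iterateProd, iterateSum, map_add]
    rw [hε.component_mul hφ (hE.pow_map_mem_roots hsimple hu j) (iterateProd_mem hE hsimple hu j),
      hε.component_mul hφ (hE.pow_map_mem_roots hsimple hu j) (iterateSum_mem hE hsimple hu hr j)]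
    ring
  obtain ⟨g, hg, hgb⟩ := hε.exists_of_components hE hsimple b
  have hg0 : ε * g = c • ε := by
    have := hgb 0 hε.pos
    rwa [pow_zero, hb0] at this
  -- The value `j = P` is included: it is where the last component leads back to the first.
  have hgP : ∀ j ≤ P, ε * (σ' ^ j) g = b j • ε := by
    intro j hj
    rcases hj.lt_or_eq with h | rfl
    · exact hgb j h
    · conv_lhs => rw [← hε.period, ← map_mul, hg0, hE.pow_map_smul, hc, hε.period]
  refine ⟨g, hg, ?_, hg0⟩
  rw [← sub_eq_zero]
  refine hε.eq_zero_of_mul_eq_zero fun j hj => ?_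
  rw [map_sub, map_add, map_mul, ← RingAut.mul_apply, ← pow_succ, mul_sub, hgP (j + 1) hj, mul_add,
    ← mul_assoc, hφ _ (hE.pow_map_mem_roots hsimple hu j), smul_mul_assoc, hgP j hj.le,
    hφ _ (hE.pow_map_mem_roots hsimple hr j), hb, smul_smul, add_smul, sub_self]

omit hφ hE hsimple in
theorem eq_zero_of_component {g u : E} (h : σ' g = u * g) (h0 : ε * g = 0) : g = 0 := by
  refine hε.eq_zero_of_mul_eq_zero fun j _ => ?_
  have h1 := pow_map_eq (r := 0) (by rw [h, add_zero] : σ' g = u * g + 0) j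
  have h2 : iterateSum σ' u 0 j = 0 := by
    clear h1
    induction j with
    | zero => rfl
    | succ j ih => rw [iterateSum, ih (by omega), map_zero, mul_zero, add_zero]
  rw [h1, h2, add_zero, mul_left_comm, h0, mul_zero]

end IsRootIdempotent

end Root

/-! ### Linear difference equations in the root part -/

section PLDE

universe v

/-- Problem PFLDE in the subring generated by the generators with index in `S`, for right hand
sides with tags. -/
def PLDESolvableOver (F : Type*) [Field F] [Primcodable F] (σ : F ≃+* F) {E : Type v} [CommRing E]
    [Algebra F E] [Primcodable E] (σ' : E ≃+* E) {e : ℕ} (t : Fin e → Generator E)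
    (S : Set (Fin e)) : Prop :=
  ∀ (Z : Type v) [AddCommGroup Z] [Module F Z] [Primcodable Z] [ComputableAdd Z]
    [ComputableNeg Z] [ComputableSMul F Z], Solves
      (fun x : E × List (Z × E) => (∃ u ∈ productGroup (⊤ : Subgroup Fˣ) t, (u : E) = x.1) ∧
        x.1 ∈ adjoinOver F t S ∧ ∀ p ∈ x.2, p.2 ∈ adjoinOver F t S)
      fun x N => ∀ p : Z × E, p ∈ listSpan σ N ↔ p.2 ∈ adjoinOver F t S ∧
        (p.1, σ' p.2 - x.1 * p.2) ∈ listSpan σ x.2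

variable {F : Type*} [Field F] [Primcodable F] [ComputableAdd F] [ComputableNeg F]
  [ComputableMul F] [ComputableInv F] {E : Type v} [CommRing E] [Algebra F E] [Primcodable E]
  [ComputableAdd E] [ComputableNeg E] [ComputableMul E] [ComputableSMul F E] {e : ℕ}
  {σ : F ≃+* F} {σ' : E ≃+* E} {t : Fin e → Generator E}

theorem mem_of_mem_listSpan {Z : Type*} [AddCommGroup Z] [Module F Z] {S : Set (Fin e)}
    {L : List (Z × E)} (hL : ∀ p ∈ L, p.2 ∈ adjoinOver F t S) {p : Z × E}
    (hp : p ∈ listSpan σ L) : p.2 ∈ adjoinOver F t S := by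
  obtain ⟨c, -, rfl⟩ := mem_listSpan_iff_fin.1 hp
  rw [Prod.snd_sum]
  exact sum_mem fun i _ => Subalgebra.smul_mem _ (hL _ (List.get_mem _ _)) _

/-- The right hand side itself is added to the tag, and the problem is handed to the solver over
`(F, σ ^ P)`. A component determines a unique solution of the equation in the root part, which is
found by search; equality of the constants of `σ ^ P` and `σ` makes the spans agree. -/
theorem IsComputableTower.pldeSolvableOver_roots (hC : IsComputableTower F t)
    (hE : IsRPiSigmaExtension σ σ' t)
    (hσ : Computable σ) (hsimple : IsSimpleOver (⊤ : Subgroup Fˣ) σ' t) {P : ℕ} {ε : E}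
    (hε : IsRootIdempotent F σ' t P ε) (hconst : constants (σ ^ P) = constants σ)
    (horacle : PFLDESolvable (id : F → F) (σ ^ P) (⊤ : Subgroup Fˣ)) :
    PLDESolvableOver F σ σ' t (roots t) := by
  intro Z _ _ _ _ _ _
  have hσ' := hC.computable_map hE hσ
  obtain ⟨φ, hφc, hφ⟩ := hε.exists_component hE (hC.computable_coord hE)
  have hU := computable_iterateProd hσ' P
  have hR := computable_iterateSum hσ' P
  have hmem := hC.enumerable_mem_adjoinOver hE (roots t)
  have hsmul : Computable fun c : F => c • ε := by fun_prop
  -- The lifting relation: `q` holds a tag, a right hand side and a component, and `p` holds the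
  -- same tag and a solution with this component.
  let Q : E → (Z × E) × F → Z × E → Prop := fun u q p => (p.1 = q.1.1 ∧ p.2 ∈ adjoinOver F t (roots t)) ∧
    σ' p.2 = u * p.2 + q.1.2 ∧ ε * p.2 = q.2 • ε
  have hQ : Enumerable fun x : (E × List (Z × E)) × ((Z × E) × F) × (Z × E) =>
      Q x.1.1 x.2.1 x.2.2 := by
    refine Enumerable.and (Enumerable.and (Enumerable.eq (by fun_prop) (by fun_prop))
      (hmem.comp (show Computable fun x : (E × List (Z × E)) × ((Z × E) × F) × (Z × E) => x.2.2.2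
        by fun_prop)))
      (Enumerable.and (Enumerable.eq (by fun_prop) (by fun_prop))
        (Enumerable.eq (by fun_prop) (by fun_prop)))
  have hL₀ : Computable fun x : E × List (Z × E) => (φ (iterateProd σ' x.1 P),
      x.2.map fun p => (p, φ (iterateSum σ' x.1 p.2 P))) := by
    refine Computable.pair (by fun_prop) (computable_list_map (by fun_prop) ?_)
    refine Computable.pair (by fun_prop) (hφc.comp ?_)
    exact computable_comp₂ (f := fun u r => iterateSum σ' u r P) hR (by fun_prop) (by fun_prop)
  have h1 := (PFLDESolvable.solves horacle (Z × E)).comp hL₀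
  have h2 : Solves (fun x : (E × List (Z × E)) × List ((Z × E) × F) =>
      ∀ q ∈ x.2, ∃ p, Q x.1.1 q p) fun x N => List.Forall₂ (Q x.1.1) x.2 N := by
    refine Solves.of_enumerable (Enumerable.forall₂ (α := ((E × List (Z × E)) ×
      List ((Z × E) × F)) × List (Z × E)) (R := fun y q p => Q y.1.1.1 q p) ?_
      (by fun_prop) (by fun_prop)) ?_
    · have hproj : Computable fun y : (((E × List (Z × E)) × List ((Z × E) × F)) ×
          List (Z × E)) × ((Z × E) × F) × (Z × E) => (y.1.1.1, y.2) := by fun_prop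
      exact (hQ.comp hproj).of_iff fun _ => Iff.rfl
    · rintro ⟨x, l⟩ h
      simp only at h ⊢
      induction l with
      | nil => exact ⟨[], .nil⟩
      | cons q l ih =>
        obtain ⟨N, hN⟩ := ih fun q hq => h q (List.mem_cons_of_mem _ hq)
        obtain ⟨p, hp⟩ := h q List.mem_cons_self
        exact ⟨p :: N, .cons hp hN⟩
  have hgraph : ∀ u : E, IsConstLinear σ fun p : Z × E => φ (iterateSum σ' u p.2 P) := fun u =>
    ⟨fun p q => by simp [iterateSum_add], fun c hc p => by
      simp [iterateSum_smul hE u _ hc]⟩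
  have hN₀ : ∀ x : E × List (Z × E), ∀ N₀ : List ((Z × E) × F),
      (∀ p : (Z × E) × F, p ∈ listSpan (σ ^ P) N₀ ↔
        (p.1, (σ ^ P) p.2 - φ (iterateProd σ' x.1 P) * p.2) ∈ listSpan (σ ^ P)
          (x.2.map fun p => (p, φ (iterateSum σ' x.1 p.2 P)))) →
      ∀ q : (Z × E) × F, q ∈ listSpan σ N₀ ↔ q.1 ∈ listSpan σ x.2 ∧
        (σ ^ P) q.2 = φ (iterateProd σ' x.1 P) * q.2 + φ (iterateSum σ' x.1 q.1.2 P) := by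
    intro x N₀ h q
    rw [← listSpan_congr hconst, h, listSpan_congr hconst, mem_listSpan_graph (hgraph x.1)]
    refine and_congr_right fun _ => ?_
    rw [eq_sub_iff_add_eq, add_comm, eq_comm]
  -- The oracle wants a nonzero factor. It is nonzero because the inverse of `u` also lies in the
  -- root part and the iterated product is multiplicative.
  have hunit : ∀ x : E, (∃ u ∈ productGroup (⊤ : Subgroup Fˣ) t, (u : E) = x) →
      x ∈ adjoinOver F t (roots t) → φ (iterateProd σ' x P) ≠ 0 := by
    rintro _ ⟨u, hu, rfl⟩ hx h0
    have hmul := hε.component_mul hφ (iterateProd_mem hE hsimple hx P)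
      (iterateProd_mem hE hsimple (hE.inv_mem_of_mem_productGroup hu hx) P)
    rw [← iterateProd_mul, Units.mul_inv, iterateProd_one, hε.component_one hφ, h0, zero_mul] at hmul
    exact one_ne_zero hmul
  refine ((h1.mono (D' := fun x : E × List (Z × E) =>
    (∃ u ∈ productGroup (⊤ : Subgroup Fˣ) t, (u : E) = x.1) ∧ x.1 ∈ adjoinOver F t (roots t) ∧
      ∀ p ∈ x.2, p.2 ∈ adjoinOver F t (roots t)) (fun x hx => hunit x.1 hx.1 hx.2.1)
    fun _ _ _ h => h).bind h2 ?_).mono (fun _ h => h) ?_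
  · intro x N₀ hx h q hq
    obtain ⟨h3, h4⟩ := (hN₀ x N₀ h q).1 (mem_listSpan_of_mem hq)
    obtain ⟨g, hg, hg1, hg2⟩ := hε.exists_of_component hE hsimple hφ hx.2.1
      (mem_of_mem_listSpan hx.2.2 h3) h4
    exact ⟨(q.1.1, g), ⟨rfl, hg⟩, hg1, hg2⟩
  · rintro x N hx ⟨N₀, h, hQN⟩ p
    have hrel : IsConstRel σ (Q x.1) := by
      refine ⟨⟨⟨rfl, zero_mem _⟩, by simp, by simp⟩, ?_, ?_⟩
      · rintro q p q' p' ⟨⟨a1, a2⟩, a3, a4⟩ ⟨⟨b1, b2⟩, b3, b4⟩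
        refine ⟨⟨?_, add_mem a2 b2⟩, ?_, ?_⟩
        · simp [a1, b1]
        · simp only [Prod.snd_add, Prod.fst_add, map_add, a3, b3]
          ring
        · simp only [Prod.snd_add, mul_add, a4, b4, add_smul]
      · rintro c hc q p ⟨⟨a1, a2⟩, a3, a4⟩
        refine ⟨⟨?_, Subalgebra.smul_mem _ a2 c⟩, ?_, ?_⟩
        · simp [a1]
        · simp only [Prod.smul_snd, Prod.smul_fst, hE.map_smul', a3, hc, smul_add, mul_smul_comm]
        · simp only [Prod.smul_snd, mul_smul_comm, a4, smul_smul, smul_eq_mul]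
    obtain ⟨hto, hfrom⟩ := exists_of_forall₂ hrel hQN
    constructor
    · intro hp
      obtain ⟨q, hq, ⟨a1, a2⟩, a3, -⟩ := hfrom p hp
      obtain ⟨h3, -⟩ := (hN₀ x N₀ h q).1 hq
      refine ⟨a2, ?_⟩
      rw [a3, add_sub_cancel_left, a1]
      exact h3
    · rintro ⟨hp, hpW⟩
      have hq := (hN₀ x N₀ h ((p.1, σ' p.2 - x.1 * p.2), φ p.2)).2 ⟨hpW,
        hε.component_pow_map hE hsimple hφ hp hx.2.1 (by ring)⟩
      obtain ⟨p', hp', ⟨a1, a2⟩, a3, a4⟩ := hto _ hq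
      simp only at a1 a3 a4
      -- The solution found by search and the given one have the same component and the same right
      -- hand side, so their difference is a homogeneous solution with component zero.
      have h0 : p'.2 - p.2 = 0 := by
        refine hε.eq_zero_of_component (u := x.1) ?_ ?_
        · rw [map_sub, a3]
          ring
        · rw [mul_sub, a4, hφ _ hp, sub_self]
      have : p' = p := Prod.ext a1 (sub_eq_zero.1 h0)
      rwa [← this]

end PLDE

/-! ### Linear algebra over the integers -/

section IntSpan

variable {Z Y : Type*} [AddCommGroup Z] [AddCommGroup Y]

/-- The subgroup generated by the entries of a list. -/
def intSpan (L : List Z) : AddSubgroup Z := AddSubgroup.closure {z | z ∈ L}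

theorem mem_intSpan_of_mem {L : List Z} {z : Z} (h : z ∈ L) : z ∈ intSpan L :=
  AddSubgroup.subset_closure h

theorem intSpan_le {L : List Z} {p : AddSubgroup Z} : intSpan L ≤ p ↔ ∀ z ∈ L, z ∈ p :=
  AddSubgroup.closure_le _

theorem intSpan_map (f : Z →+ Y) (L : List Z) : intSpan (L.map f) = (intSpan L).map f := by
  rw [intSpan, intSpan, AddMonoidHom.map_closure]
  congr 1
  ext y
  simp

theorem mem_intSpan_iff {L : List Z} {z : Z} : z ∈ intSpan L ↔
    ∃ cs : List ℤ, z = (List.zipWith (fun c y => c • y) cs L).sum := by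
  induction L generalizing z with
  | nil => simp [intSpan]
  | cons y L ih =>
    have : {x | x ∈ y :: L} = {y} ∪ {x | x ∈ L} := by
      ext
      simp
    rw [intSpan, this, AddSubgroup.closure_union, AddSubgroup.mem_sup]
    constructor
    · rintro ⟨a, ha, x, hx, rfl⟩
      obtain ⟨c, rfl⟩ := AddSubgroup.mem_closure_singleton.1 ha
      obtain ⟨cs, rfl⟩ := ih.1 hx
      exact ⟨c :: cs, by simp⟩
    · rintro ⟨cs, rfl⟩
      cases cs with
      | nil => exact ⟨0, zero_mem _, 0, zero_mem _, by simp⟩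
      | cons c cs => exact ⟨c • y, AddSubgroup.mem_closure_singleton.2 ⟨c, rfl⟩, _, ih.2 ⟨cs, rfl⟩,
          by simp⟩

variable [Primcodable Z] [Primcodable Y] [ComputableAdd Z] [ComputableSMul ℤ Z]

theorem enumerable_mem_intSpan {α : Type*} [Primcodable α] {z : α → Z} {L : α → List Z}
    (hz : Computable z) (hL : Computable L) : Enumerable fun a => z a ∈ intSpan (L a) := by
  simp only [mem_intSpan_iff]
  exact Enumerable.exists (p := fun a (cs : List ℤ) =>
    z a = (List.zipWith (fun c y => c • y) cs (L a)).sum) (Enumerable.eq (by fun_prop) (by fun_prop))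

/-- Generators of the group of all `z` with `(z, 0)` in the span of a list can be computed. -/
theorem solves_intNull : Solves (fun _ : List (Z × ℤ) => True)
    fun L N => ∀ z : Z, z ∈ intSpan N ↔ (z, (0 : ℤ)) ∈ intSpan L := by
  -- Division of `p` by a pivot `w`, with quotient `x.1` and remaining tag `x.2`. The last clause
  -- makes the quotient `0` when the pivot has second entry `0`, since it would be undetermined
  -- otherwise.
  let Q : Z × ℤ → Z × ℤ → ℤ × Z → Prop := fun w p x =>
    p = (x.2 + x.1 • w.1, x.1 * w.2) ∧ (w.2 ≠ 0 ∨ x.1 = 0)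
  have hQ : Enumerable fun y : (List (Z × ℤ) × List Z) × (List (ℤ × Z) × (Z × ℤ)) =>
      (y.2.2 ∈ intSpan y.1.1 ∧ y.1.2 = y.2.1.map Prod.snd) ∧
        List.Forall₂ (Q y.2.2) y.1.1 y.2.1 := by
    refine ((enumerable_mem_intSpan (by fun_prop) (by fun_prop)).and
      (Enumerable.eq (by fun_prop) (by fun_prop))).and ?_
    refine Enumerable.forall₂ (R := fun (y : (List (Z × ℤ) × List Z) × (List (ℤ × Z) × (Z × ℤ))) =>
      Q y.2.2) (Enumerable.and (Enumerable.eq (by fun_prop) (by fun_prop))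
      (Enumerable.or (Enumerable.ne (by fun_prop) (by fun_prop))
      (Enumerable.eq (by fun_prop) (by fun_prop)))) (by fun_prop) (by fun_prop)
  refine (Solves.of_enumerable (D := fun _ => True) (P := fun (L : List (Z × ℤ)) (N : List Z) =>
    ∃ y : List (ℤ × Z) × (Z × ℤ), (y.2 ∈ intSpan L ∧ N = y.1.map Prod.snd) ∧
      List.Forall₂ (Q y.2) L y.1) (Enumerable.exists
    (p := fun (x : List (Z × ℤ) × List Z) (y : List (ℤ × Z) × (Z × ℤ)) =>
    (y.2 ∈ intSpan x.1 ∧ x.2 = y.1.map Prod.snd) ∧ List.Forall₂ (Q y.2) x.1 y.1) hQ) ?_).mono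
    (fun _ h => h) ?_
  · intro L _
    -- The second entries generate a cyclic group; an element of the span over its generator divides
    -- all entries of the list.
    obtain ⟨g, hg⟩ := Int.subgroup_cyclic ((intSpan L).map (AddMonoidHom.snd Z ℤ))
    obtain ⟨w, hw, hwg⟩ : ∃ w ∈ intSpan L, w.2 = g := by
      have : g ∈ (intSpan L).map (AddMonoidHom.snd Z ℤ) := by
        rw [hg]
        exact AddSubgroup.subset_closure rfl
      obtain ⟨w, hw, h⟩ := AddSubgroup.mem_map.1 this
      exact ⟨w, hw, h⟩
    have hex : ∀ p ∈ L, ∃ x : ℤ × Z, Q w p x := by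
      intro p hp
      have : p.2 ∈ (intSpan L).map (AddMonoidHom.snd Z ℤ) :=
        AddSubgroup.mem_map.2 ⟨p, mem_intSpan_of_mem hp, rfl⟩
      rw [hg, AddSubgroup.mem_closure_singleton] at this
      obtain ⟨q, hq⟩ := this
      by_cases h0 : w.2 = 0
      · refine ⟨(0, p.1), ?_, Or.inr rfl⟩
        ext
        · simp
        · rw [← hwg, h0, smul_zero] at hq
          simp [← hq]
      · refine ⟨(q, p.1 - q • w.1), ?_, Or.inl h0⟩
        ext
        · simp
        · rw [hwg, ← hq, smul_eq_mul]
    have hlist : ∀ L' : List (Z × ℤ), (∀ p ∈ L', ∃ x, Q w p x) →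
        ∃ M, List.Forall₂ (Q w) L' M := by
      intro L' h
      induction L' with
      | nil => exact ⟨[], .nil⟩
      | cons p L' ih =>
        obtain ⟨M, hM⟩ := ih fun q hq => h q (List.mem_cons_of_mem _ hq)
        obtain ⟨x, hx⟩ := h p List.mem_cons_self
        exact ⟨x :: M, .cons hx hM⟩
    obtain ⟨M, hM⟩ := hlist L hex
    exact ⟨M.map Prod.snd, (M, w), ⟨hw, rfl⟩, hM⟩
  · rintro L N - ⟨⟨M, w⟩, ⟨hw, hN⟩, hM⟩ z
    simp only at hw hN hM
    subst hN
    constructor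
    · have hle : intSpan (M.map Prod.snd) ≤ (intSpan L).comap (AddMonoidHom.inl Z ℤ) := by
        rw [intSpan_le]
        intro n hn
        obtain ⟨x, hx, rfl⟩ := List.mem_map.1 hn
        obtain ⟨p, hp, hpx⟩ : ∃ p ∈ L, Q w p x := by
          clear hw hn
          induction hM with
          | nil => simp at hx
          | cons h1 _ ih =>
            rcases List.mem_cons.1 hx with rfl | hx
            · exact ⟨_, List.mem_cons_self, h1⟩
            · obtain ⟨p, hp, h⟩ := ih hx
              exact ⟨p, List.mem_cons_of_mem _ hp, h⟩
        have h1 : ((x.2, 0) : Z × ℤ) = p - x.1 • w := by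
          rw [hpx.1]
          ext <;> simp
        rw [AddSubgroup.mem_comap, AddMonoidHom.inl_apply, h1]
        exact sub_mem (mem_intSpan_of_mem hp) (zsmul_mem hw _)
      exact fun h => hle h
    · intro h
      have key : ∀ p ∈ intSpan L, ∃ x : ℤ × Z, x.2 ∈ intSpan (M.map Prod.snd) ∧ Q w p x := by
        intro p hp
        induction hp using AddSubgroup.closure_induction with
        | mem p hp =>
          obtain ⟨x, hx, hpx⟩ : ∃ x ∈ M, Q w p x := by
            clear hw h
            induction hM with
            | nil => simp at hp
            | cons h1 _ ih =>
              rcases List.mem_cons.1 hp with rfl | hp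
              · exact ⟨_, List.mem_cons_self, h1⟩
              · obtain ⟨p, hp, h⟩ := ih hp
                exact ⟨p, List.mem_cons_of_mem _ hp, h⟩
          exact ⟨x, mem_intSpan_of_mem (List.mem_map.2 ⟨x, hx, rfl⟩), hpx⟩
        | zero => exact ⟨0, zero_mem _, by ext <;> simp, Or.inr rfl⟩
        | add p q _ _ ihp ihq =>
          obtain ⟨x, hx, hx1, hx2⟩ := ihp
          obtain ⟨y, hy, hy1, hy2⟩ := ihq
          refine ⟨x + y, add_mem hx hy, ?_, ?_⟩
          · rw [hx1, hy1]
            ext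
            · simp only [Prod.fst_add, Prod.snd_add, add_smul]
              abel
            · simp only [Prod.fst_add, Prod.snd_add]
              ring
          · rcases hx2 with h | h
            · exact Or.inl h
            · rcases hy2 with h' | h'
              · exact Or.inl h'
              · exact Or.inr (by simp [h, h'])
        | neg p _ ihp =>
          obtain ⟨x, hx, hx1, hx2⟩ := ihp
          refine ⟨-x, neg_mem hx, ?_, hx2.imp id fun h => by simp [h]⟩
          rw [hx1]
          ext
          · simp only [Prod.fst_neg, Prod.snd_neg, neg_smul]
            abel
          · simp
      obtain ⟨x, hx, hx1, hx2⟩ := key _ h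
      obtain ⟨h1, h2⟩ := Prod.mk.inj hx1
      have h3 : x.1 = 0 := by
        rcases hx2 with h | h
        · exact (mul_eq_zero.1 h2.symm).resolve_right h
        · exact h
      rw [h1, h3, zero_smul, add_zero]
      exact hx

end IntSpan

/-! ### Several integral linear equations -/

section IntNull

instance {n : ℕ} {A : Type*} [Add A] [Primcodable A] [ComputableAdd A] : ComputableAdd (Fin n → A) :=
  ⟨computable_fin_lam fun i => computable_add ((computable_fin_app i).comp Computable.fst)
    ((computable_fin_app i).comp Computable.snd)⟩

instance {n : ℕ} {R A : Type*} [SMul R A] [Primcodable R] [Primcodable A] [ComputableSMul R A] :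
    ComputableSMul R (Fin n → A) :=
  ⟨computable_fin_lam fun i => computable_smul Computable.fst
    ((computable_fin_app i).comp Computable.snd)⟩

theorem solves_intNull_fin (n : ℕ) (Z : Type*) [AddCommGroup Z] [Primcodable Z] [ComputableAdd Z]
    [ComputableSMul ℤ Z] : Solves (fun _ : List (Z × (Fin n → ℤ)) => True)
      fun L N => ∀ z : Z, z ∈ intSpan N ↔ (z, (0 : Fin n → ℤ)) ∈ intSpan L := by
  induction n with
  | zero =>
    refine Solves.of_computable (f := fun L => L.map Prod.fst) (by fun_prop) fun L _ z => ?_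
    rw [show L.map Prod.fst = L.map (AddMonoidHom.fst Z (Fin 0 → ℤ)) from rfl, intSpan_map,
      AddSubgroup.mem_map]
    constructor
    · rintro ⟨⟨x, y⟩, hx, rfl⟩
      rwa [Subsingleton.elim (0 : Fin 0 → ℤ) y]
    · exact fun h => ⟨_, h, rfl⟩
  | succ n ih =>
    have hg : Computable fun L : List (Z × (Fin (n + 1) → ℤ)) =>
        L.map fun p => ((p.1, fun i : Fin n => p.2 i.succ), p.2 0) := by fun_prop
    refine (((solves_intNull (Z := Z × (Fin n → ℤ))).comp hg).bind (ih.comp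
      (g := fun x : List (Z × (Fin (n + 1) → ℤ)) × List (Z × (Fin n → ℤ)) => x.2) (by fun_prop))
      fun _ _ _ _ => trivial).mono (fun _ h => h) ?_
    rintro L N - ⟨M, h1, h2⟩ z
    rw [h2, h1]
    let f : Z × (Fin (n + 1) → ℤ) →+ (Z × (Fin n → ℤ)) × ℤ :=
      { toFun := fun p => ((p.1, fun i : Fin n => p.2 i.succ), p.2 0)
        map_zero' := rfl
        map_add' := fun _ _ => rfl }
    rw [show (L.map fun p => ((p.1, fun i : Fin n => p.2 i.succ), p.2 0)) = L.map f from rfl,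
      intSpan_map, AddSubgroup.mem_map]
    constructor
    · rintro ⟨⟨x, y⟩, hx, h⟩
      obtain ⟨h3, h4⟩ := Prod.mk.inj h
      obtain ⟨h5, h6⟩ := Prod.mk.inj h3
      have : y = 0 := by
        funext i
        refine Fin.cases ?_ (fun j => ?_) i
        · exact h4
        · exact congrFun h6 j
      rw [← this, ← show x = z from h5]
      exact hx
    · exact fun h => ⟨_, h, rfl⟩

end IntNull

/-! ### Bases of truncated lattices -/

section IntBasis

/-- The vector of the first `n` entries. -/
def truncate (n : ℕ) : (ℕ →₀ ℤ) →+ (Fin n → ℤ) where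
  toFun z i := z i
  map_zero' := rfl
  map_add' _ _ := rfl

/-- A left inverse over `ℚ` of the matrix of `b`, with its denominators cleared. It is a finite
integral certificate of independence that can be checked by arithmetic. -/
theorem exists_dual {n d : ℕ} {b : Fin d → Fin n → ℤ} (hb : LinearIndependent ℤ b) :
    ∃ D : ℤ, D ≠ 0 ∧ ∃ w : Fin d → Fin n → ℤ, ∀ i j, ∑ k, w i k * b j k = if i = j then D else 0 := by
  classical
  let ι : (Fin n → ℤ) →ₗ[ℤ] (Fin n → ℚ) :=
    { toFun := fun x k => (x k : ℚ)
      map_add' := fun x y => by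
        ext
        simp
      map_smul' := fun c x => by
        ext
        simp }
  have hι : Function.Injective ι := fun x y h => by
    funext k
    have h' : ((x k : ℤ) : ℚ) = (y k : ℤ) := congrFun h k
    exact_mod_cast h'
  have h1 : LinearIndependent ℚ (ι ∘ b) :=
    (LinearIndependent.iff_fractionRing ℤ ℚ).1 (hb.map' ι (LinearMap.ker_eq_bot.2 hι))
  obtain ⟨g, hg⟩ := LinearMap.exists_leftInverse_of_injective
    (Fintype.linearCombination ℚ (ι ∘ b)) (linearIndependent_iff_injective_fintypeLinearCombination.1
      h1 |> LinearMap.ker_eq_bot.2)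
  have hgb : ∀ j, g (ι (b j)) = Pi.single j 1 := by
    intro j
    have := LinearMap.congr_fun hg (Pi.single j 1)
    simpa [Fintype.linearCombination_apply_single] using this
  let q : Fin d → Fin n → ℚ := fun i k => g (Pi.single k 1) i
  have hq : ∀ i j, ∑ k, q i k * b j k = if i = j then 1 else 0 := by
    intro i j
    have h2 : ι (b j) = ∑ k, (b j k : ℚ) • (Pi.single k 1 : Fin n → ℚ) := by
      funext l
      simp [ι, Finset.sum_apply, Pi.single_apply]
    have h3 := congrFun (hgb j) i
    rw [h2, map_sum, Finset.sum_apply] at h3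
    simp only [map_smul, Pi.smul_apply, smul_eq_mul, Pi.single_apply] at h3
    rw [← h3]
    exact Finset.sum_congr rfl fun k _ => mul_comm _ _
  -- A common multiple of all denominators.
  let D : ℤ := ∏ i, ∏ k, ((q i k).den : ℤ)
  have hD : ∀ i k, ∃ w : ℤ, (w : ℚ) = D * q i k := by
    intro i k
    have hdvd : ((q i k).den : ℤ) ∣ D :=
      (Finset.dvd_prod_of_mem (fun k => ((q i k).den : ℤ)) (Finset.mem_univ k)).trans
        (Finset.dvd_prod_of_mem (fun i => ∏ k, ((q i k).den : ℤ)) (Finset.mem_univ i))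
    obtain ⟨c, hc⟩ := hdvd
    refine ⟨c * (q i k).num, ?_⟩
    rw [hc]
    push_cast
    rw [mul_assoc, mul_left_comm, Rat.den_mul_eq_num]
  choose w hw using hD
  refine ⟨D, Finset.prod_ne_zero_iff.2 fun i _ => Finset.prod_ne_zero_iff.2 fun k _ => by simp, w,
    fun i j => ?_⟩
  have : ((∑ k, w i k * b j k : ℤ) : ℚ) = D * ∑ k, q i k * b j k := by
    push_cast
    rw [Finset.mul_sum]
    refine Finset.sum_congr rfl fun k _ => ?_
    rw [hw, mul_assoc]
  rw [hq] at this
  split_ifs with h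
  · rw [if_pos h, mul_one] at this
    exact_mod_cast this
  · rw [if_neg h, mul_zero] at this
    exact_mod_cast this

theorem linearIndependent_of_dual {n d : ℕ} {b w : Fin d → Fin n → ℤ} {D : ℤ} (hD : D ≠ 0)
    (h : ∀ i j, ∑ k, w i k * b j k = if i = j then D else 0) : LinearIndependent ℤ b := by
  rw [Fintype.linearIndependent_iff]
  intro c hc i
  have h1 : ∑ j, c j * ∑ k, w i k * b j k = 0 := by
    simp only [Finset.mul_sum]
    rw [Finset.sum_comm]
    refine Finset.sum_eq_zero fun k _ => ?_
    have := congrFun hc k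
    simp only [Finset.sum_apply, Pi.smul_apply, smul_eq_mul, Pi.zero_apply] at this
    calc ∑ j, c j * (w i k * b j k) = w i k * ∑ j, c j * b j k := by
          rw [Finset.mul_sum]
          exact Finset.sum_congr rfl fun j _ => by ring
      _ = 0 := by rw [this, mul_zero]
  simp only [h, mul_ite, mul_zero, Finset.sum_ite_eq, Finset.mem_univ, if_true] at h1
  exact (mul_eq_zero.1 h1).resolve_right hD

theorem sum_zipWith_ofFn {n : ℕ} (x y : Fin n → ℤ) :
    (List.zipWith (fun a b => a * b) (List.ofFn x) (List.ofFn y)).sum = ∑ k, x k * y k := by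
  rw [← List.sum_ofFn]
  congr 1
  refine List.ext_get (by simp) fun n h1 h2 => ?_
  simp

/-- The vector of the first `n` entries, filled up with zeros. -/
noncomputable def cutoff (n : ℕ) (z : ℕ →₀ ℤ) : ℕ →₀ ℤ := ofList ((List.range n).map fun i => z i)

@[fun_prop]
theorem computable_cutoff {α : Type*} [Primcodable α] {n : α → ℕ} {z : α → ℕ →₀ ℤ}
    (hn : Computable n) (hz : Computable z) : Computable fun a => cutoff (n a) (z a) := by
  unfold cutoff
  fun_prop

theorem cutoff_eq (n : ℕ) (z : ℕ →₀ ℤ) : cutoff n z = ofList (List.ofFn (truncate n z)) := by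
  unfold cutoff
  congr 1
  refine List.ext_get (by simp) fun k h1 h2 => ?_
  simp only [List.get_eq_getElem, List.getElem_map, List.getElem_range, List.getElem_ofFn]
  rfl

/-- `y` certifies that the vectors in `B` are a basis of the group generated by `L`, truncated. -/
def IsBasisCertificate (n : ℕ) (L : List (ℕ →₀ ℤ)) (B : List (List ℤ)) (y : ℤ × List (List ℤ)) :
    Prop :=
  ((∀ b ∈ B, b.length = n ∧ ofList b ∈ intSpan (L.map (cutoff n))) ∧
    ∀ z ∈ L, cutoff n z ∈ intSpan (B.map ofList)) ∧
  y.1 ≠ 0 ∧ (∀ b ∈ y.2, b.length = n) ∧ y.2.length = B.length ∧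
    ∀ i < B.length, ∀ j < B.length,
      (List.zipWith (fun a b => a * b) (y.2.getD i []) (B.getD j [])).sum = if i = j then y.1 else 0

theorem enumerable_isBasisCertificate {α : Type*} [Primcodable α] {n : α → ℕ}
    {L : α → List (ℕ →₀ ℤ)} {B : α → List (List ℤ)} {y : α → ℤ × List (List ℤ)}
    (hn : Computable n) (hL : Computable L) (hB : Computable B) (hy : Computable y) :
    Enumerable fun a => IsBasisCertificate (n a) (L a) (B a) (y a) := by
  have hc : Computable fun x : ℕ × (ℕ →₀ ℤ) => cutoff x.1 x.2 := by fun_prop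
  have hLc : Computable fun a => (L a).map (cutoff (n a)) :=
    Computable.list_map hL (g := fun a z => cutoff (n a) z)
      (show Computable fun x : α × (ℕ →₀ ℤ) => cutoff (n x.1) x.2 by fun_prop)
  have hBc : Computable fun a => (B a).map ofList := by fun_prop
  refine Enumerable.and (Enumerable.and ?_ ?_) (Enumerable.and (Enumerable.ne (by fun_prop)
    (by fun_prop)) (Enumerable.and ?_ (Enumerable.and (Enumerable.eq (by fun_prop) (by fun_prop)) ?_)))
  · exact Enumerable.ball_mem (p := fun a (b : List ℤ) => b.length = n a ∧
      ofList b ∈ intSpan ((L a).map (cutoff (n a)))) (Enumerable.and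
        (Enumerable.eq (by fun_prop) (by fun_prop))
        (enumerable_mem_intSpan (by fun_prop) (hLc.comp Computable.fst))) hB
  · exact Enumerable.ball_mem (p := fun a z => cutoff (n a) z ∈ intSpan ((B a).map ofList))
      (enumerable_mem_intSpan (by fun_prop) (hBc.comp Computable.fst)) hL
  · exact Enumerable.ball_mem (p := fun a (b : List ℤ) => b.length = n a)
      (Enumerable.eq (by fun_prop) (by fun_prop)) (by fun_prop)
  · refine Enumerable.ball_lt (p := fun a i => ∀ j < (B a).length, (List.zipWith (fun a b => a * b)
        ((y a).2.getD i []) ((B a).getD j [])).sum = if i = j then (y a).1 else 0) ?_ (by fun_prop)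
    exact Enumerable.ball_lt (p := fun (x : α × ℕ) j => (List.zipWith (fun a b => a * b)
        ((y x.1).2.getD x.2 []) ((B x.1).getD j [])).sum = if x.2 = j then (y x.1).1 else 0)
        (Enumerable.eq (by fun_prop) (by fun_prop)) (by fun_prop)

/-- The vector with the given first `n` entries, filled up with zeros. -/
noncomputable def extend (n : ℕ) : (Fin n → ℤ) →+ (ℕ →₀ ℤ) where
  toFun x := ofList (List.ofFn x)
  map_zero' := by
    ext i
    by_cases h : i < n <;> simp [List.getD_eq_getElem?_getD, h]
  map_add' x y := by
    ext i
    by_cases h : i < n <;> simp [List.getD_eq_getElem?_getD, h]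

theorem extend_injective (n : ℕ) : Function.Injective (extend n) := by
  intro x y h
  funext i
  have := DFunLike.congr_fun h (i : ℕ)
  simpa [extend, List.getD_eq_getElem?_getD] using this

theorem intSpan_ofFn {Z : Type*} [AddCommGroup Z] {d : ℕ} (b : Fin d → Z) :
    intSpan (List.ofFn b) = AddSubgroup.closure (Set.range b) := by
  rw [intSpan]
  congr 1
  ext v
  simp [List.mem_ofFn]

theorem mem_intSpan_ofFn_iff {Z : Type*} [AddCommGroup Z] {d : ℕ} {b : Fin d → Z} {z : Z} :
    z ∈ intSpan (List.ofFn b) ↔ z ∈ Submodule.span ℤ (Set.range b) := by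
  rw [intSpan_ofFn, ← Submodule.span_int_eq_addSubgroupClosure, Submodule.mem_toAddSubgroup]

/-- A basis of the truncation of a lattice can be computed from generators. -/
theorem solves_intBasis : Solves (fun _ : ℕ × List (ℕ →₀ ℤ) => True)
    fun x out => ∃ (d : ℕ) (b : Fin d → Fin x.1 → ℤ), IsBasisOf ℤ b
      {m | ∃ z ∈ intSpan x.2, truncate x.1 z = m} ∧
      out = List.ofFn fun k => List.ofFn (b k) := by
  have hmap : ∀ (n : ℕ) (L : List (ℕ →₀ ℤ)), intSpan (L.map (cutoff n)) =
      ((intSpan L).map (truncate n)).map (extend n) := by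
    intro n L
    rw [AddSubgroup.map_map, ← intSpan_map]
    congr 1
    exact List.map_congr_left fun z _ => cutoff_eq n z
  refine (Solves.of_enumerable (D := fun _ => True) (P := fun x out => ∃ y, IsBasisCertificate x.1 x.2 out y)
    (Enumerable.exists (p := fun (x : (ℕ × List (ℕ →₀ ℤ)) × List (List ℤ)) y =>
      IsBasisCertificate x.1.1 x.1.2 x.2 y) (enumerable_isBasisCertificate (by fun_prop) (by fun_prop)
      (by fun_prop) (by fun_prop))) ?_).mono (fun _ h => h) ?_
  · rintro ⟨n, L⟩ -
    -- A basis and its certificate exist because subgroups of `ℤ ^ n` are free; the algorithm only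
    -- has to search for them.
    let M : Submodule ℤ (Fin n → ℤ) := AddSubgroup.toIntSubmodule ((intSpan L).map (truncate n))
    obtain ⟨d, ⟨b⟩⟩ := Submodule.nonempty_basis_of_pid (Pi.basisFun ℤ (Fin n)) M
    let b' : Fin d → Fin n → ℤ := fun k => (b k : Fin n → ℤ)
    have hind : LinearIndependent ℤ b' := b.linearIndependent.map' M.subtype (by simp)
    have hspan : Submodule.span ℤ (Set.range b') = M := by
      have := congrArg (Submodule.map M.subtype) b.span_eq
      rw [Submodule.map_span, Submodule.map_top, Submodule.range_subtype, ← Set.range_comp] at this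
      exact this
    obtain ⟨D, hD, w, hw⟩ := exists_dual hind
    refine ⟨List.ofFn fun k => List.ofFn (b' k), (D, List.ofFn fun k => List.ofFn (w k)),
      ⟨fun v hv => ?_, fun z hz => ?_⟩, hD, ?_, by simp, ?_⟩
    · obtain ⟨k, rfl⟩ := List.mem_ofFn.1 hv
      refine ⟨by simp, ?_⟩
      simp only
      rw [hmap]
      exact AddSubgroup.mem_map.2 ⟨b' k, (b k).2, rfl⟩
    · have h1 : truncate n z ∈ Submodule.span ℤ (Set.range b') := by
        rw [hspan]
        exact AddSubgroup.mem_map.2 ⟨z, mem_intSpan_of_mem hz, rfl⟩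
      simp only
      rw [cutoff_eq, List.map_ofFn]
      change extend n (truncate n z) ∈ intSpan (List.ofFn fun k => extend n (b' k))
      generalize truncate n z = v at h1
      induction h1 using Submodule.span_induction with
      | mem x hx =>
        obtain ⟨k, rfl⟩ := hx
        exact mem_intSpan_of_mem (List.mem_ofFn.2 ⟨k, rfl⟩)
      | zero => rw [map_zero]; exact zero_mem _
      | add x y _ _ hx hy => rw [map_add]; exact add_mem hx hy
      | smul c x _ hx => rw [map_zsmul]; exact zsmul_mem hx c
    · intro v hv
      obtain ⟨k, rfl⟩ := List.mem_ofFn.1 hv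
      simp
    · intro i hi j hj
      simp only [List.length_ofFn] at hi hj
      have h1 := hw ⟨i, hi⟩ ⟨j, hj⟩
      rw [← sum_zipWith_ofFn] at h1
      simp only [List.getD_eq_getElem?_getD, List.getElem?_ofFn, hi, hj, dif_pos, Option.getD_some]
      simpa using h1
  · rintro ⟨n, L⟩ out - ⟨⟨D, W⟩, ⟨h1, h2⟩, hD, h3, h4, h5⟩
    simp only at h1 h2 hD h3 h4 h5
    let b : Fin out.length → Fin n → ℤ := fun k i => (out.get k).get (i.cast (h1 _ (List.get_mem _ _)).1.symm)
    have hout : ∀ k, List.ofFn (b k) = out.get k := fun k =>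
      List.ext_get (by rw [List.length_ofFn, (h1 _ (List.get_mem out k)).1]) fun i hi hi' => by simp [b]
    let w : Fin out.length → Fin n → ℤ := fun k i => (W.get (k.cast h4.symm)).get
      (i.cast (h3 _ (List.get_mem _ _)).symm)
    have hW : ∀ k, List.ofFn (w k) = W.get (k.cast h4.symm) := fun k =>
      List.ext_get (by rw [List.length_ofFn, h3 _ (List.get_mem W (k.cast h4.symm))]) fun i hi hi' => by simp [w]
    have hout' : out = List.ofFn fun k => List.ofFn (b k) := by
      simp only [hout]
      exact (List.ofFn_get out).symm
    refine ⟨out.length, b, ⟨linearIndependent_of_dual hD (w := w) fun i j => ?_, ?_⟩, hout'⟩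
    · have := h5 i i.2 j j.2
      rw [← sum_zipWith_ofFn, hW, hout]
      simp only [List.getD_eq_getElem?_getD] at this
      rw [List.getElem?_eq_getElem (by rw [h4]; exact i.2), List.getElem?_eq_getElem j.2] at this
      simpa [Fin.ext_iff] using this
    · have hspan : intSpan (out.map ofList) = ((intSpan L).map (truncate n)).map (extend n) := by
        rw [← hmap]
        refine le_antisymm (intSpan_le.2 fun v hv => ?_) (intSpan_le.2 fun v hv => ?_)
        · obtain ⟨b, hb, rfl⟩ := List.mem_map.1 hv
          exact (h1 b hb).2
        · obtain ⟨z, hz, rfl⟩ := List.mem_map.1 hv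
          exact h2 z hz
      have hspan' : intSpan (out.map ofList) = (AddSubgroup.closure (Set.range b)).map (extend n) := by
        have h8 : out.map ofList = (List.ofFn b).map (extend n) := by
          conv_lhs => rw [hout']
          rw [List.map_ofFn, List.map_ofFn]
          rfl
        rw [h8, intSpan_map, intSpan_ofFn]
      have h6 := AddSubgroup.map_injective (extend_injective n) (hspan'.symm.trans hspan)
      ext m
      rw [SetLike.mem_coe, ← mem_intSpan_ofFn_iff, intSpan_ofFn, h6, AddSubgroup.mem_map]
      rfl

end IntBasis

/-! ### Which terms are quotients within the root part -/

section MultiplicativeRelations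

variable {F : Type*} [Field F] {E : Type*} [CommRing E] [Algebra F E] {e : ℕ}
  {σ : F ≃+* F} {σ' : E ≃+* E} {t : Fin e → Generator E}

theorem unitMonomial_zero (t : Fin e → Generator E) : unitMonomial t 0 = 1 := by
  simp [unitMonomial]

theorem unitMonomial_add (t : Fin e → Generator E) (a b : Fin e → ℤ) :
    unitMonomial t (a + b) = unitMonomial t a * unitMonomial t b := by
  simp [unitMonomial, zpow_add, Finset.prod_mul_distrib]

/-- The element `h * t ^ a` of the product group. -/
def termUnit (t : Fin e → Generator E) (h : Fˣ) (a : Fin e → ℤ) : Eˣ :=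
  Units.map (algebraMap F E : F →* E) h * unitMonomial t a

/-- The homomorphism that sends `(h, a)` to `h * t ^ a`. -/
def termHom (F : Type*) [Field F] {E : Type*} [CommRing E] [Algebra F E] {e : ℕ}
    (t : Fin e → Generator E) : Fˣ × Multiplicative (Fin e → ℤ) →* Eˣ where
  toFun x := termUnit t x.1 x.2.toAdd
  map_one' := by
    change termUnit t 1 0 = 1
    rw [termUnit, unitMonomial_zero, map_one, one_mul]
  map_mul' x y := by
    change termUnit t (x.1 * y.1) (x.2.toAdd + y.2.toAdd) = _
    rw [termUnit, unitMonomial_add, map_mul, mul_mul_mul_comm]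
    rfl

theorem termUnit_mul (h h' : Fˣ) (a a' : Fin e → ℤ) :
    termUnit t (h * h') (a + a') = termUnit t h a * termUnit t h' a' :=
  map_mul (termHom F t) (h, Multiplicative.ofAdd a) (h', Multiplicative.ofAdd a')

theorem termUnit_prod_zpow {n : ℕ} (h : Fin n → Fˣ) (a : Fin n → Fin e → ℤ) (m : Fin n → ℤ) :
    termUnit t (∏ i, h i ^ m i) (∑ i, m i • a i) = ∏ i, termUnit t (h i) (a i) ^ m i := by
  have h1 : ∏ i, termUnit t (h i) (a i) ^ m i =
      termHom F t (∏ i, (h i, Multiplicative.ofAdd (a i)) ^ m i) := by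
    rw [map_prod]
    exact Finset.prod_congr rfl fun i _ =>
      (map_zpow (termHom F t) (h i, Multiplicative.ofAdd (a i)) (m i)).symm
  have h2 : (∏ i, (h i, Multiplicative.ofAdd (a i)) ^ m i : Fˣ × Multiplicative (Fin e → ℤ)) =
      (∏ i, h i ^ m i, Multiplicative.ofAdd (∑ i, m i • a i)) := by
    refine Prod.ext ?_ ?_
    · rw [Prod.fst_prod]
      rfl
    · rw [Prod.snd_prod]
      change ∏ i, Multiplicative.ofAdd (a i) ^ m i = Multiplicative.ofAdd (∑ i, m i • a i)
      rw [ofAdd_sum]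
      rfl
  rw [h1, h2]
  rfl

theorem termUnit_mem (h : Fˣ) (a : Fin e → ℤ) :
    termUnit t h a ∈ productGroup (⊤ : Subgroup Fˣ) t := ⟨h, trivial, a, rfl⟩

theorem coe_termUnit (h : Fˣ) (a : Fin e → ℤ) :
    (termUnit t h a : E) = (h : F) • (unitMonomial t a : E) := by
  rw [termUnit, Units.val_mul, Algebra.smul_def]
  rfl

theorem iterateSum_zero (u : E) (n : ℕ) : iterateSum σ' u 0 n = 0 := by
  induction n with
  | zero => rfl
  | succ n ih => rw [iterateSum, ih, mul_zero, map_zero, add_zero]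

theorem iterateProd_algebraMap (hE : IsRPiSigmaExtension σ σ' t) (h : F) (n : ℕ) :
    iterateProd σ' (algebraMap F E h) n = algebraMap F E (iterateProd σ h n) := by
  induction n with
  | zero => exact (map_one _).symm
  | succ n ih =>
    have := hE.pow_map_smul n h 1
    rw [map_one, Algebra.smul_def, mul_one, Algebra.smul_def, mul_one] at this
    rw [iterateProd, iterateProd, ih, this, map_mul]

theorem iterateProd_ne_zero {h : F} (hh : h ≠ 0) (n : ℕ) : iterateProd σ h n ≠ 0 := by
  induction n with
  | zero => exact one_ne_zero
  | succ n ih => exact mul_ne_zero ((map_ne_zero_iff _ (σ ^ n).injective).2 hh) ih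

theorem iterateProd_of_map_eq {c : F} (hc : σ c = c) (n : ℕ) : iterateProd σ c n = c ^ n := by
  induction n with
  | zero => exact (_root_.pow_zero _).symm
  | succ n ih => rw [iterateProd, ih, pow_mem_constants_apply hc, pow_succ']

/-- Telescoping: both sides are the product of `(σ ^ j) h` for `j ≤ n`. -/
theorem map_iterateProd_mul (h : F) (n : ℕ) :
    σ (iterateProd σ h n) * h = (σ ^ n) h * iterateProd σ h n := by
  induction n with
  | zero => simp [iterateProd]
  | succ n ih =>
    rw [iterateProd, map_mul, mul_assoc, ih, pow_succ', RingAut.mul_apply]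

variable (t) in
/-- The part of an exponent vector that belongs to the roots of unity. -/
noncomputable def rootPart (a : Fin e → ℤ) : Fin e → ℤ := by
  classical
  exact fun j => if (t j).IsRoot then a j else 0

theorem rootPart_add (a b : Fin e → ℤ) : rootPart t (a + b) = rootPart t a + rootPart t b := by
  funext j
  by_cases h : (t j).IsRoot <;> simp [rootPart, h]

theorem rootPart_apply_eq_zero {a : Fin e → ℤ} {j : Fin e} (hj : j ∉ roots t) :
    rootPart t a j = 0 := by
  have : ¬ (t j).IsRoot := hj
  simp [rootPart, this]

theorem unitMonomial_rootPart {a : Fin e → ℤ} (ha : ∀ j, (t j).IsPi → a j = 0) :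
    unitMonomial t (rootPart t a) = unitMonomial t a := by
  refine Finset.prod_congr rfl fun j _ => ?_
  have h1 := ha j
  unfold rootPart
  generalize t j = g at h1 ⊢
  cases g <;> simp_all [Generator.IsRoot, Generator.IsPi, Generator.unitPart]

namespace IsRootIdempotent

variable {P : ℕ} {ε : E} (hε : IsRootIdempotent F σ' t P ε)
variable (hE : IsRPiSigmaExtension σ σ' t) (hsimple : IsSimpleOver (⊤ : Subgroup Fˣ) σ' t)
  {φ : E →ₗ[F] F} (hφ : ∀ x ∈ adjoinOver F t (roots t), ε * x = φ x • ε)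

include hε hE hsimple hφ

theorem component_iterateProd_mul {u v : E} (hu : u ∈ adjoinOver F t (roots t))
    (hv : v ∈ adjoinOver F t (roots t)) : φ (iterateProd σ' (u * v) P) =
      φ (iterateProd σ' u P) * φ (iterateProd σ' v P) := by
  rw [iterateProd_mul, hε.component_mul hφ (iterateProd_mem hE hsimple hu P)
    (iterateProd_mem hE hsimple hv P)]

theorem component_iterateProd_smul (h : F) {u : E} (hu : u ∈ adjoinOver F t (roots t)) :
    φ (iterateProd σ' (h • u) P) = iterateProd σ h P * φ (iterateProd σ' u P) := by
  rw [Algebra.smul_def, hε.component_iterateProd_mul hE hsimple hφ (Subalgebra.algebraMap_mem _ h) hu,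
    iterateProd_algebraMap hE, Algebra.algebraMap_eq_smul_one, map_smul, hε.component_one hφ,
    smul_eq_mul, mul_one]

theorem component_iterateProd_pow {u : E} (hu : u ∈ adjoinOver F t (roots t)) (n : ℕ) :
    φ (iterateProd σ' (u ^ n) P) = φ (iterateProd σ' u P) ^ n := by
  induction n with
  | zero => rw [_root_.pow_zero, _root_.pow_zero, iterateProd_one, hε.component_one hφ]
  | succ n ih => rw [pow_succ, pow_succ, hε.component_iterateProd_mul hE hsimple hφ (pow_mem hu n) hu,
      ih]

/-- The multiplicative functional `a ↦ φ (∏ σ ^ j (t ^ a))` is given by discrete logarithms. -/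
theorem exists_discreteLog : ∃ ζ : Fˣ, (∃ N, 0 < N ∧ (ζ : F) ^ N = 1) ∧
    (∀ z : F, (∃ a, z ^ P = φ (iterateProd σ' (unitMonomial t (rootPart t a) : E) P)) →
      ∃ n : ℤ, z = (ζ ^ n : Fˣ)) ∧
    ∃ d : Fin e → ℤ, ∀ a : Fin e → ℤ,
      φ (iterateProd σ' (unitMonomial t (rootPart t a) : E) P) = (ζ ^ ∑ j, a j * d j : Fˣ) := by
  set Λ := ∏ j, (t j).order with hΛ
  have hΛ0 : 0 < Λ := hE.order_pos
  let δ : (Fin e → ℤ) → F := fun a => φ (iterateProd σ' (unitMonomial t (rootPart t a) : E) P)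
  have hmem : ∀ a, (unitMonomial t (rootPart t a) : E) ∈ adjoinOver F t (roots t) := fun a =>
    hE.unitMonomial_mem fun j hj => rootPart_apply_eq_zero hj
  have hδΛ : ∀ a, δ a ^ Λ = 1 := by
    intro a
    change φ (iterateProd σ' (unitMonomial t (rootPart t a) : E) P) ^ Λ = 1
    rw [← hε.component_iterateProd_pow hE hsimple hφ (hmem a),
      coe_unitMonomial fun j hj => rootPart_apply_eq_zero ?_, hE.monomial_pow_order fun j hj =>
        rootPart_apply_eq_zero hj, iterateProd_one, hε.component_one hφ]
    intro hr
    change (t j).IsRoot at hr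
    revert hj hr
    cases t j <;> simp [Generator.IsRoot, Generator.IsSigma]
  have hadd : ∀ a b, δ (a + b) = δ a * δ b := by
    intro a b
    change φ (iterateProd σ' (unitMonomial t (rootPart t (a + b)) : E) P) = _
    rw [rootPart_add, unitMonomial_add, Units.val_mul,
      hε.component_iterateProd_mul hE hsimple hφ (hmem a) (hmem b)]
  -- The values of the functional are `Λ`-th roots of unity, so their `P`-th roots are `P * Λ`-th
  -- roots of unity. These form a finite cyclic group, and `ζ` is a generator.
  have : NeZero (P * Λ) := ⟨(mul_pos hε.pos hΛ0).ne'⟩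
  obtain ⟨ζ, hζ⟩ := IsCyclic.exists_generator (α := rootsOfUnity (P * Λ) F)
  have key : ∀ z : F, z ^ (P * Λ) = 1 → ∃ n : ℤ, z = ((ζ : Fˣ) ^ n : Fˣ) := by
    intro z hz
    obtain ⟨n, hn⟩ := hζ (rootsOfUnity.mkOfPowEq z hz)
    refine ⟨n, ?_⟩
    have := congrArg (fun x : rootsOfUnity (P * Λ) F => ((x : Fˣ) : F)) hn
    simpa using this.symm
  have hδ1 : ∀ a, δ a ^ (P * Λ) = 1 := fun a => by rw [mul_comm, pow_mul, hδΛ, one_pow]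
  choose d hd using fun j => key _ (hδ1 (Pi.single j 1))
  refine ⟨ζ, ⟨P * Λ, mul_pos hε.pos hΛ0, ?_⟩, ?_, d, ?_⟩
  · have := ζ.2
    rw [mem_rootsOfUnity'] at this
    exact this
  · rintro z ⟨a, ha⟩
    refine key z ?_
    rw [pow_mul, ha]
    exact hδΛ a
  · let δ' : (Fin e → ℤ) →+ Additive Fˣ := AddMonoidHom.mk' (fun a =>
      Additive.ofMul (Units.mk0 (δ a) fun h => by
        have := hδΛ a
        rw [h, zero_pow hΛ0.ne'] at this
        exact zero_ne_one this)) fun a b => by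
          refine congrArg Additive.ofMul (Units.ext ?_)
          exact hadd a b
    let ψ : (Fin e → ℤ) →+ Additive Fˣ := AddMonoidHom.mk' (fun a =>
      Additive.ofMul ((ζ : Fˣ) ^ ∑ j, a j * d j)) fun a b => by
        rw [← ofMul_mul, ← zpow_add, ← Finset.sum_add_distrib]
        simp [add_mul]
    have h1 : δ'.toIntLinearMap = ψ.toIntLinearMap := by
      refine LinearMap.pi_ext' fun j => LinearMap.ext_ring ?_
      refine congrArg Additive.ofMul (Units.ext ?_)
      change δ (Pi.single j 1) = ((ζ : Fˣ) ^ ∑ k, (Pi.single j 1 : Fin e → ℤ) k * d k : Fˣ)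
      rw [hd j]
      simp [Pi.single_apply]
    intro a
    exact congrArg (fun x : Additive Fˣ => ((Additive.toMul x : Fˣ) : F)) (LinearMap.congr_fun h1 a)

/-- When a term is, up to a factor in the ground field, the quotient `σ ρ / ρ` of an element of the
root of unity part. -/
theorem exists_root_iff (hstable : StrongConstantStable σ) (h : Fˣ) (a : Fin e → ℤ) :
    (∃ ρ ∈ adjoinOver F t (roots t), ρ ≠ 0 ∧ σ' ρ = termUnit t h a * ρ) ↔
      (∀ j, (t j).IsPi → a j = 0) ∧ ∃ b : F, σ b = b ∧
        b ^ P = φ (iterateProd σ' (unitMonomial t (rootPart t a) : E) P) ∧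
        ∃ c : F, c ≠ 0 ∧ σ c = h * b * c := by
  set δ := φ (iterateProd σ' (unitMonomial t (rootPart t a) : E) P) with hδ
  have hmem : (unitMonomial t (rootPart t a) : E) ∈ adjoinOver F t (roots t) :=
    hE.unitMonomial_mem fun j hj => rootPart_apply_eq_zero hj
  have hu : ∀ x : F, x • (unitMonomial t (rootPart t a) : E) ∈ adjoinOver F t (roots t) :=
    fun x => Subalgebra.smul_mem _ hmem x
  have hprod : φ (iterateProd σ' ((h : F) • (unitMonomial t (rootPart t a) : E)) P) =
      iterateProd σ (h : F) P * δ := hε.component_iterateProd_smul hE hsimple hφ _ hmem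
  constructor
  · rintro ⟨ρ, hρ, hρ0, heq⟩
    -- Both `ρ` and its image are free of `t j`, while a nonzero exponent would place `σ' ρ` at the
    -- power `a j`. Coefficients are taken over the ring generated by all other generators.
    have hpi : ∀ j, (t j).IsPi → a j = 0 := by
      intro j hj
      by_contra hne
      have hj' : j ∉ ({j}ᶜ : Set (Fin e)) := by simp
      have hsub : adjoinOver F t (roots t) ≤ adjoinOver F t ({j}ᶜ) := adjoinOver_mono t (by
        rintro k hk rfl
        change (t k).IsRoot at hk
        revert hj hk
        cases t k <;> simp [Generator.IsRoot, Generator.IsPi])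
      set y : Eˣ := termUnit t h (Function.update a j 0) with hy
      have hyS : (y : E) ∈ adjoinOver F t ({j}ᶜ) := by
        rw [hy, coe_termUnit]
        refine Subalgebra.smul_mem _ (hE.unitMonomial_mem fun k hk => ?_) _
        have : k = j := by simpa using hk
        rw [this, Function.update_self]
      have hsplit : termUnit t h a = y * (t j).unitPart ^ a j := by
        have h1 : a = Function.update a j 0 + Pi.single j (a j) := by
          funext k
          by_cases hk : k = j
          · subst hk
            simp
          · simp [hk]
        conv_lhs => rw [h1, ← mul_one h]
        rw [termUnit_mul, hy]
        congr 1
        rw [termUnit, map_one, one_mul, unitMonomial, Finset.prod_eq_single j]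
        · simp
        · intro k _ hk
          simp [hk]
        · simp
      have hsg : ¬ (t j).IsSigma := by
        revert hj
        cases t j <;> simp [Generator.IsSigma, Generator.IsPi]
      have hex : (t j).IsExponent (a j) := by
        revert hj
        cases t j <;> simp [Generator.IsExponent, Generator.IsPi]
      have h2 : σ' ρ = y * ρ * (t j).pow (a j) := by
        rw [heq, hsplit, Units.val_mul, Generator.unitPart_pow_eq hsg]
        ring
      have h3 := hE.coeff_of_mem hj' (hsub (hE.map_mem_adjoinOver_roots hsimple hρ)) (a j)
      rw [h2, hE.coeff_mul_pow hj' (mul_mem hyS (hsub hρ)) _ hex, if_pos rfl, if_neg hne] at h3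
      exact hρ0 (by simpa using h3)
    refine ⟨hpi, ?_⟩
    have heq' : σ' ρ = ((h : F) • (unitMonomial t (rootPart t a) : E)) * ρ + 0 := by
      rw [add_zero, heq, coe_termUnit, unitMonomial_rootPart hpi]
    have h4 := hε.component_pow_map hE hsimple hφ hρ (hu _) heq'
    rw [iterateSum_zero, map_zero, add_zero, hprod] at h4
    have hc0 : φ ρ ≠ 0 := fun h0 => hρ0 (hε.eq_zero_of_component (g := ρ)
      (by rw [heq', add_zero]) (by rw [hφ ρ hρ, h0, zero_smul]))
    set c := φ ρ
    have hσc : σ c ≠ 0 := (map_ne_zero_iff _ σ.injective).2 hc0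
    have hH : iterateProd σ (h : F) P ≠ 0 := iterateProd_ne_zero h.ne_zero P
    have hδ0 : δ ≠ 0 := by
      rintro h0
      rw [h0, mul_zero, zero_mul, map_eq_zero_iff _ (σ ^ P).injective] at h4
      exact hc0 h4
    -- `δ` is a power of `ζ`, hence a root of unity and a constant.
    have hσδ : σ δ = δ := by
      obtain ⟨ζ, ⟨N, hN, hζ⟩, -, d, hd⟩ := hε.exists_discreteLog hE hsimple hφ
      refine hstable.2 δ ⟨N, hN, ?_⟩
      rw [hδ, hd, ← Units.val_pow_eq_pow_val, ← zpow_natCast, ← zpow_mul, mul_comm, zpow_mul,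
        zpow_natCast]
      have : ζ ^ N = 1 := Units.ext (by simpa using hζ)
      rw [this, one_zpow, Units.val_one]
    have hσσ : (σ ^ P) (σ c) = σ ((σ ^ P) c) := by
      rw [← RingAut.mul_apply, ← RingAut.mul_apply, ← pow_succ, ← pow_succ']
    have hhP : (σ ^ P) (h : F) ≠ 0 := (map_ne_zero_iff _ (σ ^ P).injective).2 h.ne_zero
    -- The defect `σ c / (h * c)` is invariant under `σ ^ P`, because the iterates of `c` differ
    -- from `c` by the iterated product of `h` and the constant `δ`. Constant-stability makes it a
    -- constant of `σ`.
    have hb : (σ ^ P) (σ c / (h * c)) = σ c / (h * c) := by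
      rw [map_div₀, map_mul, hσσ, h4, map_mul, map_mul, hσδ, div_eq_div_iff
        (mul_ne_zero hhP (mul_ne_zero (mul_ne_zero hH hδ0) hc0)) (mul_ne_zero h.ne_zero hc0)]
      linear_combination (δ * σ c * c) * map_iterateProd_mul (σ := σ) (h : F) P
    have hb' : σ (σ c / (h * c)) = σ c / (h * c) := by
      have h5 : σ c / (h * c) ∈ constants (σ ^ P) := hb
      rw [hstable.1 P hε.pos] at h5
      exact h5
    have h6 : σ c = (h * (σ c / (h * c))) * c := by
      field_simp
    refine ⟨σ c / (h * c), hb', ?_, c, hc0, h6⟩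
    -- Iterating `σ c = h * b * c` for `P` steps and comparing with the earlier formula for `(σ ^ P)
    -- c` gives `b ^ P = δ`.
    have h7 := pow_map_eq (σ' := σ) (g := c) (u := h * (σ c / (h * c))) (r := 0)
      (by rw [add_zero]; exact h6) P
    rw [iterateSum_zero, add_zero, iterateProd_mul, iterateProd_of_map_eq hb', h4] at h7
    exact (mul_left_cancel₀ hH (mul_right_cancel₀ hc0 h7)).symm
  · rintro ⟨hpi, b, hb, hbP, c, hc0, hc⟩
    have h7 := pow_map_eq (σ' := σ) (g := c) (u := h * b) (r := 0) (by rw [add_zero]; exact hc) P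
    rw [iterateSum_zero, add_zero, iterateProd_mul, iterateProd_of_map_eq hb, hbP, ← hprod] at h7
    obtain ⟨g, hg, h8, h9⟩ := hε.exists_of_component hE hsimple hφ (hu (h : F)) (zero_mem _) (c := c)
      (by rw [iterateSum_zero, map_zero, add_zero]; exact h7)
    refine ⟨g, hg, ?_, ?_⟩
    · rintro rfl
      rw [mul_zero] at h9
      exact hc0 (hε.smul_injective (by rw [← h9, zero_smul]))
    · rw [h8, add_zero, coe_termUnit, unitMonomial_rootPart hpi]

end IsRootIdempotent

end MultiplicativeRelations

/-! ### Problem PMT in the ground field with additional linear conditions -/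

section Oracle

variable {F : Type*} [Field F] [Primcodable F] {σ : F ≃+* F}

theorem PMTSolvable.solves (h : PMTSolvable (id : F → F) σ (⊤ : Subgroup Fˣ)) :
    Solves (fun L : List F => ∀ x ∈ L, x ≠ 0) fun L (out : List (List ℤ)) =>
      ∀ (n : ℕ) (f : Fin n → Fˣ), L = List.ofFn (fun i => (f i : F)) →
        ∃ (d : ℕ) (b : Fin d → Fin n → ℤ), IsBasisOf ℤ b (multRelations σ f) ∧
          out = List.ofFn fun k => List.ofFn (b k) := by
  obtain ⟨-, alg, halg, h⟩ := h
  refine Solves.of_partrec halg fun L hL => ?_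
  obtain ⟨out, hout, -⟩ := h L L.length (fun i => Units.mk0 (L.get i) (hL _ (List.get_mem _ _)))
    (fun _ => trivial) (by simp)
  refine ⟨out, hout, fun n f hf => ?_⟩
  obtain ⟨out', hout', d, b, hb, h'⟩ := h L n f (fun _ => trivial) (by rw [List.map_id, hf])
  exact ⟨d, b, hb, (Part.mem_unique hout hout').trans h'⟩

/-- The lattice of all relations in the ground field on which further linear forms vanish,
restricted to the first `n` coordinates. -/
theorem PMTSolvable.solves_linear [ComputableMul F] (h : PMTSolvable (id : F → F) σ (⊤ : Subgroup Fˣ))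
    (q : ℕ) : Solves (fun x : ℕ × List (F × (Fin q → ℤ)) => ∀ p ∈ x.2, p.1 ≠ 0)
      fun x (out : List (List ℤ)) => ∀ (k : ℕ) (f : Fin k → Fˣ) (w : Fin k → Fin q → ℤ),
        x.2 = List.ofFn (fun i => ((f i : F), w i)) →
        ∃ (d : ℕ) (b : Fin d → Fin x.1 → ℤ), IsBasisOf ℤ b {m | ∃ m' : Fin k → ℤ,
          m' ∈ multRelations σ f ∧ ∑ i, m' i • w i = 0 ∧ truncate x.1 (extend k m') = m} ∧
          out = List.ofFn fun k => List.ofFn (b k) := by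
  have h1 := h.solves.comp (g := fun x : ℕ × List (F × (Fin q → ℤ)) => x.2.map Prod.fst)
    (by fun_prop)
  -- Each basis relation is tagged by itself and takes as value its linear forms, so the null space
  -- consists of the relations on which all forms vanish. The zero-padded tags have one type for all
  -- lengths.
  have hg : Computable fun y : (ℕ × List (F × (Fin q → ℤ))) × List (List ℤ) => y.2.map fun v =>
      (ofList v, (List.zipWith (fun (c : ℤ) (p : F × (Fin q → ℤ)) => c • p.2) v y.1.2).sum) := by
    fun_prop
  have h2 := (solves_intNull_fin q (ℕ →₀ ℤ)).comp hg
  have h3 := solves_intBasis.comp (g := fun z : ((ℕ × List (F × (Fin q → ℤ))) × List (List ℤ)) ×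
    List (ℕ →₀ ℤ) => (z.1.1.1, z.2)) (by fun_prop)
  refine (h1.bind (h2.bind h3 fun _ _ _ _ => trivial) fun _ _ _ _ => trivial).mono ?_ ?_
  · rintro ⟨n, L⟩ hL x hx
    obtain ⟨p, hp, rfl⟩ := List.mem_map.1 hx
    exact hL p hp
  · rintro ⟨n, L⟩ out - ⟨out₀, h4, N, h5, h6⟩ k f w hfw
    simp only at hfw h4 h5 h6
    obtain ⟨d, b, hb, rfl⟩ := h4 k f (by rw [hfw, List.map_ofFn]; rfl)
    let G : (Fin k → ℤ) →+ (ℕ →₀ ℤ) × (Fin q → ℤ) := (extend k).prod (AddMonoidHom.mk'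
      (fun m => ∑ i, m i • w i) fun a b => by simp [add_smul, Finset.sum_add_distrib])
    have hM : ((List.ofFn fun k => List.ofFn (b k)).map fun v => (ofList v, (List.zipWith
        (fun (c : ℤ) (p : F × (Fin q → ℤ)) => c • p.2) v L).sum)) = (List.ofFn b).map G := by
      rw [List.map_ofFn, List.map_ofFn]
      congr 1
      funext j
      refine Prod.ext rfl ?_
      change (List.zipWith _ (List.ofFn (b j)) L).sum = ∑ i, b j i • w i
      rw [hfw, ← List.sum_ofFn]
      congr 1
      refine List.ext_get (by simp) fun n h1 h2 => ?_
      simp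
    have hN : ∀ z, z ∈ intSpan N ↔ ∃ m' : Fin k → ℤ, m' ∈ multRelations σ f ∧
        ∑ i, m' i • w i = 0 ∧ extend k m' = z := by
      intro z
      rw [h5, hM, intSpan_map, AddSubgroup.mem_map]
      constructor
      · rintro ⟨m, hm, hz⟩
        obtain ⟨rfl, h8⟩ := Prod.mk.inj hz
        refine ⟨m, ?_, h8, rfl⟩
        rw [← hb.2]
        exact mem_intSpan_ofFn_iff.1 hm
      · rintro ⟨m, hm, h8, rfl⟩
        rw [← hb.2] at hm
        exact ⟨m, mem_intSpan_ofFn_iff.2 hm, Prod.ext rfl h8⟩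
    obtain ⟨d', b', hb', rfl⟩ := h6
    refine ⟨d', b', ⟨hb'.1, hb'.2.trans ?_⟩, rfl⟩
    ext m
    constructor
    · rintro ⟨z, hz, rfl⟩
      obtain ⟨m', h7, h8, rfl⟩ := (hN z).1 hz
      exact ⟨m', h7, h8, rfl⟩
    · rintro ⟨m', h7, h8, rfl⟩
      exact ⟨_, (hN _).2 ⟨m', h7, h8, rfl⟩, rfl⟩

end Oracle

/-! ### A criterion in terms of the ground field -/

section Relations

variable {F : Type*} [Field F] {E : Type*} [CommRing E] [Algebra F E] {e : ℕ}
  {σ : F ≃+* F} {σ' : E ≃+* E} {t : Fin e → Generator E}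

theorem map_unitMonomial {u : Fin e → Eˣ}
    (hu : ∀ j, (t j).IsPi → σ' ((t j).unitPart : E) = u j * ((t j).unitPart : E))
    {b : Fin e → ℤ} (hb : ∀ j, ¬ (t j).IsPi → b j = 0) :
    σ' (unitMonomial t b : E) = ((∏ j, u j ^ b j : Eˣ) : E) * (unitMonomial t b : E) := by
  simp only [unitMonomial, Units.coe_prod, map_prod, ← Finset.prod_mul_distrib]
  refine Finset.prod_congr rfl fun j _ => ?_
  by_cases hj : (t j).IsPi
  · exact map_zpow_of_map_eq (hu j hj) _
  · simp [hb j hj]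

namespace IsRPiSigmaExtension

variable (hE : IsRPiSigmaExtension σ σ' t) (hsimple : IsSimpleOver (⊤ : Subgroup Fˣ) σ' t)

include hE hsimple

/-- A solution is a unit of the root part times a Π-monomial. Dividing by the latter moves the
quotients `u j` with integral exponents to the other side and leaves an equation in the root part.
-/
theorem exists_map_eq_iff [CharZero F] (hroot : RootsOfUnityConstant σ) {u : Fin e → Eˣ}
    (hu : ∀ j, (t j).IsPi → σ' ((t j).unitPart : E) = u j * ((t j).unitPart : E))
    (hu1 : ∀ j, ¬ (t j).IsPi → u j = 1) {v : Eˣ} (hv : v ∈ productGroup (⊤ : Subgroup Fˣ) t) :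
    (∃ g, g ≠ 0 ∧ σ' g = v * g) ↔ ∃ b : Fin e → ℤ, ∃ ρ ∈ adjoinOver F t (roots t), ρ ≠ 0 ∧
      σ' ρ = ((v * ∏ j, u j ^ b j : Eˣ) : E) * ρ := by
  classical
  constructor
  · rintro ⟨g, hg0, hg⟩
    obtain ⟨ρ, hρ, ρ', -, hρρ, b, hb, -, rfl⟩ := hE.isSemimonomial_univ hsimple hroot hg0 hv hg
    refine ⟨-b, ρ, hρ, ?_, ?_⟩
    · rintro rfl
      simp at hg0
    · rw [map_mul, map_unitMonomial hu hb] at hg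
      have h1 : σ' ρ * ((∏ j, u j ^ b j : Eˣ) : E) = v * ρ :=
        (unitMonomial t b).isUnit.mul_right_cancel (by linear_combination hg)
      have h2 : ∏ j, u j ^ (-b) j = (∏ j, u j ^ b j)⁻¹ := by simp
      rw [h2, Units.val_mul, mul_right_comm, ← h1, mul_assoc, Units.mul_inv, mul_one]
  · rintro ⟨b, ρ, hρ, hρ0, h⟩
    -- The given exponents at generators of other types are harmless, since `u j = 1` there; they
    -- are dropped.
    let b' : Fin e → ℤ := fun j => if (t j).IsPi then - b j else 0
    have hb' : ∏ j, u j ^ b' j = (∏ j, u j ^ b j)⁻¹ := by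
      rw [← Finset.prod_inv_distrib]
      refine Finset.prod_congr rfl fun j _ => ?_
      by_cases hj : (t j).IsPi
      · simp [b', hj]
      · simp [hu1 j hj]
    refine ⟨ρ * (unitMonomial t b' : E), fun h0 => hρ0 (by simpa using h0), ?_⟩
    rw [map_mul, h, map_unitMonomial hu (b := b') fun j hj => by simp [b', hj], hb', Units.val_mul]
    have := Units.mul_inv (∏ j, u j ^ b j)
    linear_combination (v * ρ * (unitMonomial t b' : E)) * this

theorem exists_quotients : ∃ (h : Fin e → Fˣ) (a : Fin e → Fin e → ℤ),
    (∀ j, (t j).IsPi → σ' ((t j).unitPart : E) = termUnit t (h j) (a j) * ((t j).unitPart : E)) ∧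
      ∀ j, ¬ (t j).IsPi → termUnit t (h j) (a j) = 1 := by
  have : ∀ j, ∃ (h : Fˣ) (a : Fin e → ℤ),
      ((t j).IsPi → σ' ((t j).unitPart : E) = termUnit t h a * ((t j).unitPart : E)) ∧
      (¬ (t j).IsPi → termUnit t h a = 1) := by
    intro j
    by_cases hj : (t j).IsPi
    · have h1 := hsimple j
      cases hg : t j with
      | pi τ =>
        rw [hg] at h1
        obtain ⟨u, ⟨h, -, m, rfl⟩, h2⟩ := h1
        exact ⟨h, m, fun _ => h2, fun h3 => absurd (hg ▸ hj) h3⟩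
      | _ => simp [hg, Generator.IsPi] at hj
    · exact ⟨1, 0, fun h => absurd h hj, fun _ => by rw [termUnit, unitMonomial_zero]; simp⟩
  choose h a h1 h2 using this
  exact ⟨h, a, h1, h2⟩

/-- Whether a term is a quotient `σ g / g` is a question on multiplicative relations in the ground
field and on linear forms in the exponents. -/
theorem exists_linear_criterion [CharZero F] (hstable : StrongConstantStable σ) {P : ℕ} {ε : E}
    (hε : IsRootIdempotent F σ' t P ε) {φ : E →ₗ[F] F}
    (hφ : ∀ x ∈ adjoinOver F t (roots t), ε * x = φ x • ε) :
    ∃ (k : ℕ) (f : Fin k → Fˣ) (w : Fin k → Fin (e + 1) → ℤ) (ℓ : (Fin e → ℤ) →+ (Fin (e + 1) → ℤ)),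
      Computable ℓ ∧ ∀ (h : Fˣ) (a : Fin e → ℤ),
        (∃ g, g ≠ 0 ∧ σ' g = termUnit t h a * g) ↔ ∃ m : Fin k → ℤ,
          ℓ a + ∑ i, m i • w i = 0 ∧ ∃ c : F, c ≠ 0 ∧ σ c = ((h * ∏ i, f i ^ m i : Fˣ) : F) * c := by
  classical
  obtain ⟨uh, ua, hu, hu1⟩ := hE.exists_quotients hsimple
  obtain ⟨ζ, ⟨N, hN, hζN⟩, hζ, d, hd⟩ := hε.exists_discreteLog hE hsimple hφ
  -- The first entry is the discrete logarithm of the root part of the term; the others are the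
  -- Π-exponents, which have to vanish.
  let ℓ : (Fin e → ℤ) →+ (Fin (e + 1) → ℤ) := AddMonoidHom.mk' (fun a =>
    Fin.cons (∑ j, a j * d j) fun j => if (t j).IsPi then a j else 0) fun a b => by
      funext i
      refine Fin.cases ?_ (fun j => ?_) i
      · simp [add_mul, Finset.sum_add_distrib]
      · by_cases hj : (t j).IsPi <;> simp [hj]
  have hℓ : Computable ℓ := by
    refine computable_fin_lam fun i => ?_
    refine Fin.cases ?_ (fun j => ?_) i
    · change Computable fun a : Fin e → ℤ => ∑ j, a j * d j
      exact computable_fin_sum _ fun j => by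
        have := computable_fin_app (β := ℤ) j
        fun_prop
    · by_cases hj : (t j).IsPi
      · exact (computable_fin_app (β := ℤ) j).of_eq fun a => by simp [ℓ, hj]
      · exact (Computable.const (0 : ℤ)).of_eq fun a => by simp [ℓ, hj]
  have hζσ : ∀ n : ℤ, σ ((ζ ^ n : Fˣ) : F) = ((ζ ^ n : Fˣ) : F) := by
    intro n
    refine hstable.2 _ ⟨N, hN, ?_⟩
    rw [← Units.val_pow_eq_pow_val, ← zpow_natCast, ← zpow_mul, mul_comm, zpow_mul, zpow_natCast,
      show ζ ^ N = 1 from Units.ext (by simpa using hζN), one_zpow, Units.val_one]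
  let v0 : Fin (e + 1) → ℤ := Pi.single 0 1
  -- The auxiliary exponents are those of the `e` quotients of the Π-monomials, the exponent `n`
  -- with `b = ζ ^ n`, and a multiple `y` of the order of `ζ`. The condition `b ^ P = δ` becomes one
  -- linear equation because the last unknown, attached to the field element `1`, absorbs the
  -- congruence.
  refine ⟨e + 2, Fin.append uh ![ζ, 1], Fin.append (fun j => ℓ (ua j))
    ![(-P : ℤ) • v0, (orderOf ζ : ℤ) • v0], ℓ, hℓ, fun h a => ?_⟩
  have hstep : ∀ b : Fin e → ℤ, ((∃ ρ ∈ adjoinOver F t (roots t), ρ ≠ 0 ∧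
      σ' ρ = ((termUnit t h a * ∏ j, termUnit t (uh j) (ua j) ^ b j : Eˣ) : E) * ρ) ↔
      ∃ n y : ℤ, (ℓ a + ∑ j, b j • ℓ (ua j)) + (n • (-P : ℤ) • v0 + y • (orderOf ζ : ℤ) • v0) = 0 ∧
        ∃ c : F, c ≠ 0 ∧ σ c = ((h * ((∏ j, uh j ^ b j) * ζ ^ n) : Fˣ) : F) * c) := by
    intro b
    rw [← termUnit_prod_zpow, ← termUnit_mul, hε.exists_root_iff hE hsimple hφ hstable, hd]
    have hℓa : ℓ a + ∑ j, b j • ℓ (ua j) = ℓ (a + ∑ j, b j • ua j) := by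
      rw [map_add, map_sum]
      simp only [map_zsmul]
    rw [hℓa]
    generalize a + ∑ j, b j • ua j = A at *
    have hvec : ∀ n y : ℤ, ℓ A + (n • (-P : ℤ) • v0 + y • (orderOf ζ : ℤ) • v0) = 0 ↔
        (∑ j, A j * d j) - n * P + y * orderOf ζ = 0 ∧ ∀ j, (t j).IsPi → A j = 0 := by
      intro n y
      constructor
      · intro h0
        refine ⟨?_, fun j hj => ?_⟩
        · have := congrFun h0 0
          simp [ℓ, v0] at this
          linarith
        · have := congrFun h0 j.succ
          simpa [ℓ, v0, hj] using this
      · rintro ⟨h1, h2⟩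
        funext i
        refine Fin.cases ?_ (fun j => ?_) i
        · simp [ℓ, v0]
          linarith
        · by_cases hj : (t j).IsPi
          · simp [ℓ, v0, hj, h2 j hj]
          · simp [ℓ, v0, hj]
    simp only [hvec]
    constructor
    · rintro ⟨hpi, β, hβ, hβP, c, hc0, hc⟩
      obtain ⟨n, rfl⟩ := hζ β ⟨A, by rw [hβP, hd]⟩
      have h1 : ζ ^ (n * P) = ζ ^ ∑ j, A j * d j := by
        refine Units.ext ?_
        rw [← hβP, zpow_mul, zpow_natCast, Units.val_pow_eq_pow_val]
      obtain ⟨y, hy⟩ := (zpow_eq_zpow_iff_modEq.1 h1).symm.dvd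
      refine ⟨n, y, ⟨by linarith, hpi⟩, c, hc0, ?_⟩
      rw [hc]
      push_cast
      ring
    · rintro ⟨n, y, ⟨h1, hpi⟩, c, hc0, hc⟩
      refine ⟨hpi, _, hζσ n, ?_, c, hc0, ?_⟩
      · rw [← Units.val_pow_eq_pow_val, ← zpow_natCast, ← zpow_mul]
        refine congrArg Units.val (zpow_eq_zpow_iff_modEq.2 (Int.ModEq.symm ?_))
        exact Int.modEq_iff_dvd.2 ⟨y, by linarith⟩
      · rw [hc]
        push_cast
        ring
  rw [hE.exists_map_eq_iff hsimple hstable.2 hu hu1 (termUnit_mem h a)]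
  simp only [hstep]
  constructor
  · rintro ⟨b, n, y, h1, h2⟩
    refine ⟨Fin.append b ![n, y], ?_, ?_⟩
    · rw [Fin.sum_univ_add]
      simpa [add_assoc] using h1
    · rw [Fin.prod_univ_add]
      simpa using h2
  · rintro ⟨m, h1, h2⟩
    refine ⟨fun j => m (Fin.castAdd 2 j), m (Fin.natAdd e 0), m (Fin.natAdd e 1), ?_, ?_⟩
    · rw [Fin.sum_univ_add] at h1
      simpa [add_assoc] using h1
    · rw [Fin.prod_univ_add] at h2
      simpa using h2

end IsRPiSigmaExtension

end Relations

/-! ### Problem PMT in the tower -/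

section PMT

variable {F : Type*} [Field F] [CharZero F] [Primcodable F] [ComputableAdd F] [ComputableNeg F]
  [ComputableMul F] [ComputableInv F] {E : Type*} [CommRing E] [Algebra F E] {e : ℕ}
  {σ : F ≃+* F} {σ' : E ≃+* E} {t : Fin e → Generator E}

/-- By `exists_linear_criterion` the lattice is the projection to the given coordinates of a lattice
of relations in `F` with linear side conditions: the coefficients of the terms are followed by the
fixed auxiliary elements. -/
theorem IsRPiSigmaExtension.solves_termRelations (hE : IsRPiSigmaExtension σ σ' t)
    (hsimple : IsSimpleOver (⊤ : Subgroup Fˣ) σ' t) (hstable : StrongConstantStable σ)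
    {P : ℕ} {ε : E} (hε : IsRootIdempotent F σ' t P ε) {φ : E →ₗ[F] F}
    (hφ : ∀ x ∈ adjoinOver F t (roots t), ε * x = φ x • ε)
    (hPMT : PMTSolvable (id : F → F) σ (⊤ : Subgroup Fˣ)) :
    Solves (fun x : ℕ × List (F × (Fin e → ℤ)) => ∀ p ∈ x.2, p.1 ≠ 0)
      fun x (out : List (List ℤ)) => ∀ (h : Fin x.1 → Fˣ) (a : Fin x.1 → Fin e → ℤ),
        x.2 = List.ofFn (fun i => ((h i : F), a i)) → ∃ (d : ℕ) (b : Fin d → Fin x.1 → ℤ),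
          IsBasisOf ℤ b (multRelations σ' fun i => termUnit t (h i) (a i)) ∧
          out = List.ofFn fun k => List.ofFn (b k) := by
  obtain ⟨k, f, w, ℓ, hℓ, hcrit⟩ := hE.exists_linear_criterion hsimple hstable hε hφ
  have hg : Computable fun x : ℕ × List (F × (Fin e → ℤ)) =>
      (x.1, (x.2.map fun p => (p.1, ℓ p.2)) ++ List.ofFn fun i => ((f i : F), w i)) := by
    have : Computable fun p : F × (Fin e → ℤ) => ℓ p.2 := hℓ.comp Computable.snd
    have h2 : Computable fun x : ℕ × List (F × (Fin e → ℤ)) => x.2.map fun p => (p.1, ℓ p.2) :=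
      computable_list_map (by fun_prop) (Computable.pair (by fun_prop)
        (hℓ.comp (show Computable fun x : (ℕ × List (F × (Fin e → ℤ))) × (F × (Fin e → ℤ)) => x.2.2
          by fun_prop)))
    fun_prop
  refine ((hPMT.solves_linear (e + 1)).comp hg).mono ?_ ?_
  · rintro ⟨n, L⟩ hL p hp
    rcases List.mem_append.1 hp with hp | hp
    · obtain ⟨q, hq, rfl⟩ := List.mem_map.1 hp
      exact hL q hq
    · obtain ⟨i, rfl⟩ := List.mem_ofFn.1 hp
      exact (f i).ne_zero
  · rintro ⟨n, L⟩ out - hout h a hL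
    simp only at h a hL hout
    obtain ⟨d, b, ⟨hb, hspan⟩, rfl⟩ := hout (n + k) (Fin.append h f)
      (Fin.append (fun i => ℓ (a i)) w) (by
        rw [hL, List.map_ofFn, ← List.ofFn_fin_append]
        congr 1
        funext i
        refine Fin.addCases (fun i => ?_) (fun i => ?_) i <;> simp)
    refine ⟨d, b, ⟨hb, hspan.trans ?_⟩, rfl⟩
    ext m
    have htr : ∀ m' : Fin (n + k) → ℤ, truncate n (extend (n + k) m') = fun i =>
        m' (Fin.castAdd k i) := by
      intro m'
      funext i
      have hi : (i : ℕ) < n + k := by omega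
      change (List.ofFn m').getD i 0 = _
      rw [List.getD_eq_getElem?_getD, List.getElem?_ofFn, dif_pos hi]
      rfl
    have h1 : m ∈ multRelations σ' (fun i => termUnit t (h i) (a i)) ↔
        ∃ g, g ≠ 0 ∧ σ' g = termUnit t (∏ i, h i ^ m i) (∑ i, m i • a i) * g := by
      rw [termUnit_prod_zpow]
      rfl
    rw [h1, hcrit, map_sum]
    simp only [map_zsmul]
    constructor
    · rintro ⟨m', ⟨c, hc0, hc⟩, h2, h3⟩
      rw [htr] at h3
      subst h3
      refine ⟨fun j => m' (Fin.natAdd n j), ?_, c, hc0, ?_⟩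
      · rw [Fin.sum_univ_add] at h2
        simpa using h2
      · rw [Fin.prod_univ_add] at hc
        simpa using hc
    · rintro ⟨m₂, h2, c, hc0, hc⟩
      refine ⟨Fin.append m m₂, ⟨c, hc0, ?_⟩, ?_, ?_⟩
      · rw [Fin.prod_univ_add]
        simpa using hc
      · rw [Fin.sum_univ_add]
        simpa using h2
      · rw [htr]
        funext i
        simp

variable [Primcodable E] (hC : IsComputableTower F t)

include hC

theorem IsComputableTower.enumerable_isTerm {α : Type*} [Primcodable α] {x : α → E}
    {p : α → F × (Fin e → ℤ)} (hx : Computable x) (hp : Computable p) :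
    Enumerable fun y => (p y).1 ≠ 0 ∧ (∀ j, (t j).IsSigma → (p y).2 j = 0) ∧
      x y = (p y).1 • monomial t (p y).2 := by
  have := hC.smul
  have hmon : Computable fun y => monomial t (p y).2 := hC.computable_monomial.comp (by fun_prop)
  refine Enumerable.and (Enumerable.ne (by fun_prop) (by fun_prop)) (Enumerable.and
    (Enumerable.forall_fin fun j => ?_) (Enumerable.eq (by fun_prop) (by fun_prop)))
  by_cases hj : (t j).IsSigma
  · exact (Enumerable.eq ((computable_fin_app j).comp (Computable.snd.comp hp))
      (Computable.const 0)).of_iff fun y => by simp [hj]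
  · exact (Enumerable.const True).of_iff fun y => by simp [hj]

theorem IsComputableTower.pmtSolvable (hE : IsRPiSigmaExtension σ σ' t)
    (hsimple : IsSimpleOver (⊤ : Subgroup Fˣ) σ' t) (hstable : StrongConstantStable σ)
    (hPMT : PMTSolvable (id : F → F) σ (⊤ : Subgroup Fˣ)) :
    PMTSolvable (DifferenceRing.value (F := F) t) σ' (productGroup (⊤ : Subgroup Fˣ) t) := by
  refine ⟨hE.semiconstantsFormGroup hsimple hstable.2, ?_⟩
  obtain ⟨P, ε, hε⟩ := hE.exists_isRootIdempotent hsimple hstable.2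
  have := hC.mul hE
  obtain ⟨φ, -, hφ⟩ := hε.exists_component hE (hC.computable_coord hE)
  -- Inputs are arbitrary names, so a presentation as a single term without Σ-monomials is found by
  -- search.
  let Q : Name F e → F × (Fin e → ℤ) → Prop := fun l p => p.1 ≠ 0 ∧
    (∀ j, (t j).IsSigma → p.2 j = 0) ∧ DifferenceRing.value t l = p.1 • monomial t p.2
  have h1 : Solves (fun fs : List (Name F e) => ∀ l ∈ fs, ∃ p, Q l p) fun fs ps =>
      List.Forall₂ Q fs ps := by
    refine Solves.of_enumerable (Enumerable.forall₂ (α := List (Name F e) ×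
      List (F × (Fin e → ℤ))) (R := fun _ l p => Q l p) ?_ (by fun_prop) (by fun_prop)) ?_
    · exact hC.enumerable_isTerm (hC.value.comp (show Computable fun y :
        (List (Name F e) × List (F × (Fin e → ℤ))) × Name F e × F × (Fin e → ℤ) => y.2.1
          by fun_prop)) (by fun_prop)
    · intro fs h
      induction fs with
      | nil => exact ⟨[], .nil⟩
      | cons l fs ih =>
        obtain ⟨ps, hps⟩ := ih fun l hl => h l (List.mem_cons_of_mem _ hl)
        obtain ⟨p, hp⟩ := h l List.mem_cons_self
        exact ⟨p :: ps, .cons hp hps⟩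
  have h2 := h1.bind ((hE.solves_termRelations hsimple hstable hε hφ hPMT).comp
    (g := fun x : List (Name F e) × List (F × (Fin e → ℤ)) => (x.2.length, x.2)) (by fun_prop))
    fun fs ps _ hps p hp => by
      obtain ⟨i, rfl⟩ := List.get_of_mem hp
      exact ((List.forall₂_iff_get.1 hps).2 i (hps.length_eq.symm ▸ i.2) i.2).1
  obtain ⟨alg, halg, h3⟩ := h2.exists_partrec
  refine ⟨alg, halg, fun fs n f hf hfs => ?_⟩
  have hlen : fs.length = n := by simpa using congrArg List.length hfs
  obtain ⟨out, hout, ps, hps, h4⟩ := h3 fs fun l hl => by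
    obtain ⟨i, hi⟩ := List.mem_ofFn.1 (hfs ▸ List.mem_map_of_mem (f := DifferenceRing.value t) hl)
    obtain ⟨c, hc, a, ha, ha', h5⟩ := hE.exists_of_mem_productGroup (hf i)
    exact ⟨(c, a), hc, ha', by rw [← hi, h5]⟩
  refine ⟨out, hout, ?_⟩
  have hlen' : ps.length = n := by rw [← hps.length_eq, hlen]
  subst hlen'
  have hQ : ∀ i : Fin ps.length, Q (fs.get (i.cast hlen.symm)) (ps.get i) := fun i =>
    (List.forall₂_iff_get.1 hps).2 i _ i.2
  obtain ⟨d, b, hb, hout'⟩ := h4 (fun i => Units.mk0 (ps.get i).1 (hQ i).1) (fun i => (ps.get i).2)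
    (List.ofFn_get ps).symm
  refine ⟨d, b, ?_, hout'⟩
  have hf' : f = fun i => termUnit t (Units.mk0 (ps.get i).1 (hQ i).1) (ps.get i).2 := by
    funext i
    refine Units.ext ?_
    rw [coe_termUnit, coe_unitMonomial (hQ i).2.1, Units.val_mk0, ← (hQ i).2.2]
    have h6 : (fs.map (DifferenceRing.value t)).get (i.cast (by simp [hlen])) = f i := by
      have := List.get_of_eq hfs (i.cast (by simp [hlen]))
      simpa using this
    rw [← h6]
    simp
  rw [hf']
  exact hb

/-- For a single `v` the lattice of relations is a subgroup of `ℤ`, and a nonzero solution exists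
exactly when this subgroup contains `1`. In that case a solution is found by search. -/
theorem IsComputableTower.solves_semiconstant (hE : IsRPiSigmaExtension σ σ' t) (hσ : Computable σ)
    (h : PMTSolvable (DifferenceRing.value (F := F) t) σ' (productGroup (⊤ : Subgroup Fˣ) t)) :
    Solves (fun v : E => ∃ u ∈ productGroup (⊤ : Subgroup Fˣ) t, (u : E) = v)
      fun v (o : Option E) => (∃ g, o = some g ∧ g ≠ 0 ∧ σ' g = v * g) ∨
        (o = none ∧ ∀ g, σ' g = v * g → g = 0) := by
  have := hC.mul hE
  have hσ' := hC.computable_map hE hσ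
  obtain ⟨nm, hnm, hnm'⟩ := hC.exists_name
  obtain ⟨-, alg, halg, h⟩ := h
  have h1 : Solves (fun v : E => ∃ u ∈ productGroup (⊤ : Subgroup Fˣ) t, (u : E) = v)
      fun v (out : List (List ℤ)) => (out = [[1]] ∨ out = [[-1]]) ↔ ∃ g, g ≠ 0 ∧ σ' g = v * g := by
    refine Solves.of_partrec (halg.comp (f := fun v => alg v) (g := fun v : E => [nm v])
      (by fun_prop)) ?_
    rintro v ⟨u, hu, rfl⟩
    obtain ⟨out, hout, d, b, ⟨hb, hspan⟩, rfl⟩ := h [nm u] 1 (fun _ => u) (fun _ => hu)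
      (by simp [hnm'])
    refine ⟨_, hout, ?_⟩
    have h2 : (∃ g, g ≠ 0 ∧ σ' g = u * g) ↔ (fun _ => 1 : Fin 1 → ℤ) ∈
        Submodule.span ℤ (Set.range b) := by
      rw [← SetLike.mem_coe, hspan]
      simp [multRelations]
    rw [h2]
    -- So the output is empty or consists of one integer, which must be `1` or `-1` to generate `ℤ`.
    have hd : d ≤ 1 := by
      have := hb.fintype_card_le_finrank
      simpa using this
    interval_cases d
    · simp only [List.ofFn_zero, Set.range_eq_empty, Submodule.span_empty, Submodule.mem_bot]
      constructor
      · simp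
      · intro h3
        exact absurd (congrFun h3 0) one_ne_zero
    · rw [Set.range_unique, Submodule.mem_span_singleton]
      have h3 : (List.ofFn fun k => List.ofFn (b k)) = [[b 0 0]] := by simp
      rw [h3]
      simp only [List.cons.injEq, and_true]
      constructor
      · rintro (h4 | h4)
        · refine ⟨1, funext fun i => ?_⟩
          rw [Subsingleton.elim i 0]
          simpa using h4
        · refine ⟨-1, funext fun i => ?_⟩
          rw [Subsingleton.elim i 0]
          simp [h4]
      · rintro ⟨c, hc⟩
        have h4 : c * b 0 0 = 1 := congrFun hc 0
        exact Int.isUnit_iff.1 (IsUnit.of_mul_eq_one_right c h4)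
  have h2 : Solves (fun x : E × List (List ℤ) =>
      (x.2 = [[1]] ∨ x.2 = [[-1]]) ↔ ∃ g, g ≠ 0 ∧ σ' g = x.1 * g)
      fun x (o : Option E) => (∃ g, o = some g ∧ g ≠ 0 ∧ σ' g = x.1 * g) ∨
        (o = none ∧ ∀ g, σ' g = x.1 * g → g = 0) := by
    have hor : Enumerable fun x : E × List (List ℤ) => x.2 = [[1]] ∨ x.2 = [[-1]] :=
      Enumerable.or (Enumerable.eq (by fun_prop) (by fun_prop))
        (Enumerable.eq (by fun_prop) (by fun_prop))
    have hor' : Enumerable fun x : E × List (List ℤ) => ¬ (x.2 = [[1]] ∨ x.2 = [[-1]]) :=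
      (Enumerable.and (Enumerable.ne (f := fun x : E × List (List ℤ) => x.2) (g := fun _ => [[1]])
        (by fun_prop) (by fun_prop)) (Enumerable.ne (f := fun x : E × List (List ℤ) => x.2)
        (g := fun _ => [[-1]]) (by fun_prop) (by fun_prop))).of_iff fun x => by
          rw [not_or]
    refine Solves.cases hor hor' ?_ ?_
    · refine (Solves.of_enumerable (D := fun x : E × List (List ℤ) => ∃ g, g ≠ 0 ∧ σ' g = x.1 * g)
        (P := fun x (o : Option E) => ∃ g, o = some g ∧ g ≠ 0 ∧ σ' g = x.1 * g) (Enumerable.exists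
        (p := fun (x : (E × List (List ℤ)) × Option E) (g : E) =>
          x.2 = some g ∧ g ≠ 0 ∧ σ' g = x.1.1 * g) ?_) ?_).mono ?_ ?_
      · have hsome : Computable fun y : ((E × List (List ℤ)) × Option E) × E => some y.2 :=
          Computable.option_some.comp Computable.snd
        exact Enumerable.and (Enumerable.eq (by fun_prop) hsome) (Enumerable.and
          (Enumerable.ne (by fun_prop) (by fun_prop)) (Enumerable.eq (by fun_prop) (by fun_prop)))
      · rintro x ⟨g, hg⟩
        exact ⟨some g, g, rfl, hg⟩
      · rintro x ⟨h3, h4⟩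
        exact h3.1 h4
      · exact fun _ _ _ h => Or.inl h
    · refine Solves.of_computable (f := fun _ => none) (Computable.const none) ?_
      rintro x ⟨h3, h4⟩
      refine Or.inr ⟨rfl, fun g hg => ?_⟩
      by_contra h0
      exact h4 (h3.2 ⟨g, h0, hg⟩)
  exact (h1.bind h2 fun _ _ _ h => h).mono (fun _ h => h) fun _ _ _ ⟨_, _, h⟩ => h

end PMT

/-! ### Problem O in the product group -/

section OrderProblem

variable {F : Type*} [Field F] [CharZero F] [Primcodable F] [ComputableAdd F] [ComputableNeg F]
  [ComputableMul F] [ComputableInv F] {E : Type*} [CommRing E] [Algebra F E] {e : ℕ}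
  {σ : F ≃+* F} {σ' : E ≃+* E} {t : Fin e → Generator E}

/-- Finite order excludes Π-monomials by `eq_zero_of_pow_eq_one`. Without them, raising to the
product of the orders of the root of unity monomials leaves a power of `h`. -/
theorem IsRPiSigmaExtension.isOfFinOrder_iff (hE : IsRPiSigmaExtension σ σ' t) (h : Fˣ)
    {a : Fin e → ℤ} (ha : ∀ j, (t j).IsSigma → a j = 0) {u : Eˣ}
    (hu : (u : E) = (h : F) • monomial t a) :
    IsOfFinOrder u ↔ (∀ j, (t j).IsPi → a j = 0) ∧ IsOfFinOrder h := by
  have hu' : u = termUnit t h a := Units.ext (by rw [coe_termUnit, coe_unitMonomial ha, hu])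
  have hpow : (∀ j, (t j).IsPi → a j = 0) → ∀ n, (u ^ (n * ∏ j, (t j).order) : E) =
      algebraMap F E ((h : F) ^ (n * ∏ j, (t j).order)) := by
    intro hpi n
    have hmon := hE.monomial_pow_order (a := a) fun j hj => by
      change ¬ (t j).IsRoot at hj
      have h1 := ha j
      have h2 := hpi j
      revert hj h1 h2
      cases t j <;> simp [Generator.IsRoot, Generator.IsPi, Generator.IsSigma]
    rw [hu, Algebra.smul_def, mul_pow, map_pow, mul_comm n, pow_mul (monomial t a), hmon, one_pow,
      mul_one]
  have hpos : 0 < ∏ j, (t j).order := hE.order_pos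
  constructor
  · intro hfin
    obtain ⟨n, hn, hun⟩ := isOfFinOrder_iff_pow_eq_one.1 hfin
    have hpi : ∀ j, (t j).IsPi → a j = 0 := fun j hj => hE.eq_zero_of_pow_eq_one hn hu' hun hj
    refine ⟨hpi, isOfFinOrder_iff_pow_eq_one.2 ⟨n * ∏ j, (t j).order, mul_pos hn hpos,
      Units.ext (hE.injective ?_)⟩⟩
    rw [Units.val_pow_eq_pow_val, ← hpow hpi, ← Units.val_pow_eq_pow_val, pow_mul, hun, one_pow,
      Units.val_one, Units.val_one, map_one]
  · rintro ⟨hpi, hfin⟩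
    obtain ⟨n, hn, hun⟩ := isOfFinOrder_iff_pow_eq_one.1 hfin
    refine isOfFinOrder_iff_pow_eq_one.2 ⟨n * ∏ j, (t j).order, mul_pos hn hpos, Units.ext ?_⟩
    rw [Units.val_pow_eq_pow_val, hpow hpi, ← Units.val_pow_eq_pow_val, pow_mul, hun, one_pow,
      Units.val_one, Units.val_one, map_one]

variable [Primcodable E] (hC : IsComputableTower F t)

include hC

/-- A finite order is found by trying powers. Infinite order is certified by a term for the element
with a nonzero Π-exponent, with a coefficient that is not a constant, or with a constant coefficient
of infinite order; the second certificate is sound because roots of unity in `F` are constants. -/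
theorem IsComputableTower.problemOSolvable (hE : IsRPiSigmaExtension σ σ' t) (hσ : Computable σ)
    (hroot : RootsOfUnityConstant σ)
    (hO : ProblemOSolvable (id : F → F) (constantUnits σ)) :
    ProblemOSolvable (DifferenceRing.value (F := F) t) (productGroup (⊤ : Subgroup Fˣ) t) := by
  have := hC.mul hE
  obtain ⟨algO, halgO, hO⟩ := hO
  let I : E → F × (Fin e → ℤ) → Prop := fun x p => p.1 ≠ 0 ∧ (∀ j, (t j).IsSigma → p.2 j = 0) ∧
      x = p.1 • monomial t p.2
  classical
  let pr : (Fin e → ℤ) → (Fin e → ℤ) := fun a j => if (t j).IsPi then a j else 0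
  have hpr : Computable pr := computable_fin_lam fun j => by
    by_cases hj : (t j).IsPi
    · exact (computable_fin_app j).of_eq fun a => by simp [hj]
    · exact (Computable.const (0 : ℤ)).of_eq fun a => by simp [hj]
  have hpr0 : ∀ a, pr a = 0 ↔ ∀ j, (t j).IsPi → a j = 0 := by
    intro a
    rw [funext_iff]
    refine forall_congr' fun j => ?_
    by_cases hj : (t j).IsPi <;> simp [pr, hj]
  -- The first alternative describes a positive order as the least exponent, the second one lists
  -- the certificates of infinite order.
  let R : E × ℕ → Prop := fun x => (x.2 ≠ 0 ∧ x.1 ^ x.2 = 1 ∧ ∀ k < x.2, k = 0 ∨ x.1 ^ k ≠ 1) ∨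
    (x.2 = 0 ∧ ∃ p : F × (Fin e → ℤ), I x.1 p ∧
      (pr p.2 ≠ 0 ∨ σ p.1 ≠ p.1 ∨ 0 ∈ algO p.1))
  have hR : Enumerable R := by
    refine Enumerable.or (Enumerable.and (Enumerable.ne (by fun_prop) (by fun_prop))
      (Enumerable.and (Enumerable.eq (by fun_prop) (by fun_prop)) ?_))
      (Enumerable.and (Enumerable.eq (by fun_prop) (by fun_prop)) ?_)
    · refine Enumerable.ball_lt (p := fun (x : E × ℕ) k => k = 0 ∨ x.1 ^ k ≠ 1) ?_ (by fun_prop)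
      exact Enumerable.or (Enumerable.eq (by fun_prop) (by fun_prop))
        (Enumerable.ne (by fun_prop) (by fun_prop))
    · refine Enumerable.exists (p := fun (x : E × ℕ) (p : F × (Fin e → ℤ)) => I x.1 p ∧
        (pr p.2 ≠ 0 ∨ σ p.1 ≠ p.1 ∨ 0 ∈ algO p.1)) ?_
      refine Enumerable.and (hC.enumerable_isTerm (by fun_prop) (by fun_prop)) (Enumerable.or
        (Enumerable.ne (hpr.comp (by fun_prop)) (by fun_prop))
        (Enumerable.or (Enumerable.ne (hσ.comp (by fun_prop)) (by fun_prop)) ?_))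
      have hproj : Computable fun x : (E × ℕ) × (F × (Fin e → ℤ)) => (x.2.1, 0) := by fun_prop
      exact ((Enumerable.of_partrec halgO).comp hproj).of_iff fun x => Iff.rfl
  have hsound : ∀ (u : Eˣ), u ∈ productGroup (⊤ : Subgroup Fˣ) t → ∀ n,
      R ((u : E), n) → orderOf u = n := by
    rintro u - n (⟨hn, h1, h2⟩ | ⟨hn, p, ⟨hp0, hpa, hp⟩, h⟩)
    · refine (orderOf_eq_iff (Nat.pos_of_ne_zero hn)).2 ⟨Units.ext ?_, fun m hm hm0 hum => ?_⟩
      · rw [Units.val_pow_eq_pow_val, Units.val_one]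
        exact h1
      · rcases h2 m hm with h3 | h3
        · exact hm0.ne' h3
        · refine h3 ?_
          rw [← Units.val_pow_eq_pow_val, hum, Units.val_one]
    · simp only at hn hp h
      subst hn
      rw [orderOf_eq_zero_iff, hE.isOfFinOrder_iff (Units.mk0 p.1 hp0) hpa hp]
      rintro ⟨hpi, hfin⟩
      obtain ⟨m, hm, h3⟩ := isOfFinOrder_iff_pow_eq_one.1 hfin
      have hconst : σ p.1 = p.1 := hroot p.1 ⟨m, hm, by
        have := congrArg Units.val h3
        rwa [Units.val_pow_eq_pow_val] at this⟩
      rcases h with h | h | h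
      · exact h ((hpr0 _).2 hpi)
      · exact h hconst
      · have h4 := hO p.1 (Units.mk0 p.1 hp0) hconst rfl
        exact orderOf_eq_zero_iff.1 (Part.mem_unique h4 h) hfin
  have hcomplete : ∀ (u : Eˣ), u ∈ productGroup (⊤ : Subgroup Fˣ) t → ∃ n, R ((u : E), n) := by
    intro u hu
    by_cases hfin : IsOfFinOrder u
    · refine ⟨orderOf u, Or.inl ⟨hfin.orderOf_pos.ne', ?_, fun k hk => ?_⟩⟩
      · rw [← Units.val_pow_eq_pow_val, pow_orderOf_eq_one, Units.val_one]
      · rw [or_iff_not_imp_left]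
        intro hk0 h
        refine pow_ne_one_of_lt_orderOf hk0 hk (Units.ext ?_)
        rw [Units.val_pow_eq_pow_val, Units.val_one]
        exact h
    · obtain ⟨h, hh, a, -, ha, hua⟩ := hE.exists_of_mem_productGroup hu
      refine ⟨0, Or.inr ⟨rfl, (h, a), ⟨hh, ha, hua⟩, ?_⟩⟩
      by_contra hcon
      push Not at hcon
      obtain ⟨h1, h2, h3⟩ := hcon
      have h4 := hO h (Units.mk0 h hh) h2 rfl
      rw [hE.isOfFinOrder_iff (Units.mk0 h hh) ha hua] at hfin
      have h5 : orderOf (Units.mk0 h hh) = 0 := orderOf_eq_zero_iff.2 fun h6 =>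
        hfin ⟨(hpr0 a).1 h1, h6⟩
      rw [h5] at h4
      exact h3 h4
  obtain ⟨alg, halg, hal⟩ := (Solves.of_enumerable (D := fun x : E =>
    ∃ u ∈ productGroup (⊤ : Subgroup Fˣ) t, (u : E) = x) (P := fun x n => R (x, n)) hR (by
      rintro _ ⟨u, hu, rfl⟩
      exact hcomplete u hu)).exists_partrec
  refine ⟨fun l => alg (DifferenceRing.value t l), halg.comp hC.value, fun l u hu hl => ?_⟩
  obtain ⟨n, hn, hRn⟩ := hal u ⟨u, hu, rfl⟩
  simp only
  rw [hl, hsound u hu n hRn]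
  exact hn

end OrderProblem

/-! ### Elimination of coefficients -/

section Elimination

theorem computable_comp₃ {α β γ δ ι : Type*} [Primcodable α] [Primcodable β] [Primcodable γ]
    [Primcodable δ] [Primcodable ι] {f : α → β → γ → δ} {a : ι → α} {b : ι → β} {c : ι → γ}
    (hf : Computable fun x : (α × β) × γ => f x.1.1 x.1.2 x.2) (ha : Computable a)
    (hb : Computable b) (hc : Computable c) : Computable fun x => f (a x) (b x) (c x) :=
  hf.comp ((ha.pair hb).pair hc)

theorem computable_map_head {α X Y : Type*} [Primcodable α] [Primcodable X] [Primcodable Y]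
    {f : α → ℤ → X → Y} (hf : Computable fun x : (α × ℤ) × X => f x.1.1 x.1.2 x.2) :
    Computable fun s : (α × List ℤ) × List X => s.2.map (f s.1.1 (s.1.2.headD 0)) :=
  computable_list_map (by fun_prop) (computable_comp₃ (f := f) hf
    (show Computable fun x : ((α × List ℤ) × List X) × X => x.1.1.1 by fun_prop)
    (show Computable fun x : ((α × List ℤ) × List X) × X => x.1.1.2.headD 0 by fun_prop)
    (show Computable fun x : ((α × List ℤ) × List X) × X => x.2 by fun_prop))

universe v

variable {F : Type*} [Field F] [Primcodable F] [ComputableAdd F] [ComputableNeg F]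
  [ComputableMul F] [ComputableInv F] {E : Type v} [CommRing E] [Algebra F E] [Primcodable E]
  [ComputableAdd E] [ComputableNeg E] [ComputableMul E] [ComputableSMul F E] {e : ℕ}
  {σ : F ≃+* F} {σ' : E ≃+* E} {t : Fin e → Generator E}

/-- Elimination of one coefficient after the other from the solutions `g` of `T g = r`, where the
exponents of the generator in `g` are in a given list. The coefficient at the first exponent is
found by a solver for equations in the ring below. -/
theorem IsComputableTower.solves_elimination (hC : IsComputableTower F t)
    (hE : IsRPiSigmaExtension σ σ' t) (hσ : Computable σ) {i : Fin e} {S : Set (Fin e)} (hiS : i ∉ S)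
    {α : Type*} [Primcodable α] {T : α → E → E} (hTc : Computable fun x : α × E => T x.1 x.2)
    (hT : ∀ a, IsConstLinear σ (T a)) {p ψ : α → ℤ → E → E}
    (hpc : Computable fun x : (α × ℤ) × E => p x.1.1 x.1.2 x.2)
    (hp : ∀ a k, IsConstLinear σ (p a k))
    {Adm : α → List ℤ → Prop} (hAdm : ∀ a k ks, Adm a (k :: ks) → Adm a ks)
    (hexp : ∀ a k ks, Adm a (k :: ks) → (t i).IsExponent k)
    (hTm : ∀ a ks, Adm a ks → ∀ g ∈ adjoinOver F t (insert i S), T a g ∈ adjoinOver F t (insert i S))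
    (hpm : ∀ a k ks, Adm a (k :: ks) → ∀ r ∈ adjoinOver F t (insert i S),
      p a k r ∈ adjoinOver F t S)
    (hloc : ∀ (X : Type v) [AddCommGroup X] [Module F X] [Primcodable X] [ComputableAdd X]
      [ComputableNeg X] [ComputableSMul F X], Solves (fun y : (α × ℤ) × List (X × E) =>
        (∃ ks, Adm y.1.1 (y.1.2 :: ks)) ∧ ∀ q ∈ y.2, q.2 ∈ adjoinOver F t S)
        fun y N => ∀ q : X × E, q ∈ listSpan σ N ↔ q.2 ∈ adjoinOver F t S ∧
          (q.1, ψ y.1.1 y.1.2 q.2) ∈ listSpan σ y.2)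
    (hcoef : ∀ a k ks, Adm a (k :: ks) → ∀ g ∈ adjoinOver F t (insert i S),
      (∀ l ∉ k :: ks, hE.coeff i l g = 0) → p a k (T a g) = ψ a k (hE.coeff i k g))
    (Z : Type v) [AddCommGroup Z] [Module F Z] [Primcodable Z] [ComputableAdd Z] [ComputableNeg Z]
    [ComputableSMul F Z] : Solves (fun x : (α × List ℤ) × List (Z × E) => Adm x.1.1 x.1.2 ∧
        ∀ q ∈ x.2, q.2 ∈ adjoinOver F t (insert i S))
      fun x N => ∀ q : Z × E, q ∈ listSpan σ N ↔ (q.2 ∈ adjoinOver F t (insert i S) ∧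
        ∀ l ∉ x.1.2, hE.coeff i l q.2 = 0) ∧ (q.1, T x.1.1 q.2) ∈ listSpan σ x.2 := by
  set A := adjoinOver F t S
  set A' := adjoinOver F t (insert i S)
  have hAA : A ≤ A' := adjoinOver_mono t (Set.subset_insert i S)
  -- Meaning of a state: an entry holds a tag, the part of the solution built so far and the
  -- residual. `Φ` says that `q` is completed by some `g` with the remaining exponents whose image
  -- under `T` is the residual.
  let Φ : (α × List ℤ) × List ((Z × E) × E) → Z × E → Prop := fun s q => ∃ g ∈ A',
    (∀ l ∉ s.1.2, hE.coeff i l g = 0) ∧ ((q.1, q.2 - g), T s.1.1 g) ∈ listSpan σ s.2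
  let Inv : (α × List ℤ) × List ((Z × E) × E) → Prop := fun s => Adm s.1.1 s.1.2 ∧
    ∀ q ∈ s.2, q.2 ∈ A'
  -- A coefficient found for the exponent `k` is added to the partial solution, and its image under
  -- `T` is subtracted from the residual.
  let new : α → ℤ → ((Z × E) × E) × E → (Z × E) × E := fun a k y =>
    ((y.1.1.1, y.1.1.2 + y.2 * (t i).pow k), y.1.2 - T a (y.2 * (t i).pow k))
  have hpow := hC.computable_pow i
  have hnewc : Computable fun x : (α × ℤ) × (((Z × E) × E) × E) => new x.1.1 x.1.2 x.2 := by
    have h1 : Computable fun x : (α × ℤ) × (((Z × E) × E) × E) => x.2.2 * (t i).pow x.1.2 := by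
      have := hpow.comp (show Computable fun x : (α × ℤ) × (((Z × E) × E) × E) => x.1.2 by fun_prop)
      fun_prop
    have h2 : Computable fun x : (α × ℤ) × (((Z × E) × E) × E) =>
        T x.1.1 (x.2.2 * (t i).pow x.1.2) := computable_comp₂ hTc (by fun_prop) h1
    fun_prop
  have hnew : ∀ a k, IsConstLinear σ (new a k) := by
    intro a k
    refine ⟨fun x y => ?_, fun c hc x => ?_⟩
    · refine Prod.ext (Prod.ext rfl ?_) ?_
      · simp only [new, Prod.fst_add, Prod.snd_add, add_mul]
        ring
      · simp only [new, Prod.fst_add, Prod.snd_add, add_mul, (hT a).add]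
        ring
    · refine Prod.ext (Prod.ext rfl ?_) ?_
      · simp only [new, Prod.smul_fst, Prod.smul_snd, smul_mul_assoc, smul_add]
      · simp only [new, Prod.smul_fst, Prod.smul_snd, smul_mul_assoc, (hT a).smul c hc, smul_sub]
  have hstep : Solves (fun s => Inv s ∧ ¬ s.1.2 = []) fun s s' => Inv s' ∧
      s'.1.2.length < s.1.2.length ∧ ∀ q, Φ s q ↔ Φ s' q := by
    have hg : Computable fun s : (α × List ℤ) × List ((Z × E) × E) => ((s.1.1, s.1.2.headD 0),
        s.2.map fun x => (x, p s.1.1 (s.1.2.headD 0) x.2)) := by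
      have h1 : Computable fun x : (α × ℤ) × ((Z × E) × E) => p x.1.1 x.1.2 x.2.2 :=
        computable_comp₃ (f := p) hpc (by fun_prop) (by fun_prop) (by fun_prop)
      exact Computable.pair (by fun_prop)
        (computable_map_head (f := fun a k (x : (Z × E) × E) => (x, p a k x.2))
          (Computable.pair (by fun_prop) h1))
    have hf : Computable fun x : ((α × List ℤ) × List ((Z × E) × E)) × List (((Z × E) × E) × E) =>
        ((x.1.1.1, x.1.1.2.tail), x.2.map (new x.1.1.1 (x.1.1.2.headD 0))) := by
      refine Computable.pair (by fun_prop) ?_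
      exact computable_comp₂ (f := fun (a : α × List ℤ) (N : List (((Z × E) × E) × E)) =>
        N.map (new a.1 (a.2.headD 0)))
        (g := fun x : ((α × List ℤ) × List ((Z × E) × E)) × List (((Z × E) × E) × E) => x.1.1)
        (h := fun x => x.2) (computable_map_head hnewc) (by fun_prop) (by fun_prop)
    have hloc' : Solves (fun s => Inv s ∧ ¬ s.1.2 = []) fun s (N : List (((Z × E) × E) × E)) =>
        ∀ q, q ∈ listSpan σ N ↔ q.2 ∈ A ∧ (q.1, ψ s.1.1 (s.1.2.headD 0) q.2) ∈
          listSpan σ (s.2.map fun x => (x, p s.1.1 (s.1.2.headD 0) x.2)) := by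
      refine ((hloc ((Z × E) × E)).comp hg).mono ?_ fun _ _ _ h => h
      rintro ⟨⟨a, ks⟩, L⟩ ⟨⟨h1, h2⟩, h3⟩
      cases ks with
      | nil => exact absurd rfl h3
      | cons k ks =>
        refine ⟨⟨ks, h1⟩, fun q hq => ?_⟩
        obtain ⟨x, hx, rfl⟩ := List.mem_map.1 hq
        exact hpm a k ks h1 _ (h2 x hx)
    refine (hloc'.map (f := fun s (N : List (((Z × E) × E) × E)) =>
      ((s.1.1, s.1.2.tail), N.map (new s.1.1 (s.1.2.headD 0)))) hf).mono (fun _ h => h) ?_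
    · rintro ⟨⟨a, ks⟩, L⟩ s' ⟨⟨h1, h2⟩, h3⟩ ⟨N, hN, rfl⟩
      cases ks with
      | nil => exact absurd rfl h3
      | cons k ks =>
        simp only [List.headD_cons, List.tail_cons] at h1 h2 hN ⊢
        have hk := hexp a k ks h1
        have hN' : ∀ q : ((Z × E) × E) × E, q ∈ listSpan σ N ↔ q.2 ∈ A ∧ q.1 ∈ listSpan σ L ∧
            p a k q.1.2 = ψ a k q.2 := by
          intro q
          rw [hN, mem_listSpan_graph (f := fun x : (Z × E) × E => p a k x.2)
            ⟨fun x y => (hp a k).add _ _, fun c hc x => (hp a k).smul c hc _⟩]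
        have hpk : (t i).pow k ∈ A' := pow_mem_adjoinOver t (Set.mem_insert i S) (Or.inl hk)
        have hco : ∀ h ∈ A, ∀ l, hE.coeff i l (h * (t i).pow k) = if l = k then h else 0 :=
          fun h hh l => hE.coeff_mul_pow hiS hh l hk
        refine ⟨⟨hAdm a k ks h1, fun q hq => ?_⟩, by simp, ?_⟩
        · obtain ⟨y, hy, rfl⟩ := List.mem_map.1 hq
          obtain ⟨h4, h5, -⟩ := (hN' y).1 (mem_listSpan_of_mem hy)
          exact sub_mem (mem_of_mem_listSpan h2 h5) (hTm a _ h1 _ (mul_mem (hAA h4) hpk))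
        · rintro ⟨z, g⟩
          constructor
          · rintro ⟨g₁, hg₁, hg₁', h4⟩
            have hh : hE.coeff i k g₁ ∈ A := hE.coeff_mem_of_insert hiS hg₁ k
            refine ⟨g₁ - hE.coeff i k g₁ * (t i).pow k, sub_mem hg₁ (mul_mem (hAA hh) hpk),
              fun l hl => ?_, ?_⟩
            · rw [map_sub, hco _ hh]
              by_cases hlk : l = k
              · rw [if_pos hlk, hlk, sub_self]
              · rw [if_neg hlk, sub_zero]
                exact hg₁' l (by simpa [hlk] using hl)
            · refine (mem_listSpan_map (hnew a k)).2 ⟨(((z, g - g₁), T a g₁), hE.coeff i k g₁),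
                (hN' _).2 ⟨hh, h4, hcoef a k ks h1 g₁ hg₁ hg₁'⟩, ?_⟩
              have hTsub : T a (g₁ - hE.coeff i k g₁ * (t i).pow k) =
                  T a g₁ - T a (hE.coeff i k g₁ * (t i).pow k) := by
                rw [eq_sub_iff_add_eq, ← (hT a).add, sub_add_cancel]
              refine Prod.ext (Prod.ext rfl ?_) hTsub.symm
              simp only [new]
              ring
          · rintro ⟨g₂, hg₂, hg₂', h4⟩
            obtain ⟨⟨⟨⟨z', ga⟩, r⟩, h⟩, hy, hyy⟩ := (mem_listSpan_map (hnew a k)).1 h4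
            obtain ⟨h5, h6⟩ := Prod.mk.inj hyy
            obtain ⟨h7, h8⟩ := Prod.mk.inj h5
            simp only at h6 h7 h8
            obtain ⟨hh, h9, -⟩ := (hN' _).1 hy
            refine ⟨g₂ + h * (t i).pow k, add_mem hg₂ (mul_mem (hAA hh) hpk), fun l hl => ?_, ?_⟩
            · obtain ⟨hl1, hl2⟩ := not_or.1 (mt List.mem_cons.2 hl)
              rw [map_add, hco _ hh, if_neg hl1, add_zero]
              exact hg₂' l hl2
            · have h10 : g - (g₂ + h * (t i).pow k) = ga := by
                linear_combination -h8
              have h11 : T a (g₂ + h * (t i).pow k) = r := by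
                rw [(hT a).add]
                linear_combination -h6
              simp only at h9
              rw [h10, h11, ← h7]
              exact h9
  have hloop := Solves.iterate (Inv := Inv) (done := fun s => s.1.2 = [])
    (Rel := fun s s' => ∀ q, Φ s q ↔ Φ s' q) (fun s => s.1.2.length)
    (Enumerable.eq (by fun_prop) (by fun_prop)) (Enumerable.ne (by fun_prop) (by fun_prop)) hstep
    (fun _ _ => Iff.rfl) fun _ _ _ h h' q => (h q).trans (h' q)
  have hini : Computable fun x : (α × List ℤ) × List (Z × E) =>
      (x.1, x.2.map fun q => ((q.1, (0 : E)), q.2)) := by fun_prop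
  -- When no exponents are left, `g` must be zero, and the solutions are the combinations with
  -- residual zero.
  refine ((hloop.comp hini).bind ((hC.nullSolvable hE hσ (Z × E)).comp
    (g := fun x : ((α × List ℤ) × List (Z × E)) × ((α × List ℤ) × List ((Z × E) × E)) => x.2.2)
    (by fun_prop)) fun _ _ _ _ => trivial).mono ?_ ?_
  · rintro x ⟨h1, h2⟩
    refine ⟨h1, fun q hq => ?_⟩
    obtain ⟨y, hy, rfl⟩ := List.mem_map.1 hq
    exact h2 y hy
  · rintro x N ⟨h1, h2⟩ ⟨s, ⟨-, hdone, hrel⟩, hN⟩ q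
    have hlin : IsConstLinear σ fun q : Z × E => ((q.1, (0 : E)), q.2) :=
      ⟨fun _ _ => by simp, fun _ _ _ => by simp⟩
    have hinit : Φ (x.1, x.2.map fun q => ((q.1, (0 : E)), q.2)) q ↔
        (q.2 ∈ A' ∧ ∀ l ∉ x.1.2, hE.coeff i l q.2 = 0) ∧ (q.1, T x.1.1 q.2) ∈ listSpan σ x.2 := by
      constructor
      · rintro ⟨g, h3, h4, h5⟩
        obtain ⟨y, hy, hyy⟩ := (mem_listSpan_map hlin).1 h5
        obtain ⟨h6, h7⟩ := Prod.mk.inj hyy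
        obtain ⟨h8, h9⟩ := Prod.mk.inj h6
        simp only at h7 h8 h9
        have h10 : q.2 = g := (sub_eq_zero.1 h9.symm)
        rw [h10]
        refine ⟨⟨h3, h4⟩, ?_⟩
        rw [← h7, ← h8]
        exact hy
      · rintro ⟨⟨h3, h4⟩, h5⟩
        exact ⟨q.2, h3, h4, (mem_listSpan_map hlin).2 ⟨_, h5, by simp⟩⟩
    rw [← hinit, hrel q, hN]
    have hT0 : T s.1.1 0 = 0 := by
      have := (hT s.1.1).add 0 0
      rwa [add_zero, left_eq_add] at this
    constructor
    · intro h3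
      exact ⟨0, zero_mem _, fun l _ => map_zero _, by rwa [sub_zero, hT0]⟩
    · rintro ⟨g, h3, h4, h5⟩
      have hg : g = 0 := hE.ext_coeff i fun l => by
        rw [map_zero, h4 l (by rw [hdone]; simp)]
      rw [hg, sub_zero, hT0] at h5
      exact h5

end Elimination

/-! ### Bounds for the exponents of solutions -/

section Bounds

variable {F : Type*} [Field F] {E : Type*} [CommRing E] [Algebra F E] {e : ℕ}
  {σ : F ≃+* F} {σ' : E ≃+* E} {t : Fin e → Generator E} {i : Fin e} {τ α : Eˣ} {S : Set (Fin e)}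

/-- Exponents in the order in which the coefficients are eliminated. -/
def exponentList (s : ℤ) (B N : ℕ) : List ℤ := (List.range N).map fun j : ℕ => s * ((B : ℤ) - j)

theorem pairwise_exponentList {s m : ℤ} (h : 0 < m * s) (B N : ℕ) :
    (exponentList s B N).Pairwise fun k l => m * l < m * k := by
  refine List.pairwise_map.2 (List.pairwise_lt_range.imp fun {a b} hab => ?_)
  have : (a : ℤ) < b := by exact_mod_cast hab
  nlinarith

theorem mem_exponentList {s : ℤ} (hs : s = 1 ∨ s = -1) {B : ℕ} {l : ℤ} (hl : l.natAbs ≤ B) :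
    l ∈ exponentList s B (2 * B + 1) := by
  refine List.mem_map.2 ⟨((B : ℤ) - s * l).toNat, List.mem_range.2 ?_, ?_⟩
  · rcases hs with rfl | rfl <;> omega
  · rcases hs with rfl | rfl <;> omega

variable (hE : IsRPiSigmaExtension σ σ' t)

include hE

theorem coeff_sub_mul_of_pi (hi : t i = .pi τ) (hiS : i ∉ S)
    (hσ : ∀ x ∈ adjoinOver F t S, σ' x ∈ adjoinOver F t S)
    (hα : σ' (τ : E) = α * τ) (hαG : α ∈ productGroup (⊤ : Subgroup Fˣ) t)
    (hαS : (α : E) ∈ adjoinOver F t S) {v g : E} (hv : v ∈ adjoinOver F t S)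
    (hg : g ∈ adjoinOver F t (insert i S)) (m k : ℤ) :
    hE.coeff i k (σ' g - v * ((τ ^ m : Eˣ) : E) * g) =
      σ' (hE.coeff i k g) * ((α ^ k : Eˣ) : E) - v * hE.coeff i (k - m) g := by
  rw [map_sub, hE.coeff_map_of_pi hi hiS hσ hα hαG hαS hg, hE.coeff_mul_zpow hi hiS hv hg]

/-- Without a power of `τ` in the factor the equation decouples. Where the right hand side has no
term of exponent `l`, the term of `g` is a homogeneous solution, hence a constant multiple of `g₀`
or zero; in both cases it has no coefficient at `l`. -/
theorem coeff_eq_zero_of_homogeneous [CharZero F] (hsimple : IsSimpleOver (⊤ : Subgroup Fˣ) σ' t)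
    (hroot : RootsOfUnityConstant σ) (hi : t i = .pi τ) (hiS : i ∉ S)
    (hσ : ∀ x ∈ adjoinOver F t S, σ' x ∈ adjoinOver F t S)
    (hα : σ' (τ : E) = α * τ) (hαG : α ∈ productGroup (⊤ : Subgroup Fˣ) t)
    (hαS : (α : E) ∈ adjoinOver F t S) {v : Eˣ} (hvG : v ∈ productGroup (⊤ : Subgroup Fˣ) t)
    (hv : (v : E) ∈ adjoinOver F t S) {g g₀ : E} (hg : g ∈ adjoinOver F t (insert i S)) {l : ℤ}
    (h0 : (g₀ ≠ 0 ∧ σ' g₀ = v * g₀ ∧ hE.coeff i l g₀ = 0) ∨ ∀ x, σ' x = v * x → x = 0)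
    (h : hE.coeff i l (σ' g - v * g) = 0) : hE.coeff i l g = 0 := by
  have h1 := coeff_sub_mul_of_pi hE hi hiS hσ hα hαG hαS hv hg 0 l
  rw [zpow_zero, Units.val_one, mul_one, sub_zero, h, eq_comm, sub_eq_zero] at h1
  have hx : σ' (hE.coeff i l g * ((τ ^ l : Eˣ) : E)) = v * (hE.coeff i l g * ((τ ^ l : Eˣ) : E)) := by
    rw [map_mul, map_zpow_of_map_eq hα, ← mul_assoc, h1, mul_assoc]
  have hex : (t i).IsExponent l := by rw [hi]; trivial
  have hpow : (t i).pow l = ((τ ^ l : Eˣ) : E) := by rw [hi]; rfl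
  have hco : hE.coeff i l (hE.coeff i l g * ((τ ^ l : Eˣ) : E)) = hE.coeff i l g := by
    rw [← hpow, hE.coeff_mul_pow hiS (hE.coeff_mem_of_insert hiS hg l) l hex, if_pos rfl]
  rcases h0 with ⟨hg0, hg1, hg2⟩ | h0
  · obtain ⟨g', -, hgg⟩ := (hE.isSemimonomial_univ hsimple hroot hg0 hvG hg1).exists_inv hE
      (Set.subset_univ _)
    obtain ⟨κ, -, hκ⟩ := hE.eq_smul_of_map_eq v.isUnit hx hg1 hgg
    rw [← hco, hκ, map_smul, hg2, smul_zero]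
  · rw [← hco, h0 _ hx, map_zero]

/-- Beyond the bound `B` of the right hand side, the coefficients at `l` and `l - m` determine the
vanishing of each other. Moving away from zero in steps of `m`, one reaches exponents that do not
occur in `g`. -/
theorem coeff_eq_zero_of_shift (hi : t i = .pi τ) (hiS : i ∉ S)
    (hσ : ∀ x ∈ adjoinOver F t S, σ' x ∈ adjoinOver F t S)
    (hα : σ' (τ : E) = α * τ) (hαG : α ∈ productGroup (⊤ : Subgroup Fˣ) t)
    (hαS : (α : E) ∈ adjoinOver F t S) {v : Eˣ}
    (hv : (v : E) ∈ adjoinOver F t S) {g : E} (hg : g ∈ adjoinOver F t (insert i S)) {m : ℤ}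
    (hm : m ≠ 0) {B : ℕ} (h : ∀ l : ℤ, B < l.natAbs →
      hE.coeff i l (σ' g - v * ((τ ^ m : Eˣ) : E) * g) = 0) {l : ℤ} (hl : B < l.natAbs) :
    hE.coeff i l g = 0 := by
  have hrec : ∀ l : ℤ, B < l.natAbs →
      σ' (hE.coeff i l g) * ((α ^ l : Eˣ) : E) = v * hE.coeff i (l - m) g := by
    intro l hl
    rw [← sub_eq_zero, ← coeff_sub_mul_of_pi hE hi hiS hσ hα hαG hαS hv hg m l, h l hl]
  have hup : ∀ l : ℤ, B < l.natAbs → hE.coeff i (l - m) g = 0 → hE.coeff i l g = 0 := by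
    intro l hl h0
    have := hrec l hl
    rw [h0, mul_zero, Units.mul_left_eq_zero] at this
    simpa using this
  have hdown : ∀ l : ℤ, B < (l + m).natAbs → hE.coeff i (l + m) g = 0 → hE.coeff i l g = 0 := by
    intro l hl h0
    have := hrec (l + m) hl
    rw [h0, map_zero, zero_mul, add_sub_cancel_right, eq_comm, Units.mul_right_eq_zero] at this
    exact this
  obtain ⟨s, hs, -⟩ := hE.exists_sum_coeff i g
  obtain ⟨C, hC⟩ : ∃ C : ℕ, ∀ l : ℤ, C < l.natAbs → hE.coeff i l g = 0 :=
    ⟨s.sup Int.natAbs, fun l hl => hs l fun h => (Finset.le_sup (f := Int.natAbs) h).not_gt hl⟩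
  -- Induction on the distance to the bound `C` for the exponents in `g`. The signs of `l` and `m`
  -- decide which neighbour is farther from zero.
  have key : ∀ n : ℕ, ∀ l : ℤ, B < l.natAbs → C < l.natAbs + n → hE.coeff i l g = 0 := by
    intro n
    induction n with
    | zero => exact fun l _ h => hC l (by simpa using h)
    | succ n ih =>
      intro l hl hn
      by_cases hsgn : 0 < l ↔ 0 < m
      · exact hdown l (by omega) (ih _ (by omega) (by omega))
      · exact hup l hl (ih _ (by omega) (by omega))
  exact key (C + 1) l hl (by omega)

theorem coeff_map_top_of_sigma {s : E} (hi : t i = .sigma s) (hiS : i ∉ S)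
    (hσ : ∀ x ∈ adjoinOver F t S, σ' x ∈ adjoinOver F t S) (hs : σ' s - s ∈ adjoinOver F t S) {g : E}
    (hg : g ∈ adjoinOver F t (insert i S)) {k : ℕ} (hk : ∀ l : ℤ, k < l → hE.coeff i l g = 0) :
    hE.coeff i k (σ' g) = σ' (hE.coeff i k g) := by
  rw [hE.coeff_map_of_sigma hi hiS hσ hs hg k hk, Finset.sum_range_succ,
    Finset.sum_eq_zero fun l hl => by
      rw [Nat.choose_eq_zero_of_lt (Finset.mem_range.1 hl)]
      simp]
  simp

/-- The degree of `g` exceeds that of the right hand side by at most one. Otherwise the two highest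
coefficients of the right hand side vanish; the leading coefficient of `g` is then a semi-constant,
hence invertible, which `false_of_sigma_leading` excludes. -/
theorem coeff_eq_zero_of_sigma [CharZero F] (hsimple : IsSimpleOver (⊤ : Subgroup Fˣ) σ' t)
    (hroot : RootsOfUnityConstant σ) {s : E} (hi : t i = .sigma s)
    (hs : σ' s - s ∈ adjoinOver F t (chain t i)) {u : Eˣ}
    (huG : u ∈ productGroup (⊤ : Subgroup Fˣ) t) (hu : (u : E) ∈ adjoinOver F t (chain t i)) {g : E}
    (hg : g ∈ adjoinOver F t (insert i (chain t i))) {B : ℕ} (h : ∀ l : ℤ, B < l.natAbs →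
      hE.coeff i l (σ' g - u * g) = 0) {l : ℤ} (hl : B + 1 < l.natAbs) : hE.coeff i l g = 0 := by
  have hroots : i ∉ roots t := by
    change ¬ (t i).IsRoot
    simp [hi, Generator.IsRoot]
  have hiS := notMem_chain hroots
  have hσ : ∀ x ∈ adjoinOver F t (chain t i), σ' x ∈ adjoinOver F t (chain t i) := fun x hx =>
    hE.map_mem_chain hsimple hx
  have hneg : ∀ l : ℤ, l < 0 → hE.coeff i l g = 0 := fun l hl =>
    hE.coeff_eq_zero (by rw [hi]; exact not_le.2 hl) g
  obtain ⟨N, hN, -⟩ := hE.exists_sum_of_sigma hi g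
  have key : ∀ n D : ℕ, B < D → N < D + 1 + n → hE.coeff i (D + 1 : ℕ) g = 0 := by
    intro n
    induction n with
    | zero => exact fun D _ hD => hN _ (by omega)
    | succ n ih =>
      intro D hD hn
      have hD' : ∀ k : ℤ, (D + 1 : ℕ) < k → hE.coeff i k g = 0 := by
        intro k hk
        obtain ⟨D', rfl⟩ : ∃ D' : ℕ, k = (D' + 1 : ℕ) := ⟨(k - 1).toNat, by omega⟩
        exact ih D' (by omega) (by omega)
      by_contra h0
      have h1 : hE.coeff i (D + 1 : ℕ) (σ' g - u * g) = 0 := h _ (by omega)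
      have h2 : hE.coeff i (D : ℕ) (σ' g - u * g) = 0 := h _ (by omega)
      have hgc := hE.coeff_mem_of_insert hiS hg (D + 1 : ℕ)
      have h3 : σ' (hE.coeff i (D + 1 : ℕ) g) = u * hE.coeff i (D + 1 : ℕ) g := by
        rw [← sub_eq_zero, ← coeff_map_top_of_sigma hE hi hiS hσ hs hg hD',
          ← hE.coeff_mul_left hiS hu hg, ← map_sub, h1]
      obtain ⟨w, hw, hgw⟩ := (hE.isSemimonomial_of_map_eq hsimple hroot i i.2.le hgc h0 huG hu
        h3).exists_inv hE (roots_subset_chain t i)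
      exact hE.false_of_sigma_leading hi hiS hσ hs hg D hD' hw hgw u.isUnit hu h1 h2
  by_cases hl0 : l < 0
  · exact hneg l hl0
  · obtain ⟨D', rfl⟩ : ∃ D' : ℕ, l = (D' + 1 : ℕ) := ⟨(l - 1).toNat, by omega⟩
    exact key N D' (by omega) (by omega)

end Bounds

/-! ### Coefficient equations for one generator -/

section Solvers

universe v

variable {F : Type*} [Field F] [Primcodable F] [ComputableAdd F] [ComputableNeg F]
  [ComputableMul F] [ComputableInv F] {E : Type v} [CommRing E] [Algebra F E] [Primcodable E]
  [ComputableAdd E] [ComputableNeg E] [ComputableMul E] [ComputableSMul F E] {e : ℕ}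
  {σ : F ≃+* F} {σ' : E ≃+* E} {t : Fin e → Generator E} (hC : IsComputableTower F t)
  (hE : IsRPiSigmaExtension σ σ' t) (hσ : Computable σ)

include hC hE

/-- A crude bound, the sum of the absolute exponents in some name, is sufficient and avoids
cancellations. -/
theorem IsComputableTower.exists_degree (i : Fin e) : ∃ deg : E → ℕ, Computable deg ∧
    ∀ (x : E) (l : ℤ), deg x < l.natAbs → hE.coeff i l x = 0 := by
  obtain ⟨nm, hnm, hv⟩ := hC.exists_name
  let d : F × (Fin e → ℤ) → ℕ := fun p =>
    ((t i).reduce (p.2 i)).toNat + (-(t i).reduce (p.2 i)).toNat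
  have hd : Computable d := by
    have h1 : Computable fun p : F × (Fin e → ℤ) => (t i).reduce (p.2 i) :=
      (t i).computable_reduce.comp ((computable_fin_app i).comp Computable.snd)
    have h2 : Computable fun p : F × (Fin e → ℤ) => ((t i).reduce (p.2 i)).toNat :=
      computable_toNat.comp h1
    have h3 : Computable fun p : F × (Fin e → ℤ) => (-(t i).reduce (p.2 i)).toNat :=
      computable_toNat.comp (computable_int_neg.comp h1)
    exact computable_add h2 h3
  refine ⟨fun x => ((nm x).map d).sum, ?_, fun x l hl => ?_⟩
  · have : Computable fun x => (nm x).map d := computable_list_map hnm (hd.comp Computable.snd)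
    fun_prop
  · conv_lhs => rw [← hv x, value_eq, map_list_sum, List.map_map]
    refine List.sum_eq_zero fun y hy => ?_
    obtain ⟨p, hp, rfl⟩ := List.mem_map.1 hy
    have h1 : d p ≤ ((nm x).map d).sum := List.single_le_sum (by simp) _ (List.mem_map_of_mem hp)
    simp only [Function.comp_apply, map_smul]
    rw [hE.coeff_monomial', if_neg, smul_zero]
    intro h2
    have h3 : d p = l.toNat + (-l).toNat := by simp only [d, h2]
    rw [h3] at h1
    simp only at hl
    omega

include hσ

/-- The coefficient at the largest remaining exponent satisfies, after multiplication by the unit `γ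
k`, a first order equation in the ring below. The decreasing order of the list guarantees that all
larger coefficients have been eliminated. -/
theorem IsComputableTower.solves_diagonal {i : Fin e} {S : Set (Fin e)} (hiS : i ∉ S)
    (hS : ∀ x ∈ adjoinOver F t (insert i S), σ' x ∈ adjoinOver F t (insert i S)) {γ : ℤ → Eˣ}
    (hγc : Computable fun k => (γ k : E)) (hγG : ∀ k, γ k ∈ productGroup (⊤ : Subgroup Fˣ) t)
    (hγ : ∀ k, (γ k : E) ∈ adjoinOver F t S)
    (hdiag : ∀ u ∈ adjoinOver F t S, ∀ g ∈ adjoinOver F t (insert i S), ∀ k : ℤ,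
      (t i).IsExponent k → (∀ l, k < l → hE.coeff i l g = 0) →
        γ k * hE.coeff i k (σ' g - u * g) = σ' (hE.coeff i k g) - u * γ k * hE.coeff i k g)
    (hsolve : PLDESolvableOver F σ σ' t S) (Z : Type v) [AddCommGroup Z] [Module F Z] [Primcodable Z]
    [ComputableAdd Z] [ComputableNeg Z] [ComputableSMul F Z] :
    Solves (fun x : (E × List ℤ) × List (Z × E) =>
        ((∃ u ∈ productGroup (⊤ : Subgroup Fˣ) t, (u : E) = x.1.1) ∧ x.1.1 ∈ adjoinOver F t S ∧
          (x.1.2.Pairwise fun k l => l < k) ∧ ∀ k ∈ x.1.2, (t i).IsExponent k) ∧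
        ∀ q ∈ x.2, q.2 ∈ adjoinOver F t (insert i S))
      fun x N => ∀ q : Z × E, q ∈ listSpan σ N ↔ (q.2 ∈ adjoinOver F t (insert i S) ∧
        ∀ l ∉ x.1.2, hE.coeff i l q.2 = 0) ∧ (q.1, σ' q.2 - x.1.1 * q.2) ∈ listSpan σ x.2 := by
  have hσ' := hC.computable_map hE hσ
  have hAA : adjoinOver F t S ≤ adjoinOver F t (insert i S) :=
    adjoinOver_mono t (Set.subset_insert i S)
  have hcoeff := hC.computable_coeff hE i
  have hγ2 : Computable fun x : (E × ℤ) × E => (γ x.1.2 : E) := hγc.comp (by fun_prop)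
  have hp : Computable fun x : (E × ℤ) × E => (γ x.1.2 : E) * hE.coeff i x.1.2 x.2 := by
    have := computable_comp₂ (f := fun k x => hE.coeff i k x) hcoeff
      (g := fun x : (E × ℤ) × E => x.1.2) (h := fun x => x.2) (by fun_prop) (by fun_prop)
    fun_prop
  refine hC.solves_elimination hE hσ hiS (T := fun u g => σ' g - u * g)
    (p := fun _ k r => γ k * hE.coeff i k r) (ψ := fun u k h => σ' h - u * γ k * h)
    (Adm := fun u ks => (∃ u' ∈ productGroup (⊤ : Subgroup Fˣ) t, (u' : E) = u) ∧
      u ∈ adjoinOver F t S ∧ (ks.Pairwise fun k l => l < k) ∧ ∀ k ∈ ks, (t i).IsExponent k)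
    (by fun_prop) (fun u => ⟨fun x y => ?_, fun c hc x => ?_⟩) hp
    (fun _ k => ⟨fun x y => ?_, fun c hc x => ?_⟩) ?_ ?_ ?_ ?_ ?_ ?_ Z
  · simp only [map_add]
    ring
  · simp only [hE.map_smul', hc, mul_smul_comm, smul_sub]
  · simp only [map_add, mul_add]
  · simp only [map_smul, mul_smul_comm]
  · exact fun u k ks ⟨h1, h2, h3, h4⟩ => ⟨h1, h2, h3.of_cons, fun l hl => h4 l
      (List.mem_cons_of_mem _ hl)⟩
  · exact fun u k ks ⟨_, _, _, h4⟩ => h4 k List.mem_cons_self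
  · exact fun u ks ⟨_, h2, _⟩ g hg => sub_mem (hS g hg) (mul_mem (hAA h2) hg)
  · exact fun u k ks _ r hr => mul_mem (hγ k) (hE.coeff_mem_of_insert hiS hr k)
  · intro X _ _ _ _ _ _
    have hγ3 : Computable fun y : (E × ℤ) × List (X × E) => (γ y.1.2 : E) := hγc.comp (by fun_prop)
    have hg : Computable fun y : (E × ℤ) × List (X × E) => (y.1.1 * (γ y.1.2 : E), y.2) := by
      fun_prop
    refine ((hsolve X).comp hg).mono ?_ fun _ _ _ h => h
    rintro ⟨⟨u, k⟩, L⟩ ⟨⟨ks, ⟨u', hu', rfl⟩, h2, -⟩, h3⟩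
    exact ⟨⟨u' * γ k, mul_mem hu' (hγG k), by simp⟩, mul_mem h2 (hγ k), h3⟩
  · rintro u k ks ⟨-, h2, h3, h4⟩ g hg h5
    refine hdiag u h2 g hg k (h4 k List.mem_cons_self) fun l hl => h5 l fun h => ?_
    rcases List.mem_cons.1 h with rfl | h
    · exact lt_irrefl _ hl
    · exact (lt_trans hl ((List.pairwise_cons.1 h3).1 l h)).false

/-- With a power of `τ` in the factor, the coefficient of `T g` at `k + m` involves only the
coefficients of `g` at `k + m` and at `k`. If exponents are taken with `m * k` decreasing, the
former is already eliminated and the latter is read off, so no equation in the ring below remains.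
-/
theorem IsComputableTower.solves_shift {i : Fin e} {S : Set (Fin e)} {τ α : Eˣ}
    (hi : t i = .pi τ) (hiS : i ∉ S) (hS : ∀ x ∈ adjoinOver F t S, σ' x ∈ adjoinOver F t S)
    (hS' : ∀ x ∈ adjoinOver F t (insert i S), σ' x ∈ adjoinOver F t (insert i S))
    (hα : σ' (τ : E) = α * τ) (hαG : α ∈ productGroup (⊤ : Subgroup Fˣ) t)
    (hαS : (α : E) ∈ adjoinOver F t S) (Z : Type v) [AddCommGroup Z] [Module F Z] [Primcodable Z]
    [ComputableAdd Z] [ComputableNeg Z] [ComputableSMul F Z] :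
    Solves (fun x : (((E × E) × ℤ) × List ℤ) × List (Z × E) =>
        ((∃ v : Eˣ, (v : E) ∈ adjoinOver F t S ∧ ((v⁻¹ : Eˣ) : E) ∈ adjoinOver F t S ∧
          x.1.1.1 = (v * ((τ ^ x.1.1.2 : Eˣ) : E), ((v⁻¹ : Eˣ) : E))) ∧ x.1.1.2 ≠ 0 ∧
          (x.1.2.Pairwise fun k l => x.1.1.2 * l < x.1.1.2 * k)) ∧
        ∀ q ∈ x.2, q.2 ∈ adjoinOver F t (insert i S))
      fun x N => ∀ q : Z × E, q ∈ listSpan σ N ↔ (q.2 ∈ adjoinOver F t (insert i S) ∧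
        ∀ l ∉ x.1.2, hE.coeff i l q.2 = 0) ∧
          (q.1, σ' q.2 - x.1.1.1.1 * q.2) ∈ listSpan σ x.2 := by
  have hσ' := hC.computable_map hE hσ
  have hAA : adjoinOver F t S ≤ adjoinOver F t (insert i S) :=
    adjoinOver_mono t (Set.subset_insert i S)
  have hcoeff := hC.computable_coeff hE i
  have hp : Computable fun x : (((E × E) × ℤ) × ℤ) × E =>
      -x.1.1.1.2 * hE.coeff i (x.1.2 + x.1.1.2) x.2 := by
    have := computable_comp₂ (f := fun k x => hE.coeff i k x) hcoeff
      (g := fun x : (((E × E) × ℤ) × ℤ) × E => x.1.2 + x.1.1.2) (h := fun x => x.2)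
      (by fun_prop) (by fun_prop)
    fun_prop
  have hpow : ∀ m : ℤ, ((τ ^ m : Eˣ) : E) ∈ adjoinOver F t (insert i S) := fun m => by
    have : (t i).pow m = ((τ ^ m : Eˣ) : E) := by rw [hi]; rfl
    rw [← this]
    exact pow_mem_adjoinOver t (Set.mem_insert i S) (Or.inl (by rw [hi]; trivial))
  refine hC.solves_elimination hE hσ hiS (T := fun (a : (E × E) × ℤ) g => σ' g - a.1.1 * g)
    (p := fun (a : (E × E) × ℤ) k r => -a.1.2 * hE.coeff i (k + a.2) r) (ψ := fun _ _ h => h)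
    (Adm := fun (a : (E × E) × ℤ) ks => (∃ v : Eˣ, (v : E) ∈ adjoinOver F t S ∧
      ((v⁻¹ : Eˣ) : E) ∈ adjoinOver F t S ∧
        a.1 = (v * ((τ ^ a.2 : Eˣ) : E), ((v⁻¹ : Eˣ) : E))) ∧ a.2 ≠ 0 ∧
          (ks.Pairwise fun k l => a.2 * l < a.2 * k))
    (by fun_prop) (fun u => ⟨fun x y => ?_, fun c hc x => ?_⟩) hp
    (fun _ k => ⟨fun x y => ?_, fun c hc x => ?_⟩) ?_ ?_ ?_ ?_ ?_ ?_ Z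
  · simp only [map_add]
    ring
  · simp only [hE.map_smul', hc, mul_smul_comm, smul_sub]
  · simp only [map_add, mul_add]
  · simp only [map_smul, mul_smul_comm]
  · exact fun a k ks ⟨h1, h2, h3⟩ => ⟨h1, h2, h3.of_cons⟩
  · exact fun a k ks _ => by rw [hi]; trivial
  · rintro ⟨⟨u, v'⟩, m⟩ ks ⟨⟨v, h1, h2, h3⟩, -⟩ g hg
    simp only at h3
    obtain ⟨rfl, rfl⟩ := Prod.mk.inj h3
    exact sub_mem (hS' g hg) (mul_mem (mul_mem (hAA h1) (hpow m)) hg)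
  · rintro ⟨⟨u, v'⟩, m⟩ k ks ⟨⟨v, h1, h2, h3⟩, -⟩ r hr
    simp only at h3
    obtain ⟨rfl, rfl⟩ := Prod.mk.inj h3
    exact mul_mem (neg_mem h2) (hE.coeff_mem_of_insert hiS hr _)
  · intro X _ _ _ _ _ _
    refine Solves.of_computable (f := fun y => y.2) (by fun_prop) ?_
    rintro y ⟨-, h⟩ q
    exact ⟨fun hq => ⟨mem_of_mem_listSpan h hq, hq⟩, fun hq => hq.2⟩
  · rintro ⟨⟨u, v'⟩, m⟩ k ks ⟨⟨v, h1, h2, h3⟩, h4, h5⟩ g hg h6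
    simp only at h3
    obtain ⟨rfl, rfl⟩ := Prod.mk.inj h3
    simp only at h4 h5
    -- `m * (k + m)` exceeds `m * k`, which is the largest value on the remaining list.
    have h7 : hE.coeff i (k + m) g = 0 := h6 _ fun h => by
      have hmm : 0 < m * m := mul_self_pos.2 h4
      rcases List.mem_cons.1 h with h | h
      · exact h4 (by omega)
      · have := (List.pairwise_cons.1 h5).1 _ h
        nlinarith
    simp only
    rw [coeff_sub_mul_of_pi hE hi hiS hS hα hαG hαS h1 hg, h7, map_zero, zero_mul,
      add_sub_cancel_right, zero_sub, neg_mul_neg, ← mul_assoc, Units.inv_mul, one_mul]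

end Solvers

/-! ### Linear difference equations along the tower -/

section Towers

universe v

variable {F : Type*} [Field F] [CharZero F] [Primcodable F] [ComputableAdd F] [ComputableNeg F]
  [ComputableMul F] [ComputableInv F] {E : Type v} [CommRing E] [Algebra F E] [Primcodable E]
  [ComputableAdd E] [ComputableNeg E] [ComputableMul E] [ComputableSMul F E] {e : ℕ}
  {σ : F ≃+* F} {σ' : E ≃+* E} {t : Fin e → Generator E} (hC : IsComputableTower F t)
  (hE : IsRPiSigmaExtension σ σ' t) (hσ : Computable σ)

theorem coeff_eq_zero_of_mem_listSpan (hE : IsRPiSigmaExtension σ σ' t) {Z : Type*} [AddCommGroup Z]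
    [Module F Z] {i : Fin e} {l : ℤ} {L : List (Z × E)} (hL : ∀ p ∈ L, hE.coeff i l p.2 = 0)
    {p : Z × E} (hp : p ∈ listSpan σ L) : hE.coeff i l p.2 = 0 := by
  obtain ⟨c, -, rfl⟩ := mem_listSpan_iff_fin.1 hp
  rw [Prod.snd_sum, map_sum]
  exact Finset.sum_eq_zero fun i _ => by
    rw [Prod.smul_snd, map_smul, hL _ (List.get_mem _ _), smul_zero]

theorem le_sum_map_of_mem {α : Type*} (f : α → ℕ) {l : List α} {a : α} (h : a ∈ l) :
    f a ≤ (l.map f).sum :=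
  List.le_sum_of_mem (List.mem_map_of_mem h)

theorem mem_exponentList_of_nonneg {B : ℕ} {l : ℤ} (h0 : 0 ≤ l) (hl : l.natAbs ≤ B) :
    l ∈ exponentList 1 B (B + 1) :=
  List.mem_map.2 ⟨((B : ℤ) - l).toNat, List.mem_range.2 (by omega), by omega⟩

@[fun_prop]
theorem computable_exponentList {α : Type*} [Primcodable α] {s : α → ℤ} {B N : α → ℕ}
    (hs : Computable s) (hB : Computable B) (hN : Computable N) :
    Computable fun a => exponentList (s a) (B a) (N a) := by
  have hc := computable_natCast_int
  have h1 : Computable fun x : α × ℕ => ((B x.1 : ℕ) : ℤ) := hc.comp (hB.comp Computable.fst)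
  have h2 : Computable fun x : α × ℕ => (x.2 : ℤ) := hc.comp Computable.snd
  exact computable_list_map (by fun_prop) (by fun_prop)

include hC hE hσ

/-- Split the factor as `v * τ ^ m`. If `m = 0`, the coefficients satisfy separate equations in the
ring below, and their exponents are bounded with the help of one homogeneous solution. If `m ≠ 0`,
the exponents are bounded by the right hand side alone, and the coefficients are read off
recursively. -/
theorem IsComputableTower.pldeSolvableOver_insert_pi (hsimple : IsSimpleOver (⊤ : Subgroup Fˣ) σ' t)
    (hroot : RootsOfUnityConstant σ)
    (hsemi : Solves (fun v : E => ∃ u ∈ productGroup (⊤ : Subgroup Fˣ) t, (u : E) = v)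
      fun v (o : Option E) => (∃ g, o = some g ∧ g ≠ 0 ∧ σ' g = v * g) ∨
        (o = none ∧ ∀ g, σ' g = v * g → g = 0))
    {i : Fin e} {τ : Eˣ} (hi : t i = .pi τ) (hsolve : PLDESolvableOver F σ σ' t (chain t i)) :
    PLDESolvableOver F σ σ' t (insert i (chain t i)) := by
  intro Z _ _ _ _ _ _
  have hir : i ∉ roots t := by
    change ¬ (t i).IsRoot
    simp [hi, Generator.IsRoot]
  have hiS := notMem_chain hir
  have hS : ∀ x ∈ adjoinOver F t (chain t i), σ' x ∈ adjoinOver F t (chain t i) := fun x hx =>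
    hE.map_mem_chain hsimple hx
  have hS' : ∀ x ∈ adjoinOver F t (insert i (chain t i)),
      σ' x ∈ adjoinOver F t (insert i (chain t i)) := by
    rw [← chain_succ]
    exact fun x hx => hE.map_mem_chain hsimple hx
  obtain ⟨α, hαG, hαS, hα⟩ := hE.exists_quotient_of_pi hsimple hi
  have hpowτ : ∀ m, (t i).pow m = ((τ ^ m : Eˣ) : E) := fun m => by rw [hi]; rfl
  obtain ⟨deg, hdegc, hdeg⟩ := hC.exists_degree hE i
  have hmem := hC.enumerable_mem_adjoinOver hE (chain t i)
  have hpow := hC.computable_pow i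
  set A := adjoinOver F t (chain t i)
  set A' := adjoinOver F t (insert i (chain t i))
  let Dom : E × List (Z × E) → Prop := fun x =>
    (∃ u ∈ productGroup (⊤ : Subgroup Fˣ) t, (u : E) = x.1) ∧ x.1 ∈ A' ∧ ∀ p ∈ x.2, p.2 ∈ A'
  let O : E × List (Z × E) → Option E → Prop := fun x o =>
    (∃ g, o = some g ∧ g ≠ 0 ∧ σ' g = x.1 * g) ∨ (o = none ∧ ∀ g, σ' g = x.1 * g → g = 0)
  -- The splitting is searched for through `v⁻¹` and `m`, since the elimination divides by `v`.
  let M : E × List (Z × E) → E × ℤ → Prop := fun x w => w.1 ∈ A ∧ x.1 * w.1 = (t i).pow w.2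
  -- The absent homogeneous solution counts as `0`, for which any bound is correct.
  let B : (E × List (Z × E)) × Option E → ℕ := fun y =>
    deg (y.2.getD 0) + (y.1.2.map fun p => deg p.2).sum
  have hB : Computable B := by
    have h1 : Computable fun y : (E × List (Z × E)) × Option E => y.2.getD 0 :=
      Computable.option_getD Computable.snd (Computable.const 0)
    have h2 := hdegc.comp h1
    have h3 : Computable fun y : (E × List (Z × E)) × Option E => y.1.2.map fun p => deg p.2 :=
      computable_list_map (by fun_prop) (hdegc.comp (by fun_prop))
    exact computable_add h2 (by fun_prop)
  have hM : ∀ x, Dom x → ∀ w, M x w → ∃ v : Eˣ, v ∈ productGroup (⊤ : Subgroup Fˣ) t ∧ (v : E) ∈ A ∧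
      x.1 = v * ((τ ^ w.2 : Eˣ) : E) ∧ w.1 = ((v⁻¹ : Eˣ) : E) := by
    rintro ⟨_, L⟩ ⟨⟨u, hu, rfl⟩, -⟩ ⟨v', m⟩ ⟨h1, h2⟩
    simp only at h1 h2 ⊢
    rw [hpowτ] at h2
    have hτG : τ ∈ productGroup (⊤ : Subgroup Fˣ) t := by
      refine ⟨1, trivial, Pi.single i 1, ?_⟩
      rw [map_one, one_mul, Finset.prod_eq_single i]
      · simp [hi, Generator.unitPart]
      · intro j _ hj
        simp [hj]
      · simp
    have hvG : u * (τ ^ m)⁻¹ ∈ productGroup (⊤ : Subgroup Fˣ) t :=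
      mul_mem hu (inv_mem (zpow_mem hτG m))
    have hv' : v' = (((u * (τ ^ m)⁻¹)⁻¹ : Eˣ) : E) := by
      rw [mul_inv_rev, inv_inv, Units.val_mul, ← h2, mul_right_comm, Units.mul_inv, one_mul]
    refine ⟨u * (τ ^ m)⁻¹, hvG, ?_, ?_, hv'⟩
    · have := hE.inv_mem_of_mem_productGroup (inv_mem hvG) (hv' ▸ h1)
      rwa [inv_inv] at this
    · rw [← Units.val_mul, inv_mul_cancel_right]
  have h2 : Solves (fun y : (E × List (Z × E)) × Option E => Dom y.1) fun y w => M y.1 w := by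
    refine Solves.of_enumerable (P := fun y w => M y.1 w) (Enumerable.and
      (hmem.comp (show Computable fun z : ((E × List (Z × E)) × Option E) × (E × ℤ) => z.2.1
        by fun_prop)) (Enumerable.eq (by fun_prop) (hpow.comp (by fun_prop)))) ?_
    rintro ⟨⟨_, L⟩, o⟩ ⟨⟨u, hu, rfl⟩, hu', -⟩
    obtain ⟨v, hv, hvS, m, rfl⟩ := hE.exists_mul_pow_of_mem_productGroup hu hu'
    refine ⟨(((v⁻¹ : Eˣ) : E), m), hE.inv_mem_of_mem_productGroup hv hvS, ?_⟩
    simp only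
    rw [hpowτ, hi, Generator.unitPart, Units.val_mul, mul_right_comm, Units.mul_inv, one_mul]
  have h3 : Solves (fun y : ((E × List (Z × E)) × Option E) × (E × ℤ) => Dom y.1.1 ∧ M y.1.1 y.2)
      fun y N => ∃ ks : List ℤ, (∀ l : ℤ, l.natAbs ≤ B y.1 → l ∈ ks) ∧
        ∀ q : Z × E, q ∈ listSpan σ N ↔ (q.2 ∈ A' ∧ ∀ l ∉ ks, hE.coeff i l q.2 = 0) ∧
          (q.1, σ' q.2 - y.1.1.1 * q.2) ∈ listSpan σ y.1.1.2 := by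
    have hBy : Computable fun y : ((E × List (Z × E)) × Option E) × (E × ℤ) => B y.1 :=
      hB.comp Computable.fst
    have hdouble : Computable fun y : ((E × List (Z × E)) × Option E) × (E × ℤ) =>
        2 * B y.1 + 1 := by
      have : Computable fun y : ((E × List (Z × E)) × Option E) × (E × ℤ) => B y.1 + B y.1 + 1 := by
        fun_prop
      exact this.of_eq fun y => by rw [two_mul]
    have hm : Computable fun y : ((E × List (Z × E)) × Option E) × (E × ℤ) => y.2.2 := by fun_prop
    have h0 : Enumerable fun y : ((E × List (Z × E)) × Option E) × (E × ℤ) => y.2.2 = 0 :=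
      Enumerable.eq hm (Computable.const 0)
    have h0' : Enumerable fun y : ((E × List (Z × E)) × Option E) × (E × ℤ) => ¬ y.2.2 = 0 :=
      Enumerable.ne hm (Computable.const 0)
    refine Solves.cases h0 h0' ?_ ?_
    · have hγc : Computable fun k : ℤ => (((α ^ k)⁻¹ : Eˣ) : E) := by
        have := computable_units_zpow α (k := fun k : ℤ => -k) (by fun_prop)
        exact this.of_eq fun k => by rw [zpow_neg]
      have hdiag := hC.solves_diagonal hE hσ hiS hS' (γ := fun k => (α ^ k)⁻¹) hγc
        (fun k => inv_mem (zpow_mem hαG k)) (fun k => by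
          rw [← zpow_neg]
          exact hE.zpow_mem_of_mem_productGroup hαG hαS _) (fun u hu g hg k _ _ => by
            have := coeff_sub_mul_of_pi hE hi hiS hS hα hαG hαS hu hg 0 k
            rw [zpow_zero, Units.val_one, mul_one, sub_zero] at this
            rw [this, mul_sub, mul_comm, mul_assoc, Units.mul_inv, mul_one]
            ring) hsolve Z
      refine (hdiag.comp (g := fun y : ((E × List (Z × E)) × Option E) × (E × ℤ) =>
        ((y.1.1.1, exponentList 1 (B y.1) (2 * B y.1 + 1)), y.1.1.2)) (by fun_prop)).mono ?_ ?_
      · rintro ⟨⟨⟨u, L⟩, o⟩, w⟩ ⟨⟨hx, hw⟩, h0⟩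
        obtain ⟨v, -, h4, h5, -⟩ := hM _ hx _ hw
        simp only at h0 h5
        rw [h0, zpow_zero, Units.val_one, mul_one] at h5
        refine ⟨⟨hx.1, ?_, ?_, fun k _ => by rw [hi]; trivial⟩, hx.2.2⟩
        · simp only
          rw [h5]
          exact h4
        · simpa using pairwise_exponentList (s := 1) (m := 1) (by norm_num) (B ((u, L), o)) _
      · exact fun y N _ h => ⟨_, fun l hl => mem_exponentList (Or.inl rfl) hl, h⟩
    -- The sign of `m`, which here is not zero; it orients the list of exponents so that `m * k`
    -- decreases.
    · have hs : Computable fun y : ((E × List (Z × E)) × Option E) × (E × ℤ) =>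
          if y.2.2.toNat = 0 then (-1 : ℤ) else 1 := by
        have := computable_toNat.comp (show Computable fun y : ((E × List (Z × E)) × Option E) ×
          (E × ℤ) => y.2.2 by fun_prop)
        fun_prop
      refine ((hC.solves_shift hE hσ hi hiS hS hS' hα hαG hαS Z).comp
        (g := fun y : ((E × List (Z × E)) × Option E) × (E × ℤ) =>
          ((((y.1.1.1, y.2.1), y.2.2), exponentList (if y.2.2.toNat = 0 then (-1 : ℤ) else 1)
            (B y.1) (2 * B y.1 + 1)), y.1.1.2)) (by fun_prop)).mono ?_ ?_
      · rintro ⟨⟨⟨u, L⟩, o⟩, ⟨v', m⟩⟩ ⟨⟨hx, hw⟩, h0⟩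
        obtain ⟨v, h3, h4, h5, h6⟩ := hM _ hx _ hw
        simp only at h0 h5 h6
        refine ⟨⟨⟨v, h4, hE.inv_mem_of_mem_productGroup h3 h4, ?_⟩, h0,
          pairwise_exponentList ?_ _ _⟩, hx.2.2⟩
        · rw [← h5, ← h6]
        · simp only
          by_cases hm : m.toNat = 0
          · simp only [hm, ↓reduceIte]
            omega
          · simp only [hm, ↓reduceIte]
            omega
      · refine fun y N _ h => ⟨_, fun l hl => mem_exponentList ?_ hl, h⟩
        by_cases hm : y.2.2.toNat = 0 <;> simp [hm]
  have h1 : Solves Dom O :=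
    (hsemi.comp (g := fun x : E × List (Z × E) => x.1) (by fun_prop)).mono (fun _ h => h.1)
      fun _ _ _ h => h
  let Q : (E × List (Z × E)) × Option E → (E × ℤ) → List (Z × E) → Prop := fun y w N =>
    ∃ ks : List ℤ, (∀ l : ℤ, l.natAbs ≤ B y → l ∈ ks) ∧
      ∀ q : Z × E, q ∈ listSpan σ N ↔ (q.2 ∈ A' ∧ ∀ l ∉ ks, hE.coeff i l q.2 = 0) ∧
        (q.1, σ' q.2 - y.1.1 * q.2) ∈ listSpan σ y.1.2
  have h23 : Solves (fun y : (E × List (Z × E)) × Option E => Dom y.1)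
      fun y N => ∃ w, M y.1 w ∧ Q y w N :=
    h2.bind (Q := fun x N => Q x.1 x.2 N) h3 fun _ _ h h' => ⟨h, h'⟩
  have h123 : Solves Dom fun x N => ∃ o, O x o ∧ ∃ w, M x w ∧ Q (x, o) w N :=
    h1.bind (Q := fun y N => ∃ w, M y.1 w ∧ Q y w N) h23 fun _ _ h _ => h
  refine h123.mono (fun _ h => h) ?_
  rintro ⟨u, L⟩ N hx ⟨o, ho, w, hw, ks, hks, hN⟩ q
  rw [hN]
  refine ⟨fun h => ⟨h.1.1, h.2⟩, fun h => ⟨⟨h.1, fun l hl => ?_⟩, h.2⟩⟩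
  have hlB : B ((u, L), o) < l.natAbs := not_le.1 fun h => hl (hks l h)
  have hr : ∀ l : ℤ, B ((u, L), o) < l.natAbs → hE.coeff i l (σ' q.2 - u * q.2) = 0 := by
    intro l hl
    refine coeff_eq_zero_of_mem_listSpan hE (p := (q.1, σ' q.2 - u * q.2))
      (fun p hp => hdeg _ _ (lt_of_le_of_lt ?_ hl)) h.2
    exact (le_sum_map_of_mem (fun p : Z × E => deg p.2) hp).trans (Nat.le_add_left _ _)
  obtain ⟨v, h4, h5, h6, -⟩ := hM _ hx _ hw
  simp only at h6
  rw [h6] at hr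
  by_cases hm : w.2 = 0
  · have h7 : u = v := by rw [h6, hm, zpow_zero, Units.val_one, mul_one]
    rw [hm, zpow_zero, Units.val_one, mul_one] at hr
    refine coeff_eq_zero_of_homogeneous hE hsimple hroot hi hiS hS hα hαG hαS h4 h5 h.1
      (g₀ := o.getD 0) ?_ (hr l hlB)
    rcases ho with ⟨g, rfl, hg0, hg⟩ | ⟨-, ho⟩
    · refine Or.inl ⟨hg0, h7 ▸ hg, hdeg _ _ (lt_of_le_of_lt (Nat.le_add_right _ _) hlB)⟩
    · exact Or.inr (h7 ▸ ho)
  · exact coeff_eq_zero_of_shift hE hi hiS hS hα hαG hαS h5 h.1 hm hr hlB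

/-- The leading coefficients are not multiplied by anything, so the diagonal solver applies with `γ
= 1`, from the degree bound downwards. -/
theorem IsComputableTower.pldeSolvableOver_insert_sigma
    (hsimple : IsSimpleOver (⊤ : Subgroup Fˣ) σ' t) (hroot : RootsOfUnityConstant σ) {i : Fin e}
    {s : E} (hi : t i = .sigma s) (hsolve : PLDESolvableOver F σ σ' t (chain t i)) :
    PLDESolvableOver F σ σ' t (insert i (chain t i)) := by
  intro Z _ _ _ _ _ _
  have hir : i ∉ roots t := by
    change ¬ (t i).IsRoot
    simp [hi, Generator.IsRoot]
  have hiS := notMem_chain hir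
  have hS : ∀ x ∈ adjoinOver F t (chain t i), σ' x ∈ adjoinOver F t (chain t i) := fun x hx =>
    hE.map_mem_chain hsimple hx
  have hS' : ∀ x ∈ adjoinOver F t (insert i (chain t i)),
      σ' x ∈ adjoinOver F t (insert i (chain t i)) := by
    rw [← chain_succ]
    exact fun x hx => hE.map_mem_chain hsimple hx
  have hs : σ' s - s ∈ adjoinOver F t (chain t i) := by
    have h1 := hE.unimonomial i
    rw [hi] at h1
    exact IsRPiSigmaExtension.stage_le_chain t i h1.2
  obtain ⟨deg, hdegc, hdeg⟩ := hC.exists_degree hE i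
  let B : E × List (Z × E) → ℕ := fun y => (y.2.map fun p => deg p.2).sum
  have hB : Computable B := by
    have h3 : Computable fun y : E × List (Z × E) => y.2.map fun p => deg p.2 :=
      computable_list_map (by fun_prop) (hdegc.comp (by fun_prop))
    fun_prop
  have hle : ∀ (u : E) (L : List (Z × E)), ∀ p ∈ L, deg p.2 ≤ B (u, L) := fun u L p hp =>
    le_sum_map_of_mem (fun p : Z × E => deg p.2) hp
  have huS : ∀ u ∈ productGroup (⊤ : Subgroup Fˣ) t,
      (u : E) ∈ adjoinOver F t (insert i (chain t i)) → (u : E) ∈ adjoinOver F t (chain t i) := by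
    intro u hu hu'
    obtain ⟨v, -, hv, m, rfl⟩ := hE.exists_mul_pow_of_mem_productGroup hu hu'
    rwa [hi, Generator.unitPart, one_zpow, mul_one]
  have hdiag := hC.solves_diagonal hE hσ hiS hS' (γ := fun _ => 1) (Computable.const _)
    (fun _ => one_mem _) (fun _ => one_mem _) (fun u hu g hg k hk hkl => by
      rw [hi] at hk
      obtain ⟨n, rfl⟩ := Int.eq_ofNat_of_zero_le hk
      rw [Units.val_one, one_mul, mul_one, map_sub,
        coeff_map_top_of_sigma hE hi hiS hS hs hg hkl, hE.coeff_mul_left hiS hu hg]) hsolve Z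
  -- The exponents from `B + 1` down to `0`: the degree of a solution may exceed that of the right
  -- hand side by one.
  refine (hdiag.comp (g := fun y : E × List (Z × E) =>
    ((y.1, exponentList 1 (B y + 1) (B y + 2)), y.2)) (by fun_prop)).mono ?_ ?_
  · rintro ⟨_, L⟩ ⟨⟨u, hu, rfl⟩, hu', hL⟩
    refine ⟨⟨⟨u, hu, rfl⟩, huS u hu hu', ?_, fun k hk => ?_⟩, hL⟩
    · simpa using pairwise_exponentList (s := 1) (m := 1) (by norm_num) (B ((u : E), L) + 1) _
    · rw [hi]
      obtain ⟨j, hj, rfl⟩ := List.mem_map.1 hk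
      have := List.mem_range.1 hj
      change 0 ≤ 1 * (((B ((u : E), L) + 1 : ℕ) : ℤ) - j)
      omega
  · rintro ⟨_, L⟩ N ⟨⟨u, hu, rfl⟩, hu', hL⟩ hN q
    rw [hN]
    refine ⟨fun h => ⟨h.1.1, h.2⟩, fun h => ⟨⟨h.1, fun l hl => ?_⟩, h.2⟩⟩
    by_cases hl0 : l < 0
    · exact hE.coeff_eq_zero (by rw [hi]; exact not_le.2 hl0) _
    · refine coeff_eq_zero_of_sigma hE hsimple hroot hi hs hu (huS u hu hu') h.1
        (B := B ((u : E), L)) (fun l hl' => ?_) (not_le.1 fun h' => hl ?_)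
      · exact coeff_eq_zero_of_mem_listSpan hE (p := (q.1, σ' q.2 - u * q.2))
          (fun p hp => hdeg _ _ (lt_of_le_of_lt (hle _ L p hp) hl')) h.2
      · exact mem_exponentList_of_nonneg (not_lt.1 hl0) h'

/-- Induction along the chain. All root of unity monomials are present from the start, so meeting
one of them changes nothing. The oracle for PFLDE is consulted only at the period `P` of the
idempotent. -/
theorem IsComputableTower.pldeSolvableOver_univ (hsimple : IsSimpleOver (⊤ : Subgroup Fˣ) σ' t)
    (hstable : StrongConstantStable σ)
    (hPMT : PMTSolvable (DifferenceRing.value (F := F) t) σ' (productGroup (⊤ : Subgroup Fˣ) t))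
    (horacle : ∀ k : ℕ, 0 < k → PFLDESolvable (id : F → F) (σ ^ k) (⊤ : Subgroup Fˣ)) :
    PLDESolvableOver F σ σ' t Set.univ := by
  obtain ⟨P, ε, hε⟩ := hE.exists_isRootIdempotent hsimple hstable.2
  rw [← chain_top t]
  have key : ∀ n ≤ e, PLDESolvableOver F σ σ' t (chain t n) := by
    intro n
    induction n with
    | zero =>
      intro _
      rw [chain_zero]
      exact hC.pldeSolvableOver_roots hE hσ hsimple hε (hstable.1 P hε.pos) (horacle P hε.pos)
    | succ n ih =>
      intro hn
      have h := ih (by omega)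
      have hsucc := chain_succ t (⟨n, hn⟩ : Fin e)
      simp only at hsucc
      rw [hsucc]
      cases hi : t ⟨n, hn⟩ with
      | root m x =>
        rwa [Set.insert_eq_of_mem (roots_subset_chain t n (show (t ⟨n, hn⟩).IsRoot by
          rw [hi]; trivial))]
      | pi τ =>
        exact hC.pldeSolvableOver_insert_pi hE hσ hsimple hstable.2
          (hC.solves_semiconstant hE hσ hPMT) hi h
      | sigma s =>
        exact hC.pldeSolvableOver_insert_sigma hE hσ hsimple hstable.2 hi h
  exact key e le_rfl

end Towers

/-! ### From tagged solutions to bases of solution spaces -/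

section Solutions

variable {F : Type*} [Field F] {E : Type*} [CommRing E] [Algebra F E] {e : ℕ}
  {σ : F ≃+* F} {σ' : E ≃+* E} {t : Fin e → Generator E}

theorem mem_listSpan_ofFn {Z : Type*} [AddCommGroup Z] [Module F Z] {n : ℕ} {g : Fin n → Z}
    {z : Z} : z ∈ listSpan σ (List.ofFn g) ↔
      ∃ c : Fin n → F, (∀ i, σ (c i) = c i) ∧ ∑ i, c i • g i = z := by
  rw [listSpan, show {z | z ∈ List.ofFn g} = Set.range g from
    Set.ext fun x => List.mem_ofFn, Submodule.mem_span_range_iff_exists_fun]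
  constructor
  · rintro ⟨c, rfl⟩
    exact ⟨fun i => c i, fun i => (c i).2, rfl⟩
  · rintro ⟨c, hc, rfl⟩
    exact ⟨fun i => ⟨c i, hc i⟩, rfl⟩

/-- Tagging the `i`-th right hand side with the unit vector at `i` lets the tag of a combination
spell out its constants. -/
theorem mem_listSpan_single {n : ℕ} {f : Fin n → E} {p : (ℕ →₀ E) × E} :
    p ∈ listSpan σ (List.ofFn fun i : Fin n => (Finsupp.single (i : ℕ) (1 : E), f i)) ↔
      ∃ c : Fin n → F, (∀ i, σ (c i) = c i) ∧ (∀ i : Fin n, p.1 i = algebraMap F E (c i)) ∧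
        (∀ j, n ≤ j → p.1 j = 0) ∧ p.2 = ∑ i, algebraMap F E (c i) * f i := by
  have happly : ∀ (c : Fin n → F) (j : ℕ),
      (∑ i : Fin n, c i • (Finsupp.single (i : ℕ) (1 : E) : ℕ →₀ E)) j =
        ∑ i : Fin n, if (i : ℕ) = j then algebraMap F E (c i) else 0 := by
    intro c j
    rw [Finsupp.finsetSum_apply]
    refine Finset.sum_congr rfl fun i _ => ?_
    rw [Finsupp.smul_apply, Finsupp.single_apply, smul_ite, smul_zero, Algebra.algebraMap_eq_smul_one]
  have hlt : ∀ (c : Fin n → F) (i : Fin n),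
      (∑ i : Fin n, c i • (Finsupp.single (i : ℕ) (1 : E) : ℕ →₀ E)) i = algebraMap F E (c i) := by
    intro c i
    rw [happly, Finset.sum_eq_single i]
    · simp
    · intro j _ hj
      exact ite_cond_eq_false _ _ (eq_false fun h => hj (Fin.ext h))
    · simp
  have hge : ∀ (c : Fin n → F) (j : ℕ), n ≤ j →
      (∑ i : Fin n, c i • (Finsupp.single (i : ℕ) (1 : E) : ℕ →₀ E)) j = 0 := by
    intro c j hj
    rw [happly]
    exact Finset.sum_eq_zero fun i _ => ite_cond_eq_false _ _ (eq_false (by omega))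
  rw [mem_listSpan_ofFn]
  refine exists_congr fun c => and_congr_right fun _ => ?_
  rw [Prod.ext_iff, Prod.fst_sum, Prod.snd_sum]
  simp only [Prod.smul_fst, Prod.smul_snd, ← Algebra.smul_def]
  constructor
  · rintro ⟨h1, h2⟩
    exact ⟨fun i => by rw [← h1, hlt], fun j hj => by rw [← h1, hge c j hj], h2.symm⟩
  · rintro ⟨h1, h2, h3⟩
    refine ⟨Finsupp.ext fun j => ?_, h3.symm⟩
    by_cases hj : j < n
    · rw [hlt c ⟨j, hj⟩, h1 ⟨j, hj⟩]
    · rw [hge c j (not_lt.1 hj), h2 j (not_lt.1 hj)]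

/-- The constants of `E` are the images of the constants of `F`, so independence and span over one
field of constants carry over to the other. Tags of elements in the span vanish from position `n`
on, hence cutting them to length `n` loses nothing. -/
theorem IsRPiSigmaExtension.isBasisOf_pldeSolutions (hE : IsRPiSigmaExtension σ σ' t) {n : ℕ} {u : E}
    {f : Fin n → E} {B : List ((ℕ →₀ E) × E)}
    (hB : ∀ p : (ℕ →₀ E) × E, p ∈ listSpan σ B ↔ (p.1, σ' p.2 - u * p.2) ∈
      listSpan σ (List.ofFn fun i : Fin n => (Finsupp.single (i : ℕ) (1 : E), f i)))
    (hlin : LinearIndependent (constants σ) fun k : Fin B.length => B.get k) :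
    IsBasisOf (constants σ') (fun k : Fin B.length => (fun i : Fin n => (B.get k).1 i, (B.get k).2))
      (pldeSolutions σ' u f) := by
  have hsum : ∀ (c : Fin B.length → constants σ') (c' : Fin B.length → F),
      (∀ k, algebraMap F E (c' k) = c k) →
      ∑ k, c k • ((fun i : Fin n => (B.get k).1 i, (B.get k).2) : (Fin n → E) × E) =
        (fun i : Fin n => (∑ k, c' k • B.get k).1 i, (∑ k, c' k • B.get k).2) := by
    intro c c' h
    have hsmul : ∀ k (x : E), c k • x = c' k • x := fun k x => by
      rw [Algebra.smul_def (c' k), h]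
      rfl
    refine Prod.ext (funext fun i => ?_) ?_
    · simp only
      rw [Prod.fst_sum, Finset.sum_apply, Prod.fst_sum, Finsupp.finsetSum_apply]
      exact Finset.sum_congr rfl fun k _ => hsmul k _
    · rw [Prod.snd_sum, Prod.snd_sum]
      exact Finset.sum_congr rfl fun k _ => hsmul k _
  have hmem : ∀ c' : Fin B.length → F, (∀ k, σ (c' k) = c' k) →
      ∑ k, c' k • B.get k ∈ listSpan σ B := fun c' h => mem_listSpan_iff_fin.2 ⟨c', h, rfl⟩
  constructor
  · rw [Fintype.linearIndependent_iff] at hlin ⊢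
    intro c hc k
    choose c' hc' hcc' using fun k => hE.exists_of_mem_constants (c k).2
    rw [hsum c c' hcc'] at hc
    obtain ⟨h1, h2⟩ := Prod.ext_iff.1 hc
    obtain ⟨a, -, -, ha, -⟩ := mem_listSpan_single.1 ((hB _).1 (hmem c' hc'))
    have h3 : ∑ k, (⟨c' k, hc' k⟩ : constants σ) • B.get k = 0 := by
      refine Prod.ext (Finsupp.ext fun j => ?_) h2
      by_cases hj : j < n
      · exact congrFun h1 ⟨j, hj⟩
      · exact ha j (not_lt.1 hj)
    have h4 : c' k = 0 := congrArg Subtype.val (hlin _ h3 k)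
    exact Subtype.ext (by rw [← hcc' k, h4, map_zero]; rfl)
  · ext x
    rw [SetLike.mem_coe, Submodule.mem_span_range_iff_exists_fun]
    constructor
    · rintro ⟨c, rfl⟩
      choose c' hc' hcc' using fun k => hE.exists_of_mem_constants (c k).2
      rw [hsum c c' hcc']
      obtain ⟨a, ha, h1, -, h2⟩ := mem_listSpan_single.1 ((hB _).1 (hmem c' hc'))
      refine ⟨fun i => ?_, ?_⟩
      · simp only at h1 ⊢
        rw [h1]
        exact hE.algebraMap_mem_constants (ha i)
      · simp only at h1 h2 ⊢
        simp only [h1]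
        exact h2
    · rintro ⟨h1, h2⟩
      choose a ha haa using fun i => hE.exists_of_mem_constants (h1 i)
      let z : ℕ →₀ E := ofList (List.ofFn x.1)
      have hz : ∀ i : Fin n, z i = x.1 i := fun i => by simp [z]
      have hp : (z, x.2) ∈ listSpan σ B := by
        refine (hB _).2 (mem_listSpan_single.2 ⟨a, ha, fun i => ?_, fun j hj => ?_, ?_⟩)
        · rw [haa, ← hz]
        · simp [z, hj]
        · simp only [haa]
          exact h2
      obtain ⟨c, hc, h3⟩ := mem_listSpan_iff_fin.1 hp
      refine ⟨fun k => ⟨_, hE.algebraMap_mem_constants (hc k)⟩, ?_⟩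
      rw [hsum _ c fun _ => rfl, ← h3]
      exact Prod.ext (funext hz) rfl

end Solutions

/-! ### Problem PFLDE in the tower -/

section Towers

universe v

variable {F : Type*} [Field F] [CharZero F] [Primcodable F] [ComputableAdd F] [ComputableNeg F]
  [ComputableMul F] [ComputableInv F] {E : Type v} [CommRing E] [Algebra F E] [Primcodable E]
  [ComputableAdd E] [ComputableNeg E] [ComputableMul E] [ComputableSMul F E] {e : ℕ}
  {σ : F ≃+* F} {σ' : E ≃+* E} {t : Fin e → Generator E}

/-- The tagged problem is solved with unit vectors as tags, a basis is extracted from the resulting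
generators, and its entries are translated back into names. -/
theorem IsComputableTower.pfldeSolvable (hC : IsComputableTower F t)
    (hE : IsRPiSigmaExtension σ σ' t) (hσ : Computable σ)
    (hsimple : IsSimpleOver (⊤ : Subgroup Fˣ) σ' t) (hstable : StrongConstantStable σ)
    (hPMT : PMTSolvable (DifferenceRing.value (F := F) t) σ' (productGroup (⊤ : Subgroup Fˣ) t))
    (horacle : ∀ k : ℕ, 0 < k → PFLDESolvable (id : F → F) (σ ^ k) (⊤ : Subgroup Fˣ)) :
    PFLDESolvable (DifferenceRing.value (F := F) t) σ' (productGroup (⊤ : Subgroup Fˣ) t) := by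
  refine ⟨hE.semiconstantsFormGroup hsimple hstable.2, ?_⟩
  have : Nontrivial E := hE.injective.nontrivial
  obtain ⟨nm, hnmc, hnm⟩ := hC.exists_name
  have hval := hC.value
  have hnullE := hC.nullSolvable hE hσ
  have hnull : NullSolvable.{v} σ (ℕ →₀ E) :=
    NullSolvable.of_coordinates hnullE (fun i => Finsupp.lapply i)
      (computable_finsupp_apply Computable.snd Computable.fst)
      (fun z => List.range (toList z).length) (by fun_prop)
      (fun z i hi => apply_eq_zero_of_length_le (by simpa using hi)) fun z h => Finsupp.ext h
  let rhs : List (Name F e) → List ((ℕ →₀ E) × E) := fun fs => (List.range fs.length).map fun i =>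
    (Finsupp.single i 1, DifferenceRing.value t (fs.getD i []))
  have hrhs : Computable rhs := by
    have h1 : Computable fun x : List (Name F e) × ℕ => DifferenceRing.value t (x.1.getD x.2 []) :=
      hval.comp (by fun_prop)
    have h2 : Computable fun x : List (Name F e) × ℕ => (Finsupp.single x.2 1 : ℕ →₀ E) :=
      computable_finsupp_single Computable.snd (Computable.const 1)
    exact computable_list_map (by fun_prop) (h2.pair h1)
  let D : Name F e × List (Name F e) → Prop := fun x =>
    ∃ u ∈ productGroup (⊤ : Subgroup Fˣ) t, (u : E) = DifferenceRing.value t x.1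
  let P : Name F e × List (Name F e) → List ((ℕ →₀ E) × E) → Prop := fun x N =>
    ∀ p : (ℕ →₀ E) × E, p ∈ listSpan σ N ↔
      (p.1, σ' p.2 - DifferenceRing.value t x.1 * p.2) ∈ listSpan σ (rhs x.2)
  have hin : Computable fun x : Name F e × List (Name F e) =>
      (DifferenceRing.value t x.1, rhs x.2) :=
    (hval.comp Computable.fst).pair (hrhs.comp Computable.snd)
  have h1 : Solves D P := by
    refine ((hC.pldeSolvableOver_univ hE hσ hsimple hstable hPMT horacle (ℕ →₀ E)).comp hin).mono
      ?_ ?_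
    · intro x hx
      simp only [hE.adjoinOver_univ]
      exact ⟨hx, trivial, fun _ _ => trivial⟩
    · intro x N _ h p
      rw [h, hE.adjoinOver_univ]
      exact and_iff_right trivial
  let Q : List ((ℕ →₀ E) × E) → List ((ℕ →₀ E) × E) → Prop := fun N B =>
    listSpan σ B = listSpan σ N ∧
      LinearIndependent (constants σ) fun k : Fin B.length => B.get k
  have h2 : Solves (fun _ : (Name F e × List (Name F e)) × List ((ℕ →₀ E) × E) => True)
      fun y B => Q y.2 B :=
    ((hnull.prod hnullE).solves_basis hσ (Z := E)).comp Computable.snd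
  have h3 : Solves D fun x B => ∃ N, P x N ∧ Q N B := h1.bind h2 fun _ _ _ _ => trivial
  let out : Name F e × List (Name F e) → List ((ℕ →₀ E) × E) →
      List (List (Name F e) × Name F e) := fun x B =>
    B.map fun p => ((List.range x.2.length).map fun i => nm (p.1 i), nm p.2)
  have hout : Computable fun y : (Name F e × List (Name F e)) × List ((ℕ →₀ E) × E) =>
      out y.1 y.2 := by
    have h4 : Computable fun w : (((Name F e × List (Name F e)) × List ((ℕ →₀ E) × E)) ×
        ((ℕ →₀ E) × E)) × ℕ => nm (w.1.2.1 w.2) :=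
      hnmc.comp (computable_finsupp_apply (by fun_prop) Computable.snd)
    have h5 : Computable fun w : ((Name F e × List (Name F e)) × List ((ℕ →₀ E) × E)) ×
        ((ℕ →₀ E) × E) => (List.range w.1.1.2.length).map fun i => nm (w.2.1 i) :=
      computable_list_map (by fun_prop) h4
    exact computable_list_map Computable.snd (h5.pair (hnmc.comp (by fun_prop)))
  obtain ⟨alg, halg, h6⟩ := (Solves.map (f := out) h3 hout).exists_partrec
  refine ⟨alg, halg, fun cu u fs n f hu hcu hfs => ?_⟩
  obtain ⟨_, hmem, B, ⟨N, hN, hspan, hlin⟩, rfl⟩ := h6 (cu, fs) ⟨u, hu, hcu.symm⟩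
  have hlen : fs.length = n := by simpa using congrArg List.length hfs
  have hrhs' : rhs fs = List.ofFn fun i : Fin n => (Finsupp.single (i : ℕ) (1 : E), f i) := by
    subst hlen
    refine List.ext_getElem (by simp [rhs]) fun i hi hi' => ?_
    have hi'' : i < fs.length := by simpa using hi'
    have h7 : (fs.map (DifferenceRing.value t))[i]'(by simpa using hi'') = f ⟨i, hi''⟩ := by
      simp only [hfs, List.getElem_ofFn]
    rw [List.getElem_map] at h7
    simp [rhs, ← h7, hi'']
  refine ⟨_, hmem, B.length, _, hE.isBasisOf_pldeSolutions (B := B) (n := n) (fun p => ?_) hlin, ?_⟩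
  · rw [hspan, hN, hrhs', hcu]
  · rw [List.map_map]
    refine List.ext_getElem (by simp) fun i hi hi' => ?_
    simp only [List.getElem_map, List.getElem_ofFn, Function.comp_apply, List.map_map, hnm]
    refine Prod.ext ?_ rfl
    refine List.ext_getElem (by simp [hlen]) fun j hj hj' => ?_
    simp [hnm]

end Towers

end DifferenceRing

theorem theorem2p16 {F : Type*} [Field F] [CharZero F] [Primcodable F] (σ : F ≃+* F)
    (hF : DifferenceRing.IsComputableDifferenceField σ)
    (hO : DifferenceRing.ProblemOSolvable (id : F → F) (DifferenceRing.constantUnits σ))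
    {E : Type*} [CommRing E] [Algebra F E] (σ' : E ≃+* E)
    {e : ℕ} (t : Fin e → DifferenceRing.Generator E)
    (hE : DifferenceRing.IsRPiSigmaExtension σ σ' t)
    (hsimple : DifferenceRing.IsSimpleOver (⊤ : Subgroup Fˣ) σ' t) :
    (DifferenceRing.RootsOfUnityConstant σ →
      DifferenceRing.ProblemOSolvable (DifferenceRing.value (F := F) t)
        (DifferenceRing.productGroup (⊤ : Subgroup Fˣ) t)) ∧
    (DifferenceRing.StrongConstantStable σ →
      (DifferenceRing.PMTSolvable (id : F → F) σ (⊤ : Subgroup Fˣ) →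
        DifferenceRing.PMTSolvable (DifferenceRing.value (F := F) t) σ'
          (DifferenceRing.productGroup (⊤ : Subgroup Fˣ) t)) ∧
      (DifferenceRing.PMTSolvable (id : F → F) σ (⊤ : Subgroup Fˣ) →
        (∀ k : ℕ, 0 < k →
          DifferenceRing.PFLDESolvable (id : F → F) (σ ^ k) (⊤ : Subgroup Fˣ)) →
        DifferenceRing.PFLDESolvable (DifferenceRing.value (F := F) t) σ'
          (DifferenceRing.productGroup (⊤ : Subgroup Fˣ) t))) := by

  have : DifferenceRing.ComputableAdd F := ⟨hF.add⟩
  have : DifferenceRing.ComputableNeg F := ⟨hF.neg⟩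
  have : DifferenceRing.ComputableMul F := ⟨hF.mul⟩
  have : DifferenceRing.ComputableInv F := ⟨hF.inv⟩
  -- A coding of `E` is chosen for internal use; the conclusions refer only to names.
  obtain ⟨_, hC⟩ := hE.exists_isComputableTower
  have := hC.add
  have := hC.neg
  have := hC.smul
  have := hC.mul hE
  refine ⟨fun hroot => hC.problemOSolvable hE hF.map hroot hO, fun hstable =>
    ⟨fun hPMT => hC.pmtSolvable hE hsimple hstable hPMT, fun hPMT horacle =>
      hC.pfldeSolvable hE hF.map hsimple hstable (hC.pmtSolvable hE hsimple hstable hPMT) horacle⟩⟩
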